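/- **Conventions.** Symmetric spectra are left modules over the sphere spectrum $S$ in symmetric sequences of pointed simplicial sets: a symmetric spectrum $X$ consists of pointed simplicial sets $X[N]$, one for each finite set $N$, and associative unital actions $S^{M\setminus N}\wedge X[N]\to X[M]$ along embeddings $N\to M$. Let $\Sigma$ be the groupoid of finite sets and bijections and $\mathsf{SymSeq}$ the category of functors from $\Sigma^{op}$ to symmetric spectra. For $B,X,Y\in\mathsf{SymSeq}$, $$(X\check\otimes Y)[R]=\coprod_{R=R_1\sqcup R_2}X[R_1]\wedge Y[R_2],\qquad (B\circ Y)=\coprod_{t\ge 0}B[\mathbf t]\wedge_{\Sigma_t}Y^{\check\otimes t},$$ where $\mathbf t=\{1,\dots,t\}$ and $\wedge$ is the smash product of symmetric spectra; $Y^{\check\otimes 0}$ is the unit. A typical generator of $B\circ Y$ is written $[b;y_1,\dots,y_t]$. An *operad* $\mathcal O$ is a monoid in $(\mathsf{SymSeq},\circ)$, and a *left $\mathcal O$-module* is an $A\in\mathsf{SymSeq}$ with a unital associative action $m:\mathcal O\circ A\to A$; we write $o(a_1,\dots,a_p)=m[o;a_1,\dots,a_p]$. Let $\mathsf{Lt}_{\mathcal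 O}$ be the category of left $\mathcal O$-modules; $\mathcal O\circ X$ is the free left $\mathcal O$-module on $X$. For $A\in\mathsf{Lt}_{\mathcal O}$ the *enveloping symmetric array* $\mathcal O_A$ is the functor $\Sigma^{op}\to\mathsf{SymSeq}$ given by $$\mathcal O_A[\mathbf q]=\operatorname{coeq}\Bigl(\coprod_{p\ge0}\mathcal O[\mathbf p+\mathbf q]\wedge_{\Sigma_p}(\mathcal O\circ A)^{\check\otimes p}\rightrightarrows\coprod_{p\ge0}\mathcal O[\mathbf p+\mathbf q]\wedge_{\Sigma_p}A^{\check\otimes p}\Bigr),$$ the two maps being induced by the operad multiplication (with units in the last $q$ slots) and by $m$. Its elements are represented by $[o;a_1,\dots,a_p]$ with $o\in\mathcal O[\mathbf p+\mathbf q]$. For a map $i:X\to Y$ in $\mathsf{SymSeq}$ and $t\ge1$, let $Q^t_{t-1}$, with its $\Sigma_t$-action, be the colimit of the punctured cube $\chi\mapsto Z_{\chi(1)}\check\otimes\cdots\check\otimes Z_{\chi(t)}$, where $\chi$ runs over the maps $\{1,\dots,t\}\to\{0<1\}$ that are not constantly $1$, $Z_0=X$, $Z_1=Y$ and the maps of the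 cube are induced by $i$; let $i_*:Q^t_{t-1}\to Y^{\check\otimes t}$ be the induced $\Sigma_t$-equivariant map. **Proposition.** Let $\mathcal O$ be an operad in symmetric spectra, $A\in\mathsf{Lt}_{\mathcal O}$, and $i:X\to Y$ a map in $\mathsf{SymSeq}$. Consider any pushout diagram in $\mathsf{Lt}_{\mathcal O}$ $$\begin{array}{ccc}\mathcal O\circ X&\xrightarrow{\ f\ }&A\\ {\scriptstyle \mathrm{id}\circ i}\downarrow&&\downarrow{\scriptstyle j}\\ \mathcal O\circ Y&\xrightarrow{\ g\ }&P\end{array}$$ and denote the maps $X\to A$ and $Y\to P$ adjoint to $f$ and $g$ again by $f$ and $g$. Then there is a sequence $A_0\xrightarrow{j_1}A_1\xrightarrow{j_2}A_2\to\cdots$ in $\mathsf{SymSeq}$ with maps $c_t:A_t\to P$ exhibiting the underlying symmetric sequence of $P$ as the colimit, $$P=A\amalg_{(\mathcal O\circ X)}(\mathcal O\circ Y)\;\cong\;\operatorname{colim}(A_0\to A_1\to A_2\to\cdots),$$ such that $A_0\cong\mathcal O_A[\mathbf 0]\cong A$, the second isomorphism being $[o;a_1,\dots,a_p]\mapsto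 o(a_1,\dots,a_p)$ and $c_0$ corresponding to $j$, and such that for every $t\ge 1$ there is a pushout diagram in $\mathsf{SymSeq}$ $$\begin{array}{ccc}\mathcal O_A[\mathbf t]\check\otimes_{\Sigma_t}Q^t_{t-1}&\xrightarrow{\ f_*\ }&A_{t-1}\\ {\scriptstyle \mathrm{id}\check\otimes_{\Sigma_t}i_*}\downarrow&&\downarrow{\scriptstyle j_t}\\ \mathcal O_A[\mathbf t]\check\otimes_{\Sigma_t}Y^{\check\otimes t}&\xrightarrow{\ \xi_t\ }&A_t.\end{array}$$ Here, with $\xi_0:\mathcal O_A[\mathbf 0]\check\otimes_{\Sigma_0}Y^{\check\otimes0}\cong A_0$ the canonical isomorphism, the maps are given on generators as follows. For all $t\ge0$, $$c_t\,\xi_t\bigl([o;a_1,\dots,a_p]\otimes y_1\otimes\cdots\otimes y_t\bigr)=o\bigl(j(a_1),\dots,j(a_p),g(y_1),\dots,g(y_t)\bigr),$$ and the map $f_*$ plugs $f$ into the factors from $X$: for $t\ge1$ and $0\le s<t$, it sends, up to the action of $\Sigma_t$, the class of $[o;a_1,\dots,a_p]\otimes(x_1\otimes\cdots\otimes x_{t-s}\otimes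 y_1\otimes\cdots\otimes y_s)$, with $x_r$ in $X$ and $y_q$ in $Y$, to the image in $A_{t-1}$ of $\xi_s\bigl([o;a_1,\dots,a_p,f(x_1),\dots,f(x_{t-s})]\otimes y_1\otimes\cdots\otimes y_s\bigr)\in A_s$. This is natural: given two such pushout diagrams (for the same $\mathcal O$), any filtrations $(A_t)$ and $(A'_t)$ as above of $P$ and $P'$, and maps $\alpha:A\to A'$, $X\to X'$, $y:Y\to Y'$, $p:P\to P'$ compatible with the two diagrams, there is exactly one map of sequences $\eta_t:A_t\to A'_t$ such that $c'_t\eta_t=p\,c_t$ and $\eta_t\,\xi_t([o;a]\otimes y_1\otimes\cdots\otimes y_t)=\xi'_t([o;\alpha(a)]\otimes y(y_1)\otimes\cdots\otimes y(y_t))$ for all $t$. -/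

import Mathlib

open CategoryTheory CategoryTheory.Limits Opposite

universe u

namespace SymSpectra

/-- The indexing category of simplicial objects. -/
abbrev Dop := SimplexCategoryᵒᵖ

/-- The `k`-simplices of the simplicial circle `S¹ = Δ[1] / ∂Δ[1]`. -/
def Circle (k : Dop) : Type :=
  Quot fun x y : (SSet.stdSimplex.{0}.obj (SimplexCategory.mk 1)).obj k =>
    x ∈ (SSet.boundary.{0} 1).obj k ∧ y ∈ (SSet.boundary.{0} 1).obj k

namespace Circle

def map {k l : Dop} (α : k ⟶ l) : Circle k → Circle l :=
  Quot.map ((SSet.stdSimplex.{0}.obj (SimplexCategory.mk 1)).map α) fun _ _ h =>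
    ⟨(SSet.boundary.{0} 1).map α h.1, (SSet.boundary.{0} 1).map α h.2⟩

/-- Being the basepoint of `S¹`, i.e. the image of `∂Δ[1]`. -/
def IsBase {k : Dop} (s : Circle k) : Prop :=
  ∃ x ∈ (SSet.boundary.{0} 1).obj k, s = Quot.mk _ x

@[simp] theorem map_id {k : Dop} (s : Circle k) : map (𝟙 k) s = s := by
  induction s using Quot.ind with
  | mk x => exact congrArg (Quot.mk _) (by simp)

@[simp] theorem map_map {k l m : Dop} (α : k ⟶ l) (β : l ⟶ m) (s : Circle k) :
    map β (map α s) = map (α ≫ β) s := by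
  induction s using Quot.ind with
  | mk x => exact congrArg (Quot.mk _) (by simp)

theorem IsBase.map {k l : Dop} (α : k ⟶ l) {s : Circle k} (h : IsBase s) :
    IsBase (Circle.map α s) := by
  obtain ⟨x, hx, rfl⟩ := h
  exact ⟨_, (SSet.boundary.{0} 1).map α hx, rfl⟩

end Circle

/-- The groupoid `Σ` of finite sets and their bijections. -/
structure FinBij : Type 1 where
  carrier : Type
  [fin : Finite carrier]

namespace FinBij

instance : CoeSort FinBij Type := ⟨carrier⟩
instance (A : FinBij) : Finite A := A.fin

instance : Category FinBij where
  Hom A B := A ≃ B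
  id A := Equiv.refl A
  comp f g := f.trans g

/-- Disjoint union of a finite family. -/
abbrev sigma {T : Type} [Finite T] (A : T → FinBij) : FinBij := ⟨Σ t, A t⟩

/-- Binary disjoint union. -/
abbrev sum (A B : FinBij) : FinBij := ⟨A ⊕ B⟩

end FinBij

/-- A `k`-simplex of `S^(B ∖ A)` together with an embedding `A → B`: every point of `B` is either
(the image of) a point of `A`, each point of `A` occurring exactly once, or is labelled by a
`k`-simplex of `S¹`. -/
@[ext] structure Lab (A B : Type) (k : Dop) where
  g : B → A ⊕ Circle k
  uniq : ∀ a, ∃! b, g b = Sum.inl a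

namespace Lab

variable {A B C D : Type} {k l m : Dop}

def ofEquiv (e : B ≃ A) : Lab A B k where
  g b := Sum.inl (e b)
  uniq a := ⟨e.symm a, by simp, fun b hb => by simp at hb; simp [← hb]⟩

def id : Lab A A k := ofEquiv (Equiv.refl A)

def comp (f : Lab A B k) (h : Lab B C k) : Lab A C k where
  g c := Sum.elim f.g Sum.inr (h.g c)
  uniq a := by
    obtain ⟨b, hb, hb'⟩ := f.uniq a
    obtain ⟨c, hc, hc'⟩ := h.uniq b
    refine ⟨c, by simp [hc, hb], fun c' h' => hc' _ ?_⟩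
    rcases hx : h.g c' with b' | s
    · simp only [hx, Sum.elim_inl] at h'
      rw [← hb' _ h', hx]
    · simp [hx] at h'

def push (α : k ⟶ l) (f : Lab A B k) : Lab A B l where
  g b := Sum.map _root_.id (Circle.map α) (f.g b)
  uniq a := by
    obtain ⟨b, hb, hb'⟩ := f.uniq a
    refine ⟨b, by simp [hb], fun b' h' => hb' _ ?_⟩
    rcases hx : f.g b' with a' | s
    · simpa [hx] using h'
    · simp [hx] at h'

def sum (f : Lab A B k) (h : Lab C D k) : Lab (A ⊕ C) (B ⊕ D) k where
  g := Sum.elim (fun b => Sum.map Sum.inl _root_.id (f.g b))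
    (fun d => Sum.map Sum.inr _root_.id (h.g d))
  uniq := by
    rintro (a | c)
    · obtain ⟨b, hb, hb'⟩ := f.uniq a
      refine ⟨Sum.inl b, by simp [hb], ?_⟩
      rintro (b' | d') h'
      · rcases hx : f.g b' with a' | s
        · simp only [Sum.elim_inl, hx, Sum.map_inl, Sum.inl.injEq] at h'
          rw [hb' b' (by simp only [hx, h'])]
        · simp [hx] at h'
      · rcases hx : h.g d' with a' | s <;> simp [hx] at h'
    · obtain ⟨b, hb, hb'⟩ := h.uniq c
      refine ⟨Sum.inr b, by simp [hb], ?_⟩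
      rintro (b' | d') h'
      · rcases hx : f.g b' with a' | s <;> simp [hx] at h'
      · rcases hx : h.g d' with a' | s
        · simp only [Sum.elim_inr, hx, Sum.map_inl, Sum.inl.injEq, Sum.inr.injEq] at h'
          rw [hb' d' (by simp only [hx, h'])]
        · simp [hx] at h'

def sigma {T T' : Type} {A : T → Type} {B : T' → Type} (σ : T' ≃ T)
    (f : ∀ t', Lab (A (σ t')) (B t') k) : Lab (Σ t, A t) (Σ t', B t') k where
  g x := Sum.map (Sigma.mk (σ x.1)) _root_.id ((f x.1).g x.2)
  uniq := by
    rintro ⟨t, a⟩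
    obtain ⟨t', rfl⟩ := σ.surjective t
    obtain ⟨b, hb, hb'⟩ := (f t').uniq a
    refine ⟨⟨t', b⟩, by simp [hb], ?_⟩
    rintro ⟨s', b'⟩ h'
    rcases hx : (f s').g b' with a' | s
    · simp only [hx, Sum.map_inl, Sum.inl.injEq, Sigma.mk.injEq, EmbeddingLike.apply_eq_iff_eq] at h'
      obtain ⟨rfl, h'⟩ := h'
      simp only [heq_eq_eq] at h'
      subst h'
      rw [hb' b' hx]
    · simp [hx] at h'

/-- Some point is labelled by the basepoint of the circle. -/
def Null (f : Lab A B k) : Prop := ∃ b s, f.g b = Sum.inr s ∧ s.IsBase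

end Lab

/-- An index for the values of a symmetric sequence: `(R, N)` stands for `X[R][N]`. -/
structure Deg : Type 1 where
  R : FinBij
  N : FinBij

namespace Deg

abbrev sigma {T : Type} [Finite T] (d : T → Deg) : Deg :=
  ⟨FinBij.sigma fun t => (d t).R, FinBij.sigma fun t => (d t).N⟩

abbrev sum (c d : Deg) : Deg := ⟨c.R.sum d.R, c.N.sum d.N⟩

/-- The index of `b ∧ (y_t)_t`, for `b` of index `n` and no `R`-component. -/
abbrev circ (n : FinBij) {T : Type} [Finite T] (d : T → Deg) : Deg :=
  ⟨FinBij.sigma fun t => (d t).R, n.sum (FinBij.sigma fun t => (d t).N)⟩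

end Deg

/-- Maps of indices at simplicial level `k`. -/
@[ext] structure DHom (k : Dop) (c d : Deg) where
  r : d.R ≃ c.R
  lab : Lab c.N d.N k

namespace DHom
variable {k l : Dop} {c d e : Deg}

def id : DHom k c c := ⟨Equiv.refl _, Lab.id⟩
def comp (f : DHom k c d) (h : DHom k d e) : DHom k c e := ⟨h.r.trans f.r, f.lab.comp h.lab⟩
def push (α : k ⟶ l) (f : DHom k c d) : DHom l c d := ⟨f.r, f.lab.push α⟩
def ofEquiv (e : d.R ≃ c.R) (e' : d.N ≃ c.N) : DHom k c d := ⟨e, Lab.ofEquiv e'⟩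
def Null (f : DHom k c d) : Prop := f.lab.Null

def sigma {T T' : Type} [Finite T] [Finite T'] {c : T → Deg} {d : T' → Deg} (σ : T' ≃ T)
    (f : ∀ t', DHom k (c (σ t')) (d t')) : DHom k (Deg.sigma c) (Deg.sigma d) :=
  ⟨Equiv.sigmaCongr σ fun t' => (f t').r, Lab.sigma σ fun t' => (f t').lab⟩

def circ {T T' : Type} [Finite T] [Finite T'] {n n' : FinBij} {c : T → Deg} {d : T' → Deg}
    (σ : T' ≃ T) (h : Lab n n' k) (f : ∀ t', DHom k (c (σ t')) (d t')) :
    DHom k (Deg.circ n c) (Deg.circ n' d) :=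
  ⟨Equiv.sigmaCongr σ fun t' => (f t').r, h.sum (Lab.sigma σ fun t' => (f t').lab)⟩

end DHom


/-- Symmetric spectra, as left modules over the sphere spectrum: `el N k` is the set of
`k`-simplices of the pointed simplicial set `X[N]`, `sm` its simplicial operators, and `lab` is the
action `S^(M ∖ N) ∧ X[N] → X[M]` along embeddings `N → M` of finite sets; for bijections `N → M`
this is the functoriality of `X` on `Σ`. -/
structure SymmetricSpectrum : Type (u + 2) where
  el : FinBij → Dop → Type (u + 1)
  pt : ∀ {N k}, el N k
  sm : ∀ {N k l}, (k ⟶ l) → el N k → el N l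
  lab : ∀ {N M : FinBij} {k}, Lab N M k → el N k → el M k
  sm_id : ∀ {N k} (x : el N k), sm (𝟙 k) x = x
  sm_sm : ∀ {N k l m} (α : k ⟶ l) (β : l ⟶ m) (x : el N k), sm β (sm α x) = sm (α ≫ β) x
  lab_id : ∀ {N k} (x : el N k), lab Lab.id x = x
  lab_lab : ∀ {N M L : FinBij} {k} (f : Lab N M k) (h : Lab M L k) (x : el N k),
    lab h (lab f x) = lab (f.comp h) x
  sm_lab : ∀ {N M : FinBij} {k l} (α : k ⟶ l) (f : Lab N M k) (x : el N k),
    sm α (lab f x) = lab (f.push α) (sm α x)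
  sm_pt : ∀ {N k l} (α : k ⟶ l), sm α (pt : el N k) = pt
  lab_pt : ∀ {N M : FinBij} {k} (f : Lab N M k), lab f pt = pt
  lab_null : ∀ {N M : FinBij} {k} (f : Lab N M k) (x : el N k), f.Null → lab f x = pt

namespace SymmetricSpectrum

@[ext] structure Hom (X Y : SymmetricSpectrum.{u}) where
  f : ∀ {N k}, X.el N k → Y.el N k
  f_pt : ∀ {N k}, f (X.pt : X.el N k) = Y.pt
  f_sm : ∀ {N k l} (α : k ⟶ l) (x : X.el N k), f (X.sm α x) = Y.sm α (f x)
  f_lab : ∀ {N M : FinBij} {k} (h : Lab N M k) (x : X.el N k), f (X.lab h x) = Y.lab h (f x)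

instance : Category SymmetricSpectrum.{u} where
  Hom := Hom
  id X := ⟨fun x => x, rfl, fun _ _ => rfl, fun _ _ => rfl⟩
  comp f g := ⟨fun x => g.f (f.f x), by intros; rw [f.f_pt, g.f_pt], fun α x => by rw [f.f_sm, g.f_sm],
    fun h x => by rw [f.f_lab, g.f_lab]⟩

@[ext] theorem hom_ext {X Y : SymmetricSpectrum.{u}} {f g : X ⟶ Y}
    (h : ∀ N k (x : X.el N k), f.f x = g.f x) : f = g :=
  Hom.ext (by funext N k x; exact h N k x)

@[simp] theorem id_f {X : SymmetricSpectrum.{u}} {N k} (x : X.el N k) : Hom.f (𝟙 X) x = x := rfl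
@[simp] theorem comp_f {X Y Z : SymmetricSpectrum.{u}} (f : X ⟶ Y) (g : Y ⟶ Z) {N k}
    (x : X.el N k) : (f ≫ g).f x = g.f (f.f x) := rfl

end SymmetricSpectrum

/-- Symmetric sequences in symmetric spectra. -/
abbrev SymSeq := FinBijᵒᵖ ⥤ SymmetricSpectrum.{u}

/-- Elements: the `k`-simplices of `X[R][N]`. -/
abbrev SymSeq.el (X : SymSeq.{u}) (d : Deg) (k : Dop) : Type (u + 1) := (X.obj (op d.R)).el d.N k

namespace SymSeq
section
variable (X : SymSeq.{u}) {Y Z : SymSeq.{u}} {c d e : Deg} {k l m : Dop}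

def pt : X.el d k := (X.obj (op d.R)).pt
def sm (α : k ⟶ l) (x : X.el d k) : X.el d l := (X.obj (op d.R)).sm α x

/-- The functoriality in the index. -/
def act (h : DHom k c d) (x : X.el c k) : X.el d k :=
  (X.obj (op d.R)).lab h.lab ((X.map (Quiver.Hom.op (X := d.R) (Y := c.R) h.r)).f x)

variable {X}

/-- The effect of a morphism on elements. -/
def ap (f : X ⟶ Y) (x : X.el d k) : Y.el d k := (f.app (op d.R)).f x

@[simp] theorem sm_id (x : X.el d k) : X.sm (𝟙 k) x = x := SymmetricSpectrum.sm_id _ _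
@[simp] theorem sm_sm (α : k ⟶ l) (β : l ⟶ m) (x : X.el d k) :
    X.sm β (X.sm α x) = X.sm (α ≫ β) x := SymmetricSpectrum.sm_sm _ _ _ _
@[simp] theorem sm_pt (α : k ⟶ l) : X.sm α (X.pt : X.el d k) = X.pt :=
  SymmetricSpectrum.sm_pt _ _
@[simp] theorem act_id (x : X.el d k) : X.act DHom.id x = x := by
  have h := X.map_id (op d.R)
  unfold act
  erw [SymmetricSpectrum.lab_id, h]
  rfl
@[simp] theorem act_act (f : DHom k c d) (h : DHom k d e) (x : X.el c k) :
    X.act h (X.act f x) = X.act (f.comp h) x := by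
  unfold act DHom.comp
  rw [SymmetricSpectrum.Hom.f_lab, SymmetricSpectrum.lab_lab]
  congr 1
  rw [← SymmetricSpectrum.comp_f, ← X.map_comp]
  rfl
@[simp] theorem sm_act (α : k ⟶ l) (f : DHom k c d) (x : X.el c k) :
    X.sm α (X.act f x) = X.act (f.push α) (X.sm α x) := by
  unfold act sm DHom.push
  rw [SymmetricSpectrum.sm_lab, SymmetricSpectrum.Hom.f_sm]
@[simp] theorem act_pt (f : DHom k c d) : X.act f X.pt = X.pt := by
  unfold act pt
  rw [SymmetricSpectrum.Hom.f_pt, SymmetricSpectrum.lab_pt]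
theorem act_null (f : DHom k c d) (x : X.el c k) (h : f.Null) : X.act f x = X.pt :=
  SymmetricSpectrum.lab_null _ _ _ h
@[simp] theorem ap_pt (f : X ⟶ Y) : ap f (X.pt : X.el d k) = Y.pt :=
  SymmetricSpectrum.Hom.f_pt _
@[simp] theorem ap_sm (f : X ⟶ Y) (α : k ⟶ l) (x : X.el d k) :
    ap f (X.sm α x) = Y.sm α (ap f x) := SymmetricSpectrum.Hom.f_sm _ _ _
@[simp] theorem ap_act (f : X ⟶ Y) (h : DHom k c d) (x : X.el c k) :
    ap f (X.act h x) = Y.act h (ap f x) := by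
  unfold act ap
  rw [SymmetricSpectrum.Hom.f_lab, ← SymmetricSpectrum.comp_f, f.naturality]
  rfl
@[simp] theorem ap_id (x : X.el d k) : ap (𝟙 X) x = x := rfl
@[simp] theorem ap_comp (f : X ⟶ Y) (g : Y ⟶ Z) (x : X.el d k) :
    ap (f ≫ g) x = ap g (ap f x) := rfl
theorem hom_ext {f g : X ⟶ Y} (h : ∀ d k (x : X.el d k), ap f x = ap g x) : f = g := by
  ext R N k x
  exact h ⟨R.unop, N⟩ k x

/-- A morphism of symmetric sequences from its effect on elements. -/
def mkHom (f : ∀ d k, X.el d k → Y.el d k) (f_pt : ∀ d k, f d k X.pt = Y.pt)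
    (f_sm : ∀ d k l (α : k ⟶ l) x, f d l (X.sm α x) = Y.sm α (f d k x))
    (f_act : ∀ c d k (h : DHom k c d) x, f d k (X.act h x) = Y.act h (f c k x)) : X ⟶ Y where
  app R :=
    { f := fun {N k} => f ⟨R.unop, N⟩ k
      f_pt := fun {N k} => f_pt ⟨R.unop, N⟩ k
      f_sm := fun {N k l} α x => f_sm ⟨R.unop, N⟩ k l α x
      f_lab := fun {N M k} h x => by
        have := f_act ⟨R.unop, N⟩ ⟨R.unop, M⟩ k ⟨Equiv.refl _, h⟩ x
        unfold act at this
        erw [X.map_id, Y.map_id] at this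
        exact this }
  naturality R S e := by
    ext N k x
    have := f_act ⟨R.unop, N⟩ ⟨S.unop, N⟩ k ⟨e.unop, Lab.id⟩ x
    unfold act at this
    erw [SymmetricSpectrum.lab_id, SymmetricSpectrum.lab_id] at this
    exact this

@[simp] theorem ap_mkHom (f : ∀ d k, X.el d k → Y.el d k) (h₁ h₂ h₃) (x : X.el d k) :
    ap (mkHom f h₁ h₂ h₃) x = f d k x := rfl
end
end SymSeq

/-- A symmetric sequence from its elements. -/
structure ElData : Type (u + 2) where
  el : Deg → Dop → Type (u + 1)
  pt : ∀ {d k}, el d k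
  sm : ∀ {d k l}, (k ⟶ l) → el d k → el d l
  act : ∀ {c d k}, DHom k c d → el c k → el d k
  sm_id : ∀ {d k} (x : el d k), sm (𝟙 k) x = x
  sm_sm : ∀ {d k l m} (α : k ⟶ l) (β : l ⟶ m) (x : el d k), sm β (sm α x) = sm (α ≫ β) x
  act_id : ∀ {d k} (x : el d k), act DHom.id x = x
  act_act : ∀ {c d e k} (f : DHom k c d) (h : DHom k d e) (x : el c k),
    act h (act f x) = act (f.comp h) x
  sm_act : ∀ {c d k l} (α : k ⟶ l) (f : DHom k c d) (x : el c k),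
    sm α (act f x) = act (f.push α) (sm α x)
  sm_pt : ∀ {d k l} (α : k ⟶ l), sm α (pt : el d k) = pt
  act_pt : ∀ {c d k} (f : DHom k c d), act f pt = pt
  act_null : ∀ {c d k} (f : DHom k c d) (x : el c k), f.Null → act f x = pt

namespace Lab
variable {A B C D : Type} {k l m : Dop}
@[simp] theorem id_comp (f : Lab A B k) : Lab.id.comp f = f := by
  ext b : 2
  rcases h : f.g b with a | s <;> simp [comp, id, ofEquiv, h]
@[simp] theorem comp_id (f : Lab A B k) : f.comp Lab.id = f := by
  ext b : 2
  simp [comp, id, ofEquiv]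
theorem comp_assoc (f : Lab A B k) (g : Lab B C k) (h : Lab C D k) :
    (f.comp g).comp h = f.comp (g.comp h) := by
  ext b : 2
  rcases h' : h.g b with a | s <;> simp [comp, h']
@[simp] theorem push_id (α : k ⟶ l) : (Lab.id : Lab A A k).push α = Lab.id := by
  ext b : 2
  simp [push, id, ofEquiv]
@[simp] theorem push_push (α : k ⟶ l) (β : l ⟶ m) (f : Lab A B k) :
    (f.push α).push β = f.push (α ≫ β) := by
  ext b : 2
  rcases h' : f.g b with a | s <;> simp [push, h']
@[simp] theorem push_one (f : Lab A B k) : f.push (𝟙 k) = f := by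
  ext b : 2
  rcases h' : f.g b with a | s <;> simp [push, h']
theorem push_comp (α : k ⟶ l) (f : Lab A B k) (g : Lab B C k) :
    (f.comp g).push α = (f.push α).comp (g.push α) := by
  ext b : 2
  rcases h' : g.g b with a | s <;> simp [push, comp, h']
theorem Null.comp_left {f : Lab A B k} (hf : f.Null) (g : Lab B C k) : (f.comp g).Null := by
  obtain ⟨b, s, h, hs⟩ := hf
  obtain ⟨c, hc, -⟩ := g.uniq b
  exact ⟨c, s, by simp [comp, hc, h], hs⟩
theorem Null.comp_right (f : Lab A B k) {g : Lab B C k} (hg : g.Null) : (f.comp g).Null := by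
  obtain ⟨b, s, h, hs⟩ := hg
  exact ⟨b, s, by simp [comp, h], hs⟩
theorem Null.push (α : k ⟶ l) {f : Lab A B k} (hf : f.Null) : (f.push α).Null := by
  obtain ⟨b, s, h, hs⟩ := hf
  exact ⟨b, _, by simp only [Lab.push, h]; rfl, hs.map α⟩
end Lab

namespace DHom
variable {k l m : Dop} {b c d e : Deg}
@[simp] theorem id_comp (f : DHom k c d) : DHom.id.comp f = f := by
  ext1 <;> simp [comp, id]
@[simp] theorem comp_id (f : DHom k c d) : f.comp DHom.id = f := by
  ext1 <;> simp [comp, id]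
theorem comp_assoc (f : DHom k b c) (g : DHom k c d) (h : DHom k d e) :
    (f.comp g).comp h = f.comp (g.comp h) := by
  ext1 <;> simp [comp, Lab.comp_assoc, Equiv.trans_assoc]
@[simp] theorem push_id (α : k ⟶ l) : (DHom.id : DHom k c c).push α = DHom.id := by
  ext1 <;> simp [push, id]
@[simp] theorem push_push (α : k ⟶ l) (β : l ⟶ m) (f : DHom k c d) :
    (f.push α).push β = f.push (α ≫ β) := by ext1 <;> simp [push]
@[simp] theorem push_one (f : DHom k c d) : f.push (𝟙 k) = f := by ext1 <;> simp [push]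
theorem push_comp (α : k ⟶ l) (f : DHom k c d) (g : DHom k d e) :
    (f.comp g).push α = (f.push α).comp (g.push α) := by
  ext1 <;> simp [push, comp, Lab.push_comp]
end DHom

def ElData.toSymSeq (X : ElData.{u}) : SymSeq.{u} where
  obj R :=
    { el := fun N => X.el ⟨R.unop, N⟩
      pt := X.pt
      sm := X.sm
      lab := fun {N M k} f => X.act (c := ⟨R.unop, N⟩) (d := ⟨R.unop, M⟩) ⟨Equiv.refl _, f⟩
      sm_id := X.sm_id
      sm_sm := X.sm_sm
      lab_id := X.act_id
      lab_lab := fun _ _ => X.act_act _ _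
      sm_lab := fun _ _ => X.sm_act _ _
      sm_pt := X.sm_pt
      lab_pt := fun _ => X.act_pt _
      lab_null := fun f x h => X.act_null _ x h }
  map {R S} e :=
    { f := fun {N k} => X.act (c := ⟨R.unop, N⟩) (d := ⟨S.unop, N⟩) ⟨e.unop, Lab.id⟩
      f_pt := X.act_pt _
      f_sm := fun α x => by
        refine Eq.trans ?_ (X.sm_act _ _ _).symm
        simp [DHom.push]
      f_lab := fun h x => by
        dsimp only
        rw [X.act_act, X.act_act]
        congr 1
        ext1 <;> simp [DHom.comp] }
  map_id R := by
    ext N k x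
    exact X.act_id x
  map_comp e e' := by
    ext N k x
    exact ((X.act_act _ _ _).trans (congrArg (fun h => X.act h x)
      (by
        unfold DHom.comp
        rw [Lab.comp_id]
        rfl))).symm

@[simp] theorem ElData.act_toSymSeq (X : ElData.{u}) {c d : Deg} {k : Dop} (h : DHom k c d)
    (x : X.el c k) : X.toSymSeq.act h x = X.act h x := by
  unfold SymSeq.act ElData.toSymSeq
  dsimp only
  rw [X.act_act]
  congr 1
  ext1
  · rfl
  · simp [DHom.comp]

/-- A presentation of a symmetric sequence: generators of shapes `s : Sh`, of index `deg s`, with a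
simplicial set `val s` of them in each shape; relations `v' = h_* v` for `step s s' h v v'`, and
`v = *` for `null v`. -/
structure Pres : Type (u + 2) where
  Sh : Type 1
  deg : Sh → Deg
  val : Sh → Dop → Type (u + 1)
  sm : ∀ {s k l}, (k ⟶ l) → val s k → val s l
  sm_id : ∀ {s k} (v : val s k), sm (𝟙 k) v = v
  sm_sm : ∀ {s k l m} (α : k ⟶ l) (β : l ⟶ m) (v : val s k), sm β (sm α v) = sm (α ≫ β) v
  step : ∀ {k} (s s' : Sh), DHom k (deg s) (deg s') → val s k → val s' k → Prop
  null : ∀ {s k}, val s k → Prop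
  step_sm : ∀ {k l} (α : k ⟶ l) {s s' : Sh} (h : DHom k (deg s) (deg s')) v v', step s s' h v v' →
    step s s' (h.push α) (sm α v) (sm α v')
  null_sm : ∀ {s k l} (α : k ⟶ l) (v : val s k), null v → null (sm α v)

namespace Pres
variable (P : Pres.{u}) {k l m : Dop} {c d e : Deg}

/-- A generator together with a map of indices. -/
structure Gen (d : Deg) (k : Dop) where
  s : P.Sh
  v : P.val s k
  ψ : DHom k (P.deg s) d

variable {P}

/-- The relations; `none` is the basepoint. -/
inductive Rel {d : Deg} {k : Dop} : Option (P.Gen d k) → Option (P.Gen d k) → Prop where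
  | step (s s' : P.Sh) (h : DHom k (P.deg s) (P.deg s')) (v : P.val s k) (v' : P.val s' k)
      (ψ : DHom k (P.deg s') d) : P.step s s' h v v' →
      Rel (some ⟨s, v, h.comp ψ⟩) (some ⟨s', v', ψ⟩)
  | null (g : P.Gen d k) : P.null g.v → Rel (some g) none
  | nullMap (g : P.Gen d k) : g.ψ.Null → Rel (some g) none

def Gen.sm (α : k ⟶ l) (g : P.Gen d k) : P.Gen d l := ⟨g.s, P.sm α g.v, g.ψ.push α⟩
def Gen.act (h : DHom k c d) (g : P.Gen c k) : P.Gen d k := ⟨g.s, g.v, g.ψ.comp h⟩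

variable (P)

def elData : ElData.{u} where
  el d k := Quot (Rel (P := P) (d := d) (k := k))
  pt := Quot.mk _ none
  sm α := Quot.map (Option.map (Gen.sm α)) (by
    rintro _ _ (⟨s, s', h, v, v', ψ, hs⟩ | ⟨g, hg⟩ | ⟨g, hg⟩)
    · simp only [Option.map_some, Gen.sm, DHom.push_comp]
      exact .step _ _ _ _ _ _ (P.step_sm α h v v' hs)
    · exact .null _ (P.null_sm α _ hg)
    · exact .nullMap _ (hg.push α))
  act h := Quot.map (Option.map (Gen.act h)) (by
    rintro _ _ (⟨s, s', h, v, v', ψ, hs⟩ | ⟨g, hg⟩ | ⟨g, hg⟩)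
    · simp only [Option.map_some, Gen.act, DHom.comp_assoc]
      exact .step _ _ _ _ _ _ hs
    · exact .null _ hg
    · exact .nullMap _ (hg.comp_left _))
  sm_id x := by
    obtain ⟨_ | g⟩ := x <;> simp [Quot.map, Gen.sm, P.sm_id]
  sm_sm α β x := by
    obtain ⟨_ | g⟩ := x <;> simp [Quot.map, Gen.sm, P.sm_sm]
  act_id x := by
    obtain ⟨_ | g⟩ := x <;> simp [Quot.map, Gen.act]
  act_act f h x := by
    obtain ⟨_ | g⟩ := x <;> simp [Quot.map, Gen.act, DHom.comp_assoc]
  sm_act α f x := by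
    obtain ⟨_ | g⟩ := x <;> simp [Quot.map, Gen.act, Gen.sm, DHom.push_comp]
  sm_pt α := rfl
  act_pt f := rfl
  act_null f x hf := by
    obtain ⟨_ | g⟩ := x
    · rfl
    · exact Quot.sound (.nullMap _ (Lab.Null.comp_right _ hf))

/-- The symmetric sequence presented by `P`. -/
def obj : SymSeq.{u} := P.elData.toSymSeq

variable {P}

/-- The element given by a generator. -/
def gen (s : P.Sh) (v : P.val s k) (ψ : DHom k (P.deg s) d) : P.obj.el d k :=
  Quot.mk _ (some ⟨s, v, ψ⟩)

@[simp] theorem sm_gen (α : k ⟶ l) (s : P.Sh) (v : P.val s k) (ψ : DHom k (P.deg s) d) :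
    P.obj.sm α (gen s v ψ) = gen s (P.sm α v) (ψ.push α) := rfl
@[simp] theorem act_gen (h : DHom k c d) (s : P.Sh) (v : P.val s k) (ψ : DHom k (P.deg s) c) :
    P.obj.act h (gen s v ψ) = gen s v (ψ.comp h) := ElData.act_toSymSeq _ _ _
theorem gen_step {s s' : P.Sh} {h : DHom k (P.deg s) (P.deg s')} {v : P.val s k} {v' : P.val s' k}
    (hs : P.step s s' h v v') (ψ : DHom k (P.deg s') d) : gen s v (h.comp ψ) = gen s' v' ψ :=
  Quot.sound (.step _ _ _ _ _ _ hs)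
theorem gen_null {s : P.Sh} {v : P.val s k} (hv : P.null v) (ψ : DHom k (P.deg s) d) :
    gen s v ψ = P.obj.pt := Quot.sound (.null _ hv)
theorem gen_nullMap {s : P.Sh} {v : P.val s k} {ψ : DHom k (P.deg s) d} (hψ : ψ.Null) :
    gen s v ψ = P.obj.pt := Quot.sound (.nullMap _ hψ)
theorem ind {p : P.obj.el d k → Prop} (h₀ : p P.obj.pt) (h : ∀ s v ψ, p (gen s v ψ))
    (x : P.obj.el d k) : p x := by
  obtain ⟨_ | g⟩ := x
  exacts [h₀, h _ _ _]

/-- Morphisms out of a presented symmetric sequence. -/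
def lift (Z : SymSeq.{u}) (F : ∀ s k, P.val s k → Z.el (P.deg s) k)
    (F_sm : ∀ s k l (α : k ⟶ l) v, F s l (P.sm α v) = Z.sm α (F s k v))
    (F_step : ∀ k s s' h v v', P.step (k := k) s s' h v v' → F s' k v' = Z.act h (F s k v))
    (F_null : ∀ s k v, P.null v → F s k v = Z.pt) : P.obj ⟶ Z :=
  SymSeq.mkHom (fun d k => Quot.lift (fun g => g.elim Z.pt fun g => Z.act g.ψ (F g.s k g.v)) (by
    rintro _ _ (⟨s, s', h, v, v', ψ, hs⟩ | ⟨g, hg⟩ | ⟨g, hg⟩)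
    · simp [F_step _ _ _ _ _ _ hs]
    · simp [F_null _ _ _ hg]
    · exact Z.act_null _ _ hg))
    (fun _ _ => rfl)
    (fun d k l α => ind (by erw [Z.sm_pt]; rfl) fun s v ψ => by
      rw [sm_gen]
      simp only [gen, Option.elim, F_sm, Z.sm_act])
    (fun c d k h => ind (by erw [Z.act_pt]; rfl) fun s v ψ => by
      rw [act_gen]
      simp only [gen, Option.elim, Z.act_act])

@[simp] theorem ap_lift {Z : SymSeq.{u}} (F F_sm F_step F_null) (s : P.Sh) (v : P.val s k)
    (ψ : DHom k (P.deg s) d) :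
    SymSeq.ap (lift Z F F_sm F_step F_null) (gen s v ψ) = Z.act ψ (F s k v) := rfl

theorem hom_ext {Z : SymSeq.{u}} {f g : P.obj ⟶ Z}
    (h : ∀ k s (v : P.val s k), SymSeq.ap f (gen s v DHom.id) = SymSeq.ap g (gen s v DHom.id)) :
    f = g := by
  refine SymSeq.hom_ext fun d k => ind (by simp) fun s v ψ => ?_
  have : gen s v ψ = P.obj.act ψ (gen s v DHom.id) := by simp
  rw [this, SymSeq.ap_act, SymSeq.ap_act, h]

end Pres

section Colimits
variable {J : Type} [Category.{0} J] (F : J ⥤ SymSeq.{u})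

/-- Colimits of symmetric sequences. -/
abbrev colimPres : Pres.{u} where
  Sh := J × Deg
  deg s := s.2
  val s k := (F.obj s.1).el s.2 k
  sm α := (F.obj _).sm α
  sm_id := SymSeq.sm_id
  sm_sm := SymSeq.sm_sm
  step s s' h v v' := ∃ f : s.1 ⟶ s'.1, v' = SymSeq.act _ h (SymSeq.ap (F.map f) v)
  null v := v = SymSeq.pt _
  step_sm α s s' h v v' := by
    rintro ⟨f, rfl⟩
    exact ⟨f, by simp⟩
  null_sm α v := by
    rintro rfl
    simp

theorem colim_step {j j' : J} (f : j ⟶ j') {c d : Deg} {k : Dop} (h : DHom k c d)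
    (x : (F.obj j).el c k) :
    Pres.gen (P := colimPres F) (j, c) x h =
      Pres.gen (P := colimPres F) (j', d) (SymSeq.act _ h (SymSeq.ap (F.map f) x)) DHom.id := by
  rw [← Pres.gen_step (P := colimPres F) (s := (j, c)) (s' := (j', d)) (h := h) ⟨f, rfl⟩,
    DHom.comp_id]

def colimCocone : Cocone F where
  pt := (colimPres F).obj
  ι :=
    { app j := SymSeq.mkHom (Y := (colimPres F).obj)
        (fun d k x => Pres.gen (P := colimPres F) (j, d) x DHom.id)
        (fun d k => Pres.gen_null (P := colimPres F) rfl _)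
        (fun d k l α x => by rw [Pres.sm_gen, DHom.push_id])
        (fun c d k h x => by
          have := colim_step F (𝟙 j) h x
          rw [F.map_id, SymSeq.ap_id] at this
          rw [Pres.act_gen, DHom.id_comp, this])
      naturality j j' f := SymSeq.hom_ext fun d k x => by
        refine Eq.trans ?_ (colim_step F f DHom.id x).symm
        rw [SymSeq.act_id]
        rfl }

def colimIsColimit : IsColimit (colimCocone F) where
  desc c := Pres.lift c.pt (fun s k v => SymSeq.ap (c.ι.app s.1) v)
    (fun s k l α v => by exact SymSeq.ap_sm _ _ _)
    (fun k s s' h v v' ⟨f, hf⟩ => by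
      rw [hf, ← c.w f]
      exact SymSeq.ap_act _ _ _)
    (fun s k v hv => by rw [hv]; exact SymSeq.ap_pt _)
  fac c j := SymSeq.hom_ext fun d k x => by
    exact SymSeq.act_id _
  uniq c m hm := Pres.hom_ext fun k s v => by
    have := congrArg (fun f => SymSeq.ap f v) (hm s.1)
    exact this.trans (SymSeq.act_id _).symm

end Colimits

instance : HasColimitsOfSize.{0, 0} SymSeq.{u} where
  has_colimits_of_shape _ _ := { has_colimit := fun F => ⟨⟨⟨colimCocone F, colimIsColimit F⟩⟩⟩ }

namespace Lab
variable {A B C D : Type} {k l : Dop}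

theorem push_sum (α : k ⟶ l) (f : Lab A B k) (h : Lab C D k) :
    (f.sum h).push α = (f.push α).sum (h.push α) := by
  ext (b | d) : 2
  · rcases hb : f.g b with a | s <;> simp [push, sum, hb]
  · rcases hd : h.g d with a | s <;> simp [push, sum, hd]

theorem push_sigma {T T' : Type} {A : T → Type} {B : T' → Type} (α : k ⟶ l) (σ : T' ≃ T)
    (f : ∀ t', Lab (A (σ t')) (B t') k) :
    (sigma σ f).push α = sigma σ fun t' => (f t').push α := by
  ext ⟨t, b⟩ : 2
  rcases hb : (f t).g b with a | s <;> simp [push, sigma, hb]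

theorem Null.sigma {T T' : Type} {A : T → Type} {B : T' → Type} (σ : T' ≃ T)
    {f : ∀ t', Lab (A (σ t')) (B t') k} {t : T'} (h : (f t).Null) : (sigma σ f).Null := by
  obtain ⟨b, s, hb, hs⟩ := h
  exact ⟨⟨t, b⟩, s, by simp [Lab.sigma, hb], hs⟩

theorem Null.sum_right (f : Lab A B k) {h : Lab C D k} (hh : h.Null) : (f.sum h).Null := by
  obtain ⟨b, s, hb, hs⟩ := hh
  exact ⟨Sum.inr b, s, by simp [Lab.sum, hb], hs⟩
end Lab


namespace DHom
variable {k l : Dop} {T T' : Type} [Finite T] [Finite T']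

theorem push_sigma (α : k ⟶ l) {c : T → Deg} {d : T' → Deg} (σ : T' ≃ T)
    (f : ∀ t', DHom k (c (σ t')) (d t')) :
    (sigma σ f).push α = sigma σ fun t' => (f t').push α := by
  ext1
  · rfl
  · exact Lab.push_sigma (A := fun t => (c t).N) (B := fun t => (d t).N) α σ fun t' => (f t').lab

theorem push_circ (α : k ⟶ l) {n n' : FinBij} {c : T → Deg} {d : T' → Deg} (σ : T' ≃ T)
    (h : Lab n n' k) (f : ∀ t', DHom k (c (σ t')) (d t')) :
    (circ σ h f).push α = circ σ (h.push α) fun t' => (f t').push α := by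
  ext1
  · rfl
  · exact (Lab.push_sum α h _).trans (congrArg _
      (Lab.push_sigma (A := fun t => (c t).N) (B := fun t => (d t).N) α σ fun t' => (f t').lab))

theorem sigma_comp {T'' : Type} [Finite T''] {c : T → Deg} {d : T' → Deg} {e : T'' → Deg}
    (σ : T' ≃ T) (f : ∀ t', DHom k (c (σ t')) (d t')) (τ : T'' ≃ T')
    (g : ∀ t'', DHom k (d (τ t'')) (e t'')) :
    (sigma σ f).comp (sigma τ g) = sigma (τ.trans σ) fun t => (f (τ t)).comp (g t) := by
  ext1
  · exact Equiv.ext fun ⟨t, x⟩ => rfl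
  · refine Lab.ext (funext fun ⟨t, x⟩ => ?_)
    rcases h : (g t).lab.g x with a | s <;> simp [comp, sigma, Lab.comp, Lab.sigma, h]

/-- A disjoint union of maps of indices. -/
def fam {c d : T → Deg} (f : ∀ t, DHom k (c t) (d t)) : DHom k (Deg.sigma c) (Deg.sigma d) :=
  sigma (Equiv.refl T) f

theorem push_fam (α : k ⟶ l) {c d : T → Deg} (f : ∀ t, DHom k (c t) (d t)) :
    (fam f).push α = fam fun t => (f t).push α := push_sigma α (Equiv.refl T) f

theorem fam_id (c : T → Deg) : fam (fun t => (id : DHom k (c t) (c t))) = id := rfl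

/-- Reindexing a disjoint union along a bijection. -/
def reindex (σ : T' ≃ T) (d : T → Deg) : DHom k (Deg.sigma fun t' => d (σ t')) (Deg.sigma d) :=
  ofEquiv (Equiv.sigmaCongrLeft (β := fun t => (d t).R) σ).symm
    (Equiv.sigmaCongrLeft (β := fun t => (d t).N) σ).symm

theorem push_reindex (α : k ⟶ l) (σ : T' ≃ T) (d : T → Deg) :
    (reindex σ d : DHom k _ _).push α = reindex σ d := rfl

theorem ofEquiv_comp {c d e : Deg} (a : d.R ≃ c.R) (b : d.N ≃ c.N) (a' : e.R ≃ d.R)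
    (b' : e.N ≃ d.N) : (ofEquiv a b : DHom k c d).comp (ofEquiv a' b') =
      ofEquiv (a'.trans a) (b'.trans b) := rfl

theorem reindex_inv (σ : T' ≃ T) (d : T → Deg) : (reindex σ d : DHom k _ _).comp
    (sigma σ fun t' => (id : DHom k (d (σ t')) (d (σ t')))) = id := by
  have : (sigma σ fun t' => (id : DHom k (d (σ t')) (d (σ t')))) =
    ofEquiv (Equiv.sigmaCongrLeft (β := fun t => (d t).R) σ)
      (Equiv.sigmaCongrLeft (β := fun t => (d t).N) σ) := rfl
  rw [this, reindex, ofEquiv_comp, Equiv.self_trans_symm, Equiv.self_trans_symm]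
  rfl

theorem inv_reindex (σ : T' ≃ T) (d : T → Deg) :
    (sigma σ fun t' => (id : DHom k (d (σ t')) (d (σ t')))).comp (reindex σ d) = id := by
  have : (sigma σ fun t' => (id : DHom k (d (σ t')) (d (σ t')))) =
    ofEquiv (Equiv.sigmaCongrLeft (β := fun t => (d t).R) σ)
      (Equiv.sigmaCongrLeft (β := fun t => (d t).N) σ) := rfl
  rw [this, reindex, ofEquiv_comp, Equiv.symm_trans_self, Equiv.symm_trans_self]
  rfl

theorem fam_reindex (σ : T' ≃ T) {c d : T → Deg} (f : ∀ t, DHom k (c t) (d t)) :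
    (fam fun t' => f (σ t')).comp (reindex σ d) = (reindex σ c).comp (fam f) := by
  have h : (fam f).comp (sigma σ fun t' => (id : DHom k (d (σ t')) (d (σ t')))) =
      (sigma σ fun t' => (id : DHom k (c (σ t')) (c (σ t')))).comp (fam fun t' => f (σ t')) :=
    (sigma_comp (Equiv.refl T) f σ _).trans (Eq.trans (congrArg (sigma σ)
      (funext fun t' => (comp_id _).trans (id_comp _).symm))
      (sigma_comp σ (fun t' => (id : DHom k (c (σ t')) (c (σ t')))) (Equiv.refl T')
        (d := fun t' => c (σ t')) (e := fun t' => d (σ t')) fun t' => f (σ t')).symm)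
  calc _ = ((reindex σ c).comp (sigma σ fun t' => (id : DHom k (c (σ t')) (c (σ t'))))).comp
        ((fam fun t' => f (σ t')).comp (reindex σ d)) := by
        rw [reindex_inv, id_comp]
    _ = ((reindex σ c).comp (fam f)).comp
        ((sigma σ fun t' => (id : DHom k (d (σ t')) (d (σ t')))).comp (reindex σ d)) := by
        simp only [comp_assoc]
        rw [← comp_assoc (sigma σ _) (fam _), ← h, comp_assoc]
    _ = _ := by rw [inv_reindex, comp_id]

theorem reindex_reindex {T'' : Type} [Finite T''] (σ : T' ≃ T) (τ : T'' ≃ T') (d : T → Deg) :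
    (reindex τ fun t' => d (σ t')).comp (reindex σ d) = (reindex (τ.trans σ) d : DHom k _ _) := by
  have h (β : T → Type) : (Equiv.sigmaCongrLeft (β := β) σ).symm.trans
      (Equiv.sigmaCongrLeft (β := fun t' => β (σ t')) τ).symm =
      (Equiv.sigmaCongrLeft (β := β) (τ.trans σ)).symm := by
    refine Equiv.ext fun x => ?_
    obtain ⟨⟨t, x⟩, rfl⟩ := (Equiv.sigmaCongrLeft (β := β) (τ.trans σ)).surjective x
    refine Eq.trans ?_ (Equiv.symm_apply_apply _ _).symm
    exact (Equiv.symm_apply_eq (Equiv.sigmaCongrLeft (β := fun t' => β (σ t')) τ)).2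
      ((Equiv.symm_apply_eq (Equiv.sigmaCongrLeft (β := β) σ)).2 rfl)
  exact DHom.ext (h fun t => (d t).R) (congrArg Lab.ofEquiv (h fun t => (d t).N))
end DHom

section Tensor
variable {T T' T'' : Type} [Finite T] [Finite T'] [Finite T'']

/-- The tensor product of a finite family of symmetric sequences: generated by families of elements
`x_t ∈ X_t[R_t][N_t]_k` in `[∐ R_t][∐ N_t]_k`, naturally in each `(R_t, N_t)` and `k`. -/
abbrev tensorPres (X : T → SymSeq.{u}) : Pres.{u} where
  Sh := T → Deg
  deg d := Deg.sigma d
  val d k := ∀ t, (X t).el (d t) k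
  sm α v t := (X t).sm α (v t)
  sm_id v := by simp
  sm_sm α β v := by simp
  step d d' h v v' := ∃ f : ∀ t, DHom _ (d t) (d' t),
    h = DHom.fam f ∧ ∀ t, v' t = (X t).act (f t) (v t)
  null v := ∃ t, v t = (X t).pt
  step_sm α d d' h v v' := by
    rintro ⟨f, rfl, hf⟩
    exact ⟨fun t => (f t).push α, DHom.push_fam _ _, fun t => by simp [hf]⟩
  null_sm α v := by
    rintro ⟨t, h⟩
    exact ⟨t, by simp [h]⟩

def tensor (X : T → SymSeq.{u}) : SymSeq.{u} := (tensorPres X).obj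

/-- Functoriality of the tensor product, also in the indexing set. -/
def tensorMap {X : T → SymSeq.{u}} {Y : T' → SymSeq.{u}} (σ : T' ≃ T)
    (f : ∀ t', X (σ t') ⟶ Y t') : tensor X ⟶ tensor Y :=
  Pres.lift (P := tensorPres X) (tensorPres Y).obj
    (fun d _ v => Pres.gen (P := tensorPres Y) (fun t' => d (σ t'))
      (fun t' => SymSeq.ap (f t') (v (σ t'))) (DHom.reindex σ d))
    (fun d k l α v => by
      rw [Pres.sm_gen]
      simp [DHom.push_reindex])
    (fun k d d' h v v' ⟨g, hg, hv⟩ => by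
      rw [Pres.act_gen, hg, ← DHom.fam_reindex]
      refine (Pres.gen_step ?_ _).symm
      exact ⟨fun t' => g (σ t'), rfl, fun t' => by simp [hv]⟩)
    (fun d k v ⟨t, ht⟩ => by
      obtain ⟨t', rfl⟩ := σ.surjective t
      exact Pres.gen_null (P := tensorPres Y) ⟨t', by simp [ht]⟩ _)

theorem ap_tensorMap {X : T → SymSeq.{u}} {Y : T' → SymSeq.{u}} (σ : T' ≃ T)
    (f : ∀ t', X (σ t') ⟶ Y t') {e : Deg} {k : Dop} (d : T → Deg) (v : ∀ t, (X t).el (d t) k)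
    (p : DHom k (Deg.sigma d) e) :
    SymSeq.ap (tensorMap σ f) (Pres.gen (P := tensorPres X) d v p) =
      Pres.gen (P := tensorPres Y) (fun t' => d (σ t'))
        (fun t' => SymSeq.ap (f t') (v (σ t'))) ((DHom.reindex σ d).comp p) :=
  (Pres.ap_lift _ _ _ _ _ _ _).trans (Pres.act_gen _ _ _ _)

theorem tensorMap_id (X : T → SymSeq.{u}) :
    tensorMap (X := X) (Y := X) (Equiv.refl T) (fun t => 𝟙 (X t)) = 𝟙 (tensor X) :=
  Pres.hom_ext (P := tensorPres X) fun k d v => by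
    refine (ap_tensorMap (X := X) (Y := X) _ _ _ _ _).trans ?_
    rfl

theorem tensorMap_comp {X : T → SymSeq.{u}} {Y : T' → SymSeq.{u}} {Z : T'' → SymSeq.{u}}
    (σ : T' ≃ T) (f : ∀ t', X (σ t') ⟶ Y t') (τ : T'' ≃ T') (g : ∀ t'', Y (τ t'') ⟶ Z t'') :
    tensorMap σ f ≫ tensorMap τ g =
      tensorMap (X := X) (Y := Z) (τ.trans σ) fun t => f (τ t) ≫ g t :=
  Pres.hom_ext (P := tensorPres X) fun k d v => by
    refine (congrArg (SymSeq.ap (tensorMap τ g)) (ap_tensorMap σ f d v DHom.id)).trans ?_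
    refine (ap_tensorMap τ g _ _ _).trans
      (Eq.trans ?_ (ap_tensorMap (X := X) (Y := Z) (τ.trans σ) _ d v DHom.id).symm)
    rw [← DHom.comp_assoc, DHom.reindex_reindex]
    rfl

end Tensor

section MultiLift

theorem piQuot {T : Type} [Finite T] {α : T → Type*} {r : ∀ t, α t → α t → Prop} {C : Sort*}
    (F : (∀ t, α t) → C) (hF : ∀ x x', (∀ t, x t = x' t ∨ r t (x t) (x' t)) → F x = F x')
    (x x' : ∀ t, α t) (h : ∀ t, Quot.mk (r t) (x t) = Quot.mk (r t) (x' t)) : F x = F x' := by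
  classical
  cases nonempty_fintype T
  suffices H : ∀ (s : Finset T) (x x' : ∀ t, α t), (∀ t, Quot.mk (r t) (x t) = Quot.mk (r t) (x' t)) →
      (∀ t, t ∉ s → x t = x' t) → F x = F x' from H Finset.univ x x' h (by simp)
  intro s
  induction s using Finset.induction with
  | empty => exact fun x x' _ h => congrArg F (funext fun t => h t (by simp))
  | insert a s ha ih =>
    intro x x' h h'
    have h1 : F x = F (Function.update x' a (x a)) := by
      refine ih _ _ (fun t => ?_) fun t ht => ?_
      · rcases eq_or_ne t a with rfl | hta
        · simp
        · simp [hta, h t]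
      · rcases eq_or_ne t a with rfl | hta
        · simp
        · simp [hta, h' t (by simp [hta, ht])]
    have h2 : ∀ u v, Relation.EqvGen (r a) u v →
        F (Function.update x' a u) = F (Function.update x' a v) := by
      intro u v huv
      induction huv with
      | rel u v huv =>
        refine hF _ _ fun t => ?_
        rcases eq_or_ne t a with rfl | hta
        · simp [huv]
        · simp [hta]
      | refl => rfl
      | symm _ _ _ h => exact h.symm
      | trans _ _ _ _ _ h h' => exact h.trans h'
    rw [h1, h2 _ _ (Quot.eqvGen_exact (h a)), Function.update_eq_self]

namespace Pres
variable {P : Pres.{u}} {k : Dop} {T : Type} [Finite T] {d : T → Deg}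

/-- A function of a family of elements from its values on families of generators. -/
noncomputable def multi {C : Sort*} (c₀ : C) (G : (∀ t, P.Gen (d t) k) → C)
    (z : ∀ t, P.obj.el (d t) k) : C := by
  classical
  exact if h : ∃ g : ∀ t, P.Gen (d t) k, z = fun t => gen (g t).s (g t).v (g t).ψ then G h.choose
    else c₀

theorem exists_gens (z : ∀ t, P.obj.el (d t) k) : (∃ t, z t = P.obj.pt) ∨
    ∃ g : ∀ t, P.Gen (d t) k, z = fun t => gen (g t).s (g t).v (g t).ψ := by
  by_cases h : ∃ t, z t = P.obj.pt
  · exact .inl h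
  · refine .inr ?_
    have : ∀ t, ∃ g : P.Gen (d t) k, z t = gen g.s g.v g.ψ := fun t => by
      have h' : z t ≠ P.obj.pt := fun h' => h ⟨t, h'⟩
      generalize z t = y at h'
      revert h'
      refine ind (p := fun y => y ≠ P.obj.pt → ∃ g : P.Gen (d t) k, y = gen g.s g.v g.ψ)
        (fun h' => absurd rfl h') (fun s v ψ _ => ⟨⟨s, v, ψ⟩, rfl⟩) y
    choose g hg using this
    exact ⟨g, funext hg⟩

/-- The condition for a function of families of generators to be well defined. -/
structure Multi {C : Sort*} (c₀ : C) (G : (∀ t, P.Gen (d t) k) → C) : Prop where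
  step : ∀ (s s' : T → P.Sh) (h : ∀ t, DHom k (P.deg (s t)) (P.deg (s' t)))
    (v : ∀ t, P.val (s t) k) (v' : ∀ t, P.val (s' t) k) (ψ : ∀ t, DHom k (P.deg (s' t)) (d t)),
    (∀ t, P.step (s t) (s' t) (h t) (v t) (v' t)) →
    G (fun t => ⟨s t, v t, (h t).comp (ψ t)⟩) = G fun t => ⟨s' t, v' t, ψ t⟩
  null : ∀ g t, P.null (g t).v → G g = c₀
  nullMap : ∀ g t, (g t).ψ.Null → G g = c₀

variable {C : Sort*} {c₀ : C} {G : (∀ t, P.Gen (d t) k) → C}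

theorem Rel.elim {d : Deg} {x y : Option (P.Gen d k)} (h : Rel x y) :
    (∃ (s s' : P.Sh) (h : DHom k (P.deg s) (P.deg s')) (v : P.val s k) (v' : P.val s' k)
      (ψ : DHom k (P.deg s') d), P.step s s' h v v' ∧ x = some ⟨s, v, h.comp ψ⟩ ∧
      y = some ⟨s', v', ψ⟩) ∨ ∃ g, x = some g ∧ y = none ∧ (P.null g.v ∨ g.ψ.Null) := by
  obtain ⟨s, s', h, v, v', ψ, hs⟩ | ⟨g, hg⟩ | ⟨g, hg⟩ := h
  exacts [.inl ⟨s, s', h, v, v', ψ, hs, rfl, rfl⟩, .inr ⟨g, rfl, rfl, .inl hg⟩,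
    .inr ⟨g, rfl, rfl, .inr hg⟩]

theorem multi_aux (hP : ∀ s k (v : P.val s k), P.step s s DHom.id v v) (hG : Multi c₀ G)
    {H : (∀ t, Option (P.Gen (d t) k)) → C} (H₁ : ∀ g, H (fun t => some (g t)) = G g)
    (H₀ : ∀ x t, x t = none → H x = c₀) (x x' : ∀ t, Option (P.Gen (d t) k))
    (h : ∀ t, Quot.mk Rel (x t) = Quot.mk Rel (x' t)) : H x = H x' := by
  refine piQuot H (fun x x' h => ?_) x x' h
  by_cases hn : ∃ t, x' t = none
  · obtain ⟨t, ht⟩ := hn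
    rw [H₀ x' t ht]
    by_cases hx : ∃ t, x t = none
    · exact H₀ x _ hx.choose_spec
    · push Not at hx
      choose g hg using fun t => Option.ne_none_iff_exists'.1 (hx t)
      obtain rfl : x = fun t => some (g t) := funext hg
      rw [H₁]
      rcases h t with h | h
      · rw [ht] at h
        simp at h
      · obtain ⟨_, _, _, _, _, _, -, -, h⟩ | ⟨g', h, -, hg'⟩ := h.elim
        · rw [ht] at h
          simp at h
        · obtain rfl : g t = g' := by simpa using h
          exact hg'.elim (hG.null _ _) (hG.nullMap _ _)
  · push Not at hn
    choose g' hg' using fun t => Option.ne_none_iff_exists'.1 (hn t)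
    obtain rfl : x' = fun t => some (g' t) := funext hg'
    have : ∀ t, ∃ (s : P.Sh) (h : DHom k (P.deg s) (P.deg (g' t).s)) (v : P.val s k),
        P.step s (g' t).s h v (g' t).v ∧ x t = some ⟨s, v, h.comp (g' t).ψ⟩ := fun t => by
      rcases h t with h | h
      · exact ⟨_, _, _, hP _ _ _, by rw [h, DHom.id_comp]⟩
      · obtain ⟨s, s', h, v, v', ψ, hs, hx, h'⟩ | ⟨_, _, h, -⟩ := h.elim
        · obtain h' : g' t = ⟨s', v', ψ⟩ := by simpa using h'
          rw [h']
          exact ⟨s, h, v, hs, hx⟩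
        · simp at h
    choose s h v hs hx using this
    obtain rfl : x = _ := funext hx
    rw [H₁, H₁]
    exact hG.step _ _ _ _ _ _ hs

theorem multi_gen (hP : ∀ s k (v : P.val s k), P.step s s DHom.id v v) (hG : Multi c₀ G)
    (g : ∀ t, P.Gen (d t) k) : multi c₀ G (fun t => gen (g t).s (g t).v (g t).ψ) = G g := by
  classical
  have h : ∃ g' : ∀ t, P.Gen (d t) k, (fun t => gen (g t).s (g t).v (g t).ψ) =
    fun t => gen (g' t).s (g' t).v (g' t).ψ := ⟨g, rfl⟩
  rw [multi, dif_pos h]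
  let H (x : ∀ t, Option (P.Gen (d t) k)) : C :=
    if h : ∀ t, (x t).isSome then G fun t => (x t).get (h t) else c₀
  have H₁ : ∀ g, H (fun t => some (g t)) = G g := fun g => by simp [H]
  have H₀ : ∀ x t, x t = none → H x = c₀ := fun x t ht =>
    dif_neg fun h => by simpa [ht] using h t
  rw [← H₁ g, ← H₁ h.choose]
  exact (multi_aux hP hG H₁ H₀ _ _ fun t => congrFun h.choose_spec t).symm

theorem multi_pt (hP : ∀ s k (v : P.val s k), P.step s s DHom.id v v) (hG : Multi c₀ G)
    (z : ∀ t, P.obj.el (d t) k) (t : T) (h : z t = P.obj.pt) : multi c₀ G z = c₀ := by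
  classical
  by_cases h' : ∃ g : ∀ t, P.Gen (d t) k, z = fun t => gen (g t).s (g t).v (g t).ψ
  · obtain ⟨g, rfl⟩ := h'
    rw [multi_gen hP hG]
    let H (x : ∀ t, Option (P.Gen (d t) k)) : C :=
      if h : ∀ t, (x t).isSome then G fun t => (x t).get (h t) else c₀
    have H₁ : ∀ g, H (fun t => some (g t)) = G g := fun g => by simp [H]
    have H₀ : ∀ x t, x t = none → H x = c₀ := fun x t ht =>
      dif_neg fun h => by simpa [ht] using h t
    rw [← H₁ g, ← H₀ (Function.update (fun t => some (g t)) t none) t (by simp)]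
    refine multi_aux hP hG H₁ H₀ _ _ fun t' => ?_
    rcases eq_or_ne t' t with rfl | ht
    · rw [Function.update_self]
      exact h
    · simp [ht]
  · rw [multi, dif_neg h']
end Pres
end MultiLift

namespace Lab
variable {A B C D E F : Type} {k : Dop}
theorem sum_comp (f : Lab A B k) (g : Lab B C k) (f' : Lab D E k) (g' : Lab E F k) :
    (f.sum f').comp (g.sum g') = (f.comp g).sum (f'.comp g') := by
  ext (b | d) : 2
  · rcases hb : g.g b with a | s <;> simp [comp, sum, hb]
  · rcases hd : g'.g d with a | s <;> simp [comp, sum, hd]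
end Lab

namespace DHom
variable {k l : Dop} {T T' T'' : Type} [Finite T] [Finite T'] [Finite T'']

theorem circ_comp {n n' n'' : FinBij} {c : T → Deg} {d : T' → Deg} {e : T'' → Deg}
    (σ : T' ≃ T) (a : Lab n n' k) (f : ∀ t', DHom k (c (σ t')) (d t')) (τ : T'' ≃ T')
    (b : Lab n' n'' k) (g : ∀ t'', DHom k (d (τ t'')) (e t'')) :
    (circ σ a f).comp (circ τ b g) =
      circ (τ.trans σ) (a.comp b) fun t => (f (τ t)).comp (g t) := by
  ext1
  · exact (congrArg r (sigma_comp σ f τ g) :)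
  · exact (Lab.sum_comp _ _ _ _).trans (congrArg _ (congrArg lab (sigma_comp σ f τ g)))

theorem circ_id (n : FinBij) (d : T → Deg) : (circ (Equiv.refl T) (Lab.id : Lab n n k)
    fun t => (id : DHom k (d t) (d t))) = id := by
  ext1
  · rfl
  · refine Lab.ext (funext ?_)
    rintro (x | x) <;> rfl

/-- `n ∐ -` of a disjoint union of maps of indices. -/
def circFam (n : FinBij) {c d : T → Deg} (f : ∀ t, DHom k (c t) (d t)) :
    DHom k (Deg.circ n c) (Deg.circ n d) := circ (Equiv.refl T) Lab.id f

theorem circFam_id (n : FinBij) (d : T → Deg) :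
    circFam n (fun t => (id : DHom k (d t) (d t))) = id := circ_id n d

theorem circFam_circ {n n' : FinBij} {c c' : T → Deg} {d : T' → Deg} (f : ∀ t, DHom k (c t) (c' t))
    (σ : T' ≃ T) (a : Lab n n' k) (g : ∀ t', DHom k (c' (σ t')) (d t')) :
    (circFam n f).comp (circ σ a g) = circ σ a fun t => (f (σ t)).comp (g t) :=
  (circ_comp (Equiv.refl T) Lab.id f σ a g).trans (by rw [Lab.id_comp]; rfl)

theorem circ_circFam {n n' : FinBij} {c : T → Deg} {d d' : T' → Deg} (σ : T' ≃ T) (a : Lab n n' k)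
    (f : ∀ t', DHom k (c (σ t')) (d t')) (g : ∀ t', DHom k (d t') (d' t')) :
    (circ σ a f).comp (circFam n' g) = circ σ a fun t => (f t).comp (g t) :=
  (circ_comp σ a f (Equiv.refl T') Lab.id g).trans (by rw [Lab.comp_id]; rfl)

theorem circFam_comp (n : FinBij) {c d e : T → Deg} (f : ∀ t, DHom k (c t) (d t))
    (g : ∀ t, DHom k (d t) (e t)) :
    (circFam n f).comp (circFam n g) = circFam n fun t => (f t).comp (g t) :=
  circFam_circ f (Equiv.refl T) Lab.id g

theorem push_circFam (α : k ⟶ l) (n : FinBij) {c d : T → Deg} (f : ∀ t, DHom k (c t) (d t)) :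
    (circFam n f).push α = circFam n fun t => (f t).push α :=
  push_circ α (Equiv.refl T) Lab.id f

theorem circ_null {n n' : FinBij} {c : T → Deg} {d : T' → Deg} (σ : T' ≃ T) (h : Lab n n' k)
    (f : ∀ t', DHom k (c (σ t')) (d t')) (t : T') (hf : (f t).Null) : (circ σ h f).Null :=
  Lab.Null.sum_right _ (Lab.Null.sigma (A := fun t => (c t).N) (B := fun t => (d t).N) σ
    (f := fun t => (f t).lab) hf)

end DHom

/-- Shapes of generators of the composition product. -/
structure CircSh : Type 1 where
  T : FinBij
  n : FinBij
  d : T → Deg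

section Circ
variable (B Y : SymSeq.{u})

/-- The composition product `B ∘ Y = ∐_t B[t] ∧_{Σ_t} Y^{⊗ t}`: generated by the `[b; (y_t)]` for
finite sets `T`, `b ∈ B[T][n]_k` and `y_t ∈ Y[R_t][N_t]_k`, of index
`(∐ R_t, n ∐ (∐ N_t))`. -/
abbrev circPres : Pres.{u} where
  Sh := CircSh
  deg s := Deg.circ s.n s.d
  val s k := B.el ⟨s.T, s.n⟩ k × ∀ t, Y.el (s.d t) k
  sm α v := (B.sm α v.1, fun t => Y.sm α (v.2 t))
  sm_id v := by simp
  sm_sm α β v := by simp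
  step s s' h v v' := ∃ (σ : s'.T ≃ s.T) (a : Lab s.n s'.n _)
    (f : ∀ t, DHom _ (s.d (σ t)) (s'.d t)), h = DHom.circ σ a f ∧
      v'.1 = B.act (c := ⟨s.T, s.n⟩) (d := ⟨s'.T, s'.n⟩) ⟨σ, a⟩ v.1 ∧
      ∀ t, v'.2 t = Y.act (f t) (v.2 (σ t))
  null v := v.1 = B.pt ∨ ∃ t, v.2 t = Y.pt
  step_sm α d d' h v v' := by
    rintro ⟨σ, a, f, rfl, h₁, hf⟩
    exact ⟨σ, a.push α, fun t => (f t).push α, DHom.push_circ _ _ _ _, by simp [h₁, DHom.push],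
      fun t => by simp [hf]⟩
  null_sm α v := by
    rintro (h | ⟨t, h⟩)
    · exact .inl (by simp [h])
    · exact .inr ⟨t, by simp [h]⟩

def circ : SymSeq.{u} := (circPres B Y).obj

variable {B Y}

/-- The element `[b; (y_t)]`. -/
def circ.mk {k : Dop} (T n : FinBij) (d : T → Deg) (b : B.el ⟨T, n⟩ k) (y : ∀ t, Y.el (d t) k) :
    (circ B Y).el (Deg.circ n d) k :=
  Pres.gen (P := circPres B Y) ⟨T, n, d⟩ (b, y) DHom.id

theorem circ.act_mk {k : Dop} (T n : FinBij) (d : T → Deg) (b : B.el ⟨T, n⟩ k)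
    (y : ∀ t, Y.el (d t) k) {e : Deg} (h : DHom k (Deg.circ n d) e) :
    (circ B Y).act h (circ.mk T n d b y) = Pres.gen (P := circPres B Y) ⟨T, n, d⟩ (b, y) h := by
  exact (Pres.act_gen (P := circPres B Y) _ _ _ _).trans (by rw [DHom.id_comp])

theorem circ.mk_act {k : Dop} {T T' n n' : FinBij} {d : T → Deg} {d' : T' → Deg}
    (σ : T' ≃ T) (a : Lab n n' k) (f : ∀ t, DHom k (d (σ t)) (d' t))
    (b : B.el ⟨T, n⟩ k) (y : ∀ t, Y.el (d t) k) :
    circ.mk T' n' d' (B.act (c := ⟨T, n⟩) (d := ⟨T', n'⟩) ⟨σ, a⟩ b)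
      (fun t => Y.act (f t) (y (σ t))) = (circ B Y).act (DHom.circ σ a f) (circ.mk T n d b y) := by
  rw [circ.act_mk]
  refine (Pres.gen_step (P := circPres B Y) (s := ⟨T, n, d⟩) (s' := ⟨T', n', d'⟩)
    (v := (b, y)) ⟨σ, a, f, rfl, rfl, fun t => rfl⟩ DHom.id).symm.trans ?_
  rw [DHom.comp_id]

theorem circ.mk_act_right {k : Dop} {T n : FinBij} {d d' : T → Deg}
    (f : ∀ t, DHom k (d t) (d' t)) (b : B.el ⟨T, n⟩ k) (y : ∀ t, Y.el (d t) k) :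
    circ.mk T n d' b (fun t => Y.act (f t) (y t)) =
      (circ B Y).act (DHom.circFam n f) (circ.mk T n d b y) := by
  refine Eq.trans ?_ (circ.mk_act (Equiv.refl T) Lab.id f b y)
  congr 1
  exact (SymSeq.act_id (X := B) (d := ⟨T, n⟩) b).symm

theorem circ.mk_act_left {k : Dop} {T T' n n' : FinBij} {d : T → Deg} (σ : T' ≃ T)
    (a : Lab n n' k) (b : B.el ⟨T, n⟩ k) (y : ∀ t, Y.el (d t) k) :
    circ.mk T' n' (fun t => d (σ t)) (B.act (c := ⟨T, n⟩) (d := ⟨T', n'⟩) ⟨σ, a⟩ b)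
      (fun t => y (σ t)) = (circ B Y).act (DHom.circ σ a fun _ => DHom.id) (circ.mk T n d b y) := by
  refine Eq.trans ?_ (circ.mk_act σ a (fun _ => DHom.id) b y)
  exact congrArg _ (funext fun t => (SymSeq.act_id (y (σ t))).symm)

theorem circ.mk_pt_left {k : Dop} {T n : FinBij} {d : T → Deg} (y : ∀ t, Y.el (d t) k) :
    circ.mk (B := B) T n d B.pt y = (circ B Y).pt :=
  Pres.gen_null (P := circPres B Y) (.inl rfl) _

theorem circ.mk_pt {k : Dop} {T n : FinBij} {d : T → Deg} (b : B.el ⟨T, n⟩ k)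
    (y : ∀ t, Y.el (d t) k) (t : T) (h : y t = Y.pt) :
    circ.mk T n d b y = (circ B Y).pt :=
  Pres.gen_null (P := circPres B Y) (.inr ⟨t, h⟩) _

@[simp] theorem circ.sm_mk {k l : Dop} (α : k ⟶ l) {T n : FinBij} {d : T → Deg} (b : B.el ⟨T, n⟩ k)
    (y : ∀ t, Y.el (d t) k) : (circ B Y).sm α (circ.mk T n d b y) =
      circ.mk T n d (B.sm α b) (fun t => Y.sm α (y t)) :=
  (Pres.sm_gen (P := circPres B Y) _ _ _ _).trans (by rw [DHom.push_id]; rfl)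

theorem circ.hom_ext {Z : SymSeq.{u}} {f g : circ B Y ⟶ Z}
    (h : ∀ k (T n : FinBij) (d : T → Deg) (b : B.el ⟨T, n⟩ k) (y : ∀ t, Y.el (d t) k),
      SymSeq.ap f (circ.mk T n d b y) = SymSeq.ap g (circ.mk T n d b y)) : f = g :=
  Pres.hom_ext (P := circPres B Y) fun k s v => h k s.T s.n s.d v.1 v.2

/-- A morphism out of `B ∘ Y` from its values on the `[b; (y_t)]`. -/
def circ.lift (Z : SymSeq.{u})
    (F : ∀ (k : Dop) (T n : FinBij) (d : T → Deg), B.el ⟨T, n⟩ k → (∀ t, Y.el (d t) k) →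
      Z.el (Deg.circ n d) k)
    (F_sm : ∀ k l (α : k ⟶ l) T n d b y, F l T n d (B.sm α b) (fun t => Y.sm α (y t)) =
      Z.sm α (F k T n d b y))
    (F_act : ∀ (k : Dop) (T T' n n' : FinBij) (d : T → Deg) (d' : T' → Deg) (σ : T' ≃ T)
      (a : Lab n n' k) (f : ∀ t, DHom k (d (σ t)) (d' t)) b y,
      F k T' n' d' (B.act (c := ⟨T, n⟩) (d := ⟨T', n'⟩) ⟨σ, a⟩ b) (fun t => Y.act (f t) (y (σ t))) =
        Z.act (DHom.circ σ a f) (F k T n d b y))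
    (F_pt_left : ∀ k T n d y, F k T n d B.pt y = Z.pt)
    (F_pt : ∀ k T n d b y t, y t = Y.pt → F k T n d b y = Z.pt) : circ B Y ⟶ Z :=
  Pres.lift (P := circPres B Y) Z (fun s k v => F k s.T s.n s.d v.1 v.2)
    (fun s k l α v => F_sm k l α _ _ _ _ _)
    (fun k s s' h v v' ⟨σ, a, f, hh, h₁, h₂⟩ => by
      rw [h₁, hh, ← F_act]
      congr 1
      exact funext h₂)
    (fun s k v hv => by
      rcases hv with h | ⟨t, h⟩
      · exact (congrArg (fun b => F k s.T s.n s.d b v.2) h).trans (F_pt_left _ _ _ _ _)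
      · exact F_pt _ _ _ _ _ _ t h)

@[simp] theorem circ.ap_lift (Z : SymSeq.{u}) (F F_sm F_act F_pt_left F_pt) {k : Dop}
    (T n : FinBij) (d : T → Deg) (b : B.el ⟨T, n⟩ k) (y : ∀ t, Y.el (d t) k) :
    SymSeq.ap (circ.lift Z F F_sm F_act F_pt_left F_pt) (circ.mk T n d b y) = F k T n d b y :=
  SymSeq.act_id (X := Z) _

/-- Functoriality of the composition product. -/
def circMap {B' Y' : SymSeq.{u}} (β : B ⟶ B') (f : Y ⟶ Y') : circ B Y ⟶ circ B' Y' :=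
  circ.lift (circ B' Y')
    (fun k T n d b y => circ.mk T n d (SymSeq.ap β (d := ⟨T, n⟩) b) fun t => SymSeq.ap f (y t))
    (fun k l α T n d b y => by
      rw [circ.sm_mk]
      simp only [SymSeq.ap_sm])
    (fun k T T' n n' d d' σ a g b y => by
      rw [← circ.mk_act]
      simp only [SymSeq.ap_act])
    (fun k T n d y => by
      rw [SymSeq.ap_pt, circ.mk_pt_left])
    (fun k T n d b y t h => circ.mk_pt _ _ t (by rw [h, SymSeq.ap_pt]))

@[simp] theorem ap_circMap {B' Y' : SymSeq.{u}} (β : B ⟶ B') (f : Y ⟶ Y') {k : Dop}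
    (T n : FinBij) (d : T → Deg) (b : B.el ⟨T, n⟩ k) (y : ∀ t, Y.el (d t) k) :
    SymSeq.ap (circMap β f) (circ.mk T n d b y) =
      circ.mk T n d (SymSeq.ap β (d := ⟨T, n⟩) b) fun t => SymSeq.ap f (y t) :=
  circ.ap_lift _ _ _ _ _ _ _ _ _ _ _

@[simp] theorem circMap_id : circMap (𝟙 B) (𝟙 Y) = 𝟙 (circ B Y) :=
  circ.hom_ext fun k T n d b y => by
    rw [ap_circMap]
    rfl

theorem circMap_comp {B' Y' B'' Y'' : SymSeq.{u}} (β : B ⟶ B') (f : Y ⟶ Y') (β' : B' ⟶ B'')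
    (f' : Y' ⟶ Y'') : circMap β f ≫ circMap β' f' = circMap (β ≫ β') (f ≫ f') :=
  circ.hom_ext fun k T n d b y => by
    rw [SymSeq.ap_comp, ap_circMap, ap_circMap, ap_circMap]
    rfl

end Circ

/-- The bijection `n ∐ ∐_t (m_t ∐ ∐_p N_{t,p}) ≅ (n ∐ ∐_t m_t) ∐ ∐_{(t,p)} N_{t,p}`. -/
def assocEquiv (n : Type) {T : Type} {P : T → Type} (m : T → Type) (N : ∀ t, P t → Type) :
    (n ⊕ Σ t, m t ⊕ Σ p, N t p) ≃ (n ⊕ Σ t, m t) ⊕ Σ x : (Σ t, P t), N x.1 x.2 where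
  toFun
    | .inl x => .inl (.inl x)
    | .inr ⟨t, .inl y⟩ => .inl (.inr ⟨t, y⟩)
    | .inr ⟨t, .inr ⟨p, z⟩⟩ => .inr ⟨⟨t, p⟩, z⟩
  invFun
    | .inl (.inl x) => .inl x
    | .inl (.inr ⟨t, y⟩) => .inr ⟨t, .inl y⟩
    | .inr ⟨⟨t, p⟩, z⟩ => .inr ⟨t, .inr ⟨p, z⟩⟩
  left_inv := by rintro (x | ⟨t, y | ⟨p, z⟩⟩) <;> rfl
  right_inv := by rintro ((x | ⟨t, y⟩) | ⟨⟨t, p⟩, z⟩) <;> rfl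

section
variable (n : Type) {T : Type} {P : T → Type} (m : T → Type) (N : ∀ t, P t → Type)
@[simp] theorem assocEquiv_inl (x : n) : assocEquiv n m N (.inl x) = .inl (.inl x) := rfl
@[simp] theorem assocEquiv_inr_inl (t : T) (y : m t) :
    assocEquiv n m N (.inr ⟨t, .inl y⟩) = .inl (.inr ⟨t, y⟩) := rfl
@[simp] theorem assocEquiv_inr_inr (t : T) (p : P t) (z : N t p) :
    assocEquiv n m N (.inr ⟨t, .inr ⟨p, z⟩⟩) = .inr ⟨⟨t, p⟩, z⟩ := rfl
end

theorem Lab.assoc_nat {k : Dop} {n n' T T' : Type} {P : T → Type} {P' : T' → Type} {m : T → Type}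
    {m' : T' → Type} {N : ∀ t, P t → Type} {N' : ∀ t, P' t → Type} (σ : T' ≃ T) (a : Lab n n' k)
    (σ₁ : ∀ t, P' t ≃ P (σ t)) (a₁ : ∀ t, Lab (m (σ t)) (m' t) k)
    (f : ∀ t p, Lab (N (σ t) (σ₁ t p)) (N' t p) k) :
    (ofEquiv (assocEquiv n m N)).comp
        (a.sum (Lab.sigma σ fun t => (a₁ t).sum (Lab.sigma (σ₁ t) (f t)))) =
      ((a.sum (Lab.sigma σ a₁)).sum (Lab.sigma (A := fun x : (Σ t, P t) => N x.1 x.2)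
        (B := fun x : (Σ t, P' t) => N' x.1 x.2) (Equiv.sigmaCongr σ σ₁) fun x => f x.1 x.2)).comp
        (ofEquiv (assocEquiv n' m' N')) := by
  refine Lab.ext (funext ?_)
  rintro (x | ⟨t, y | ⟨p, z⟩⟩)
  · rcases h : a.g x with y | y <;> simp [comp, Lab.sum, Lab.sigma, Lab.ofEquiv, h]
  · rcases h : (a₁ t).g y with y | y <;> simp [comp, Lab.sum, Lab.sigma, Lab.ofEquiv, h]
  · rcases h : (f t p).g z with y | y <;> simp [comp, Lab.sum, Lab.sigma, Lab.ofEquiv, h] <;> rfl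

/-- The shape of `[[b; (o_t)]; (y_{t,p})]`, from those of the `[o_t; (y_{t,p})_p]`. -/
abbrev CircSh.assoc (n : FinBij) {T : FinBij} (s : T → CircSh) : CircSh :=
  ⟨FinBij.sigma fun t => (s t).T, n.sum (FinBij.sigma fun t => (s t).n), fun x => (s x.1).d x.2⟩

/-- The index of a generator. -/
abbrev CircSh.deg (s : CircSh) : Deg := Deg.circ s.n s.d

namespace DHom
variable {k : Dop} {T T' : FinBij}

/-- The associativity bijections of indices. -/
def assoc (n : FinBij) (s : T → CircSh) :
    DHom k (CircSh.assoc n s).deg (Deg.circ n fun t => (s t).deg) :=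
  ofEquiv (c := (CircSh.assoc n s).deg)
    ((Equiv.sigmaAssoc fun t p => ((s t).d p).R).symm)
    (assocEquiv n (fun t => (s t).n) fun t p => ((s t).d p).N)

theorem push_assoc {l : Dop} (α : k ⟶ l) (n : FinBij) (s : T → CircSh) :
    (assoc n s : DHom k _ _).push α = assoc n s := rfl

theorem assoc_nat {n n' : FinBij} {s : T → CircSh} {s' : T' → CircSh} (σ : T' ≃ T)
    (a : Lab n n' k) (σ₁ : ∀ t, (s' t).T ≃ (s (σ t)).T) (a₁ : ∀ t, Lab (s (σ t)).n (s' t).n k)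
    (f : ∀ t p, DHom k ((s (σ t)).d (σ₁ t p)) ((s' t).d p)) :
    (assoc n s).comp (circ σ a fun t => circ (σ₁ t) (a₁ t) (f t)) =
      (circ (T := (CircSh.assoc n s).T) (T' := (CircSh.assoc n' s').T)
        (c := (CircSh.assoc n s).d) (d := (CircSh.assoc n' s').d)
        (Equiv.sigmaCongr σ σ₁) (a.sum (Lab.sigma σ a₁)) fun x => f x.1 x.2).comp
        (assoc n' s') := by
  ext1
  · exact Equiv.ext fun ⟨t, p, x⟩ => rfl
  · exact Lab.assoc_nat (N := fun t p => ((s t).d p).N) (N' := fun t p => ((s' t).d p).N)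
      (m := fun t => (s t).n) (m' := fun t => (s' t).n) σ a σ₁ a₁
      fun t p => (f t p).lab

end DHom

section Assoc
variable (B O Y : SymSeq.{u}) {k : Dop}
variable {B O Y}

/-- `[b; ([o_t; (y_{t,p})_p]_t)] ↦ [[b; (o_t)]; (y_{t,p})]`, on generators. -/
def assocGen {T n : FinBij} {d : T → Deg} (b : B.el ⟨T, n⟩ k)
    (g : ∀ t, (circPres O Y).Gen (d t) k) : (circ (circ B O) Y).el (Deg.circ n d) k :=
  (circ (circ B O) Y).act
    ((DHom.assoc n fun t => (g t).s).comp (DHom.circFam n fun t => (g t).ψ))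
    (circ.mk (CircSh.assoc n fun t => (g t).s).T (CircSh.assoc n fun t => (g t).s).n
      (CircSh.assoc n fun t => (g t).s).d
      (circ.mk T n (fun t => ⟨(g t).s.T, (g t).s.n⟩) b fun t => (g t).v.1) fun x => (g x.1).v.2 x.2)

theorem assocGen_step {T T' n n' : FinBij} {d : T → Deg} {d' : T' → Deg} (σ : T' ≃ T)
    (a : Lab n n' k) (f : ∀ t, DHom k (d (σ t)) (d' t)) (b : B.el ⟨T, n⟩ k)
    (g : ∀ t, (circPres O Y).Gen (d t) k) (g' : ∀ t, (circPres O Y).Gen (d' t) k)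
    (h : ∀ t, DHom k (g (σ t)).s.deg (g' t).s.deg)
    (hs : ∀ t, (circPres O Y).step (g (σ t)).s (g' t).s (h t) (g (σ t)).v (g' t).v)
    (hψ : ∀ t, (g (σ t)).ψ.comp (f t) = (h t).comp (g' t).ψ) :
    assocGen (d := d') (B.act (c := ⟨T, n⟩) (d := ⟨T', n'⟩) ⟨σ, a⟩ b) g' =
      (circ (circ B O) Y).act (DHom.circ σ a f) (assocGen b g) := by
  choose σ₁ a₁ f₁ hh h₁ h₂ using hs
  unfold assocGen
  have e₁ : (fun x : (Σ t : T', (g' t).s.T) => (g' x.1).v.2 x.2) =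
      fun x : (Σ t : T', (g' t).s.T) =>
        Y.act (f₁ x.1 x.2) ((g (σ x.1)).v.2 (σ₁ x.1 x.2)) := funext fun x => h₂ x.1 x.2
  have e₂ : circ.mk T' n' (fun t => ⟨(g' t).s.T, (g' t).s.n⟩)
      (B.act (c := ⟨T, n⟩) (d := ⟨T', n'⟩) ⟨σ, a⟩ b) (fun t => (g' t).v.1) =
      (circ B O).act (DHom.circ (c := fun t => ⟨(g t).s.T, (g t).s.n⟩)
        (d := fun t => ⟨(g' t).s.T, (g' t).s.n⟩) σ a fun t => ⟨σ₁ t, a₁ t⟩)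
        (circ.mk T n (fun t => ⟨(g t).s.T, (g t).s.n⟩) b fun t => (g t).v.1) := by
    rw [← circ.mk_act]
    exact congrArg _ (funext h₁)
  rw [e₁, e₂]
  refine (congrArg _ (circ.mk_act (B := circ B O) (Y := Y)
    (T := (CircSh.assoc n fun t => (g t).s).T) (T' := (CircSh.assoc n' fun t => (g' t).s).T)
    (n := (CircSh.assoc n fun t => (g t).s).n) (n' := (CircSh.assoc n' fun t => (g' t).s).n)
    (d := (CircSh.assoc n fun t => (g t).s).d) (d' := (CircSh.assoc n' fun t => (g' t).s).d)
    (Equiv.sigmaCongr σ σ₁) (a.sum (Lab.sigma σ a₁)) (fun x => f₁ x.1 x.2)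
    (circ.mk T n (fun t => ⟨(g t).s.T, (g t).s.n⟩) b fun t => (g t).v.1)
    fun x => (g x.1).v.2 x.2)).trans ?_
  rw [SymSeq.act_act, SymSeq.act_act]
  congr 1
  rw [← DHom.comp_assoc]
  refine (congrArg (fun h => DHom.comp h _) (DHom.assoc_nat (s := fun t => (g t).s)
    (s' := fun t => (g' t).s) σ a σ₁ a₁ f₁).symm).trans ?_
  rw [DHom.comp_assoc, DHom.comp_assoc]
  refine congrArg _ ((DHom.circ_circFam (c := fun t => (g t).s.deg) (d := fun t => (g' t).s.deg)
    σ a _ fun t => (g' t).ψ).trans (Eq.trans ?_ (DHom.circFam_circ _ σ a f).symm))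
  refine congrArg (fun f => DHom.circ σ a f) (funext fun t => ?_)
  exact (congrArg (fun h => DHom.comp h _) (hh t).symm).trans (hψ t).symm

theorem circ_step_refl (s : CircSh) (v : (circPres O Y).val s k) :
    (circPres O Y).step s s DHom.id v v :=
  ⟨Equiv.refl _, Lab.id, fun _ => DHom.id, (DHom.circ_id _ _).symm,
    (SymSeq.act_id (X := O) (d := ⟨s.T, s.n⟩) v.1).symm, fun t => (SymSeq.act_id (v.2 t)).symm⟩

theorem assocGen_multi {T n : FinBij} {d : T → Deg} (b : B.el ⟨T, n⟩ k) :
    Pres.Multi (P := circPres O Y) (d := d) (circ (circ B O) Y).pt (assocGen b) where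
  step s s' h v v' ψ hs := by
    have := assocGen_step (d := d) (d' := d) (Equiv.refl T) Lab.id (fun t => DHom.id) b
      (fun t => ⟨s t, v t, (h t).comp (ψ t)⟩) (fun t => ⟨s' t, v' t, ψ t⟩) h hs
      fun t => DHom.comp_id _
    refine (Eq.trans ?_ this.symm).trans (congrArg (fun b => assocGen b _)
      (SymSeq.act_id (X := B) (d := ⟨T, n⟩) b))
    exact (SymSeq.act_id _).symm.trans
      (congrArg (fun h => SymSeq.act _ h _) (DHom.circFam_id n d).symm)
  null g t h := by
    unfold assocGen
    rcases h with h | ⟨p, h⟩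
    · rw [circ.mk_pt (B := B) (Y := O) b _ t h, circ.mk_pt_left, SymSeq.act_pt]
    · refine (congrArg _ (circ.mk_pt (B := circ B O) (Y := Y) _ _
        (⟨t, p⟩ : (Σ t : T, (g t).s.T)) h)).trans (SymSeq.act_pt _)
  nullMap g t h := by
    unfold assocGen
    exact SymSeq.act_null _ _ (Lab.Null.comp_right _ (DHom.circ_null _ _ _ t h))

/-- `assocGen`, for arbitrary elements of `O ∘ Y`. -/
noncomputable def assocEl {T n : FinBij} {d : T → Deg} (b : B.el ⟨T, n⟩ k)
    (z : ∀ t, (circ O Y).el (d t) k) : (circ (circ B O) Y).el (Deg.circ n d) k :=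
  Pres.multi (P := circPres O Y) (circ (circ B O) Y).pt (assocGen b) z

theorem assocEl_gen {T n : FinBij} {d : T → Deg} (b : B.el ⟨T, n⟩ k)
    (g : ∀ t, (circPres O Y).Gen (d t) k) :
    assocEl b (fun t => Pres.gen (P := circPres O Y) (g t).s (g t).v (g t).ψ) = assocGen b g :=
  Pres.multi_gen (P := circPres O Y) (fun s _ v => circ_step_refl s v) (assocGen_multi b) g

theorem assocEl_pt {T n : FinBij} {d : T → Deg} (b : B.el ⟨T, n⟩ k)
    (z : ∀ t, (circ O Y).el (d t) k) (t : T) (h : z t = (circ O Y).pt) :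
    assocEl b z = (circ (circ B O) Y).pt :=
  Pres.multi_pt (P := circPres O Y) (fun s _ v => circ_step_refl s v) (assocGen_multi b) z t h

/-- The associativity map `[b; ([o_t; (y_{t,p})_p]_t)] ↦ [[b; (o_t)]; (y_{t,p})]`. -/
noncomputable def circAssoc (B O Y : SymSeq.{u}) : circ B (circ O Y) ⟶ circ (circ B O) Y :=
  circ.lift _ (fun k T n d b y => assocEl b y)
    (fun k l α T n d b y => by
      rcases Pres.exists_gens (P := circPres O Y) y with ⟨t, h⟩ | ⟨g, rfl⟩
      · rw [assocEl_pt _ _ t ((congrArg _ h).trans (SymSeq.sm_pt _)), assocEl_pt b y t h,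
          SymSeq.sm_pt]
      · refine (assocEl_gen _ (fun t => (g t).sm α)).trans
          (Eq.trans ?_ (congrArg _ (assocEl_gen b g)).symm)
        unfold assocGen
        rw [SymSeq.sm_act, circ.sm_mk, circ.sm_mk, DHom.push_comp, DHom.push_circFam]
        rfl)
    (fun k T T' n n' d d' σ a f b y => by
      rcases Pres.exists_gens (P := circPres O Y) y with ⟨t, h⟩ | ⟨g, rfl⟩
      · obtain ⟨t, rfl⟩ := σ.surjective t
        rw [assocEl_pt _ _ t ((congrArg _ h).trans (SymSeq.act_pt _)), assocEl_pt b y (σ t) h,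
          SymSeq.act_pt]
      · refine Eq.trans ?_ ((assocGen_step σ a f b g
          (fun t => ⟨(g (σ t)).s, (g (σ t)).v, (g (σ t)).ψ.comp (f t)⟩) (fun t => DHom.id)
          (fun t => circ_step_refl _ _) (fun t => (DHom.id_comp _).symm)).trans
          (congrArg _ (assocEl_gen b g)).symm)
        refine Eq.trans (congrArg _ (funext fun t => ?_)) (assocEl_gen _ _)
        exact Pres.act_gen (P := circPres O Y) _ _ _ _)
    (fun k T n d y => by
      rcases Pres.exists_gens (P := circPres O Y) y with ⟨t, h⟩ | ⟨g, rfl⟩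
      · exact assocEl_pt _ _ t h
      · refine (assocEl_gen _ g).trans ?_
        unfold assocGen
        rw [circ.mk_pt_left, circ.mk_pt_left, SymSeq.act_pt])
    (fun k T n d b y t h => assocEl_pt b y t h)

theorem ap_circAssoc {T n : FinBij} {s : T → CircSh} (b : B.el ⟨T, n⟩ k)
    (o : ∀ t, O.el ⟨(s t).T, (s t).n⟩ k) (y : ∀ t p, Y.el ((s t).d p) k) :
    SymSeq.ap (circAssoc B O Y) (circ.mk T n (fun t => (s t).deg) b fun t =>
      circ.mk (s t).T (s t).n (s t).d (o t) (y t)) =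
    (circ (circ B O) Y).act (DHom.assoc n s) (circ.mk (CircSh.assoc n s).T (CircSh.assoc n s).n
      (CircSh.assoc n s).d (circ.mk T n (fun t => ⟨(s t).T, (s t).n⟩) b o) fun x => y x.1 x.2) := by
  refine (circ.ap_lift _ _ _ _ _ _ _ _ _ _ _).trans
    ((assocEl_gen b fun t => ⟨s t, (o t, y t), DHom.id⟩).trans ?_)
  unfold assocGen
  rw [DHom.circFam_id, DHom.comp_id]

theorem circ.hom_ext₂ {Z : SymSeq.{u}} {f g : circ B (circ O Y) ⟶ Z}
    (h : ∀ k (T n : FinBij) (s : T → CircSh) (b : B.el ⟨T, n⟩ k)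
      (o : ∀ t, O.el ⟨(s t).T, (s t).n⟩ k) (y : ∀ t p, Y.el ((s t).d p) k),
      SymSeq.ap f (circ.mk T n (fun t => (s t).deg) b fun t =>
        circ.mk (s t).T (s t).n (s t).d (o t) (y t)) =
      SymSeq.ap g (circ.mk T n (fun t => (s t).deg) b fun t =>
        circ.mk (s t).T (s t).n (s t).d (o t) (y t))) : f = g :=
  circ.hom_ext fun k T n d b z => by
    rcases Pres.exists_gens (P := circPres O Y) z with ⟨t, h⟩ | ⟨w, rfl⟩
    · rw [circ.mk_pt b z t h, SymSeq.ap_pt, SymSeq.ap_pt]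
    · have := circ.mk_act_right (Y := circ O Y) (fun t => (w t).ψ) b
        (fun t => circ.mk (w t).s.T (w t).s.n (w t).s.d (w t).v.1 (w t).v.2)
      rw [show (fun t => (circ O Y).act (w t).ψ (circ.mk (w t).s.T (w t).s.n (w t).s.d (w t).v.1
        (w t).v.2)) = fun t => Pres.gen (P := circPres O Y) (w t).s (w t).v (w t).ψ from
        funext fun t => circ.act_mk _ _ _ _ _ _] at this
      rw [this, SymSeq.ap_act, SymSeq.ap_act]
      exact congrArg _ (h k T n (fun t => (w t).s) b (fun t => (w t).v.1) fun t => (w t).v.2)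
end Assoc

section AssocLaws
variable {B O P Y : SymSeq.{u}} {k : Dop}

theorem circAssoc_naturality {B' O' Y' : SymSeq.{u}} (β : B ⟶ B') (ω : O ⟶ O') (f : Y ⟶ Y') :
    circMap β (circMap ω f) ≫ circAssoc B' O' Y' =
      circAssoc B O Y ≫ circMap (circMap β ω) f :=
  circ.hom_ext₂ fun k T n s b o y => by
    rw [SymSeq.ap_comp, SymSeq.ap_comp, ap_circAssoc, SymSeq.ap_act, ap_circMap, ap_circMap,
      ap_circMap]
    refine (congrArg _ (congrArg _ (funext fun t => ap_circMap ω f _ _ _ _ _))).trans ?_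
    exact ap_circAssoc (s := s) _ _ _

theorem circ.hom_ext₃ {Z : SymSeq.{u}} {f g : circ B (circ O (circ P Y)) ⟶ Z}
    (h : ∀ k (T n : FinBij) (R m : T → FinBij) (r : ∀ t, R t → CircSh) (b : B.el ⟨T, n⟩ k)
      (o : ∀ t, O.el ⟨R t, m t⟩ k) (q : ∀ t p, P.el ⟨(r t p).T, (r t p).n⟩ k)
      (y : ∀ t p i, Y.el ((r t p).d i) k),
      SymSeq.ap f (circ.mk T n (fun t => Deg.circ (m t) fun p => (r t p).deg) b fun t =>
        circ.mk (R t) (m t) (fun p => (r t p).deg) (o t) fun p =>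
          circ.mk (r t p).T (r t p).n (r t p).d (q t p) (y t p)) =
      SymSeq.ap g (circ.mk T n (fun t => Deg.circ (m t) fun p => (r t p).deg) b fun t =>
        circ.mk (R t) (m t) (fun p => (r t p).deg) (o t) fun p =>
          circ.mk (r t p).T (r t p).n (r t p).d (q t p) (y t p))) : f = g :=
  circ.hom_ext₂ fun k T n s b o z => by
    rcases Pres.exists_gens (P := circPres P Y) (T := Σ t, (s t).T) (d := fun x => (s x.1).d x.2)
      (fun x => z x.1 x.2) with ⟨⟨t, p⟩, hz⟩ | ⟨w, hw⟩
    · rw [circ.mk_pt (Y := circ O (circ P Y)) b _ t (circ.mk_pt (o t) _ p hz), SymSeq.ap_pt,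
        SymSeq.ap_pt]
    · have hz : ∀ t p, z t p = (circ P Y).act (w ⟨t, p⟩).ψ (circ.mk (w ⟨t, p⟩).s.T (w ⟨t, p⟩).s.n
          (w ⟨t, p⟩).s.d (w ⟨t, p⟩).v.1 (w ⟨t, p⟩).v.2) := fun t p =>
        (congrFun hw ⟨t, p⟩).trans (circ.act_mk _ _ _ _ _ _).symm
      have h₁ : ∀ t, circ.mk (s t).T (s t).n (s t).d (o t) (z t) = (circ O (circ P Y)).act
          (DHom.circFam (s t).n fun p => (w ⟨t, p⟩).ψ) (circ.mk (s t).T (s t).n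
            (fun p => (w ⟨t, p⟩).s.deg) (o t) fun p => circ.mk (w ⟨t, p⟩).s.T (w ⟨t, p⟩).s.n
              (w ⟨t, p⟩).s.d (w ⟨t, p⟩).v.1 (w ⟨t, p⟩).v.2) := fun t =>
        (congrArg _ (funext fun p => hz t p)).trans (circ.mk_act_right (Y := circ P Y)
          (fun p => (w ⟨t, p⟩).ψ) (o t) _)
      rw [funext h₁, circ.mk_act_right, SymSeq.ap_act, SymSeq.ap_act]
      exact congrArg _ (h k T n (fun t => (s t).T) (fun t => (s t).n) (fun t p => (w ⟨t, p⟩).s) b o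
        (fun t p => (w ⟨t, p⟩).v.1) fun t p => (w ⟨t, p⟩).v.2)

theorem pentagon : circMap (𝟙 B) (circAssoc O P Y) ≫ circAssoc B (circ O P) Y ≫
      circMap (circAssoc B O P) (𝟙 Y) =
    circAssoc B O (circ P Y) ≫ circAssoc (circ B O) P Y :=
  circ.hom_ext₃ fun k T n R m r b o q y => by
    simp only [SymSeq.ap_comp]
    rw [ap_circMap]
    have h₁ : ∀ t, SymSeq.ap (circAssoc O P Y) (circ.mk (R t) (m t) (fun p => (r t p).deg) (o t)
        fun p => circ.mk (r t p).T (r t p).n (r t p).d (q t p) (y t p)) = _ := fun t =>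
      ap_circAssoc (s := r t) (o t) (q t) (y t)
    rw [funext h₁, SymSeq.ap_id, circ.mk_act_right, SymSeq.ap_act, SymSeq.ap_act]
    have h₂ := ap_circAssoc (Y := Y) (s := fun t => CircSh.assoc (m t) (r t)) b (fun t => circ.mk (R t) (m t)
      (fun p => ⟨(r t p).T, (r t p).n⟩) (o t) (q t)) fun t x => y t x.1 x.2
    refine (congrArg _ (congrArg _ h₂)).trans ?_
    rw [SymSeq.ap_act, SymSeq.act_act, ap_circMap]
    have h₃ := ap_circAssoc (s := fun t => ⟨R t, m t, fun p => ⟨(r t p).T, (r t p).n⟩⟩) b o q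
    rw [h₃]
    have h₄ := ap_circAssoc (s := fun t => ⟨R t, m t, fun p => (r t p).deg⟩) b o 
      (fun t p => circ.mk (r t p).T (r t p).n (r t p).d (q t p) (y t p))
    refine Eq.trans ?_ (congrArg _ h₄.symm)
    rw [SymSeq.ap_act]
    have h₅ := ap_circAssoc (T := FinBij.sigma R) (n := n.sum (FinBij.sigma m))
      (s := fun x => r x.1 x.2) (circ.mk T n (fun t => ⟨R t, m t⟩) b o) (fun x => q x.1 x.2)
        fun x => y x.1 x.2
    refine Eq.trans ?_ (congrArg _ h₅.symm)
    rw [SymSeq.act_act]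
    have h₆ := circ.mk_act_left (B := circ (circ B O) P) (Y := Y)
      (T := (CircSh.assoc (n.sum (FinBij.sigma m)) (T := FinBij.sigma R) fun x => r x.1 x.2).T)
      (d := (CircSh.assoc (n.sum (FinBij.sigma m)) (T := FinBij.sigma R) fun x => r x.1 x.2).d)
      (T' := (CircSh.assoc n fun t => CircSh.assoc (m t) (r t)).T)
      (DHom.assoc (k := k) n fun t => ⟨R t, m t, fun p => ⟨(r t p).T, (r t p).n⟩⟩).r
      (DHom.assoc (k := k) n fun t => ⟨R t, m t, fun p => ⟨(r t p).T, (r t p).n⟩⟩).lab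
      (circ.mk (FinBij.sigma R) (n.sum (FinBij.sigma m))
        (fun x => ⟨(r x.1 x.2).T, (r x.1 x.2).n⟩) (circ.mk T n (fun t => ⟨R t, m t⟩) b o)
        fun x => q x.1 x.2) fun x => y x.1.1 x.1.2 x.2
    refine (congrArg _ h₆).trans ((SymSeq.act_act _ _ _).trans ?_)
    refine congrArg (fun h => SymSeq.act _ h _) ?_
    ext1
    · exact Equiv.ext fun ⟨t, p, i, x⟩ => rfl
    · refine Lab.ext (funext ?_)
      rintro (x | ⟨t, x | ⟨p, x | ⟨i, x⟩⟩⟩) <;> rfl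

end AssocLaws

/-- A one-point set. -/
abbrev FinBij.one : FinBij := ⟨Unit⟩
/-- The empty set. -/
abbrev FinBij.zero : FinBij := ⟨Empty⟩

namespace DHom
variable {k : Dop}

/-- The unit bijections of indices. -/
def unitL (d : Deg) : DHom k (Deg.circ FinBij.zero fun _ : FinBij.one => d) d :=
  ofEquiv (c := Deg.circ FinBij.zero fun _ : FinBij.one => d)
    (Equiv.uniqueSigma (α := Unit) fun _ => d.R).symm
    ((Equiv.uniqueSigma (α := Unit) fun _ => d.N).symm.trans (Equiv.emptySum Empty _).symm)

def unitR (T n : FinBij) : DHom k (Deg.circ n fun _ : T => ⟨FinBij.one, FinBij.zero⟩) ⟨T, n⟩ :=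
  ofEquiv (c := Deg.circ n fun _ : T => ⟨FinBij.one, FinBij.zero⟩) (d := ⟨T, n⟩)
    (Equiv.sigmaUnique T fun _ => Unit).symm (@Equiv.sumEmpty n (Σ _ : T, Empty) ⟨fun x => x.2.elim⟩).symm
end DHom

/-- Operads in symmetric spectra: monoids with respect to the composition product. The unit is a
morphism from the sphere spectrum to the spectrum of one-ary operations, given by its value on the
nonbasepoint simplices of `S⁰`. -/
structure Operad : Type (u + 2) where
  S : SymSeq.{u}
  μ : circ S S ⟶ S
  one : ∀ k, S.el ⟨FinBij.one, FinBij.zero⟩ k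
  sm_one : ∀ {k l : Dop} (α : k ⟶ l), S.sm α (one k) = one l
  assoc : circAssoc S S S ≫ circMap μ (𝟙 S) ≫ μ = circMap (𝟙 S) μ ≫ μ
  one_mul : ∀ {d k} (x : S.el d k), S.act (DHom.unitL d) (SymSeq.ap μ
    (circ.mk FinBij.one FinBij.zero (fun _ => d) (one k) fun _ => x)) = x
  mul_one : ∀ {T n k} (x : S.el ⟨T, n⟩ k), S.act (DHom.unitR T n) (SymSeq.ap μ
    (circ.mk T n (fun _ => ⟨FinBij.one, FinBij.zero⟩) x fun _ => one k)) = x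

namespace Operad
variable (O : Operad.{u})

/-- The unit `X ⟶ O ∘ X`, `x ↦ [1; x]`. -/
def unit (X : SymSeq.{u}) : X ⟶ circ O.S X :=
  SymSeq.mkHom (fun d k x => (circ O.S X).act (DHom.unitL d)
      (circ.mk FinBij.one FinBij.zero (fun _ => d) (O.one k) fun _ => x))
    (fun d k => by rw [circ.mk_pt (O.one k) _ () rfl, SymSeq.act_pt])
    (fun d k l α x => by
      rw [SymSeq.sm_act, circ.sm_mk, O.sm_one]
      rfl)
    (fun c d k h x => by
      rw [circ.mk_act_right (Y := X) (fun _ : FinBij.one => h), SymSeq.act_act, SymSeq.act_act]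
      refine congrArg (fun h => SymSeq.act _ h _) ?_
      ext1
      · exact Equiv.ext fun x => rfl
      · refine Lab.ext (funext fun x => ?_)
        rcases hx : h.lab.g x with a | s <;>
        simp [DHom.comp, DHom.circFam, DHom.circ, DHom.unitL, DHom.ofEquiv, Lab.comp, Lab.sum,
          Lab.sigma, Lab.ofEquiv, hx])

theorem ap_unit {X : SymSeq.{u}} {d : Deg} {k : Dop} (x : X.el d k) :
    SymSeq.ap (O.unit X) x = (circ O.S X).act (DHom.unitL d)
      (circ.mk FinBij.one FinBij.zero (fun _ => d) (O.one k) fun _ => x) := rfl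

/-- The multiplication `O ∘ (O ∘ X) ⟶ O ∘ X`. -/
noncomputable def mult (X : SymSeq.{u}) : circ O.S (circ O.S X) ⟶ circ O.S X :=
  circAssoc O.S O.S X ≫ circMap O.μ (𝟙 X)

theorem mult_assoc (X : SymSeq.{u}) :
    circMap (𝟙 O.S) (O.mult X) ≫ O.mult X = O.mult (circ O.S X) ≫ O.mult X := by
  have h : circMap (𝟙 O.S) (O.mult X) =
      circMap (𝟙 O.S) (circAssoc O.S O.S X) ≫ circMap (𝟙 O.S) (circMap O.μ (𝟙 X)) := by
    rw [circMap_comp, Category.comp_id]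
    rfl
  have h₂ : circMap (circMap (𝟙 O.S) O.μ) (𝟙 X) ≫ circMap O.μ (𝟙 X) =
      circMap (circAssoc O.S O.S O.S) (𝟙 X) ≫ circMap (circMap O.μ (𝟙 O.S)) (𝟙 X) ≫
        circMap O.μ (𝟙 X) := by
    simp only [circMap_comp, Category.comp_id, ← O.assoc]
  have h₃ := circAssoc_naturality (B := circ O.S O.S) (O := O.S) (Y := X) O.μ (𝟙 O.S) (𝟙 X)
  have h₄ := pentagon (B := O.S) (O := O.S) (P := O.S) (Y := X)
  rw [h, mult, mult, Category.assoc, ← Category.assoc (circMap (𝟙 O.S) (circMap O.μ (𝟙 X))),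
    circAssoc_naturality, Category.assoc, h₂]
  rw [← Category.assoc (circAssoc O.S (circ O.S O.S) X), ← Category.assoc (circMap _ _), h₄]
  rw [circMap_id] at h₃
  simp only [Category.assoc]
  rw [← Category.assoc (circMap O.μ _), h₃, Category.assoc]

theorem unit_mult (X : SymSeq.{u}) : O.unit (circ O.S X) ≫ O.mult X = 𝟙 _ := by
  refine circ.hom_ext fun k T n d b x => ?_
  rw [SymSeq.ap_comp, ap_unit, SymSeq.ap_act, mult, SymSeq.ap_comp]
  have h := ap_circAssoc (T := FinBij.one) (n := FinBij.zero) (s := fun _ => ⟨T, n, d⟩) (O.one k)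
    (fun _ => b) fun _ => x
  refine (congrArg _ (congrArg _ h)).trans ?_
  rw [SymSeq.ap_act, ap_circMap, SymSeq.act_act]
  have h₂ := circ.mk_act_left (Y := X) (T := FinBij.sigma fun _ : FinBij.one => T)
    (n := FinBij.zero.sum (FinBij.sigma fun _ : FinBij.one => n))
    (d := fun x : (Σ _ : FinBij.one, T) => d x.2)
    (DHom.unitL (k := k) ⟨T, n⟩).r (DHom.unitL (k := k) ⟨T, n⟩).lab
    (SymSeq.ap O.μ (circ.mk FinBij.one FinBij.zero (fun _ => ⟨T, n⟩) (O.one k) fun _ => b))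
    fun y => x y.2
  have h₃ := O.one_mul (d := ⟨T, n⟩) b
  refine Eq.trans ?_ (h₂.symm.trans (congrArg (fun b => circ.mk T n d b x) h₃))
  refine congrArg (fun h => SymSeq.act _ h _) ?_
  ext1
  · exact Equiv.ext fun x => rfl
  · refine Lab.ext (funext ?_)
    rintro (x | x) <;> rfl

theorem map_unit_mult (X : SymSeq.{u}) : circMap (𝟙 O.S) (O.unit X) ≫ O.mult X = 𝟙 _ := by
  refine circ.hom_ext fun k T n d b x => ?_
  rw [SymSeq.ap_comp, ap_circMap, mult, SymSeq.ap_comp]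
  have h₀ := circ.mk_act_right (B := O.S) (fun t => DHom.unitL (d t)) b fun t =>
    circ.mk FinBij.one FinBij.zero (fun _ => d t) (O.one k) fun _ => x t
  have h := ap_circAssoc (T := T) (n := n) (s := fun t => ⟨FinBij.one, FinBij.zero, fun _ => d t⟩) b
    (fun _ => O.one k) fun t _ => x t
  refine (congrArg _ (congrArg _ h₀)).trans ?_
  rw [SymSeq.ap_act, SymSeq.ap_act]
  refine (congrArg _ (congrArg _ h)).trans ?_
  rw [SymSeq.ap_act, ap_circMap, SymSeq.act_act]
  have h₂ := circ.mk_act_left (Y := X) (T := FinBij.sigma fun _ : T => FinBij.one)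
    (n := n.sum (FinBij.sigma fun _ : T => FinBij.zero))
    (d := fun x : (Σ _ : T, FinBij.one) => d x.1)
    (DHom.unitR (k := k) T n).r (DHom.unitR (k := k) T n).lab
    (SymSeq.ap O.μ (circ.mk T n (fun _ => ⟨FinBij.one, FinBij.zero⟩) b fun _ => O.one k))
    fun y => x y.1
  have h₃ := O.mul_one b
  refine Eq.trans ?_ (h₂.symm.trans (congrArg (fun b => circ.mk T n d b x) h₃))
  refine congrArg (fun h => SymSeq.act _ h _) ?_
  ext1
  · exact Equiv.ext fun x => rfl
  · refine Lab.ext (funext ?_)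
    rintro (x | x) <;> rfl

/-- The monad `O ∘ -` on symmetric sequences. -/
noncomputable def monad : Monad SymSeq.{u} where
  obj X := circ O.S X
  map f := circMap (𝟙 _) f
  map_id X := circMap_id
  map_comp f g := by rw [circMap_comp, Category.comp_id]
  η := { app X := O.unit X
         naturality X Y f := SymSeq.hom_ext fun d k x => by
          refine Eq.trans ?_ ((SymSeq.ap_act _ _ _).trans (congrArg _ (ap_circMap _ _ _ _ _ _ _))).symm
          rfl }
  μ := { app X := O.mult X
         naturality X Y f := by
          dsimp [mult]
          rw [← Category.assoc, circAssoc_naturality, circMap_id, Category.assoc, Category.assoc,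
            circMap_comp, circMap_comp]
          simp }
  assoc X := O.mult_assoc X
  left_unit X := O.unit_mult X
  right_unit X := O.map_unit_mult X

/-- Left `O`-modules: symmetric sequences `A` with a unital and associative action `O ∘ A ⟶ A`. -/
abbrev Lt := O.monad.Algebra

/-- The free left `O`-module functor `X ↦ O ∘ X`. -/
noncomputable abbrev free : SymSeq.{u} ⥤ O.Lt := O.monad.free

/-- The action on a left `O`-module. -/
noncomputable abbrev action (A : O.Lt) : circ O.S A.A ⟶ A.A := A.a
end Operad

/-- `d ↦ (R ∐ Q, N)` for `d = (R, N)`. -/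
abbrev Deg.plus (d : Deg) (Q : FinBij) : Deg := ⟨d.R.sum Q, d.N⟩

/-- The index of a one-ary operation without suspension coordinate. -/
abbrev Deg.unit : Deg := ⟨FinBij.one, FinBij.zero⟩

/-- The functor `- ∐ Q`. -/
def FinBij.addRight (Q : FinBij) : FinBij ⥤ FinBij where
  obj R := R.sum Q
  map {R R'} (e : R ≃ R') := Equiv.sumCongr e (Equiv.refl Q)
  map_id R := Equiv.ext (by rintro (x | x) <;> rfl)
  map_comp f g := Equiv.ext (by rintro (x | x) <;> rfl)

namespace DHom
variable {k : Dop} {c d : Deg} {Q Q' Q'' : FinBij}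

def plus (h : DHom k c d) (e : Q' ≃ Q) : DHom k (c.plus Q) (d.plus Q') :=
  ⟨Equiv.sumCongr h.r e, h.lab⟩

/-- The bijections of indices for `[o; (y_t), 1, …, 1]`. -/
def plusUnits (n : FinBij) {T : FinBij} (d : T → Deg) (Q : FinBij) :
    DHom k (Deg.circ n (T := T.sum Q) (Sum.elim d fun _ => Deg.unit)) ((Deg.circ n d).plus Q) :=
  ofEquiv (c := Deg.circ n (T := T.sum Q) (Sum.elim d fun _ => Deg.unit))
    (d := (Deg.circ n d).plus Q)
    { toFun
        | .inl ⟨t, x⟩ => ⟨.inl t, x⟩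
        | .inr q => ⟨.inr q, ()⟩
      invFun
        | ⟨.inl t, x⟩ => .inl ⟨t, x⟩
        | ⟨.inr q, _⟩ => .inr q
      left_inv := by rintro (⟨t, x⟩ | q) <;> rfl
      right_inv := by rintro ⟨t | q, x⟩ <;> rfl }
    { toFun
        | .inl x => .inl x
        | .inr ⟨t, x⟩ => .inr ⟨.inl t, x⟩
      invFun
        | .inl x => .inl x
        | .inr ⟨.inl t, x⟩ => .inr ⟨t, x⟩
        | .inr ⟨.inr _, x⟩ => x.elim
      left_inv := by rintro (x | ⟨t, x⟩) <;> rfl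
      right_inv := by
        rintro (x | ⟨t | q, x⟩)
        exacts [rfl, rfl, x.elim] }

end DHom

/-- Two families of elements as one. -/
def famSum {X : SymSeq.{u}} {k : Dop} {T Q : Type} {d : T → Deg} {e : Q → Deg}
    (x : ∀ t, X.el (d t) k) (y : ∀ q, X.el (e q) k) : ∀ s, X.el (Sum.elim d e s) k
  | .inl t => x t
  | .inr q => y q

/-- The symmetric sequence `P ↦ B[P ∐ Q]`. -/
def shift (Q : FinBij) (B : SymSeq.{u}) : SymSeq.{u} := (FinBij.addRight Q).op ⋙ B

section
variable {B : SymSeq.{u}} {Q Q' Q'' : FinBij}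

theorem act_shift {k : Dop} {c d : Deg} (h : DHom k c d) (x : (shift Q B).el c k) :
    (shift Q B).act h x = B.act (c := c.plus Q) (d := d.plus Q) (h.plus (Equiv.refl Q)) x := rfl

/-- Functoriality of `B[P ∐ Q]` in `Q`. -/
def shiftMap (B : SymSeq.{u}) (e : Q' ≃ Q) : shift Q B ⟶ shift Q' B :=
  SymSeq.mkHom (fun d k x => B.act (c := d.plus Q) (d := d.plus Q') (DHom.id.plus e) x)
    (fun d k => SymSeq.act_pt _)
    (fun d k l α x => (SymSeq.sm_act (X := B) (c := d.plus Q) (d := d.plus Q') α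
      (DHom.id.plus e) x).symm)
    (fun c d k h x => by
      refine (SymSeq.act_act (X := B) (c := c.plus Q) (d := d.plus Q) (e := d.plus Q')
        (h.plus (Equiv.refl Q)) (DHom.id.plus e) x).trans (Eq.trans (congrArg (fun h => SymSeq.act _ h _) ?_) (SymSeq.act_act (X := B)
          (c := c.plus Q) (d := c.plus Q') (e := d.plus Q')
          (DHom.id.plus e) (h.plus (Equiv.refl Q')) x).symm)
      ext1
      · exact Equiv.ext (by rintro (x | x) <;> rfl)
      · exact (Lab.comp_id _).trans (Lab.id_comp _).symm)

theorem ap_shiftMap (e : Q' ≃ Q) {d : Deg} {k : Dop} (x : (shift Q B).el d k) :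
    SymSeq.ap (shiftMap B e) x =
      B.act (c := d.plus Q) (d := d.plus Q') (DHom.id.plus e) x := rfl

theorem shiftMap_refl : shiftMap B (Equiv.refl Q) = 𝟙 (shift Q B) :=
  SymSeq.hom_ext fun d k x => by
    rw [ap_shiftMap]
    refine Eq.trans (congrArg (fun h => SymSeq.act _ h _) ?_) (SymSeq.act_id (X := B)
      (d := d.plus Q) x)
    ext1
    · exact Equiv.ext (by rintro (x | x) <;> rfl)
    · rfl

theorem shiftMap_comp (e : Q' ≃ Q) (e' : Q'' ≃ Q') :
    shiftMap B e ≫ shiftMap B e' = shiftMap B (e'.trans e) :=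
  SymSeq.hom_ext fun d k x => by
    rw [SymSeq.ap_comp, ap_shiftMap, ap_shiftMap, ap_shiftMap]
    refine (SymSeq.act_act (X := B) (c := d.plus Q) (d := d.plus Q') (e := d.plus Q'') _ _ _).trans
      (congrArg (fun h => SymSeq.act _ h _) ?_)
    ext1
    · exact Equiv.ext (by rintro (x | x) <;> rfl)
    · rfl
end

namespace Operad
variable (O : Operad.{u})

/-- `μ[o; (o_t), 1, …, 1]`. -/
def plug {k : Dop} {T n Q : FinBij} {d : T → Deg} (b : O.S.el ⟨T.sum Q, n⟩ k)
    (y : ∀ t, O.S.el (d t) k) : O.S.el ((Deg.circ n d).plus Q) k :=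
  O.S.act (DHom.plusUnits n d Q) (SymSeq.ap O.μ
    (circ.mk (T.sum Q) n (Sum.elim d fun _ => Deg.unit) b (famSum y fun _ => O.one k)))

theorem sm_plug {k l : Dop} (α : k ⟶ l) {T n Q : FinBij} {d : T → Deg}
    (b : O.S.el ⟨T.sum Q, n⟩ k) (y : ∀ t, O.S.el (d t) k) :
    O.S.sm α (O.plug b y) = O.plug (O.S.sm α b) fun t => O.S.sm α (y t) := by
  unfold plug
  rw [SymSeq.sm_act, ← SymSeq.ap_sm, circ.sm_mk]
  refine congrArg _ (congrArg _ (congrArg _ (funext ?_)))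
  rintro (t | q)
  exacts [rfl, O.sm_one α]

theorem plug_act {k : Dop} {T T' n n' Q Q' : FinBij} {d : T → Deg} {d' : T' → Deg} (σ : T' ≃ T)
    (e : Q' ≃ Q) (a : Lab n n' k) (f : ∀ t, DHom k (d (σ t)) (d' t)) (b : O.S.el ⟨T.sum Q, n⟩ k)
    (y : ∀ t, O.S.el (d t) k) :
    O.plug (O.S.act (c := ⟨T.sum Q, n⟩) (d := ⟨T'.sum Q', n'⟩) ⟨Equiv.sumCongr σ e, a⟩ b)
      (fun t => O.S.act (f t) (y (σ t))) =
      O.S.act (c := (Deg.circ n d).plus Q) (d := (Deg.circ n' d').plus Q')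
        ((DHom.circ σ a f).plus e) (O.plug b y) := by
  have h := circ.mk_act (B := O.S) (Y := O.S) (T := T.sum Q) (T' := T'.sum Q')
    (d := Sum.elim d fun _ => Deg.unit) (d' := Sum.elim d' fun _ => Deg.unit)
    (Equiv.sumCongr σ e) a
    (fun | .inl t => f t | .inr q => DHom.id) b (famSum y fun _ => O.one k)
  unfold plug
  rw [SymSeq.act_act]
  refine Eq.trans (congrArg (fun z => O.S.act _ (SymSeq.ap O.μ z)) (Eq.trans ?_ h)) ?_
  · refine congrArg _ (funext ?_)
    rintro (t | q)
    exacts [rfl, (SymSeq.act_id (O.one k)).symm]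
  · rw [SymSeq.ap_act, SymSeq.act_act]
    refine congrArg (fun h => SymSeq.act _ h _) ?_
    ext1
    · exact Equiv.ext (by rintro (x | x) <;> rfl)
    · refine Lab.ext (funext ?_)
      rintro (x | ⟨t, x⟩)
      · rcases h : a.g x with y | y <;> simp [DHom.comp, DHom.circ, DHom.plusUnits, DHom.ofEquiv,
          Lab.comp, Lab.sum, Lab.sigma, Lab.ofEquiv, DHom.plus, h]
      · rcases h : (f t).lab.g x with y | y <;> simp [DHom.comp, DHom.circ, DHom.plusUnits,
          DHom.ofEquiv, Lab.comp, Lab.sum, Lab.sigma, Lab.ofEquiv, DHom.plus, h] <;> rfl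

/-- The right action of `O` on `P ↦ O[P ∐ Q]`: `[o; (o_t)] ↦ μ[o; (o_t), 1, …, 1]`. -/
def rightAction (Q : FinBij) : circ (shift Q O.S) O.S ⟶ shift Q O.S :=
  circ.lift _ (fun k T n d b y => O.plug b y)
    (fun k l α T n d b y => (O.sm_plug α b y).symm)
    (fun k T T' n n' d d' σ a f b y => O.plug_act σ (Equiv.refl Q) a f b y)
    (fun k T n d y => by
      refine (congrArg (fun z => O.S.act _ (SymSeq.ap O.μ z)) (circ.mk_pt_left _)).trans ?_
      rw [SymSeq.ap_pt, SymSeq.act_pt]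
      rfl)
    (fun k T n d b y t h => by
      refine (congrArg (fun z => O.S.act _ (SymSeq.ap O.μ z)) (circ.mk_pt (T := T.sum Q) _ _
        (Sum.inl t : T ⊕ Q) h)).trans ?_
      rw [SymSeq.ap_pt, SymSeq.act_pt]
      rfl)

theorem rightAction_shiftMap {Q Q' : FinBij} (e : Q' ≃ Q) :
    O.rightAction Q ≫ shiftMap O.S e =
      circMap (shiftMap O.S e) (𝟙 O.S) ≫ O.rightAction Q' :=
  circ.hom_ext fun k T n d b y => by
    rw [SymSeq.ap_comp, SymSeq.ap_comp, ap_circMap, ap_shiftMap]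
    refine (congrArg _ (circ.ap_lift _ _ _ _ _ _ _ _ _ _ _)).trans
      (Eq.trans ?_ (circ.ap_lift _ _ _ _ _ _ _ _ _ _ _).symm)
    refine Eq.trans ?_ ((O.plug_act (Equiv.refl T) e Lab.id (fun t => DHom.id) b y).symm.trans ?_)
    · exact congrArg (fun h => O.S.act (c := (Deg.circ n d).plus Q)
        (d := (Deg.circ n d).plus Q') (DHom.plus h e) _) (DHom.circ_id n d).symm
    · exact congrArg _ (funext fun t => SymSeq.act_id (y t))

variable (A : O.Lt)

/-- The two maps whose coequalizer is `O_A[Q]`: the operad multiplication and the action on `A`,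
on `∐_p O[p ∐ Q] ∧_{Σ_p} (O ∘ A)^{⊗ p}`. -/
noncomputable def envL (Q : FinBij) : circ (shift Q O.S) (circ O.S A.A) ⟶ circ (shift Q O.S) A.A :=
  circAssoc _ _ _ ≫ circMap (O.rightAction Q) (𝟙 A.A)

noncomputable def envR (Q : FinBij) : circ (shift Q O.S) (circ O.S A.A) ⟶ circ (shift Q O.S) A.A :=
  circMap (𝟙 _) (O.action A)

/-- The symmetric array `O_A`, with `O_A[Q]` the coequalizer of `envL` and `envR`. -/
noncomputable def env : FinBijᵒᵖ ⥤ SymSeq.{u} where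
  obj Q := coequalizer (O.envL A Q.unop) (O.envR A Q.unop)
  map {Q Q'} e := coequalizer.desc (circMap (shiftMap O.S e.unop) (𝟙 A.A) ≫ coequalizer.π _ _) (by
    have h₁ : O.envL A Q.unop ≫ circMap (shiftMap O.S e.unop) (𝟙 A.A) =
        circMap (shiftMap O.S e.unop) (𝟙 _) ≫ O.envL A Q'.unop := by
      have h := circAssoc_naturality (shiftMap O.S e.unop) (𝟙 O.S) (𝟙 A.A)
      rw [circMap_id] at h
      rw [envL, envL, ← Category.assoc, h, Category.assoc, Category.assoc, circMap_comp,
        circMap_comp, rightAction_shiftMap]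
    have h₂ : O.envR A Q.unop ≫ circMap (shiftMap O.S e.unop) (𝟙 A.A) =
        circMap (shiftMap O.S e.unop) (𝟙 _) ≫ O.envR A Q'.unop := by
      rw [envR, envR, circMap_comp, circMap_comp]
      simp
    rw [← Category.assoc, h₁, ← Category.assoc, h₂, Category.assoc, Category.assoc,
      coequalizer.condition])
  map_id Q := coequalizer.hom_ext (by
    have : circMap (shiftMap O.S (𝟙 Q : Q ⟶ Q).unop) (𝟙 A.A) = 𝟙 _ :=
      (congrArg (fun f => circMap f (𝟙 A.A)) shiftMap_refl).trans circMap_id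
    rw [coequalizer.π_desc, this, Category.id_comp, Category.comp_id])
  map_comp {Q Q' Q''} e e' := coequalizer.hom_ext (by
    have : circMap (shiftMap O.S (e ≫ e').unop) (𝟙 A.A) =
        circMap (shiftMap O.S e.unop) (𝟙 A.A) ≫ circMap (shiftMap O.S e'.unop) (𝟙 A.A) := by
      rw [circMap_comp, shiftMap_comp, Category.comp_id]
      rfl
    rw [coequalizer.π_desc, this, coequalizer.π_desc_assoc, Category.assoc, Category.assoc,
      coequalizer.π_desc])

/-- The element of `O_A[Q]` represented by `[o; (a_t)]`. -/
noncomputable def env.mk {k : Dop} {T n Q : FinBij} {d : T → Deg} (o : O.S.el ⟨T.sum Q, n⟩ k)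
    (a : ∀ t, A.A.el (d t) k) : ((O.env A).obj (op Q)).el (Deg.circ n d) k :=
  SymSeq.ap (coequalizer.π (O.envL A Q) (O.envR A Q)) (circ.mk (B := shift Q O.S) T n d o a)
end Operad

namespace DHom
variable {k l : Dop} {b c d b' c' d' : Deg}
def sum (f : DHom k c d) (g : DHom k c' d') : DHom k (c.sum c') (d.sum d') :=
  ⟨Equiv.sumCongr f.r g.r, f.lab.sum g.lab⟩
theorem push_sum (α : k ⟶ l) (f : DHom k c d) (g : DHom k c' d') :
    (f.sum g).push α = (f.push α).sum (g.push α) := by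
  ext1
  · rfl
  · exact Lab.push_sum _ _ _
end DHom

section Tensor₂
variable (M W : SymSeq.{u})

/-- The tensor product of two symmetric sequences. -/
abbrev tensor₂Pres : Pres.{u} where
  Sh := Deg × Deg
  deg s := s.1.sum s.2
  val s k := M.el s.1 k × W.el s.2 k
  sm α v := (M.sm α v.1, W.sm α v.2)
  sm_id v := by simp
  sm_sm α β v := by simp
  step s s' h v v' := ∃ (f : DHom _ s.1 s'.1) (g : DHom _ s.2 s'.2), h = f.sum g ∧
    v'.1 = M.act f v.1 ∧ v'.2 = W.act g v.2
  null v := v.1 = M.pt ∨ v.2 = W.pt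
  step_sm α s s' h v v' := by
    rintro ⟨f, g, rfl, hf, hg⟩
    exact ⟨f.push α, g.push α, DHom.push_sum _ _ _, by simp [hf], by simp [hg]⟩
  null_sm α v := by
    rintro (h | h)
    · exact .inl (by simp [h])
    · exact .inr (by simp [h])

def tensor₂ : SymSeq.{u} := (tensor₂Pres M W).obj

variable {M W}

/-- The element `x ⊗ w`. -/
def tensor₂.mk {c d : Deg} {k : Dop} (x : M.el c k) (w : W.el d k) :
    (tensor₂ M W).el (c.sum d) k := Pres.gen (P := tensor₂Pres M W) (c, d) (x, w) DHom.id

/-- Functoriality of the tensor product. -/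
def tensor₂Map {M' W' : SymSeq.{u}} (f : M ⟶ M') (g : W ⟶ W') : tensor₂ M W ⟶ tensor₂ M' W' :=
  Pres.lift (P := tensor₂Pres M W) (tensor₂ M' W')
    (fun s k v => tensor₂.mk (SymSeq.ap f v.1) (SymSeq.ap g v.2))
    (fun s k l α v => by
      refine Eq.trans ?_ (Pres.sm_gen (P := tensor₂Pres M' W') _ _ _ _).symm
      rw [DHom.push_id, SymSeq.ap_sm, SymSeq.ap_sm]
      rfl)
    (fun k s s' h v v' ⟨a, b, hh, h₁, h₂⟩ => by
      rw [h₁, h₂, hh, SymSeq.ap_act, SymSeq.ap_act]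
      refine Eq.trans ?_ (Pres.act_gen (P := tensor₂Pres M' W') _ _ _ _).symm
      have := Pres.gen_step (P := tensor₂Pres M' W') (s := s) (s' := s') (h := a.sum b)
        (v := (SymSeq.ap f v.1, SymSeq.ap g v.2))
        (v' := (M'.act a (SymSeq.ap f v.1), W'.act b (SymSeq.ap g v.2))) ⟨a, b, rfl, rfl, rfl⟩
        DHom.id
      rw [DHom.comp_id] at this
      rw [DHom.id_comp]
      exact this.symm)
    (fun s k v hv => by
      refine Pres.gen_null (P := tensor₂Pres M' W') ?_ _
      rcases hv with h | h
      · exact .inl (by simp [h])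
      · exact .inr (by simp [h]))

theorem ap_tensor₂Map {M' W' : SymSeq.{u}} (f : M ⟶ M') (g : W ⟶ W') {c d : Deg} {k : Dop}
    (x : M.el c k) (w : W.el d k) : SymSeq.ap (tensor₂Map f g) (tensor₂.mk x w) =
      tensor₂.mk (SymSeq.ap f x) (SymSeq.ap g w) :=
  (Pres.ap_lift _ _ _ _ _ _ _).trans (SymSeq.act_id (X := tensor₂ M' W') _)

theorem tensor₂Map_comp {M' W' M'' W'' : SymSeq.{u}} (f : M ⟶ M') (g : W ⟶ W') (f' : M' ⟶ M'')
    (g' : W' ⟶ W'') : tensor₂Map f g ≫ tensor₂Map f' g' = tensor₂Map (f ≫ f') (g ≫ g') :=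
  Pres.hom_ext (P := tensor₂Pres M W) fun k s v => by
    have h {A B : SymSeq.{u}} (f : M ⟶ A) (g : W ⟶ B) := ap_tensor₂Map f g v.1 v.2
    exact (congrArg _ (h f g)).trans ((ap_tensor₂Map _ _ _ _).trans (h (f ≫ f') (g ≫ g')).symm)
end Tensor₂

/-- The `T`-th tensor powers of a symmetric sequence. -/
def pow (Y : SymSeq.{u}) : FinBijᵒᵖ ⥤ SymSeq.{u} where
  obj T := tensor fun _ : T.unop => Y
  map {T T'} e := tensorMap (X := fun _ : T.unop => Y) (Y := fun _ : T'.unop => Y)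
    (id e.unop : T'.unop ≃ T.unop) fun _ => 𝟙 Y
  map_id T := tensorMap_id _
  map_comp {T T' T''} e e' := ((tensorMap_comp (X := fun _ : T.unop => Y)
    (Y := fun _ : T'.unop => Y) (Z := fun _ : T''.unop => Y) (id e.unop : T'.unop ≃ T.unop)
    (fun _ => 𝟙 Y) (id e'.unop : T''.unop ≃ T'.unop) fun _ => 𝟙 Y).trans (by
      simp only [Category.comp_id]
      rfl)).symm

section Cube
variable {X Y : SymSeq.{u}} (i : X ⟶ Y)

/-- `i` as a functor: `false ↦ X`, `true ↦ Y`. -/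
def arrow : Bool ⥤ SymSeq.{u} where
  obj b := match b with
    | false => X
    | true => Y
  map {b b'} h := match b, b', h with
    | false, false, _ => 𝟙 X
    | false, true, _ => i
    | true, true, _ => 𝟙 Y
    | true, false, h => absurd (leOfHom h) (by decide)
  map_id b := by cases b <;> rfl
  map_comp {b b' b''} h h' := by
    cases b <;> cases b' <;> cases b'' <;> first
      | exact absurd (leOfHom h) (by decide)
      | exact absurd (leOfHom h') (by decide)
      | simp

/-- The cube `χ ↦ ⨂_t Z_t`, with `Z_t = X` if `χ t = false` and `Z_t = Y` if `χ t = true`. -/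
def cube (T : FinBij) : (T → Bool) ⥤ SymSeq.{u} where
  obj χ := tensor fun t => (arrow i).obj (χ t)
  map {χ χ'} h := tensorMap (X := fun t => (arrow i).obj (χ t))
    (Y := fun t => (arrow i).obj (χ' t)) (Equiv.refl T) fun t => (arrow i).map (h t)
  map_id χ := by
    refine Eq.trans ?_ (tensorMap_id _)
    exact congrArg (tensorMap (X := fun t => (arrow i).obj (χ t))
      (Y := fun t => (arrow i).obj (χ t)) (Equiv.refl T)) (funext fun t => (arrow i).map_id _)
  map_comp {χ χ' χ''} h h' := by
    refine Eq.trans ?_ (tensorMap_comp (X := fun t => (arrow i).obj (χ t))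
      (Y := fun t => (arrow i).obj (χ' t)) (Z := fun t => (arrow i).obj (χ'' t)) (Equiv.refl T)
      (fun t => (arrow i).map (h t)) (Equiv.refl T) fun t => (arrow i).map (h' t)).symm
    exact congrArg (tensorMap (X := fun t => (arrow i).obj (χ t))
      (Y := fun t => (arrow i).obj (χ'' t)) (Equiv.refl T))
      (funext fun t => (arrow i).map_comp (h t) (h' t))

/-- The vertices of the punctured cube. -/
abbrev Punctured (T : FinBij) : Type :=
  ObjectProperty.FullSubcategory fun χ : T → Bool => ∃ t, χ t = false

/-- The punctured cube: `cube` without its terminal vertex `Y^{⊗ T}`. -/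
abbrev puncturedCube (T : FinBij) : Punctured T ⥤ SymSeq.{u} :=
  ObjectProperty.ι _ ⋙ cube i T

/-- Reindexing along a bijection, from the `χ`-vertex of the cube. -/
def cubeReindex {T T' : FinBij} (e : T' ≃ T) (χ : T → Bool) :
    (cube i T).obj χ ⟶ (cube i T').obj (fun t => χ (e t)) :=
  tensorMap (X := fun t => (arrow i).obj (χ t)) (Y := fun t => (arrow i).obj (χ (e t))) e
    fun _ => 𝟙 _

def Punctured.reindex {T T' : FinBij} (e : T' ≃ T) (χ : Punctured T) : Punctured T' :=
  ⟨fun t => χ.obj (e t), by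
    obtain ⟨t, ht⟩ := χ.property
    exact ⟨e.symm t, by simpa using ht⟩⟩

theorem cubeReindex_naturality {T T' : FinBij} (e : T' ≃ T) {χ χ' : T → Bool} (h : χ ⟶ χ') :
    (cube i T).map h ≫ cubeReindex i e χ' =
      cubeReindex i e χ ≫ (cube i T').map (X := fun t => χ (e t)) (Y := fun t => χ' (e t))
        fun t => h (e t) := by
  refine (tensorMap_comp (X := fun t => (arrow i).obj (χ t)) (Y := fun t => (arrow i).obj (χ' t))
    (Z := fun t => (arrow i).obj (χ' (e t))) (Equiv.refl T) (fun t => (arrow i).map (h t)) e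
    fun t => 𝟙 _).trans (Eq.trans ?_ (tensorMap_comp (X := fun t => (arrow i).obj (χ t))
    (Y := fun t => (arrow i).obj (χ (e t))) (Z := fun t => (arrow i).obj (χ' (e t))) e
    (fun t => 𝟙 _) (Equiv.refl T') fun t => (arrow i).map (h (e t))).symm)
  exact congrArg (tensorMap (X := fun t => (arrow i).obj (χ t))
    (Y := fun t => (arrow i).obj (χ' (e t))) e)
    (funext fun t => (Category.comp_id _).trans (Category.id_comp _).symm)

theorem cubeReindex_comp {T T' T'' : FinBij} (e : T' ≃ T) (e' : T'' ≃ T') (χ : T → Bool) :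
    cubeReindex i e χ ≫ cubeReindex i e' (fun t => χ (e t)) = cubeReindex i (e'.trans e) χ := by
  refine (tensorMap_comp (X := fun t => (arrow i).obj (χ t))
    (Y := fun t => (arrow i).obj (χ (e t))) (Z := fun t => (arrow i).obj (χ (e (e' t)))) e
    (fun t => 𝟙 _) e' fun t => 𝟙 _).trans ?_
  exact congrArg (tensorMap (X := fun t => (arrow i).obj (χ t))
    (Y := fun t => (arrow i).obj (χ (e (e' t)))) (e'.trans e))
    (funext fun t => Category.comp_id _)

/-- `Q^t_{t-1}`, for a finite set `T` of `t` elements: the colimit of the punctured cube. -/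
noncomputable def QObj (T : FinBij) : SymSeq.{u} := colimit (puncturedCube i T)

namespace QObj
variable {T T' T'' : FinBij}

/-- The map from a vertex of the punctured cube. -/
noncomputable def ι (χ : Punctured T) : (cube i T).obj χ.obj ⟶ QObj i T :=
  colimit.ι (puncturedCube i T) χ

theorem w {χ χ' : Punctured T} (h : χ ⟶ χ') : (cube i T).map h.hom ≫ ι i χ' = ι i χ :=
  colimit.w (puncturedCube i T) h

noncomputable def desc {Z : SymSeq.{u}} (f : ∀ χ : Punctured T, (cube i T).obj χ.obj ⟶ Z)
    (hf : ∀ (χ χ' : Punctured T) (h : χ ⟶ χ'), (cube i T).map h.hom ≫ f χ' = f χ) :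
    QObj i T ⟶ Z :=
  colimit.desc (puncturedCube i T)
    { pt := Z
      ι :=
        { app := f
          naturality χ χ' h := (hf χ χ' h).trans (Category.comp_id _).symm } }

theorem ι_desc {Z : SymSeq.{u}} (f : ∀ χ : Punctured T, (cube i T).obj χ.obj ⟶ Z)
    (hf : ∀ (χ χ' : Punctured T) (h : χ ⟶ χ'), (cube i T).map h.hom ≫ f χ' = f χ)
    (χ : Punctured T) : ι i χ ≫ desc i f hf = f χ :=
  colimit.ι_desc _ _

theorem hom_ext {Z : SymSeq.{u}} {f g : QObj i T ⟶ Z} (h : ∀ χ, ι i χ ≫ f = ι i χ ≫ g) : f = g :=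
  colimit.hom_ext h

theorem map_w (e : T' ≃ T) (χ χ' : Punctured T) (h : χ ⟶ χ') : (cube i T).map h.hom ≫
    cubeReindex i e χ'.obj ≫ ι i (χ'.reindex e) = cubeReindex i e χ.obj ≫ ι i (χ.reindex e) := by
  have h₁ := cubeReindex_naturality i e h.hom
  have h₂ := w i (χ := χ.reindex e) (χ' := χ'.reindex e) (ObjectProperty.homMk fun t => h.hom (e t))
  exact (Category.assoc _ _ _).symm.trans ((congrArg (fun f => f ≫ ι i (χ'.reindex e)) h₁).trans
    ((Category.assoc _ _ _).trans (congrArg _ h₂)))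

/-- Reindexing along a bijection. -/
noncomputable def map (e : T' ≃ T) : QObj i T ⟶ QObj i T' :=
  desc i (fun χ => cubeReindex i e χ.obj ≫ ι i (χ.reindex e)) (map_w i e)

theorem ι_map (e : T' ≃ T) (χ : Punctured T) :
    ι i χ ≫ map i e = cubeReindex i e χ.obj ≫ ι i (χ.reindex e) := ι_desc i _ (map_w i e) χ

theorem map_refl : map i (Equiv.refl T) = 𝟙 _ := hom_ext i fun χ => by
  rw [ι_map, Category.comp_id]
  exact (congrArg (fun f => f ≫ ι i χ) (tensorMap_id _)).trans (Category.id_comp _)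

theorem map_map (e : T' ≃ T) (e' : T'' ≃ T') : map i e ≫ map i e' = map i (e'.trans e) :=
  hom_ext i fun χ => by
    have h := ι_map i e' (χ.reindex e)
    rw [ι_map, ← Category.assoc, ι_map]
    refine (Category.assoc _ _ _).trans ((congrArg _ h).trans ?_)
    exact (Category.assoc _ _ _).symm.trans (congrArg (fun f => f ≫ ι i _)
      (cubeReindex_comp i e e' χ.obj))

end QObj

/-- `Q^t_{t-1}`, with its action of `Σ_t`. -/
noncomputable def Q : FinBijᵒᵖ ⥤ SymSeq.{u} where
  obj T := QObj i T.unop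
  map e := QObj.map i e.unop
  map_id _ := QObj.map_refl i
  map_comp e e' := (QObj.map_map i e.unop e'.unop).symm

/-- The map from a vertex of the cube to the terminal vertex. -/
def toPow (T : FinBij) (χ : T → Bool) : (cube i T).obj χ ⟶ (pow Y).obj (op T) :=
  (cube i T).map (X := χ) (Y := fun _ => true) fun t => homOfLE (Bool.le_true (χ t))

theorem toPow_map {T T' : FinBij} (e : T' ≃ T) (χ : T → Bool) :
    toPow i T χ ≫ (pow Y).map (Quiver.Hom.op (X := T') (Y := T) e) =
      cubeReindex i e χ ≫ toPow i T' fun t => χ (e t) :=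
  cubeReindex_naturality i e (χ := χ) (χ' := fun _ => true) fun t => homOfLE (Bool.le_true (χ t))

theorem toPow_w (T : FinBij) (χ χ' : Punctured T) (h : χ ⟶ χ') :
    (cube i T).map h.hom ≫ toPow i T χ'.obj = toPow i T χ.obj := ((cube i T).map_comp _ _).symm

/-- The map `i_* : Q^t_{t-1} ⟶ Y^{⊗ t}`. -/
noncomputable def iStar : Q i ⟶ pow Y where
  app T := QObj.desc i (fun χ => toPow i T.unop χ.obj) (toPow_w i T.unop)
  naturality T T' e := QObj.hom_ext i fun χ => by
    have h (T) := QObj.ι_desc i (fun χ => toPow i T χ.obj) (toPow_w i T)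
    have h₁ : QObj.ι i χ ≫ QObj.map i e.unop ≫ QObj.desc i (fun χ => toPow i T'.unop χ.obj)
        (toPow_w i T'.unop) = cubeReindex i e.unop χ.obj ≫ toPow i T'.unop (χ.reindex e.unop).obj := by
      rw [← h, ← Category.assoc, QObj.ι_map]
      exact Category.assoc _ _ _
    have h₂ : QObj.ι i χ ≫ QObj.desc i (fun χ => toPow i T.unop χ.obj) (toPow_w i T.unop) ≫
        (pow Y).map e = toPow i T.unop χ.obj ≫ (pow Y).map e := by
      rw [← Category.assoc, h]
    exact h₁.trans ((toPow_map i e.unop χ.obj).symm.trans h₂.symm)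
end Cube

section Balanced
variable (M : FinBijᵒᵖ ⥤ SymSeq.{u})

/-- `M[T] ⊗_{Σ_T} W[T]`: the coequalizer of the two maps `x ⊗ w ↦ xτ ⊗ w` and `x ⊗ w ↦ x ⊗ τw` on
the sum over all permutations `τ` of `T`. -/
noncomputable def bal (W : FinBijᵒᵖ ⥤ SymSeq.{u}) (T : FinBij) : SymSeq.{u} :=
  coequalizer
    (Sigma.desc (f := fun _ : T ≃ T => tensor₂ (M.obj (op T)) (W.obj (op T))) fun τ =>
      tensor₂Map (M.map (Quiver.Hom.op (X := T) (Y := T) τ)) (𝟙 _))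
    (Sigma.desc (f := fun _ : T ≃ T => tensor₂ (M.obj (op T)) (W.obj (op T))) fun τ =>
      tensor₂Map (𝟙 _) (W.map (Quiver.Hom.op (X := T) (Y := T) τ.symm)))

variable {M} {W W' : FinBijᵒᵖ ⥤ SymSeq.{u}}

noncomputable def balMap (M : FinBijᵒᵖ ⥤ SymSeq.{u}) (g : W ⟶ W') (T : FinBij) :
    bal M W T ⟶ bal M W' T :=
  coequalizer.desc (tensor₂Map (𝟙 _) (g.app (op T)) ≫ coequalizer.π _ _) (by
    refine Sigma.hom_ext _ _ fun τ => ?_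
    have h := (Sigma.ι (fun _ : T ≃ T => tensor₂ (M.obj (op T)) (W'.obj (op T))) τ ≫=
      coequalizer.condition (Sigma.desc (f := fun _ : T ≃ T => tensor₂ (M.obj (op T))
        (W'.obj (op T))) fun τ => tensor₂Map (M.map (Quiver.Hom.op (X := T) (Y := T) τ)) (𝟙 _))
        (Sigma.desc (f := fun _ : T ≃ T => tensor₂ (M.obj (op T)) (W'.obj (op T))) fun τ =>
          tensor₂Map (𝟙 _) (W'.map (Quiver.Hom.op (X := T) (Y := T) τ.symm))))
    simp only [Sigma.ι_desc_assoc] at h ⊢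
    have h₁ := tensor₂Map_comp (M.map (Quiver.Hom.op (X := T) (Y := T) τ)) (𝟙 _) (𝟙 _)
      (g.app (op T))
    have h₂ := tensor₂Map_comp (𝟙 (M.obj (op T))) (g.app (op T))
      (M.map (Quiver.Hom.op (X := T) (Y := T) τ)) (𝟙 _)
    have h₃ := tensor₂Map_comp (𝟙 (M.obj (op T))) (W.map (Quiver.Hom.op (X := T) (Y := T) τ.symm))
      (𝟙 _) (g.app (op T))
    have h₄ := tensor₂Map_comp (𝟙 (M.obj (op T))) (g.app (op T)) (𝟙 _)
      (W'.map (Quiver.Hom.op (X := T) (Y := T) τ.symm))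
    rw [g.naturality] at h₃
    simp only [Category.id_comp, Category.comp_id] at h₁ h₂ h₃ h₄
    refine (Category.assoc _ _ _).symm.trans ((congrArg (fun f => f ≫ _) (h₁.trans h₂.symm)).trans
      ((Category.assoc _ _ _).trans ((congrArg _ h).trans ?_)))
    exact (Category.assoc _ _ _).symm.trans ((congrArg (fun f => f ≫ _) (h₄.trans h₃.symm)).trans
      (Category.assoc _ _ _)))

/-- The class of `x ⊗ w`. -/
noncomputable def bal.mk {T : FinBij} {c d : Deg} {k : Dop} (x : (M.obj (op T)).el c k)
    (w : (W.obj (op T)).el d k) : (bal M W T).el (c.sum d) k :=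
  SymSeq.ap (coequalizer.π _ _) (tensor₂.mk x w)

end Balanced

/-- The finite set with `t` elements. -/
abbrev FinBij.std (t : ℕ) : FinBij := ⟨Fin t⟩

section Regroup
variable {T S Q : Type}

/-- A disjoint union over `T ∐ Q` as two disjoint unions. -/
def fibSum (F : Deg → Type) (d : T → Deg) (e : Q → Deg) :
    ((Σ t, F (d t)) ⊕ Σ q, F (e q)) ≃ Σ x : T ⊕ Q, F (Sum.elim d e x) :=
  (Equiv.sumSigmaDistrib fun x => F (Sum.elim d e x)).symm

/-- Moving the `N`-part of a disjoint union over `Q ≅ N ∐ S` into one over `T`. -/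
def fibMove {N : Type} (F : Deg → Type) (w : N ⊕ S ≃ Q) (d : T → Deg) (e : Q → Deg) :
    ((Σ t, F (d t)) ⊕ Σ q, F (e q)) ≃
      (Σ x : T ⊕ N, F (Sum.elim d (fun r => e (w (.inl r))) x)) ⊕ Σ s, F (e (w (.inr s))) :=
  ((Equiv.sumCongr (Equiv.refl _) ((Equiv.sigmaCongrLeft (β := fun q => F (e q)) w).symm.trans
    (Equiv.sumSigmaDistrib fun x => F (e (w x))))).trans (Equiv.sumAssoc _ _ _).symm).trans
    (Equiv.sumCongr (fibSum F d fun r => e (w (.inl r))) (Equiv.refl _))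

end Regroup

namespace DHom
variable {k : Dop} (n : FinBij) {T Q S N : FinBij} (d : T → Deg) (e : Q → Deg)

/-- The bijections of indices between `[o; x, y]` and `[o; x] ⊗ y`. -/
def split : DHom k (Deg.circ n (T := T.sum Q) (Sum.elim d e)) ((Deg.circ n d).sum (Deg.sigma e)) :=
  ofEquiv (c := Deg.circ n (T := T.sum Q) (Sum.elim d e)) (d := (Deg.circ n d).sum (Deg.sigma e))
    (fibSum (fun c => c.R) d e)
    ((Equiv.sumAssoc _ _ _).trans (Equiv.sumCongr (Equiv.refl n) (fibSum (fun c => c.N) d e)))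

/-- The bijections of indices between `[o; x, (z_r)_N] ⊗ (z_s)_S` and `[o; x] ⊗ z`. -/
def move (w : N ⊕ S ≃ Q) :
    DHom k ((Deg.circ n (T := T.sum N) (Sum.elim d fun r => e (w (.inl r)))).sum
      (Deg.sigma fun s : S => e (w (.inr s)))) ((Deg.circ n d).sum (Deg.sigma e)) :=
  ofEquiv (c := (Deg.circ n (T := T.sum N) (Sum.elim d fun r => e (w (.inl r)))).sum
      (Deg.sigma fun s : S => e (w (.inr s)))) (d := (Deg.circ n d).sum (Deg.sigma e))
    (fibMove (fun c => c.R) w d e)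
    ((Equiv.sumAssoc _ _ _).trans ((Equiv.sumCongr (Equiv.refl n)
      (fibMove (fun c => c.N) w d e)).trans (Equiv.sumAssoc _ _ _).symm))

/-- Adding an empty disjoint union. -/
def sumZero (c : Deg) (e : FinBij.std 0 → Deg) : DHom k c (c.sum (Deg.sigma e)) :=
  ofEquiv (d := c.sum (Deg.sigma e))
    (@Equiv.sumEmpty c.R (Σ x, (e x).R) ⟨fun x => x.1.elim0⟩)
    (@Equiv.sumEmpty c.N (Σ x, (e x).N) ⟨fun x => x.1.elim0⟩)

/-- Dropping an empty set of inputs. -/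
def dropZero (T n : FinBij) : DHom k ⟨T.sum (FinBij.std 0), n⟩ ⟨T, n⟩ :=
  ofEquiv (c := ⟨T.sum (FinBij.std 0), n⟩) (d := ⟨T, n⟩) (Equiv.sumEmpty T (Fin 0)).symm
    (Equiv.refl n)

/-- Regrouping the inputs of an operation. -/
def moveInputs (T n : FinBij) (w : N ⊕ S ≃ Q) :
    DHom k ⟨T.sum Q, n⟩ ⟨(T.sum N).sum S, n⟩ :=
  ofEquiv (c := ⟨T.sum Q, n⟩) (d := ⟨(T.sum N).sum S, n⟩)
    ((Equiv.sumAssoc T N S).trans (Equiv.sumCongr (Equiv.refl T) w)) (Equiv.refl n)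

end DHom

/-- The element `⨂_t z_t`. -/
def tensor.mk {T : Type} [Finite T] {X : T → SymSeq.{u}} {k : Dop} {e : T → Deg}
    (z : ∀ t, (X t).el (e t) k) : (tensor X).el (Deg.sigma e) k :=
  Pres.gen (P := tensorPres X) e z DHom.id

def pow.mk {Y : SymSeq.{u}} {T : FinBij} {k : Dop} {e : T → Deg} (y : ∀ t, Y.el (e t) k) :
    ((pow Y).obj (op T)).el (Deg.sigma e) k := tensor.mk (X := fun _ : T => Y) y

/-- The element of `Q^t_{t-1}` given by `⨂_t z_t` in the `χ`-vertex of the punctured cube. -/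
noncomputable def Q.mk {X Y : SymSeq.{u}} {i : X ⟶ Y} {T : FinBij} (χ : Punctured T) {k : Dop}
    {e : T → Deg} (z : ∀ t, ((arrow i).obj (χ.obj t)).el (e t) k) :
    ((Q i).obj (op T)).el (Deg.sigma e) k :=
  SymSeq.ap (QObj.ι i χ) (tensor.mk (X := fun t => (arrow i).obj (χ.obj t)) z)

/-- An element of a vertex of the arrow `i : X ⟶ Y`, regarded as an element of `X` or of `Y`. -/
def inArrow {X Y : SymSeq.{u}} {i : X ⟶ Y} {b b' : Bool} (h : b = b') {c : Deg} {k : Dop}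
    (z : ((arrow i).obj b).el c k) : ((arrow i).obj b').el c k :=
  SymSeq.ap (eqToHom (congrArg (arrow i).obj h)) z

namespace Operad
variable (O : Operad.{u})

/-- The morphism of symmetric sequences corresponding to a morphism out of a free module. -/
noncomputable def adjunct {X : SymSeq.{u}} {A : O.Lt} (f : O.free.obj X ⟶ A) : X ⟶ A.A := O.unit X ≫ f.f

/-- The value `o(x_t)_t` of an operation on elements of a left module. -/
noncomputable def eval {A : O.Lt} {k : Dop} {T n : FinBij} {d : T → Deg} (o : O.S.el ⟨T, n⟩ k)
    (x : ∀ t, A.A.el (d t) k) : A.A.el (Deg.circ n d) k := SymSeq.ap A.a (circ.mk (B := O.S) T n d o x)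

/-- A filtration `A_0 ⟶ A_1 ⟶ ⋯` with colimit `P` in symmetric sequences, starting with
`A_0 ≅ O_A[0] ≅ A` and such that `A_{t+1}` is the pushout of
`A_t ⟵ O_A[t+1] ⊗_{Σ_{t+1}} Q^{t+1}_t ⟶ O_A[t+1] ⊗_{Σ_{t+1}} Y^{⊗ (t+1)}`; all maps are the canonical
ones, which are described on the generators of their sources. -/
structure CellFiltration {A P : O.Lt} {X Y : SymSeq.{u}} (i : X ⟶ Y) (f : O.free.obj X ⟶ A)
    (j : A ⟶ P) (g : O.free.obj Y ⟶ P) where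
  /-- `A_0 ⟶ A_1 ⟶ A_2 ⟶ ⋯` -/
  stage : ℕ ⥤ SymSeq.{u}
  /-- The maps `A_t ⟶ P`. -/
  c : stage ⟶ (Functor.const ℕ).obj P.A
  isColimit : Nonempty (IsColimit (Cocone.mk P.A c))
  /-- `O_A[0] ≅ A_0` -/
  zero : (O.env A).obj (op (FinBij.std 0)) ≅ stage.obj 0
  /-- `O_A[0] ≅ A` -/
  aug : (O.env A).obj (op (FinBij.std 0)) ≅ A.A
  /-- `[o; a] ↦ o(a)` -/
  aug_mk : ∀ {k : Dop} {T n : FinBij} {d : T → Deg} (o : O.S.el ⟨T.sum (FinBij.std 0), n⟩ k)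
    (a : ∀ t, A.A.el (d t) k), SymSeq.ap aug.hom (env.mk O A o a) =
      O.eval (O.S.act (DHom.dropZero T n) o) a
  zero_c : zero.hom ≫ c.app 0 = aug.hom ≫ j.f
  /-- The maps `ξ_t`; `ξ_0` is the canonical isomorphism. -/
  ξ : ∀ t, bal (O.env A) (pow Y) (FinBij.std t) ⟶ stage.obj t
  ξ_zero : ∀ {k : Dop} {b : Deg} {e : FinBij.std 0 → Deg}
    (x : ((O.env A).obj (op (FinBij.std 0))).el b k) (y : ∀ s, Y.el (e s) k),
    SymSeq.ap (ξ 0) (bal.mk x (pow.mk y)) =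
      SymSeq.act _ (DHom.sumZero b e) (SymSeq.ap zero.hom x)
  /-- The maps `f_*`. -/
  fStar : ∀ t, bal (O.env A) (Q i) (FinBij.std (t + 1)) ⟶ stage.obj t
  isPushout : ∀ t, IsPushout (fStar t) (balMap (O.env A) (iStar i) (FinBij.std (t + 1)))
    (stage.map (homOfLE t.le_succ)) (ξ (t + 1))
  /-- In `P`, `ξ_t` is `[o; a] ⊗ y ↦ o(j(a), g(y))`. -/
  ξ_c : ∀ {t : ℕ} {k : Dop} {T n : FinBij} {d : T → Deg} {e : FinBij.std t → Deg}
    (o : O.S.el ⟨T.sum (FinBij.std t), n⟩ k) (a : ∀ r, A.A.el (d r) k) (y : ∀ s, Y.el (e s) k),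
    SymSeq.ap (c.app t) (SymSeq.ap (ξ t) (bal.mk (env.mk O A o a) (pow.mk y))) =
      P.A.act (DHom.split n d e) (O.eval (T := T.sum (FinBij.std t)) o
        (famSum (fun r => SymSeq.ap j.f (a r)) fun s => SymSeq.ap (O.adjunct g) (y s)))
  /-- Plugging in `f`: if `z` consists of the `x_r` in `X`, `r ∈ N`, and of the `y_q` in `Y`, with
  `q ∈ {1, …, s}`, where `s ≤ t`, then `f_*` sends `[o; a] ⊗ z` to the image in `A_t` of
  `ξ_s([o; a, f(x)] ⊗ y)`. -/
  fStar_mk : ∀ {t s : ℕ} (hs : s ≤ t) {N : FinBij} (w : N ⊕ Fin s ≃ Fin (t + 1))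
    (χ : Punctured (FinBij.std (t + 1))) (hX : ∀ r, χ.obj (w (.inl r)) = false)
    (hY : ∀ q, χ.obj (w (.inr q)) = true)
    {k : Dop} {T n : FinBij} {d : T → Deg} {e : FinBij.std (t + 1) → Deg}
    (o : O.S.el ⟨T.sum (FinBij.std (t + 1)), n⟩ k) (a : ∀ r, A.A.el (d r) k)
    (z : ∀ q, ((arrow i).obj (χ.obj q)).el (e q) k),
    SymSeq.ap (fStar t) (bal.mk (env.mk O A o a) (Q.mk χ z)) =
      SymSeq.act _ (DHom.move (S := FinBij.std s) n d e w)
        (SymSeq.ap (stage.map (homOfLE hs)) (SymSeq.ap (ξ s) (bal.mk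
          (env.mk O A (O.S.act (DHom.moveInputs (S := FinBij.std s) T n w) o)
            (famSum a fun r => SymSeq.ap (O.adjunct f) (inArrow (hX r) (z (w (.inl r))))))
          (pow.mk fun q => inArrow (i := i) (hY q) (z (w (.inr q)))))))

end Operad

end SymSpectra

/-! Every element of $P$ is a value $o(j(a_1),\dots,g(y_1),\dots)$, and it can be filtered by the
number of entries from $Y$. The only way to lower this number is to replace an entry $i(x)$ by the
element $f(x)$ of $A$. The proof turns this into a presentation by generators and relations. For a
predicate $p$ on natural numbers, `cell i φ p` is generated by symbols $x\otimes y$, where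
$x\in\mathcal O_A[Q]$, $y$ is a family in $Y$ indexed by $Q$, and $|Q|$ satisfies $p$. The relations
are naturality in $Q$ and in the indices, together with plugging: if $Q\cong N\sqcup S$ with $N$
nonempty and the entries of $y$ over $N$ come from $X$, then their images in $A$ may be inserted
into $x$, which leaves a symbol over $S$. The stage $A_t$ is `cell` for $|Q|\le t$, and the model of
$P$ is `cell` without restriction.

Inserting elements of $A$ into inputs of $\mathcal O_A[Q]$ is well defined by `exists_plug`: an
inserted element $b$ is rewritten as $1(b)$, so that the relation defining $\mathcal O_A$ applies to
all inputs at once. By `env.plug_plug` successive insertions can be merged. This makes the attaching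
map well defined on the punctured cube (`cell.mixed_map`).

The square is a pushout (`cell.isPushout`) because passing from degree $\le t$ to $\le t+1$ adds the
symbols over $t+1$ inputs. Naturality among these is the balanced tensor product over
$\Sigma_{t+1}$, and a plugging relation starting from them says that a symbol with at least one
factor from $X$ equals its image under $f_*$. The stages have the unrestricted `cell` as colimit
(`cell.isColimit_stageCocone`), since each relation already holds in a finite stage.

It remains to identify the unrestricted `cell` with the underlying sequence of $P$ (`isIso_toP`). As
a left module, $P$ is the coequalizer of two maps from the free module on $(\mathcal O\circ A\amalg
X)\amalg Y$ to the free module on $A\amalg Y$ (`isColimit_freeπ`). On underlying sequences the pair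
has a common section, $\mathcal O\circ-$ preserves such coequalizers (`isColimit_circ`), and hence
so does the forgetful functor (`preservesColimit_forget`). So a morphism out of the underlying
sequence of $P$ is a morphism out of $\mathcal O\circ(A\amalg Y)$ respecting the relations. Sorting
inputs, $[o;a,y]\mapsto[o;a]\otimes y$, is such a morphism (`liftCell_condition`). It induces the
inverse of the evaluation map $[o;a]\otimes y\mapsto o(j(a),g(y))$.

Naturality works for arbitrary filtrations with the stated properties. A map out of $A_t$ is
determined on the images of the $\xi_s$ with $s\le t$ (`CellFiltration.hom_ext`), and the maps
$\eta_t$ are built by induction over the pushout squares (`exists_isStageMap`). -/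

namespace SymSpectra

/-! ### Elements of colimits of symmetric sequences -/

section ColimitElements
variable {J : Type} [Category.{0} J] {F : J ⥤ SymSeq.{u}} {s : Cocone F}

/-- The given colimit is isomorphic to the presented one, where every element is the basepoint or a
generator with an index map. The index map can be absorbed by acting in `F.obj j`. The basepoint is
a separate case because `J` may be empty. -/
theorem el_cases_of_isColimit (hs : IsColimit s) {d : Deg} {k : Dop} (y : s.pt.el d k) :
    y = s.pt.pt ∨ ∃ j x, SymSeq.ap (s.ι.app j) x = y := by
  obtain ⟨z, rfl⟩ : ∃ z, SymSeq.ap ((colimIsColimit F).desc s) z = y := by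
    refine ⟨SymSeq.ap (hs.desc (colimCocone F)) y, ?_⟩
    rw [← SymSeq.ap_comp]
    have : hs.desc (colimCocone F) ≫ (colimIsColimit F).desc s = 𝟙 _ :=
      hs.hom_ext fun j => by simp
    rw [this, SymSeq.ap_id]
  revert z
  exact Pres.ind (P := colimPres F) (.inl (SymSeq.ap_pt _)) fun j x ψ =>
    .inr ⟨j.1, SymSeq.act _ ψ x, SymSeq.ap_act _ _ _⟩

/-- At a fixed index `d` and level `k` the colimit is one of pointed sets, so a compatible family of
plain functions descends. The target `β` carries no structure. This allows functions that are
defined at a single index and do not come from morphisms of symmetric sequences. -/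
theorem exists_el_desc (hs : IsColimit s) {d : Deg} {k : Dop} {β : Sort*} (b : β)
    (G : ∀ j, (F.obj j).el d k → β) (hG : ∀ {j j'} (f : j ⟶ j') x, G j' (SymSeq.ap (F.map f) x) = G j x)
    (hb : ∀ j, G j (SymSeq.pt _) = b) :
    ∃ φ : s.pt.el d k → β, (∀ j x, φ (SymSeq.ap (s.ι.app j) x) = G j x) ∧ φ s.pt.pt = b := by
  let φ : (colimPres F).obj.el d k → β := Quot.lift
    (fun g => g.elim b fun g => G g.s.1 (SymSeq.act _ g.ψ g.v)) (by
      rintro _ _ (⟨s, s', h, v, v', ψ, f, rfl⟩ | ⟨g, hg⟩ | ⟨g, hg⟩)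
      · simp only [Option.elim]
        rw [SymSeq.act_act, ← SymSeq.ap_act, hG]
      · simp only [Option.elim]
        rw [hg, SymSeq.act_pt, hb]
      · simp only [Option.elim]
        rw [SymSeq.act_null _ _ hg, hb])
  exact ⟨fun y => φ (SymSeq.ap (hs.desc (colimCocone F)) y), fun j x =>
    (congrArg (fun f => φ (SymSeq.ap f x)) (hs.fac (colimCocone F) j)).trans
      (congrArg (G j) (SymSeq.act_id x)), congrArg φ (SymSeq.ap_pt _)⟩

variable {M N : SymSeq.{u}} {v w : M ⟶ N} {c : Cofork v w}

theorem el_surjective_of_isColimit_cofork (hc : IsColimit c) {d : Deg} {k : Dop} (y : c.pt.el d k) :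
    ∃ x, SymSeq.ap c.π x = y := by
  rcases el_cases_of_isColimit hc y with rfl | ⟨_ | _, x, rfl⟩
  · exact ⟨N.pt, SymSeq.ap_pt _⟩
  · exact ⟨SymSeq.ap v x, by rw [← SymSeq.ap_comp, Cofork.app_zero_eq_comp_π_left]⟩
  · exact ⟨x, rfl⟩

/-- For detecting which elements become equal in a coequalizer: any invariant function of sets will
do, and it need not preserve the structure or the basepoint. -/
theorem eq_of_cofork_π_eq (hc : IsColimit c) {d : Deg} {k : Dop} {β : Sort*}
    (G : N.el d k → β) (hG : ∀ x, G (SymSeq.ap v x) = G (SymSeq.ap w x)) {y y' : N.el d k}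
    (h : SymSeq.ap c.π y = SymSeq.ap c.π y') : G y = G y' := by
  -- The value at the basepoint of the colimit has to be chosen, and `G N.pt` is the only compatible
  -- choice.
  obtain ⟨φ, hφ, -⟩ := exists_el_desc hc (G N.pt) (fun j => match j with
    | .zero => fun x => G (SymSeq.ap v x)
    | .one => G) (by
      rintro _ _ (_ | _ | _) x
      · rfl
      · exact (hG x).symm
      · simp) (by
      rintro (_ | _)
      · exact congrArg G (SymSeq.ap_pt _)
      · rfl)
  exact (hφ .one y).symm.trans ((congrArg φ h).trans (hφ .one y'))

end ColimitElements

/-! ### Bilinear functions out of tensor products -/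

section Tensor₂
variable {M W Z : SymSeq.{u}} {k : Dop}

theorem tensor₂.act_mk {c d e : Deg} (x : M.el c k) (w : W.el d k) (h : DHom k (c.sum d) e) :
    (tensor₂ M W).act h (tensor₂.mk x w) = Pres.gen (P := tensor₂Pres M W) (c, d) (x, w) h :=
  (Pres.act_gen (P := tensor₂Pres M W) _ _ _ _).trans (by rw [DHom.id_comp])

theorem tensor₂.mk_act {c c' d d' : Deg} (f : DHom k c c') (g : DHom k d d') (x : M.el c k)
    (w : W.el d k) : tensor₂.mk (M.act f x) (W.act g w) =
      (tensor₂ M W).act (f.sum g) (tensor₂.mk x w) := by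
  rw [tensor₂.act_mk]
  refine (Pres.gen_step (P := tensor₂Pres M W) (s := (c, d)) (s' := (c', d')) (v := (x, w))
    ⟨f, g, rfl, rfl, rfl⟩ DHom.id).symm.trans ?_
  rw [DHom.comp_id]

theorem tensor₂.mk_pt_left {c d : Deg} (w : W.el d k) :
    tensor₂.mk (M.pt : M.el c k) w = (tensor₂ M W).pt :=
  Pres.gen_null (P := tensor₂Pres M W) (.inl rfl) _

theorem tensor₂.mk_pt_right {c d : Deg} (x : M.el c k) :
    tensor₂.mk x (W.pt : W.el d k) = (tensor₂ M W).pt :=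
  Pres.gen_null (P := tensor₂Pres M W) (.inr rfl) _

theorem tensor₂.sm_mk {l : Dop} (α : k ⟶ l) {c d : Deg} (x : M.el c k) (w : W.el d k) :
    (tensor₂ M W).sm α (tensor₂.mk x w) = tensor₂.mk (M.sm α x) (W.sm α w) :=
  Pres.sm_gen (P := tensor₂Pres M W) _ _ _ _

theorem tensor₂.hom_ext {f g : tensor₂ M W ⟶ Z} (h : ∀ k c d (x : M.el c k) (w : W.el d k),
    SymSeq.ap f (tensor₂.mk x w) = SymSeq.ap g (tensor₂.mk x w)) : f = g :=
  Pres.hom_ext (P := tensor₂Pres M W) fun k s v => h k s.1 s.2 v.1 v.2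

/-- Natural bilinear functions on elements, i.e. morphisms out of a tensor product. -/
structure Pairing (M W Z : SymSeq.{u}) where
  f : ∀ {c d : Deg} {k : Dop}, M.el c k → W.el d k → Z.el (c.sum d) k
  sm : ∀ {c d : Deg} {k l : Dop} (α : k ⟶ l) (x : M.el c k) (w : W.el d k),
    f (M.sm α x) (W.sm α w) = Z.sm α (f x w)
  act : ∀ {c c' d d' : Deg} {k : Dop} (a : DHom k c c') (b : DHom k d d') (x : M.el c k)
    (w : W.el d k), f (M.act a x) (W.act b w) = Z.act (a.sum b) (f x w)
  pt_left : ∀ {c d : Deg} {k : Dop} (w : W.el d k), f (M.pt : M.el c k) w = Z.pt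
  pt_right : ∀ {c d : Deg} {k : Dop} (x : M.el c k), f x (W.pt : W.el d k) = Z.pt

def Pairing.desc (F : Pairing M W Z) : tensor₂ M W ⟶ Z :=
  Pres.lift (P := tensor₂Pres M W) Z (fun s k v => F.f v.1 v.2)
    (fun s k l α v => F.sm α v.1 v.2)
    (fun k s s' h v v' ⟨a, b, hh, h₁, h₂⟩ => by rw [hh, h₁, h₂, F.act])
    (fun s k v hv => by
      rcases hv with h | h
      · rw [h, F.pt_left]
      · rw [h, F.pt_right])

@[simp] theorem Pairing.ap_desc (F : Pairing M W Z) {c d : Deg} (x : M.el c k) (w : W.el d k) :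
    SymSeq.ap F.desc (tensor₂.mk x w) = F.f x w := SymSeq.act_id (X := Z) _

/-- Natural bilinear functions out of a colimit. -/
noncomputable def Pairing.ofColimit {J : Type} [Category.{0} J] [Nonempty J] {F : J ⥤ SymSeq.{u}}
    {s : Cocone F} (hs : IsColimit s) (φ : ∀ j, Pairing M (F.obj j) Z)
    (hφ : ∀ {j j'} (f : j ⟶ j') {c d : Deg} {k : Dop} (x : M.el c k) (w : (F.obj j).el d k),
      (φ j').f x (SymSeq.ap (F.map f) w) = (φ j).f x w) : Pairing M s.pt Z :=
  -- For each fixed `x` the function of `w` is only a function of sets on the colimit at one index.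
  -- Naturality in `x` and `w` together is recovered afterwards from the values on the vertices.
  have H {c d k} (x : M.el c k) := exists_el_desc hs (d := d) (k := k) (Z.pt : Z.el (c.sum d) k)
    (fun j w => (φ j).f x w) (fun f w => hφ f x w) fun j => (φ j).pt_right x
  -- As `J` is nonempty, the basepoint also comes from a vertex, so every element does.
  have Hcases {d k} (w : s.pt.el d k) : ∃ j x, SymSeq.ap (s.ι.app j) x = w := by
    rcases el_cases_of_isColimit hs w with rfl | h
    · exact ⟨Classical.arbitrary J, SymSeq.pt _, SymSeq.ap_pt _⟩
    · exact h
  { f x w := (H x).choose w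
    sm α x w := by
      obtain ⟨j, w, rfl⟩ := Hcases w
      rw [← SymSeq.ap_sm, (H _).choose_spec.1, (H _).choose_spec.1, (φ j).sm]
    act a b x w := by
      obtain ⟨j, w, rfl⟩ := Hcases w
      rw [← SymSeq.ap_act, (H _).choose_spec.1, (H _).choose_spec.1, (φ j).act]
    pt_left w := by
      obtain ⟨j, w, rfl⟩ := Hcases w
      rw [(H _).choose_spec.1, (φ j).pt_left]
    pt_right x := (H x).choose_spec.2 }

theorem Pairing.ofColimit_ι {J : Type} [Category.{0} J] [Nonempty J] {F : J ⥤ SymSeq.{u}}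
    {s : Cocone F} (hs : IsColimit s) (φ : ∀ j, Pairing M (F.obj j) Z)
    (hφ : ∀ {j j'} (f : j ⟶ j') {c d : Deg} {k : Dop} (x : M.el c k) (w : (F.obj j).el d k),
      (φ j').f x (SymSeq.ap (F.map f) w) = (φ j).f x w) (j : J) {c d : Deg} (x : M.el c k)
    (w : (F.obj j).el d k) :
    (Pairing.ofColimit hs φ hφ).f x (SymSeq.ap (s.ι.app j) w) = (φ j).f x w := by
  have H := exists_el_desc hs (d := d) (k := k) (Z.pt : Z.el (c.sum d) k)
    (fun j w => (φ j).f x w) (fun f w => hφ f x w) fun j => (φ j).pt_right x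
  exact H.choose_spec.1 j w

end Tensor₂

namespace Lab
variable {A B C D : Type} {k : Dop}
theorem id_sum_id : (Lab.id : Lab A A k).sum (Lab.id : Lab C C k) = Lab.id := by
  refine Lab.ext (funext ?_)
  rintro (x | x) <;> rfl
theorem Null.sum_left {f : Lab A B k} (hf : f.Null) (h : Lab C D k) : (f.sum h).Null := by
  obtain ⟨b, s, hb, hs⟩ := hf
  exact ⟨Sum.inl b, s, by simp [Lab.sum, hb], hs⟩
end Lab

namespace DHom
variable {k : Dop} {c d e c' d' e' : Deg}
theorem sum_comp (f : DHom k c d) (g : DHom k d e) (f' : DHom k c' d') (g' : DHom k d' e') :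
    (f.sum f').comp (g.sum g') = (f.comp g).sum (f'.comp g') := by
  ext1
  · exact Equiv.ext (by rintro (x | x) <;> rfl)
  · exact Lab.sum_comp _ _ _ _
theorem id_sum_id : (DHom.id : DHom k c c).sum (DHom.id : DHom k d d) = DHom.id := by
  ext1
  · exact Equiv.ext (by rintro (x | x) <;> rfl)
  · exact Lab.id_sum_id
theorem Null.sum_left {f : DHom k c d} (hf : f.Null) (g : DHom k c' d') : (f.sum g).Null :=
  Lab.Null.sum_left hf _
theorem Null.sum_right (f : DHom k c d) {g : DHom k c' d'} (hg : g.Null) : (f.sum g).Null :=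
  Lab.Null.sum_right _ hg
end DHom

/-! ### Multilinear functions out of tensor products of families -/

section TensorPairing
variable {M Z : SymSeq.{u}} {T : Type} [Finite T] {X : T → SymSeq.{u}} {k : Dop}

theorem tensor.act_mk {d : T → Deg} {e : Deg} (v : ∀ t, (X t).el (d t) k)
    (h : DHom k (Deg.sigma d) e) : (tensor X).act h (tensor.mk v) =
      Pres.gen (P := tensorPres X) d v h :=
  (Pres.act_gen (P := tensorPres X) _ _ _ _).trans (by rw [DHom.id_comp])

theorem tensor.mk_act {d d' : T → Deg} (f : ∀ t, DHom k (d t) (d' t)) (v : ∀ t, (X t).el (d t) k) :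
    tensor.mk (fun t => (X t).act (f t) (v t)) = (tensor X).act (DHom.fam f) (tensor.mk v) := by
  rw [tensor.act_mk]
  refine (Pres.gen_step (P := tensorPres X) (s := d) (s' := d') (v := v) ⟨f, rfl, fun t => rfl⟩
    DHom.id).symm.trans ?_
  rw [DHom.comp_id]

theorem tensor.mk_pt {d : T → Deg} (v : ∀ t, (X t).el (d t) k) (t : T) (h : v t = (X t).pt) :
    tensor.mk v = (tensor X).pt := Pres.gen_null (P := tensorPres X) ⟨t, h⟩ _

theorem tensor.sm_mk {l : Dop} (α : k ⟶ l) {d : T → Deg} (v : ∀ t, (X t).el (d t) k) :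
    (tensor X).sm α (tensor.mk v) = tensor.mk fun t => (X t).sm α (v t) :=
  Pres.sm_gen (P := tensorPres X) _ _ _ _

theorem tensor.cases {e : Deg} (w : (tensor X).el e k) : w = (tensor X).pt ∨
    ∃ (d : T → Deg) (v : ∀ t, (X t).el (d t) k) (h : DHom k (Deg.sigma d) e),
      w = (tensor X).act h (tensor.mk v) := by
  revert w
  refine Pres.ind (P := tensorPres X) (.inl rfl) fun d v h => .inr ⟨d, v, h, ?_⟩
  rw [tensor.act_mk]

theorem tensorMap_mk {T' : Type} [Finite T'] {Y : T' → SymSeq.{u}} (σ : T' ≃ T)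
    (f : ∀ t', X (σ t') ⟶ Y t') (d : T → Deg) (v : ∀ t, (X t).el (d t) k) :
    SymSeq.ap (tensorMap σ f) (tensor.mk v) = (tensor Y).act (DHom.reindex σ d)
      (tensor.mk (X := Y) fun t' => SymSeq.ap (f t') (v (σ t'))) := by
  rw [tensor.act_mk]
  refine (ap_tensorMap σ f d v DHom.id).trans ?_
  rw [DHom.comp_id]

/-- Natural multilinear functions, i.e. natural bilinear functions out of a tensor product. -/
structure MultiPairing (M : SymSeq.{u}) {T : Type} [Finite T] (X : T → SymSeq.{u})
    (Z : SymSeq.{u}) where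
  f : ∀ {c : Deg} {d : T → Deg} {k : Dop}, M.el c k → (∀ t, (X t).el (d t) k) →
    Z.el (c.sum (Deg.sigma d)) k
  sm : ∀ {c : Deg} {d : T → Deg} {k l : Dop} (α : k ⟶ l) (x : M.el c k)
    (v : ∀ t, (X t).el (d t) k), f (M.sm α x) (fun t => (X t).sm α (v t)) = Z.sm α (f x v)
  act : ∀ {c c' : Deg} {d d' : T → Deg} {k : Dop} (a : DHom k c c') (b : ∀ t, DHom k (d t) (d' t))
    (x : M.el c k) (v : ∀ t, (X t).el (d t) k), f (M.act a x) (fun t => (X t).act (b t) (v t)) =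
      Z.act (a.sum (DHom.fam b)) (f x v)
  pt_left : ∀ {c : Deg} {d : T → Deg} {k : Dop} (v : ∀ t, (X t).el (d t) k),
    f (M.pt : M.el c k) v = Z.pt
  pt_right : ∀ {c : Deg} {d : T → Deg} {k : Dop} (x : M.el c k) (v : ∀ t, (X t).el (d t) k) (t : T),
    v t = (X t).pt → f x v = Z.pt

/-- The bilinear function given by a multilinear one. -/
def MultiPairing.pairing (F : MultiPairing M X Z) : Pairing M (tensor X) Z where
  -- An element of the tensor product is a family with an index map `ψ`. The index map is moved
  -- outside as `id ⊔ ψ`, and the basepoint goes to the basepoint.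
  f {c d k} x := Quot.lift (fun g => g.elim Z.pt fun g =>
      Z.act ((DHom.id : DHom k c c).sum g.ψ) (F.f x g.v)) (by
    rintro _ _ (⟨s, s', h, v, v', ψ, g, rfl, hg⟩ | ⟨g, t, hg⟩ | ⟨g, hg⟩)
    · obtain rfl : v' = _ := funext hg
      have := F.act DHom.id g x v
      rw [SymSeq.act_id] at this
      simp only [Option.elim]
      rw [this, SymSeq.act_act, DHom.sum_comp, DHom.id_comp]
    · simp only [Option.elim]
      rw [F.pt_right x g.v t hg, SymSeq.act_pt]
    · exact SymSeq.act_null _ _ (hg.sum_right _))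
  sm {c d k l} α x := Pres.ind (P := tensorPres X) (SymSeq.sm_pt _).symm fun e v ψ => by
    refine (congrArg (Z.act (DHom.id.sum (ψ.push α))) (F.sm α x v)).trans
      (Eq.trans ?_ (SymSeq.sm_act (X := Z) α (DHom.id.sum ψ) (F.f x v)).symm)
    rw [DHom.push_sum, DHom.push_id]
  act {c c' d d' k} a b x := Pres.ind (P := tensorPres X)
    ((congrArg _ (SymSeq.act_pt _)).trans (SymSeq.act_pt _).symm) fun e v ψ => by
    refine (congrArg _ (Pres.act_gen (P := tensorPres X) _ _ _ _)).trans ?_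
    have := F.act a (fun t => DHom.id) x v
    simp only [SymSeq.act_id] at this
    refine (congrArg (Z.act (DHom.id.sum (ψ.comp b))) this).trans
      (Eq.trans ?_ (SymSeq.act_act (X := Z) (DHom.id.sum ψ) (a.sum b) (F.f x v)).symm)
    rw [DHom.fam_id, SymSeq.act_act, DHom.sum_comp, DHom.sum_comp, DHom.id_comp, DHom.id_comp,
      DHom.comp_id]
  pt_left := Pres.ind (P := tensorPres X) rfl fun e v ψ => by
    refine (congrArg _ (F.pt_left v)).trans (SymSeq.act_pt _)
  pt_right x := rfl

@[simp] theorem MultiPairing.pairing_mk (F : MultiPairing M X Z) {c : Deg} {d : T → Deg}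
    (x : M.el c k) (v : ∀ t, (X t).el (d t) k) : F.pairing.f x (tensor.mk v) = F.f x v := by
  refine Eq.trans ?_ (SymSeq.act_id _)
  rw [← DHom.id_sum_id]
  rfl

end TensorPairing

/-! ### Balanced tensor products over symmetric groups -/

section Balanced
variable {M W : FinBijᵒᵖ ⥤ SymSeq.{u}} {T : FinBij} {Z : SymSeq.{u}}

/-- The quotient map onto `M[T] ⊗_{Σ_T} W[T]`. -/
noncomputable def bal.π (M W : FinBijᵒᵖ ⥤ SymSeq.{u}) (T : FinBij) :
    tensor₂ (M.obj (op T)) (W.obj (op T)) ⟶ bal M W T := coequalizer.π _ _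

theorem bal.ap_π {c d : Deg} {k : Dop} (x : (M.obj (op T)).el c k) (w : (W.obj (op T)).el d k) :
    SymSeq.ap (bal.π M W T) (tensor₂.mk x w) = bal.mk x w := rfl

/-- The defining coequalizer relation on elements. Both `M` and `W` are contravariant in `T`, so
moving a permutation across the tensor sign inverts it. -/
theorem bal.condition (τ : T ≃ T) {c d : Deg} {k : Dop} (x : (M.obj (op T)).el c k)
    (w : (W.obj (op T)).el d k) :
    bal.mk (SymSeq.ap (M.map (Quiver.Hom.op (X := T) (Y := T) τ)) x) w =
      bal.mk (M := M) (W := W) x (SymSeq.ap (W.map (Quiver.Hom.op (X := T) (Y := T) τ.symm)) w) := by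
  have h := (Sigma.ι (fun _ : T ≃ T => tensor₂ (M.obj (op T)) (W.obj (op T))) τ ≫=
      coequalizer.condition (Sigma.desc (f := fun _ : T ≃ T => tensor₂ (M.obj (op T))
        (W.obj (op T))) fun τ => tensor₂Map (M.map (Quiver.Hom.op (X := T) (Y := T) τ)) (𝟙 _))
        (Sigma.desc (f := fun _ : T ≃ T => tensor₂ (M.obj (op T)) (W.obj (op T))) fun τ =>
          tensor₂Map (𝟙 _) (W.map (Quiver.Hom.op (X := T) (Y := T) τ.symm))))
  simp only [Sigma.ι_desc_assoc] at h
  have h' := congrArg (fun f => SymSeq.ap f (tensor₂.mk x w)) h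
  simp only [SymSeq.ap_comp, ap_tensor₂Map, SymSeq.ap_id] at h'
  exact h'

/-- Morphisms out of `M[T] ⊗_{Σ_T} W[T]`. -/
noncomputable def bal.desc (F : Pairing (M.obj (op T)) (W.obj (op T)) Z)
    (hF : ∀ (τ : T ≃ T) {c d : Deg} {k : Dop} (x : (M.obj (op T)).el c k)
      (w : (W.obj (op T)).el d k),
      F.f (SymSeq.ap (M.map (Quiver.Hom.op (X := T) (Y := T) τ)) x) w =
        F.f x (SymSeq.ap (W.map (Quiver.Hom.op (X := T) (Y := T) τ.symm)) w)) : bal M W T ⟶ Z :=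
  coequalizer.desc F.desc (Sigma.hom_ext _ _ fun τ => by
    simp only [Sigma.ι_desc_assoc]
    refine tensor₂.hom_ext fun k c d x w => ?_
    rw [SymSeq.ap_comp, SymSeq.ap_comp, ap_tensor₂Map, ap_tensor₂Map, Pairing.ap_desc,
      Pairing.ap_desc]
    exact hF τ x w)

@[simp] theorem bal.ap_desc (F : Pairing (M.obj (op T)) (W.obj (op T)) Z) (hF)
    {c d : Deg} {k : Dop} (x : (M.obj (op T)).el c k) (w : (W.obj (op T)).el d k) :
    SymSeq.ap (bal.desc F hF) (bal.mk x w) = F.f x w := by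
  exact (congrArg (fun f => SymSeq.ap f (tensor₂.mk x w)) (coequalizer.π_desc F.desc _)).trans
    (F.ap_desc x w)

theorem bal.hom_ext {f g : bal M W T ⟶ Z}
    (h : ∀ k c d (x : (M.obj (op T)).el c k) (w : (W.obj (op T)).el d k),
      SymSeq.ap f (bal.mk x w) = SymSeq.ap g (bal.mk x w)) : f = g :=
  coequalizer.hom_ext (tensor₂.hom_ext h)

theorem bal.mk_act {c c' d d' : Deg} {k : Dop} (a : DHom k c c') (b : DHom k d d')
    (x : (M.obj (op T)).el c k) (w : (W.obj (op T)).el d k) :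
    bal.mk (SymSeq.act _ a x) (SymSeq.act _ b w) = (bal M W T).act (a.sum b) (bal.mk x w) := by
  rw [← bal.ap_π, tensor₂.mk_act, SymSeq.ap_act, bal.ap_π]

theorem bal.mk_pt_left {c d : Deg} {k : Dop} (w : (W.obj (op T)).el d k) :
    bal.mk (SymSeq.pt _ : (M.obj (op T)).el c k) w = (bal M W T).pt := by
  rw [← bal.ap_π, tensor₂.mk_pt_left, SymSeq.ap_pt]

theorem bal.mk_pt_right {c d : Deg} {k : Dop} (x : (M.obj (op T)).el c k) :
    bal.mk x (SymSeq.pt _ : (W.obj (op T)).el d k) = (bal M W T).pt := by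
  rw [← bal.ap_π, tensor₂.mk_pt_right, SymSeq.ap_pt]

theorem bal.sm_mk {c d : Deg} {k l : Dop} (α : k ⟶ l) (x : (M.obj (op T)).el c k)
    (w : (W.obj (op T)).el d k) : (bal M W T).sm α (bal.mk x w) =
      bal.mk (SymSeq.sm _ α x) (SymSeq.sm _ α w) := by
  rw [← bal.ap_π, ← SymSeq.ap_sm, tensor₂.sm_mk, bal.ap_π]

theorem balMap_mk {W' : FinBijᵒᵖ ⥤ SymSeq.{u}} (g : W ⟶ W') {c d : Deg} {k : Dop}
    (x : (M.obj (op T)).el c k) (w : (W.obj (op T)).el d k) :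
    SymSeq.ap (balMap M g T) (bal.mk x w) = bal.mk x (SymSeq.ap (g.app (op T)) w) := by
  refine (congrArg (fun f => SymSeq.ap f (tensor₂.mk x w)) (coequalizer.π_desc
    (tensor₂Map (𝟙 (M.obj (op T))) (g.app (op T)) ≫ bal.π M W' T) _)).trans ?_
  rw [SymSeq.ap_comp, ap_tensor₂Map, SymSeq.ap_id, bal.ap_π]

end Balanced

/-! ### Elements of tensor powers and of the punctured cube -/

section PowQ
variable {X Y : SymSeq.{u}} {i : X ⟶ Y} {T : FinBij} {k : Dop}

theorem pow.map_mk {T' : FinBij} (σ : T' ≃ T) {e : T → Deg} (y : ∀ t, Y.el (e t) k) :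
    SymSeq.ap ((pow Y).map (Quiver.Hom.op (X := T') (Y := T) σ)) (pow.mk y) =
      SymSeq.act _ (DHom.reindex σ e) (pow.mk (T := T') fun t => y (σ t)) :=
  tensorMap_mk (X := fun _ => Y) (Y := fun _ => Y) σ (fun _ => 𝟙 Y) e y

theorem iStar_mk (χ : Punctured T) {e : T → Deg} (z : ∀ t, ((arrow i).obj (χ.obj t)).el (e t) k) :
    SymSeq.ap ((iStar i).app (op T)) (Q.mk χ z) = pow.mk (T := T) fun t =>
      SymSeq.ap ((arrow i).map (homOfLE (Bool.le_true (χ.obj t)))) (z t) := by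
  refine (congrArg (fun f => SymSeq.ap f (tensor.mk z))
    (QObj.ι_desc i (fun χ => toPow i T χ.obj) (toPow_w i T) χ)).trans ?_
  refine (tensorMap_mk (X := fun t => (arrow i).obj (χ.obj t))
    (Y := fun t => (arrow i).obj true) (Equiv.refl T) (fun t => (arrow i).map
      (homOfLE (Bool.le_true (χ.obj t)))) e z).trans (SymSeq.act_id _)

theorem Q.map_mk {T' : FinBij} (σ : T' ≃ T) (χ : Punctured T) {e : T → Deg}
    (z : ∀ t, ((arrow i).obj (χ.obj t)).el (e t) k) :
    SymSeq.ap ((Q i).map (Quiver.Hom.op (X := T') (Y := T) σ)) (Q.mk χ z) =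
      SymSeq.act _ (DHom.reindex σ e) (Q.mk (i := i) (χ.reindex σ) fun t => z (σ t)) := by
  refine (congrArg (fun f => SymSeq.ap f (tensor.mk z)) (QObj.ι_map i σ χ)).trans ?_
  refine (congrArg (SymSeq.ap (QObj.ι i (χ.reindex σ)))
    (tensorMap_mk (X := fun t => (arrow i).obj (χ.obj t))
    (Y := fun t => (arrow i).obj (χ.obj (σ t))) σ (fun _ => 𝟙 _) e z)).trans ?_
  exact SymSeq.ap_act _ _ _

theorem QObj.cases [Nonempty T] {d : Deg} (w : (QObj i T).el d k) : w = SymSeq.pt _ ∨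
    ∃ (χ : Punctured T) (e : T → Deg) (z : ∀ t, ((arrow i).obj (χ.obj t)).el (e t) k)
      (h : DHom k (Deg.sigma e) d), w = SymSeq.act ((Q i).obj (op T)) h (Q.mk χ z) := by
  rcases el_cases_of_isColimit (colimit.isColimit (puncturedCube i T)) w with rfl | ⟨χ, w, rfl⟩
  · exact .inl rfl
  · rcases tensor.cases w with rfl | ⟨e, z, h, rfl⟩
    · exact .inl (SymSeq.ap_pt _)
    · exact .inr ⟨χ, e, z, h, SymSeq.ap_act _ _ _⟩

end PowQ

section
variable {T Q : Type} (F : Deg → Type) (d : T → Deg) (e : Q → Deg)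

@[simp] theorem fibSum_inl (t : T) (x : F (d t)) : fibSum F d e (.inl ⟨t, x⟩) = ⟨.inl t, x⟩ := rfl

@[simp] theorem fibSum_inr (q : Q) (x : F (e q)) : fibSum F d e (.inr ⟨q, x⟩) = ⟨.inr q, x⟩ := rfl

end

namespace DHom
variable {k : Dop}

/-- Two families of maps of indices as one. -/
def sumFam {T T' Q Q' : Type} {d : T → Deg} {d' : T' → Deg} {e : Q → Deg} {e' : Q' → Deg}
    {σ : T' ≃ T} {τ : Q' ≃ Q} (f : ∀ t, DHom k (d (σ t)) (d' t)) (g : ∀ q, DHom k (e (τ q)) (e' q)) :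
    ∀ x, DHom k (Sum.elim d e (Equiv.sumCongr σ τ x)) (Sum.elim d' e' x)
  | .inl t => f t
  | .inr q => g q

/-- Reindexing the blocks `T` and `Q` separately commutes with splitting a disjoint union into these
blocks. This is the index part of `split_env_mk`. -/
theorem split_nat {n n' T T' Q Q' : FinBij} {d : T → Deg} {d' : T' → Deg} {e : Q → Deg}
    {e' : Q' → Deg} (σ : T' ≃ T) (τ : Q' ≃ Q) (l : Lab n n' k) (f : ∀ t, DHom k (d (σ t)) (d' t))
    (g : ∀ q, DHom k (e (τ q)) (e' q)) :
    (circ (T := T.sum Q) (T' := T'.sum Q') (c := Sum.elim d e) (d := Sum.elim d' e')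
      (Equiv.sumCongr σ τ) l (sumFam f g)).comp (split n' d' e') =
      (split n d e).comp ((circ σ l f).sum (sigma τ g)) := by
  ext1
  · exact Equiv.ext (by rintro (⟨t, x⟩ | ⟨q, x⟩) <;> rfl)
  · refine Lab.ext (funext ?_)
    rintro ((x | ⟨t, x⟩) | ⟨q, x⟩)
    · rcases h : l.g x with y | y <;> simp [DHom.comp, DHom.circ, DHom.split, DHom.sum, DHom.ofEquiv,
        Lab.comp, Lab.sum, Lab.sigma, Lab.ofEquiv, h]
    · rcases h : (f t).lab.g x with y | y <;> simp [DHom.comp, DHom.circ, DHom.split, DHom.sum,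
        DHom.ofEquiv, Lab.comp, Lab.sum, Lab.sigma, Lab.ofEquiv, sumFam, h] <;> rfl
    · rcases h : (g q).lab.g x with y | y <;> simp [DHom.comp, DHom.circ, DHom.split, DHom.sum,
        DHom.sigma, DHom.ofEquiv, Lab.comp, Lab.sum, Lab.sigma, Lab.ofEquiv, sumFam, h] <;> rfl

end DHom

/-! ### Evaluation in left modules and elements of enveloping arrays -/

namespace Operad
variable {O : Operad.{u}} {A A' : O.Lt} {k : Dop}

section Eval
variable {T n : FinBij} {d : T → Deg}

/-- The action on a left module, as a morphism out of `O ∘ A`. -/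
noncomputable def act₁ (A : O.Lt) : circ O.S A.A ⟶ A.A := A.a

theorem ap_act₁ (o : O.S.el ⟨T, n⟩ k) (a : ∀ t, A.A.el (d t) k) :
    SymSeq.ap (act₁ A) (circ.mk T n d o a) = O.eval o a := rfl

theorem eval_act_left {T' n' : FinBij} (σ : T' ≃ T) (l : Lab n n' k)
    (o : O.S.el ⟨T, n⟩ k) (a : ∀ t, A.A.el (d t) k) :
    O.eval (A := A) (O.S.act (c := ⟨T, n⟩) (d := ⟨T', n'⟩) ⟨σ, l⟩ o) (fun t => a (σ t)) =
      A.A.act (DHom.circ σ l fun _ => DHom.id) (O.eval o a) := by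
  rw [← ap_act₁, circ.mk_act_left, SymSeq.ap_act, ap_act₁]

theorem eval_act_right {d' : T → Deg} (f : ∀ t, DHom k (d t) (d' t)) (o : O.S.el ⟨T, n⟩ k)
    (a : ∀ t, A.A.el (d t) k) : O.eval (A := A) o (fun t => A.A.act (f t) (a t)) =
      A.A.act (DHom.circFam n f) (O.eval o a) := by
  rw [← ap_act₁, circ.mk_act_right, SymSeq.ap_act, ap_act₁]

theorem ap_eval (α : A ⟶ A') (o : O.S.el ⟨T, n⟩ k) (a : ∀ t, A.A.el (d t) k) :
    SymSeq.ap α.f (O.eval o a) = O.eval (A := A') o fun t => SymSeq.ap α.f (a t) := by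
  have h := congrArg (fun f => SymSeq.ap f (circ.mk T n d o a)) α.h
  exact h.symm.trans (congrArg (SymSeq.ap A'.a) (ap_circMap _ _ _ _ _ _ _))

theorem eval_one {d : Deg} (a : A.A.el d k) : A.A.act (DHom.unitL d)
    (O.eval (A := A) (T := FinBij.one) (n := FinBij.zero) (d := fun _ => d) (O.one k) fun _ => a) =
      a := by
  have h := congrArg (fun f => SymSeq.ap f a) A.unit
  exact (SymSeq.ap_act _ _ _).symm.trans h

end Eval

section Env
variable {T n Q : FinBij} {d : T → Deg}

/-- The quotient map onto `O_A[Q]`. -/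
noncomputable def env.π (A : O.Lt) (Q : FinBij) : circ (shift Q O.S) A.A ⟶ (O.env A).obj (op Q) :=
  coequalizer.π (O.envL A Q) (O.envR A Q)

theorem env.mk_act {T' n' : FinBij} {d' : T' → Deg} (σ : T' ≃ T) (l : Lab n n' k)
    (f : ∀ t, DHom k (d (σ t)) (d' t)) (o : O.S.el ⟨T.sum Q, n⟩ k) (a : ∀ t, A.A.el (d t) k) :
    env.mk O A (O.S.act (c := ⟨T.sum Q, n⟩) (d := ⟨T'.sum Q, n'⟩)
      ⟨Equiv.sumCongr σ (Equiv.refl Q), l⟩ o) (fun t => A.A.act (f t) (a (σ t))) =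
      SymSeq.act _ (DHom.circ σ l f) (env.mk O A o a) :=
  (congrArg (SymSeq.ap (env.π A Q)) (circ.mk_act (B := shift Q O.S) σ l f o a)).trans
    (SymSeq.ap_act _ _ _)

theorem env.mk_act_right {d' : T → Deg} (f : ∀ t, DHom k (d t) (d' t)) (o : O.S.el ⟨T.sum Q, n⟩ k)
    (a : ∀ t, A.A.el (d t) k) : env.mk O A o (fun t => A.A.act (f t) (a t)) =
      SymSeq.act _ (DHom.circFam n f) (env.mk O A o a) :=
  (congrArg (SymSeq.ap (env.π A Q)) (circ.mk_act_right (B := shift Q O.S) f o a)).trans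
    (SymSeq.ap_act _ _ _)

theorem env.mk_pt (o : O.S.el ⟨T.sum Q, n⟩ k) (a : ∀ t, A.A.el (d t) k) (t : T)
    (h : a t = A.A.pt) : env.mk O A o a = SymSeq.pt _ :=
  (congrArg (SymSeq.ap (env.π A Q)) (circ.mk_pt (B := shift Q O.S) o a t h)).trans
    (SymSeq.ap_pt _)

theorem env.mk_pt_left (a : ∀ t, A.A.el (d t) k) :
    env.mk O A (O.S.pt : O.S.el ⟨T.sum Q, n⟩ k) a = SymSeq.pt _ :=
  (congrArg (SymSeq.ap (env.π A Q)) (circ.mk_pt_left (B := shift Q O.S) a)).trans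
    (SymSeq.ap_pt _)

theorem env.sm_mk {l : Dop} (α : k ⟶ l) (o : O.S.el ⟨T.sum Q, n⟩ k) (a : ∀ t, A.A.el (d t) k) :
    SymSeq.sm _ α (env.mk O A o a) = env.mk O A (O.S.sm α o) fun t => A.A.sm α (a t) :=
  (SymSeq.ap_sm (env.π A Q) α _).symm.trans
    (congrArg (SymSeq.ap (env.π A Q)) (circ.sm_mk (B := shift Q O.S) α o a))

theorem env.map_mk {Q' : FinBij} (e : Q' ≃ Q) (o : O.S.el ⟨T.sum Q, n⟩ k)
    (a : ∀ t, A.A.el (d t) k) :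
    SymSeq.ap ((O.env A).map (Quiver.Hom.op (X := Q') (Y := Q) e)) (env.mk O A o a) =
      env.mk O A (O.S.act (c := ⟨T.sum Q, n⟩) (d := ⟨T.sum Q', n⟩)
        ⟨Equiv.sumCongr (Equiv.refl T) e, Lab.id⟩ o) a :=
  (congrArg (fun f => SymSeq.ap f (circ.mk (B := shift Q O.S) T n d o a)) (coequalizer.π_desc
    (circMap (shiftMap O.S e) (𝟙 A.A) ≫ env.π A Q') _)).trans
    (congrArg (SymSeq.ap (env.π A Q')) (ap_circMap _ _ _ _ _ _ _))

/-- The coequalizer relation defining $\mathcal O_A[Q]$, on representatives: operations at the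
inputs from $A$ can be composed into `o`, with units at the inputs `Q`. The index map `assoc`
corrects the bracketing of the indices. -/
theorem env.mk_eval {s : T → CircSh} (o : O.S.el ⟨T.sum Q, n⟩ k)
    (os : ∀ t, O.S.el ⟨(s t).T, (s t).n⟩ k) (as : ∀ t p, A.A.el ((s t).d p) k) :
    env.mk O A (d := fun t => (s t).deg) o (fun t => O.eval (os t) (as t)) =
      SymSeq.act _ (DHom.assoc n s) (env.mk O A (T := (CircSh.assoc n s).T)
        (n := (CircSh.assoc n s).n) (d := (CircSh.assoc n s).d)
        (O.plug (d := fun t => ⟨(s t).T, (s t).n⟩) o os) fun x => as x.1 x.2) := by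
  have h := congrArg (fun f => SymSeq.ap f (circ.mk (B := shift Q O.S) T n (fun t => (s t).deg) o
    fun t => circ.mk (s t).T (s t).n (s t).d (os t) (as t)))
    (coequalizer.condition (O.envL A Q) (O.envR A Q))
  have h₁ := congrArg (SymSeq.ap (env.π A Q)) (ap_circMap (𝟙 (shift Q O.S)) A.a T n
    (fun t => (s t).deg) o fun t => circ.mk (s t).T (s t).n (s t).d (os t) (as t))
  refine (h₁.symm.trans h.symm).trans ?_
  refine (congrArg (fun x => SymSeq.ap (env.π A Q) (SymSeq.ap (circMap (O.rightAction Q) (𝟙 A.A)) x))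
    (ap_circAssoc (B := shift Q O.S) o os as)).trans ?_
  rw [SymSeq.ap_act, SymSeq.ap_act, ap_circMap]
  refine congrArg (SymSeq.act _ (DHom.assoc n s)) (congrArg (SymSeq.ap (env.π A Q))
    (congrArg (fun o => circ.mk (B := shift Q O.S) (CircSh.assoc n s).T (CircSh.assoc n s).n
      (CircSh.assoc n s).d o fun x => as x.1 x.2) ?_))
  exact circ.ap_lift _ _ _ _ _ _ _ _ _ _ _

theorem env.cases {c : Deg} (x : ((O.env A).obj (op Q)).el c k) : x = SymSeq.pt _ ∨
    ∃ (T n : FinBij) (d : T → Deg) (o : O.S.el ⟨T.sum Q, n⟩ k) (a : ∀ t, A.A.el (d t) k)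
      (ψ : DHom k (Deg.circ n d) c), x = SymSeq.act _ ψ (env.mk O A o a) := by
  obtain ⟨x, rfl⟩ := el_surjective_of_isColimit_cofork
    (coequalizerIsCoequalizer (O.envL A Q) (O.envR A Q)) x
  revert x
  refine Pres.ind (P := circPres (shift Q O.S) A.A) (.inl (SymSeq.ap_pt _))
    fun s v ψ => .inr ⟨s.T, s.n, s.d, v.1, v.2, ψ, ?_⟩
  exact (congrArg (SymSeq.ap (env.π A Q)) (circ.act_mk (B := shift Q O.S) s.T s.n s.d v.1 v.2 ψ).symm
    ).trans (SymSeq.ap_act _ _ _)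

/-- A universal property of $\mathcal O_A[Q]$ at one index and one simplicial level, for functions
of sets. A morphism of symmetric sequences would not suffice for plugging: the family plugged in
lives at a fixed level, so the resulting function is not natural in the index and the level by
itself. `G_eval` is the coequalizer relation; the other hypotheses make `G` descend to the
composition product. -/
theorem env.exists_desc {c : Deg} {β : Sort*} (β₀ : β)
    (G : ∀ {T n : FinBij} {d : T → Deg}, O.S.el ⟨T.sum Q, n⟩ k → (∀ t, A.A.el (d t) k) →
      DHom k (Deg.circ n d) c → β)
    (G_step : ∀ {T T' n n' : FinBij} {d : T → Deg} {d' : T' → Deg} (σ : T' ≃ T) (l : Lab n n' k)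
      (f : ∀ t, DHom k (d (σ t)) (d' t)) (o : O.S.el ⟨T.sum Q, n⟩ k) (a : ∀ t, A.A.el (d t) k)
      (ψ : DHom k (Deg.circ n' d') c), G (O.S.act (c := ⟨T.sum Q, n⟩) (d := ⟨T'.sum Q, n'⟩)
        ⟨Equiv.sumCongr σ (Equiv.refl Q), l⟩ o) (fun t => A.A.act (f t) (a (σ t))) ψ =
        G o a ((DHom.circ σ l f).comp ψ))
    (G_eval : ∀ {T n : FinBij} {s : T → CircSh} (o : O.S.el ⟨T.sum Q, n⟩ k)
      (os : ∀ t, O.S.el ⟨(s t).T, (s t).n⟩ k) (as : ∀ t p, A.A.el ((s t).d p) k)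
      (ψ : DHom k (Deg.circ n fun t => (s t).deg) c),
      G (T := (CircSh.assoc n s).T) (n := (CircSh.assoc n s).n) (d := (CircSh.assoc n s).d)
        (O.plug (d := fun t => ⟨(s t).T, (s t).n⟩) o os) (fun x => as x.1 x.2)
        ((DHom.assoc n s).comp ψ) = G o (fun t => O.eval (os t) (as t)) ψ)
    (G_pt_left : ∀ {T n : FinBij} {d : T → Deg} (a : ∀ t, A.A.el (d t) k)
      (ψ : DHom k (Deg.circ n d) c), G (O.S.pt : O.S.el ⟨T.sum Q, n⟩ k) a ψ = β₀)
    (G_pt : ∀ {T n : FinBij} {d : T → Deg} (o : O.S.el ⟨T.sum Q, n⟩ k) (a : ∀ t, A.A.el (d t) k)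
      (ψ : DHom k (Deg.circ n d) c) (t : T), a t = A.A.pt → G o a ψ = β₀)
    (G_null : ∀ {T n : FinBij} {d : T → Deg} (o : O.S.el ⟨T.sum Q, n⟩ k) (a : ∀ t, A.A.el (d t) k)
      (ψ : DHom k (Deg.circ n d) c), ψ.Null → G o a ψ = β₀) :
    ∃ φ : ((O.env A).obj (op Q)).el c k → β, (∀ {T n : FinBij} {d : T → Deg}
      (o : O.S.el ⟨T.sum Q, n⟩ k) (a : ∀ t, A.A.el (d t) k) (ψ : DHom k (Deg.circ n d) c),
      φ (SymSeq.act _ ψ (env.mk O A o a)) = G o a ψ) ∧ φ (SymSeq.pt _) = β₀ := by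
  -- First `G` descends to the composition product of which $\mathcal O_A[Q]$ is a quotient.
  let H : (circ (shift Q O.S) A.A).el c k → β := Quot.lift (fun g => g.elim β₀ fun g =>
    G (T := g.s.T) (n := g.s.n) (d := g.s.d) g.v.1 g.v.2 g.ψ) (by
      rintro _ _ (⟨s, s', h, v, ⟨v₁, v₂⟩, ψ, σ, l, f, rfl, h₁, h₂⟩ | ⟨g, hg | ⟨t, hg⟩⟩ | ⟨g, hg⟩)
      · obtain rfl : v₂ = _ := funext h₂
        obtain rfl : v₁ = _ := h₁
        exact (G_step σ l f v.1 v.2 ψ).symm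
      · simp only [Option.elim]
        rw [hg]
        exact G_pt_left _ _
      · exact G_pt _ _ _ t hg
      · exact G_null _ _ _ hg)
  have hH {T n : FinBij} {d : T → Deg} (o : O.S.el ⟨T.sum Q, n⟩ k) (a : ∀ t, A.A.el (d t) k)
      (ψ : DHom k (Deg.circ n d) c) :
      H (SymSeq.act _ ψ (circ.mk (B := shift Q O.S) T n d o a)) = G o a ψ :=
    congrArg H (circ.act_mk _ _ _ _ _ _)
  -- Invariance under the two maps of the coequalizer. An entry of the inner composition product is
  -- a generator with an index map; these index maps are pulled out of the family, so that `G_eval`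
  -- applies to the bare generators.
  have key : ∀ x, H (SymSeq.ap (O.envL A Q) x) = H (SymSeq.ap (O.envR A Q) x) := by
    refine Pres.ind (P := circPres (shift Q O.S) (circ O.S A.A)) ?_ ?_
    · exact (congrArg H (SymSeq.ap_pt (O.envL A Q))).trans
        (congrArg H (SymSeq.ap_pt (O.envR A Q)).symm)
    · rintro ⟨T, n, d⟩ ⟨o, z⟩ ψ
      change (∀ t, (circ O.S A.A).el (d t) k) at z
      rw [← circ.act_mk (B := shift Q O.S), SymSeq.ap_act, SymSeq.ap_act]
      rcases Pres.exists_gens (P := circPres O.S A.A) z with ⟨t, h⟩ | ⟨g, rfl⟩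
      · rw [circ.mk_pt (B := shift Q O.S) (Y := circ O.S A.A) o z t h, SymSeq.ap_pt, SymSeq.ap_pt]
      · have h₁ := circ.mk_act_right (B := shift Q O.S) (Y := circ O.S A.A) (fun t => (g t).ψ) o
          fun t => circ.mk (g t).s.T (g t).s.n (g t).s.d (g t).v.1 (g t).v.2
        rw [show (fun t => (circ O.S A.A).act (g t).ψ (circ.mk (g t).s.T (g t).s.n (g t).s.d
          (g t).v.1 (g t).v.2)) = fun t => Pres.gen (P := circPres O.S A.A) (g t).s (g t).v (g t).ψ
          from funext fun t => circ.act_mk _ _ _ _ _ _] at h₁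
        rw [h₁, SymSeq.ap_act, SymSeq.ap_act, SymSeq.act_act, SymSeq.act_act]
        have hL : SymSeq.ap (O.envL A Q) (circ.mk (B := shift Q O.S) T n (fun t => (g t).s.deg) o
            fun t => circ.mk (g t).s.T (g t).s.n (g t).s.d (g t).v.1 (g t).v.2) =
            SymSeq.act _ (DHom.assoc n fun t => (g t).s) (circ.mk (B := shift Q O.S)
              (CircSh.assoc n fun t => (g t).s).T (CircSh.assoc n fun t => (g t).s).n
              (CircSh.assoc n fun t => (g t).s).d (O.plug (d := fun t => ⟨(g t).s.T, (g t).s.n⟩) o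
                fun t => (g t).v.1) fun x => (g x.1).v.2 x.2) := by
          unfold envL
          rw [SymSeq.ap_comp]
          refine (congrArg _ (ap_circAssoc (B := shift Q O.S) (s := fun t => (g t).s) o
            (fun t => (g t).v.1) fun t => (g t).v.2)).trans ?_
          rw [SymSeq.ap_act, ap_circMap]
          refine congrArg (SymSeq.act _ _) (congrArg (fun o => circ.mk (B := shift Q O.S)
            (CircSh.assoc n fun t => (g t).s).T (CircSh.assoc n fun t => (g t).s).n
            (CircSh.assoc n fun t => (g t).s).d o fun x => (g x.1).v.2 x.2) ?_)
          exact circ.ap_lift _ _ _ _ _ _ _ _ _ _ _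
        have hR : SymSeq.ap (O.envR A Q) (circ.mk (B := shift Q O.S) T n (fun t => (g t).s.deg) o
            fun t => circ.mk (g t).s.T (g t).s.n (g t).s.d (g t).v.1 (g t).v.2) =
            circ.mk (B := shift Q O.S) T n (fun t => (g t).s.deg) o
              fun t => O.eval (A := A) (g t).v.1 (g t).v.2 := ap_circMap _ _ _ _ _ _ _
        refine (congrArg (fun x => H (SymSeq.act _ _ x)) hL).trans
          (Eq.trans ?_ (congrArg (fun x => H (SymSeq.act _ _ x)) hR).symm)
        rw [SymSeq.act_act]
        exact (hH _ _ _).trans ((G_eval (s := fun t => (g t).s) o (fun t => (g t).v.1)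
          (fun t => (g t).v.2) _).trans (hH _ _ _).symm)
  have key' {x y : (circ (shift Q O.S) A.A).el c k}
      (h : SymSeq.ap (env.π A Q) x = SymSeq.ap (env.π A Q) y) : H x = H y :=
    eq_of_cofork_π_eq (coequalizerIsCoequalizer (O.envL A Q) (O.envR A Q)) H key h
  -- The function on the quotient is evaluated on arbitrary representatives; by `key'` the choice
  -- does not matter.
  choose r hr using fun x : ((O.env A).obj (op Q)).el c k => el_surjective_of_isColimit_cofork
    (coequalizerIsCoequalizer (O.envL A Q) (O.envR A Q)) x
  refine ⟨fun x => H (r x), fun {T n d} o a ψ => ?_, ?_⟩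
  · exact (key' (y := SymSeq.act _ ψ (circ.mk (B := shift Q O.S) T n d o a))
      ((hr _).trans (SymSeq.ap_act (env.π A Q) _ _).symm)).trans (hH o a ψ)
  · exact (key' ((hr _).trans (SymSeq.ap_pt (env.π A Q)).symm) : _ = H (SymSeq.pt _))

theorem env.hom_ext {Z : SymSeq.{u}} {f g : (O.env A).obj (op Q) ⟶ Z}
    (h : ∀ k (T n : FinBij) (d : T → Deg) (o : O.S.el ⟨T.sum Q, n⟩ k) (a : ∀ t, A.A.el (d t) k),
      SymSeq.ap f (env.mk O A o a) = SymSeq.ap g (env.mk O A o a)) : f = g :=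
  coequalizer.hom_ext (circ.hom_ext h)

/-- `O_A[Q]` is functorial in `A`. -/
noncomputable def envMapApp (α : A ⟶ A') (Q : FinBij) :
    (O.env A).obj (op Q) ⟶ (O.env A').obj (op Q) :=
  coequalizer.desc (circMap (𝟙 _) α.f ≫ env.π A' Q) (by
    have h₁ : O.envL A Q ≫ circMap (𝟙 _) α.f =
        circMap (𝟙 _) (circMap (𝟙 _) α.f) ≫ O.envL A' Q := by
      have h := circAssoc_naturality (𝟙 (shift Q O.S)) (𝟙 O.S) α.f
      rw [envL, envL, ← Category.assoc, h, Category.assoc, Category.assoc, circMap_comp,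
        circMap_comp, circMap_id]
      simp
    have h₂ : O.envR A Q ≫ circMap (𝟙 _) α.f =
        circMap (𝟙 _) (circMap (𝟙 _) α.f) ≫ O.envR A' Q := by
      rw [envR, envR, circMap_comp, circMap_comp]
      exact congrArg (circMap _) α.h.symm
    have h₃ : O.envL A' Q ≫ env.π A' Q = O.envR A' Q ≫ env.π A' Q :=
      coequalizer.condition _ _
    exact (Category.assoc _ _ _).symm.trans ((congrArg (fun f => f ≫ env.π A' Q) h₁).trans
      ((Category.assoc _ _ _).trans ((congrArg _ h₃).trans ((Category.assoc _ _ _).symm.trans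
        ((congrArg (fun f => f ≫ env.π A' Q) h₂.symm).trans (Category.assoc _ _ _)))))))

theorem envMapApp_mk (α : A ⟶ A') (o : O.S.el ⟨T.sum Q, n⟩ k) (a : ∀ t, A.A.el (d t) k) :
    SymSeq.ap (envMapApp α Q) (env.mk O A o a) = env.mk O A' o fun t => SymSeq.ap α.f (a t) :=
  (congrArg (fun f => SymSeq.ap f (circ.mk (B := shift Q O.S) T n d o a)) (coequalizer.π_desc
    (circMap (𝟙 _) α.f ≫ env.π A' Q) _)).trans
    (congrArg (SymSeq.ap (env.π A' Q)) (ap_circMap _ _ _ _ _ _ _))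

/-- Functoriality of `O_A` in `A`. -/
noncomputable def envMap (α : A ⟶ A') : O.env A ⟶ O.env A' where
  app Q := envMapApp α Q.unop
  naturality Q Q' e := env.hom_ext fun k T n d o a => by
    rw [SymSeq.ap_comp, SymSeq.ap_comp]
    exact (congrArg _ (env.map_mk e.unop o a)).trans ((envMapApp_mk α _ _).trans
      ((congrArg _ (envMapApp_mk α o a)).trans (env.map_mk e.unop o _)).symm)

theorem envMap_mk (α : A ⟶ A') (o : O.S.el ⟨T.sum Q, n⟩ k) (a : ∀ t, A.A.el (d t) k) :
    SymSeq.ap ((envMap α).app (op Q)) (env.mk O A o a) =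
      env.mk O A' o fun t => SymSeq.ap α.f (a t) := envMapApp_mk α o a

end Env

end Operad
end SymSpectra

/-! ### Plugging elements of $A$ into inputs: existence -/

namespace SymSpectra

namespace Operad
variable {O : Operad.{u}} {A A' : O.Lt} {k : Dop}

section Plug

/-- The two blocks of entries can be moved independently before the index is split. This is the form
of naturality in which plugged families occur. -/
theorem split_env_mk {T T' n n' Q Q' S : FinBij} {d : T → Deg} {d' : T' → Deg} {e : Q → Deg}
    {e' : Q' → Deg} (σ : T' ≃ T) (τ : Q' ≃ Q) (l : Lab n n' k)
    (f : ∀ t, DHom k (d (σ t)) (d' t)) (g : ∀ q, DHom k (e (τ q)) (e' q))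
    (o : O.S.el ⟨(T.sum Q).sum S, n⟩ k) (a : ∀ t, A.A.el (d t) k) (b : ∀ q, A.A.el (e q) k) :
    SymSeq.act _ (DHom.split n' d' e') (env.mk O A (Q := S) (T := T'.sum Q')
      (O.S.act (c := ⟨(T.sum Q).sum S, n⟩) (d := ⟨(T'.sum Q').sum S, n'⟩)
        ⟨Equiv.sumCongr (Equiv.sumCongr σ τ) (Equiv.refl S), l⟩ o)
      (famSum (fun t => A.A.act (f t) (a (σ t))) fun q => A.A.act (g q) (b (τ q)))) =
    SymSeq.act _ ((DHom.circ σ l f).sum (DHom.sigma τ g))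
      (SymSeq.act _ (DHom.split n d e) (env.mk O A (T := T.sum Q) o (famSum a b))) := by
  have h := env.mk_act (A := A) (Q := S) (T := T.sum Q) (T' := T'.sum Q') (d := Sum.elim d e)
    (d' := Sum.elim d' e') (Equiv.sumCongr σ τ) l (DHom.sumFam f g) o (famSum a b)
  rw [SymSeq.act_act, ← DHom.split_nat, ← SymSeq.act_act]
  refine congrArg _ (Eq.trans (congrArg _ (funext ?_)) h)
  rintro (t | q) <;> rfl

theorem split_env_mk_left {T T' n n' Q S : FinBij} {d : T → Deg} {d' : T' → Deg} {e : Q → Deg}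
    (σ : T' ≃ T) (l : Lab n n' k) (f : ∀ t, DHom k (d (σ t)) (d' t))
    (o : O.S.el ⟨(T.sum Q).sum S, n⟩ k) (a : ∀ t, A.A.el (d t) k) (b : ∀ q, A.A.el (e q) k) :
    SymSeq.act _ (DHom.split n' d' e) (env.mk O A (Q := S) (T := T'.sum Q)
      (O.S.act (c := ⟨(T.sum Q).sum S, n⟩) (d := ⟨(T'.sum Q).sum S, n'⟩)
        ⟨Equiv.sumCongr (Equiv.sumCongr σ (Equiv.refl Q)) (Equiv.refl S), l⟩ o)
      (famSum (fun t => A.A.act (f t) (a (σ t))) b)) =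
    SymSeq.act _ ((DHom.circ σ l f).sum DHom.id)
      (SymSeq.act _ (DHom.split n d e) (env.mk O A (T := T.sum Q) o (famSum a b))) :=
  (congrArg (fun b => SymSeq.act _ (DHom.split n' d' e) (env.mk O A (Q := S) (T := T'.sum Q)
      (O.S.act (c := ⟨(T.sum Q).sum S, n⟩) (d := ⟨(T'.sum Q).sum S, n'⟩)
        ⟨Equiv.sumCongr (Equiv.sumCongr σ (Equiv.refl Q)) (Equiv.refl S), l⟩ o)
      (famSum (fun t => A.A.act (f t) (a (σ t))) b)))
    (funext fun r => (SymSeq.act_id (b r)).symm)).trans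
    (split_env_mk σ (Equiv.refl Q) l f (fun _ => DHom.id) o a b)

section
variable {T N : FinBij} (s : T → CircSh) (d : N → Deg)

/-- Inserting identity operations. -/
abbrev withUnits : T.sum N → CircSh :=
  Sum.elim s fun r => ⟨FinBij.one, FinBij.zero, fun _ => d r⟩

/-- The inputs of $o(o_t,1,\dots,1)$ are the inputs of the $o_t$ together with `N`, since a unit
operation has one input. -/
def withUnitsT : (Σ x, (withUnits s d x).T) ≃ (Σ t, (s t).T) ⊕ N where
  toFun
    | ⟨.inl t, p⟩ => .inl ⟨t, p⟩
    | ⟨.inr r, _⟩ => .inr r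
  invFun
    | .inl x => ⟨.inl x.1, x.2⟩
    | .inr r => ⟨.inr r, ()⟩
  left_inv := by rintro ⟨t | r, p⟩ <;> rfl
  right_inv := by rintro (x | r) <;> rfl

/-- Unit operations have no suspension coordinates, so the second summand contributes nothing. -/
def withUnitsN (n : FinBij) :
    (n ⊕ Σ x, (withUnits s d x).n) ≃ n ⊕ Σ t, (s t).n where
  toFun
    | .inl x => .inl x
    | .inr ⟨.inl t, p⟩ => .inr ⟨t, p⟩
    | .inr ⟨.inr _, p⟩ => p.elim
  invFun
    | .inl x => .inl x
    | .inr x => .inr ⟨.inl x.1, x.2⟩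
  left_inv := by
    rintro (x | ⟨t | r, p⟩)
    exacts [rfl, rfl, p.elim]
  right_inv := by rintro (x | r) <;> rfl

def withUnitsO (os : ∀ t, O.S.el ⟨(s t).T, (s t).n⟩ k) :
    ∀ x, O.S.el ⟨(withUnits s d x).T, (withUnits s d x).n⟩ k
  | .inl t => os t
  | .inr _ => O.one k

def withUnitsA {s : T → CircSh} {d : N → Deg} {B : SymSeq.{u}} (as : ∀ t p, B.el ((s t).d p) k)
    (b : ∀ r, B.el (d r) k) :
    ∀ x p, B.el ((withUnits s d x).d p) k
  | .inl t, p => as t p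
  | .inr r, _ => b r

/-- An identity in every entry. It is given by cases because the two families of indices agree
definitionally only on each constructor; `withUnitsId'` and `withUnitsId''` follow the same pattern,
the latter with a unit bijection at each entry of `N`. -/
def withUnitsId : ∀ x : (Σ x, (withUnits s d x).T),
    DHom k (Sum.elim (fun x : (Σ t, (s t).T) => (s x.1).d x.2) d (withUnitsT s d x))
      ((withUnits s d x.1).d x.2)
  | ⟨.inl _, _⟩ => DHom.id
  | ⟨.inr _, _⟩ => DHom.id

def withUnitsId' {Q : FinBij} : ∀ x : (T.sum N).sum Q,
    DHom k (Sum.elim (fun t => ⟨(s t).T, (s t).n⟩) (fun _ : N.sum Q => Deg.unit)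
      (Equiv.sumAssoc T N Q x)) (Sum.elim (fun x => ⟨(withUnits s d x).T, (withUnits s d x).n⟩)
        (fun _ => Deg.unit) x)
  | .inl (.inl _) => DHom.id
  | .inl (.inr _) => DHom.id
  | .inr _ => DHom.id

def withUnitsId'' : ∀ x : T.sum N,
    DHom k (withUnits s d x).deg (Sum.elim (fun t => (s t).deg) d x)
  | .inl _ => DHom.id
  | .inr r => DHom.unitL (d r)

/-- On both sides `o` is composed with the `os` and with units at `N` and `Q`. On the left the units
at `N` belong to the explicit family, on the right they are supplied by `plug`. The two
multiplications agree after reassociating the inputs. -/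
theorem plug_withUnits {n Q : FinBij} (o : O.S.el ⟨T.sum (N.sum Q), n⟩ k)
    (os : ∀ t, O.S.el ⟨(s t).T, (s t).n⟩ k) :
    O.plug (T := T.sum N) (Q := Q) (d := fun x => ⟨(withUnits s d x).T, (withUnits s d x).n⟩)
      (O.S.act (c := ⟨T.sum (N.sum Q), n⟩) (d := ⟨(T.sum N).sum Q, n⟩)
        ⟨Equiv.sumAssoc T N Q, Lab.id⟩ o) (withUnitsO s d os) =
    O.S.act (c := ⟨(FinBij.sigma fun t => (s t).T).sum (N.sum Q), n.sum (FinBij.sigma fun t => (s t).n)⟩)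
      (d := ⟨(FinBij.sigma fun x => (withUnits s d x).T).sum Q,
        n.sum (FinBij.sigma fun x => (withUnits s d x).n)⟩)
      ⟨(Equiv.sumCongr (withUnitsT s d) (Equiv.refl Q)).trans (Equiv.sumAssoc _ _ _),
        Lab.ofEquiv (withUnitsN s d n)⟩
      (O.plug (Q := N.sum Q) (d := fun t => ⟨(s t).T, (s t).n⟩) o os) := by
  have h := circ.mk_act (B := O.S) (Y := O.S) (T := T.sum (N.sum Q)) (T' := (T.sum N).sum Q)
    (n := n) (n' := n) (Equiv.sumAssoc T N Q) Lab.id (withUnitsId' (k := k) s d) o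
    (famSum os fun _ : N.sum Q => O.one k)
  unfold plug
  rw [SymSeq.act_act]
  refine Eq.trans (congrArg (fun z => O.S.act _ (SymSeq.ap O.μ z)) (Eq.trans ?_ h)) ?_
  · refine congrArg _ (funext ?_)
    rintro ((t | r) | q)
    exacts [(SymSeq.act_id (X := O.S) (d := ⟨(s t).T, (s t).n⟩) (os t)).symm,
      (SymSeq.act_id (O.one k)).symm, (SymSeq.act_id (O.one k)).symm]
  · rw [SymSeq.ap_act, SymSeq.act_act]
    refine congrArg (fun h => SymSeq.act _ h _) ?_
    ext1
    · refine Equiv.ext ?_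
      rintro (⟨t | r, x⟩ | q) <;> rfl
    · refine Lab.ext (funext ?_)
      rintro (x | ⟨t | r, x⟩)
      · rfl
      · rfl
      · exact x.elim

end

variable {T n Q Q' N N' S S' : FinBij} {c c' : Deg}

/-- Inserting a fixed family `b` into the inputs `N`, so $[o;a]\mapsto[o;a,b]$, respects the
relations of $\mathcal O_A[N\sqcup S]$. The essential case is the coequalizer relation, which only
allows operations at the inputs `T`, while in the target the inputs are `T ⊔ N`. -/
theorem exists_plug {d : N → Deg} (b : ∀ r, A.A.el (d r) k) :
    ∃ φ : ((O.env A).obj (op (N.sum S))).el c k →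
        ((O.env A).obj (op S)).el (c.sum (Deg.sigma d)) k,
      (∀ {T n : FinBij} {d' : T → Deg} (o : O.S.el ⟨T.sum (N.sum S), n⟩ k)
        (a : ∀ t, A.A.el (d' t) k) (ψ : DHom k (Deg.circ n d') c),
        φ (SymSeq.act _ ψ (env.mk O A o a)) = SymSeq.act _ (ψ.sum DHom.id)
          (SymSeq.act _ (DHom.split n d' d) (env.mk O A (T := T.sum N)
            (O.S.act (c := ⟨T.sum (N.sum S), n⟩) (d := ⟨(T.sum N).sum S, n⟩)
              ⟨Equiv.sumAssoc T N S, Lab.id⟩ o) (famSum a b)))) ∧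
      φ (SymSeq.pt _) = SymSeq.pt _ := by
  refine env.exists_desc (SymSeq.pt _) (fun {T n d'} o a ψ => SymSeq.act _ (ψ.sum DHom.id)
          (SymSeq.act _ (DHom.split n d' d) (env.mk O A (T := T.sum N)
            (O.S.act (c := ⟨T.sum (N.sum S), n⟩) (d := ⟨(T.sum N).sum S, n⟩)
              ⟨Equiv.sumAssoc T N S, Lab.id⟩ o) (famSum a b)))) ?_ ?_ ?_ ?_ ?_
  -- Naturality in the entries from $A$: the family `b` is left fixed.
  · intro T T' n n' d₁ d₁' σ l f o a ψ
    have h := split_env_mk_left (A := A) (S := S) (e := d) σ l f (O.S.act (c := ⟨T.sum (N.sum S), n⟩) (d := ⟨(T.sum N).sum S, n⟩)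
        ⟨Equiv.sumAssoc T N S, Lab.id⟩ o) a b
    rw [SymSeq.act_act (X := O.S) (c := ⟨T.sum (N.sum S), n⟩) (d := ⟨(T.sum N).sum S, n⟩)
      (e := ⟨(T'.sum N).sum S, n'⟩)] at h
    rw [SymSeq.act_act (X := O.S) (c := ⟨T.sum (N.sum S), n⟩) (d := ⟨T'.sum (N.sum S), n'⟩)
      (e := ⟨(T'.sum N).sum S, n'⟩)]
    have h₁ : DHom.comp (k := k) (c := ⟨T.sum (N.sum S), n⟩) (d := ⟨T'.sum (N.sum S), n'⟩)
        (e := ⟨(T'.sum N).sum S, n'⟩) ⟨Equiv.sumCongr σ (Equiv.refl _), l⟩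
        ⟨Equiv.sumAssoc T' N S, Lab.id⟩ = DHom.comp (c := ⟨T.sum (N.sum S), n⟩)
          (d := ⟨(T.sum N).sum S, n⟩) (e := ⟨(T'.sum N).sum S, n'⟩)
          ⟨Equiv.sumAssoc T N S, Lab.id⟩
          ⟨Equiv.sumCongr (Equiv.sumCongr σ (Equiv.refl _)) (Equiv.refl _), l⟩ := by
      ext1
      · exact Equiv.ext (by rintro ((t | r) | q) <;> rfl)
      · exact (Lab.comp_id _).trans (Lab.id_comp _).symm
    rw [h₁]
    refine (congrArg _ h).trans ?_
    rw [SymSeq.act_act]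
    rw [DHom.sum_comp, DHom.comp_id]
  · intro T n s o os as ψ
    -- Each `b r` is written as the unit operation applied to `b r`. All entries are then values of
    -- operations, and `env.mk_eval` applies over `T ⊔ N`.
    have h₁ : famSum (fun t => O.eval (os t) (as t)) b = fun x => A.A.act
        (withUnitsId'' (k := k) s d x) (O.eval (A := A) (withUnitsO s d os x)
          (withUnitsA as b x)) := by
      refine funext ?_
      rintro (t | r)
      exacts [(SymSeq.act_id _).symm, (eval_one _).symm]
    rw [h₁, env.mk_act_right]
    refine Eq.symm ((congrArg (fun x => SymSeq.act _ _ (SymSeq.act _ _ (SymSeq.act _ _ x)))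
      (env.mk_eval (A := A) (T := T.sum N) (Q := S) (s := withUnits s d) _ (withUnitsO s d os)
        (withUnitsA as b))).trans ?_)
    rw [plug_withUnits]
    have h₂ := env.mk_act (A := A) (Q := S) (T := (CircSh.assoc n s).T.sum N)
      (d := Sum.elim (fun x : (Σ t, (s t).T) => (s x.1).d x.2) d)
      (T' := (CircSh.assoc n (withUnits s d)).T) (d' := (CircSh.assoc n (withUnits s d)).d)
      (n := (CircSh.assoc n s).n) (n' := (CircSh.assoc n (withUnits s d)).n)
      (withUnitsT s d) (Lab.ofEquiv (withUnitsN s d n)) (withUnitsId (k := k) s d)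
      (O.S.act (c := ⟨(FinBij.sigma fun t => (s t).T).sum (N.sum S),
          n.sum (FinBij.sigma fun t => (s t).n)⟩)
        (d := ⟨((FinBij.sigma fun t => (s t).T).sum N).sum S,
          n.sum (FinBij.sigma fun t => (s t).n)⟩) ⟨Equiv.sumAssoc _ N S, Lab.id⟩
        (O.plug (Q := N.sum S) (d := fun t => ⟨(s t).T, (s t).n⟩) o os))
      (famSum (fun x : (Σ t, (s t).T) => as x.1 x.2) b)
    rw [SymSeq.act_act (X := O.S)] at h₂
    have h₃ : (fun x => A.A.act (withUnitsId (k := k) s d x)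
        (famSum (fun x : (Σ t, (s t).T) => as x.1 x.2) b (withUnitsT s d x))) =
        fun x : (Σ x, (withUnits s d x).T) => withUnitsA as b x.1 x.2 := by
      refine funext ?_
      rintro ⟨t | r, p⟩
      exacts [SymSeq.act_id (as t p), SymSeq.act_id (b r)]
    rw [h₃] at h₂
    refine (congrArg (fun x => SymSeq.act _ _ (SymSeq.act _ _ (SymSeq.act _ _ (SymSeq.act _ _ x))))
      (Eq.trans ?_ h₂)).trans ?_
    · refine congrArg (fun o => env.mk O A (Q := S) (T := (CircSh.assoc n (withUnits s d)).T)
        (n := (CircSh.assoc n (withUnits s d)).n) (d := (CircSh.assoc n (withUnits s d)).d) o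
        fun x : (Σ x, (withUnits s d x).T) => withUnitsA as b x.1 x.2) (congrArg (fun h => SymSeq.act _ h _) ?_)
      ext1
      · exact Equiv.ext fun x => rfl
      · exact (Lab.id_comp _).symm
    · simp only [SymSeq.act_act]
      congr 1
      -- Once the elements agree, only an identity between bijections of the indices is left.
      have h₄ : (DHom.circ (T := (CircSh.assoc n s).T.sum N)
          (T' := (CircSh.assoc n (withUnits s d)).T) (n := (CircSh.assoc n s).n)
          (n' := (CircSh.assoc n (withUnits s d)).n)
          (c := Sum.elim (fun x : (Σ t, (s t).T) => (s x.1).d x.2) d)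
          (d := (CircSh.assoc n (withUnits s d)).d)
          (withUnitsT s d) (Lab.ofEquiv (withUnitsN s d n)) (withUnitsId (k := k) s d)).comp
          ((DHom.assoc n (withUnits s d)).comp ((DHom.circFam n (withUnitsId'' s d)).comp
            (DHom.split n (fun t => (s t).deg) d))) =
          (DHom.split (CircSh.assoc n s).n (CircSh.assoc n s).d d).comp
            ((DHom.assoc n s).sum DHom.id) := by
        ext1
        · exact Equiv.ext (by rintro (⟨t, p, x⟩ | ⟨r, x⟩) <;> rfl)
        · refine Lab.ext (funext ?_)
          rintro ((x | ⟨t, x | ⟨p, x⟩⟩) | ⟨r, x⟩) <;> rfl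
      refine Eq.trans (b := DHom.comp (DHom.comp (DHom.circ (T := (CircSh.assoc n s).T.sum N)
          (T' := (CircSh.assoc n (withUnits s d)).T) (n := (CircSh.assoc n s).n)
          (n' := (CircSh.assoc n (withUnits s d)).n)
          (c := Sum.elim (fun x : (Σ t, (s t).T) => (s x.1).d x.2) d)
          (d := (CircSh.assoc n (withUnits s d)).d)
          (withUnitsT s d) (Lab.ofEquiv (withUnitsN s d n)) (withUnitsId (k := k) s d))
          ((DHom.assoc n (withUnits s d)).comp ((DHom.circFam n (withUnitsId'' s d)).comp
            (DHom.split n (fun t => (s t).deg) d)))) (ψ.sum DHom.id)) ?_ ?_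
      · simp only [DHom.comp_assoc]
      · rw [h₄, DHom.comp_assoc, DHom.sum_comp, DHom.id_comp]
  · intro T n d' a ψ
    rw [SymSeq.act_pt (X := O.S), env.mk_pt_left, SymSeq.act_pt, SymSeq.act_pt]
  · intro T n d' o a ψ t h
    rw [env.mk_pt (T := T.sum N) _ _ (Sum.inl t) h, SymSeq.act_pt, SymSeq.act_pt]
  · intro T n d' o a ψ h
    exact SymSeq.act_null _ _ (h.sum_left _)

end Plug

end Operad
end SymSpectra

/-! ### Plugging: naturality and composition -/

namespace SymSpectra

namespace DHom
variable {k : Dop}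

/-- Grouping a disjoint union over `N ∐ Q` into one over `N` and one over `Q`. -/
def assocSum (c : Deg) {N Q : FinBij} (d : N → Deg) (e : Q → Deg) :
    DHom k (c.sum (Deg.sigma (T := N.sum Q) (Sum.elim d e))) ((c.sum (Deg.sigma d)).sum (Deg.sigma e)) :=
  ofEquiv (c := c.sum (Deg.sigma (T := N.sum Q) (Sum.elim d e)))
    (d := (c.sum (Deg.sigma d)).sum (Deg.sigma e))
    ((Equiv.sumAssoc _ _ _).trans (Equiv.sumCongr (Equiv.refl _) (fibSum (fun c => c.R) d e)))
    ((Equiv.sumAssoc _ _ _).trans (Equiv.sumCongr (Equiv.refl _) (fibSum (fun c => c.N) d e)))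

end DHom

namespace Operad
variable {O : Operad.{u}} {A A' : O.Lt} {k : Dop}
variable {T n Q Q' N N' S S' : FinBij} {c c' : Deg}

/-- Plugging elements of `A` into the inputs `N` of an element of `O_A[Q]`, where `Q ≅ N ∐ S`. -/
noncomputable def env.plug (w : N ⊕ S ≃ Q) {d : N → Deg} (x : ((O.env A).obj (op Q)).el c k)
    (b : ∀ r, A.A.el (d r) k) : ((O.env A).obj (op S)).el (c.sum (Deg.sigma d)) k :=
  (exists_plug (S := S) b).choose
    (SymSeq.ap ((O.env A).map (Quiver.Hom.op (X := N.sum S) (Y := Q) w)) x)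

namespace env

/-- The function `plug` is obtained from an existence statement, so this formula is all that is
known about it away from the basepoint. The laws for variable `x` and `b` follow from it by
`env.cases`. -/
theorem plug_act_mk (w : N ⊕ S ≃ Q) {d : N → Deg} {d' : T → Deg} (o : O.S.el ⟨T.sum Q, n⟩ k)
    (a : ∀ t, A.A.el (d' t) k) (ψ : DHom k (Deg.circ n d') c) (b : ∀ r, A.A.el (d r) k) :
    plug (S := S) w (SymSeq.act _ ψ (env.mk O A o a)) b = SymSeq.act _ (ψ.sum DHom.id)
      (SymSeq.act _ (DHom.split n d' d) (env.mk O A (Q := S) (T := T.sum N)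
        (O.S.act (DHom.moveInputs (S := S) T n w) o) (famSum a b))) := by
  unfold plug
  rw [SymSeq.ap_act, env.map_mk]
  refine ((exists_plug (A := A) (S := S) b).choose_spec.1 _ a ψ).trans ?_
  rw [SymSeq.act_act (X := O.S)]
  rfl

theorem plug_mk (w : N ⊕ S ≃ Q) {d : N → Deg} {d' : T → Deg} (o : O.S.el ⟨T.sum Q, n⟩ k)
    (a : ∀ t, A.A.el (d' t) k) (b : ∀ r, A.A.el (d r) k) :
    plug (S := S) w (env.mk O A o a) b =
      SymSeq.act _ (DHom.split n d' d) (env.mk O A (Q := S) (T := T.sum N)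
        (O.S.act (DHom.moveInputs (S := S) T n w) o) (famSum a b)) := by
  have h := plug_act_mk (S := S) w o a DHom.id b
  rwa [SymSeq.act_id, DHom.id_sum_id, SymSeq.act_id] at h

@[simp] theorem plug_pt (w : N ⊕ S ≃ Q) {d : N → Deg} (b : ∀ r, A.A.el (d r) k) :
    plug w (SymSeq.pt _ : ((O.env A).obj (op Q)).el c k) b = SymSeq.pt _ := by
  unfold plug
  rw [SymSeq.ap_pt]
  exact (exists_plug (A := A) (S := S) b).choose_spec.2

theorem plug_act (w : N ⊕ S ≃ Q) {d : N → Deg} (h : DHom k c c')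
    (x : ((O.env A).obj (op Q)).el c k) (b : ∀ r, A.A.el (d r) k) :
    plug w (SymSeq.act _ h x) b = SymSeq.act _ (h.sum DHom.id) (plug (S := S) w x b) := by
  rcases env.cases x with rfl | ⟨T, n, d', o, a, ψ, rfl⟩
  · rw [SymSeq.act_pt, plug_pt, plug_pt, SymSeq.act_pt]
  · rw [SymSeq.act_act, plug_act_mk, plug_act_mk]
    simp only [SymSeq.act_act, DHom.comp_assoc, DHom.sum_comp, DHom.comp_id]

theorem plug_pt_right (w : N ⊕ S ≃ Q) {d : N → Deg} (x : ((O.env A).obj (op Q)).el c k)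
    (b : ∀ r, A.A.el (d r) k) (r : N) (h : b r = A.A.pt) :
    plug (S := S) w x b = SymSeq.pt _ := by
  rcases env.cases x with rfl | ⟨T, n, d', o, a, ψ, rfl⟩
  · rw [plug_pt]
  · rw [plug_act_mk, env.mk_pt (T := T.sum N) _ _ (Sum.inr r) h, SymSeq.act_pt, SymSeq.act_pt]

theorem sm_plug {l : Dop} (α : k ⟶ l) (w : N ⊕ S ≃ Q) {d : N → Deg}
    (x : ((O.env A).obj (op Q)).el c k) (b : ∀ r, A.A.el (d r) k) :
    SymSeq.sm _ α (plug (S := S) w x b) =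
      plug w (SymSeq.sm _ α x) fun r => A.A.sm α (b r) := by
  rcases env.cases x with rfl | ⟨T, n, d', o, a, ψ, rfl⟩
  · rw [plug_pt, SymSeq.sm_pt, SymSeq.sm_pt, plug_pt]
  · rw [SymSeq.sm_act, env.sm_mk, plug_act_mk, plug_act_mk, SymSeq.sm_act, SymSeq.sm_act,
      env.sm_mk, SymSeq.sm_act, DHom.push_sum, DHom.push_id]
    refine congrArg (SymSeq.act _ _) (congrArg (SymSeq.act _ _) (congrArg _ (funext ?_)))
    rintro (t | r) <;> rfl

/-- Relabelling the plugged family by `σ` is compensated by changing the identification `w`, so what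
is inserted into each input of `Q` stays the same. -/
theorem plug_act_right (w : N' ⊕ S ≃ Q) (σ : N' ≃ N) {d : N → Deg} {d' : N' → Deg}
    (g : ∀ r, DHom k (d (σ r)) (d' r)) (x : ((O.env A).obj (op Q)).el c k)
    (b : ∀ r, A.A.el (d r) k) : plug w x (fun r => A.A.act (g r) (b (σ r))) =
      SymSeq.act _ ((DHom.id : DHom k c c).sum (DHom.sigma σ g))
        (plug (S := S) ((Equiv.sumCongr σ.symm (Equiv.refl S)).trans w) x b) := by
  rcases env.cases x with rfl | ⟨T, n, d₁, o, a, ψ, rfl⟩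
  · rw [plug_pt, plug_pt, SymSeq.act_pt]
  · rw [plug_act_mk, plug_act_mk]
    have h := split_env_mk (A := A) (S := S) (Equiv.refl T) σ Lab.id (fun t => DHom.id) g
      (O.S.act (DHom.moveInputs (S := S) T n
        ((Equiv.sumCongr σ.symm (Equiv.refl S)).trans w)) o) a b
    have h₁ : famSum (fun t => A.A.act (DHom.id : DHom k (d₁ t) (d₁ t)) (a t))
        (fun r => A.A.act (g r) (b (σ r))) = famSum a fun r => A.A.act (g r) (b (σ r)) :=
      congrArg (fun a => famSum a fun r => A.A.act (g r) (b (σ r)))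
        (funext fun t => SymSeq.act_id (a t))
    have h₂ : O.S.act (c := ⟨(T.sum N).sum S, n⟩) (d := ⟨(T.sum N').sum S, n⟩)
        ⟨Equiv.sumCongr (Equiv.sumCongr (Equiv.refl T) σ) (Equiv.refl S), Lab.id⟩
        (O.S.act (DHom.moveInputs (S := S) T n
        ((Equiv.sumCongr σ.symm (Equiv.refl S)).trans w)) o) =
        O.S.act (DHom.moveInputs (S := S) T n w) o := by
      rw [SymSeq.act_act]
      refine congrArg (fun h => SymSeq.act _ h _) ?_
      ext1
      · refine Equiv.ext ?_
        rintro ((t | r) | s) <;> simp [DHom.comp, DHom.moveInputs, DHom.ofEquiv]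
      · rfl
    have h₃ : SymSeq.act _ (DHom.split n d₁ d') (env.mk O A (Q := S) (T := T.sum N')
        (O.S.act (DHom.moveInputs (S := S) T n w) o)
        (famSum a fun r => A.A.act (g r) (b (σ r)))) =
        SymSeq.act _ ((DHom.id : DHom k (Deg.circ n d₁) (Deg.circ n d₁)).sum (DHom.sigma σ g))
          (SymSeq.act _ (DHom.split n d₁ d) (env.mk O A (Q := S) (T := T.sum N)
            (O.S.act (DHom.moveInputs (S := S) T n
              ((Equiv.sumCongr σ.symm (Equiv.refl S)).trans w)) o) (famSum a b))) :=
      ((congrArg₂ (fun o a => SymSeq.act _ (DHom.split n d₁ d') (env.mk O A (Q := S)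
        (T := T.sum N') o a)) h₂.symm h₁.symm).trans h).trans
        (congrArg (fun h => SymSeq.act _ (DHom.sum h (DHom.sigma σ g)) _) (DHom.circ_id n d₁))
    refine (congrArg _ h₃).trans ?_
    rw [SymSeq.act_act, SymSeq.act_act (DHom.sum ψ _), DHom.sum_comp, DHom.sum_comp, DHom.id_comp,
      DHom.comp_id, DHom.comp_id, DHom.id_comp]

theorem plug_map (w : N ⊕ S ≃ Q') (ρ : Q' ≃ Q) {d : N → Deg} (x : ((O.env A).obj (op Q)).el c k)
    (b : ∀ r, A.A.el (d r) k) :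
    plug (S := S) w (SymSeq.ap ((O.env A).map (Quiver.Hom.op (X := Q') (Y := Q) ρ)) x) b =
      plug (w.trans ρ) x b := by
  unfold plug
  refine congrArg _ ((SymSeq.ap_comp _ _ _).symm.trans (congrArg (fun f => SymSeq.ap f x) ?_))
  exact ((O.env A).map_comp (Quiver.Hom.op (X := Q') (Y := Q) ρ)
    (Quiver.Hom.op (X := N.sum S) (Y := Q') w)).symm

theorem map_plug (w : N ⊕ S ≃ Q) (τ : S' ≃ S) {d : N → Deg} (x : ((O.env A).obj (op Q)).el c k)
    (b : ∀ r, A.A.el (d r) k) :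
    SymSeq.ap ((O.env A).map (Quiver.Hom.op (X := S') (Y := S) τ)) (plug (S := S) w x b) =
      plug ((Equiv.sumCongr (Equiv.refl N) τ).trans w) x b := by
  rcases env.cases x with rfl | ⟨T, n, d₁, o, a, ψ, rfl⟩
  · rw [plug_pt, plug_pt, SymSeq.ap_pt]
  · rw [plug_act_mk, plug_act_mk, SymSeq.ap_act, SymSeq.ap_act, env.map_mk]
    refine congrArg (SymSeq.act _ _) (congrArg (SymSeq.act _ _)
      (congrArg (fun o => env.mk O A (T := T.sum N) o (famSum a b)) ?_))
    rw [SymSeq.act_act]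
    refine congrArg (fun h => SymSeq.act _ h _) ?_
    ext1
    · refine Equiv.ext ?_
      rintro ((t | r) | s) <;> rfl
    · rfl

/-- Both sides insert the same elements into the same inputs, and only the bracketing of inputs and
indices differs. This makes iterated plugging relations consistent, and it also yields
`env.ev_plug`. -/
theorem plug_plug (w : N ⊕ Q' ≃ Q) (w' : N' ⊕ S ≃ Q') {d : N → Deg} {d' : N' → Deg}
    (x : ((O.env A).obj (op Q)).el c k) (b : ∀ r, A.A.el (d r) k) (b' : ∀ r, A.A.el (d' r) k) :
    plug (S := S) w' (plug (S := Q') w x b) b' = SymSeq.act _ (DHom.assocSum c d d')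
      (plug (N := N.sum N') (S := S) ((Equiv.sumAssoc N N' S).trans
        ((Equiv.sumCongr (Equiv.refl N) w').trans w)) x (famSum b b')) := by
  rcases env.cases x with rfl | ⟨T, n, d₁, o, a, ψ, rfl⟩
  · rw [plug_pt, plug_pt, plug_pt, SymSeq.act_pt]
  · rw [plug_act_mk, plug_act_mk, plug_act, plug_act_mk, SymSeq.act_act (X := O.S)]
    -- The bracketings $(T\sqcup N)\sqcup N'$ and $T\sqcup(N\sqcup N')$ give families of indices
    -- that agree only case by case.
    let f : ∀ x : (T.sum N).sum N', DHom k (Sum.elim d₁ (Sum.elim d d') (Equiv.sumAssoc T N N' x))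
      (Sum.elim (Sum.elim d₁ d) d' x) := fun
      | .inl (.inl _) => DHom.id
      | .inl (.inr _) => DHom.id
      | .inr _ => DHom.id
    have h := env.mk_act (A := A) (Q := S) (T := T.sum (N.sum N')) (T' := (T.sum N).sum N')
      (d := Sum.elim d₁ (Sum.elim d d')) (d' := Sum.elim (Sum.elim d₁ d) d')
      (Equiv.sumAssoc T N N') Lab.id f (O.S.act (DHom.moveInputs (S := S) T n
        ((Equiv.sumAssoc N N' S).trans ((Equiv.sumCongr (Equiv.refl N) w').trans w))) o)
      (famSum (X := A.A) a (famSum b b'))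
    rw [SymSeq.act_act (X := O.S)] at h
    have h₁ : famSum (famSum a b) b' = fun x => A.A.act (f x)
        (famSum (X := A.A) a (famSum b b') (Equiv.sumAssoc T N N' x)) := by
      refine funext ?_
      rintro ((t | r) | r)
      exacts [(SymSeq.act_id _).symm, (SymSeq.act_id _).symm, (SymSeq.act_id _).symm]
    rw [h₁]
    refine (congrArg (fun x => SymSeq.act _ _ (SymSeq.act _ _ (SymSeq.act _ _ x)))
      (Eq.trans ?_ h)).trans ?_
    · refine congrArg (fun o => env.mk O A (T := (T.sum N).sum N') o _)
        (congrArg (fun h => SymSeq.act _ h _) ?_)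
      ext1
      · refine Equiv.ext ?_
        rintro (((t | r) | r) | s) <;> rfl
      · rfl
    · simp only [SymSeq.act_act]
      refine congrArg (fun h => SymSeq.act _ h _) ?_
      ext1
      · refine Equiv.ext ?_
        rintro ((x | ⟨r, x⟩) | ⟨r, x⟩)
        · rcases hx : ψ.r x with ⟨t, y⟩
          simp [DHom.comp, DHom.circ, DHom.split, DHom.sum, DHom.ofEquiv, DHom.assocSum, DHom.id, hx]
          rfl
        · rfl
        · rfl
      · refine Lab.ext (funext ?_)
        rintro ((x | ⟨r, x⟩) | ⟨r, x⟩)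
        · rcases hx : ψ.lab.g x with (y | ⟨t, y⟩) | y
          · simp [DHom.comp, DHom.circ, DHom.split, DHom.sum, DHom.ofEquiv, DHom.assocSum, DHom.id,
              Lab.comp, Lab.sum, Lab.sigma, Lab.ofEquiv, Lab.id, hx]
          · simp [DHom.comp, DHom.circ, DHom.split, DHom.sum, DHom.ofEquiv, DHom.assocSum, DHom.id,
              Lab.comp, Lab.sum, Lab.sigma, Lab.ofEquiv, Lab.id, hx]
            rfl
          · simp [DHom.comp, DHom.circ, DHom.split, DHom.sum, DHom.ofEquiv, DHom.assocSum, DHom.id,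
              Lab.comp, Lab.sum, Lab.sigma, Lab.ofEquiv, Lab.id, hx]
        · rfl
        · rfl

theorem envMap_plug (α : A ⟶ A') (w : N ⊕ S ≃ Q) {d : N → Deg}
    (x : ((O.env A).obj (op Q)).el c k) (b : ∀ r, A.A.el (d r) k) :
    SymSeq.ap ((envMap α).app (op S)) (plug (S := S) w x b) =
      plug w (SymSeq.ap ((envMap α).app (op Q)) x) fun r => SymSeq.ap α.f (b r) := by
  rcases env.cases x with rfl | ⟨T, n, d₁, o, a, ψ, rfl⟩
  · rw [plug_pt, SymSeq.ap_pt, SymSeq.ap_pt, plug_pt]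
  · rw [plug_act_mk, SymSeq.ap_act, SymSeq.ap_act, SymSeq.ap_act, envMap_mk, envMap_mk, plug_act_mk]
    refine congrArg (SymSeq.act _ _) (congrArg (SymSeq.act _ _) (congrArg _ (funext ?_)))
    rintro (t | r) <;> rfl

end env

/-! ### The isomorphism $\mathcal O_A[0]\cong A$ -/

section Aug

/-- `O[R ∐ ∅] ≅ O[R]`. -/
def dropHom (B : SymSeq.{u}) : shift (FinBij.std 0) B ⟶ B :=
  SymSeq.mkHom (fun d k x => B.act (DHom.dropZero d.R d.N) x) (fun d k => SymSeq.act_pt _)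
    (fun d k l α x => (SymSeq.sm_act (X := B) α (DHom.dropZero d.R d.N) x).symm)
    (fun c d k h x => by
      rw [act_shift]
      refine (SymSeq.act_act _ _ _).trans (Eq.trans ?_ (SymSeq.act_act _ _ _).symm)
      refine congrArg (fun h => SymSeq.act _ h _) ?_
      ext1
      · exact Equiv.ext fun x => rfl
      · exact (Lab.comp_id _).trans (Lab.id_comp _).symm)

def addHom (B : SymSeq.{u}) : B ⟶ shift (FinBij.std 0) B :=
  SymSeq.mkHom (fun d k x => B.act (c := d) (d := d.plus (FinBij.std 0))
      (DHom.ofEquiv (c := d) (d := d.plus (FinBij.std 0)) (Equiv.sumEmpty d.R (Fin 0))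
        (Equiv.refl _)) x) (fun d k => SymSeq.act_pt _)
    (fun d k l α x => (SymSeq.sm_act (X := B) (c := d) (d := d.plus (FinBij.std 0)) α
      (DHom.ofEquiv (c := d) (d := d.plus (FinBij.std 0)) (Equiv.sumEmpty d.R (Fin 0))
        (Equiv.refl _)) x).symm)
    (fun c d k h x => by
      refine (SymSeq.act_act (X := B) (c := c) (d := d) (e := d.plus (FinBij.std 0)) _ _ _).trans
        (Eq.trans ?_ ((act_shift (Q := FinBij.std 0) (B := B) h _).trans (SymSeq.act_act (X := B) (c := c)
          (d := c.plus (FinBij.std 0)) (e := d.plus (FinBij.std 0)) _ _ _)).symm)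
      refine congrArg (fun h => SymSeq.act _ h _) ?_
      ext1
      · refine Equiv.ext ?_
        rintro (x | x)
        · rfl
        · exact x.elim0
      · exact (Lab.comp_id _).trans (Lab.id_comp _).symm)

theorem addHom_dropHom (B : SymSeq.{u}) : addHom B ≫ dropHom B = 𝟙 B :=
  SymSeq.hom_ext fun _ _ x => (SymSeq.act_act _ _ _).trans (SymSeq.act_id x)

theorem dropHom_addHom (B : SymSeq.{u}) : dropHom B ≫ addHom B = 𝟙 _ :=
  SymSeq.hom_ext fun _ _ x => (SymSeq.act_act (X := B) (c := Deg.plus _ (FinBij.std 0)) _ _ _).trans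
    (Eq.trans (congrArg (fun h => SymSeq.act _ h _) (by
      ext1
      · refine Equiv.ext ?_
        rintro (x | x)
        · rfl
        · exact x.elim0
      · rfl)) (SymSeq.act_id (X := B) (d := Deg.plus _ (FinBij.std 0)) x))

/-- With no reserved inputs there are no units to insert, so the right action is the operad
multiplication. -/
theorem rightAction_dropHom :
    O.rightAction (FinBij.std 0) ≫ dropHom O.S = circMap (dropHom O.S) (𝟙 _) ≫ O.μ :=
  circ.hom_ext fun k T n d b y => by
    rw [SymSeq.ap_comp, SymSeq.ap_comp, ap_circMap]
    refine (congrArg _ (circ.ap_lift _ _ _ _ _ _ _ _ _ _ _)).trans ?_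
    have h := circ.mk_act (B := O.S) (Y := O.S) (T := T.sum (FinBij.std 0)) (T' := T)
      (d := Sum.elim d fun _ => Deg.unit) (d' := d) (n := n) (n' := n)
      (Equiv.sumEmpty T (Fin 0)).symm Lab.id (fun t => DHom.id) b (famSum y fun _ => O.one k)
    have h₁ : SymSeq.ap O.μ (circ.mk (B := O.S) T n d (SymSeq.ap (dropHom O.S) (d := ⟨T, n⟩) b)
        fun t => SymSeq.ap (𝟙 O.S) (y t)) = _ := (congrArg (SymSeq.ap O.μ) (Eq.trans
        (congrArg (circ.mk (B := O.S) T n d _) (funext fun t => (SymSeq.act_id (y t)).symm))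
          h)).trans (SymSeq.ap_act O.μ _ _)
    refine Eq.trans ?_ h₁.symm
    refine (SymSeq.act_act (X := O.S) (c := Deg.circ n (T := T.sum (FinBij.std 0))
      (Sum.elim d fun _ => Deg.unit)) (d := (Deg.circ n d).plus (FinBij.std 0))
      (e := Deg.circ n d) _ _ _).trans (congrArg (fun h => SymSeq.act _ h _) ?_)
    ext1
    · exact Equiv.ext fun x => rfl
    · refine Lab.ext (funext ?_)
      rintro (x | x) <;> rfl

theorem mult_act₁ : O.mult A.A ≫ act₁ A = circMap (𝟙 _) (act₁ A) ≫ act₁ A := A.assoc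

theorem unit_act₁ : O.unit A.A ≫ act₁ A = 𝟙 _ := A.unit

theorem unit_naturality {X Y : SymSeq.{u}} (f : X ⟶ Y) :
    f ≫ O.unit Y = O.unit X ≫ circMap (𝟙 _) f := O.monad.η.naturality f

/-- For $Q=\emptyset$ the two maps defining $\mathcal O_A[Q]$ become multiplication and action
$\mathcal O\circ\mathcal O\circ A\rightrightarrows\mathcal O\circ A$, the canonical presentation of
the algebra $A$. -/
theorem envL_dropHom : O.envL A (FinBij.std 0) ≫ circMap (dropHom O.S) (𝟙 _) =
    circMap (dropHom O.S) (𝟙 _) ≫ O.mult A.A := by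
  have h := circAssoc_naturality (dropHom O.S) (𝟙 O.S) (𝟙 A.A)
  rw [circMap_id] at h
  rw [envL, mult, Category.assoc, circMap_comp, rightAction_dropHom, Category.comp_id,
    ← Category.assoc (circMap _ _), h, Category.assoc, circMap_comp, Category.comp_id]

/-- The morphism `O_A[∅] ⟶ A`, `[o; a] ↦ o(a)`. -/
noncomputable def augHom (A : O.Lt) : (O.env A).obj (op (FinBij.std 0)) ⟶ A.A :=
  coequalizer.desc (circMap (dropHom O.S) (𝟙 _) ≫ act₁ A) (by
    rw [← Category.assoc, envL_dropHom, Category.assoc, mult_act₁, envR, ← Category.assoc,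
      ← Category.assoc, circMap_comp, circMap_comp, Category.comp_id, Category.comp_id,
      Category.id_comp, Category.id_comp]
    rfl)

theorem π_augHom : env.π A (FinBij.std 0) ≫ augHom A = circMap (dropHom O.S) (𝟙 _) ≫ act₁ A :=
  coequalizer.π_desc _ _

theorem envR_π : circMap (𝟙 _) (act₁ A) ≫ env.π A Q = O.envL A Q ≫ env.π A Q :=
  (coequalizer.condition _ _).symm

/-- The isomorphism `O_A[∅] ≅ A`. -/
noncomputable def augIso (A : O.Lt) : (O.env A).obj (op (FinBij.std 0)) ≅ A.A where
  hom := augHom A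
  -- The inverse is $a\mapsto[1;a]$, from the usual splitting of the canonical presentation by the
  -- unit.
  inv := O.unit A.A ≫ circMap (addHom O.S) (𝟙 _) ≫ env.π A (FinBij.std 0)
  hom_inv_id := by
    have h₁ : O.envL A (FinBij.std 0) = circMap (dropHom O.S) (𝟙 _) ≫ O.mult A.A ≫
        circMap (addHom O.S) (𝟙 _) := by
      rw [← Category.assoc, ← envL_dropHom, Category.assoc, circMap_comp, dropHom_addHom,
        Category.comp_id, circMap_id, Category.comp_id]
    -- On representatives this is $[1;o(a)]=[1\circ o;a]=[o;a]$: `envR_π` is the first equality, the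
    -- unit law of the operad the second.
    have h₂ : env.π A (FinBij.std 0) ≫ augHom A ≫ O.unit A.A ≫ circMap (addHom O.S) (𝟙 _) ≫
        env.π A (FinBij.std 0) = env.π A (FinBij.std 0) ≫ 𝟙 _ := by
      rw [← Category.assoc, π_augHom, Category.assoc, ← Category.assoc (act₁ A), unit_naturality,
        Category.assoc, ← Category.assoc (circMap (𝟙 _) (act₁ A)), circMap_comp, Category.id_comp,
        Category.comp_id]
      have h₃ : circMap (addHom O.S) (act₁ A) = circMap (addHom O.S) (𝟙 _) ≫
        circMap (𝟙 _) (act₁ A) := by rw [circMap_comp, Category.id_comp, Category.comp_id]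
      rw [h₃, Category.assoc, envR_π, h₁, ← Category.assoc (circMap (addHom O.S) _),
        ← Category.assoc (circMap (addHom O.S) _), circMap_comp, addHom_dropHom, Category.comp_id,
        circMap_id, Category.id_comp, ← Category.assoc (O.unit _), ← Category.assoc (O.unit _),
        unit_mult, Category.id_comp, ← Category.assoc, circMap_comp, dropHom_addHom,
        Category.comp_id, circMap_id, Category.id_comp, Category.comp_id]
    exact coequalizer.hom_ext h₂
  inv_hom_id := by
    rw [Category.assoc, Category.assoc, π_augHom, ← Category.assoc (circMap _ _), circMap_comp,
      addHom_dropHom, Category.comp_id, circMap_id, Category.id_comp, unit_act₁]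

theorem augHom_mk {d : T → Deg} (o : O.S.el ⟨T.sum (FinBij.std 0), n⟩ k)
    (a : ∀ t, A.A.el (d t) k) : SymSeq.ap (augHom A) (env.mk O A o a) =
      O.eval (O.S.act (DHom.dropZero T n) o) a := by
  exact (congrArg (fun f => SymSeq.ap f
    (circ.mk (B := shift (FinBij.std 0) O.S) T n d o a)) π_augHom).trans
    (congrArg (SymSeq.ap (act₁ A)) (ap_circMap _ _ _ _ _ _ _))

end Aug

end Operad
end SymSpectra

/-! ### Regrouping disjoint unions along $Q\cong N\sqcup S$ -/

namespace SymSpectra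

section
variable {C N S Q : Type}

/-- Splitting the part indexed by `Q ≅ N ∐ S` of a disjoint union. -/
def fibGroup (F : Deg → Type) (C : Type) (w : N ⊕ S ≃ Q) (e : Q → Deg) :
    ((C ⊕ Σ r, F (e (w (.inl r)))) ⊕ Σ s, F (e (w (.inr s)))) ≃ C ⊕ Σ q, F (e q) :=
  (Equiv.sumAssoc _ _ _).trans (Equiv.sumCongr (Equiv.refl C)
    ((Equiv.sumSigmaDistrib fun x => F (e (w x))).symm.trans
      (Equiv.sigmaCongrLeft (β := fun q => F (e q)) w)))

theorem fibMove_inl {T : Type} (F : Deg → Type) (w : N ⊕ S ≃ Q) (d : T → Deg) (e : Q → Deg) (r : N)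
    (x : F (e (w (.inl r)))) : fibMove F w d e (.inr ⟨w (.inl r), x⟩) = .inl ⟨.inr r, x⟩ :=
  ((Equiv.eq_symm_apply _).1 rfl)

theorem fibMove_inr {T : Type} (F : Deg → Type) (w : N ⊕ S ≃ Q) (d : T → Deg) (e : Q → Deg) (s : S)
    (x : F (e (w (.inr s)))) : fibMove F w d e (.inr ⟨w (.inr s), x⟩) = .inr ⟨s, x⟩ :=
  ((Equiv.eq_symm_apply _).1 rfl)

/-- A bijection that respects the summands is a pair of bijections. Hence two splittings of one
family with the same parts differ only by relabelling the parts. -/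
theorem sumCongr_of_isLeft {N' S' : Type} (e : N' ⊕ S' ≃ N ⊕ S)
    (hl : ∀ r, (e (.inl r)).isLeft) (hr : ∀ s, (e (.inr s)).isRight) :
    ∃ (σ : N' ≃ N) (τ : S' ≃ S), e = Equiv.sumCongr σ τ := by
  choose f hf using fun r => Sum.isLeft_iff.1 (hl r)
  choose g hg using fun s => Sum.isRight_iff.1 (hr s)
  have hf' : Function.Bijective f := by
    refine ⟨fun a b h => Sum.inl_injective (e.injective (by rw [hf, hf, h])), fun r => ?_⟩
    obtain ⟨x | x, hx⟩ := e.surjective (.inl r)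
    · exact ⟨x, Sum.inl_injective ((hf x).symm.trans hx)⟩
    · simp [hg] at hx
  have hg' : Function.Bijective g := by
    refine ⟨fun a b h => Sum.inr_injective (e.injective (by rw [hg, hg, h])), fun r => ?_⟩
    obtain ⟨x | x, hx⟩ := e.surjective (.inr r)
    · simp [hf] at hx
    · exact ⟨x, Sum.inr_injective ((hg x).symm.trans hx)⟩
  refine ⟨Equiv.ofBijective f hf', Equiv.ofBijective g hg', Equiv.ext ?_⟩
  rintro (r | s)
  exacts [hf r, hg s]

end

namespace DHom
variable {k l : Dop} {N S Q : FinBij} (w : N ⊕ S ≃ Q) (c : Deg) (e : Q → Deg)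

/-- Splitting the part indexed by `Q ≅ N ∐ S` of a disjoint union. -/
def group : DHom k (c.sum (Deg.sigma e)) ((c.sum (Deg.sigma fun r : N => e (w (.inl r)))).sum
    (Deg.sigma fun s : S => e (w (.inr s)))) :=
  ofEquiv (c := c.sum (Deg.sigma e)) (d := (c.sum (Deg.sigma fun r : N => e (w (.inl r)))).sum
    (Deg.sigma fun s : S => e (w (.inr s)))) (fibGroup (fun c => c.R) c.R w e)
    (fibGroup (fun c => c.N) c.N w e)

/-- The inverse of `group`. -/
def ungroup : DHom k ((c.sum (Deg.sigma fun r : N => e (w (.inl r)))).sum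
    (Deg.sigma fun s : S => e (w (.inr s)))) (c.sum (Deg.sigma e)) :=
  ofEquiv (d := c.sum (Deg.sigma e)) (c := (c.sum (Deg.sigma fun r : N => e (w (.inl r)))).sum
    (Deg.sigma fun s : S => e (w (.inr s)))) (fibGroup (fun c => c.R) c.R w e).symm
    (fibGroup (fun c => c.N) c.N w e).symm

theorem group_ungroup : (group w c e : DHom k _ _).comp (ungroup w c e) = id := by
  unfold group ungroup
  rw [ofEquiv_comp, Equiv.symm_trans_self, Equiv.symm_trans_self]
  rfl

theorem ungroup_group : (ungroup w c e : DHom k _ _).comp (group w c e) = id := by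
  unfold group ungroup
  rw [ofEquiv_comp, Equiv.self_trans_symm, Equiv.self_trans_symm]
  rfl

theorem push_group (α : k ⟶ l) : (group w c e : DHom k _ _).push α = group w c e := rfl

/-- The identities, from a family on `N ∐ S` to its two parts. -/
def elimId (e : N ⊕ S → Deg) : ∀ x, DHom k (e x)
    (Sum.elim (fun r => e (.inl r)) (fun s => e (.inr s)) x)
  | .inl _ => id
  | .inr _ => id

/-- Splitting along `w` means reindexing along `w` and then reassociating. The right-hand side has
the form produced by `env.plug_act_right` and `env.plug_plug`. -/
theorem group_eq : (group w c e : DHom k _ _) =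
    ((id : DHom k c c).sum (sigma (T' := N.sum S) w (elimId fun x => e (w x)))).comp
      (assocSum c _ _) := by
  ext1
  · refine Equiv.ext ?_
    rintro ((x | ⟨r, x⟩) | ⟨s, x⟩) <;> rfl
  · refine Lab.ext (funext ?_)
    rintro ((x | ⟨r, x⟩) | ⟨s, x⟩) <;> rfl

theorem move_group (n : FinBij) {T : FinBij} (d : T → Deg) :
    (move n d e w : DHom k _ _).comp (group w (Deg.circ n d) e) =
      (split n d fun r => e (w (.inl r))).sum id := by
  ext1
  · refine Equiv.ext ?_
    rintro ((⟨r, x⟩ | ⟨r, x⟩) | ⟨s, x⟩)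
    exacts [rfl, fibMove_inl (fun c => c.R) w d e r x, fibMove_inr (fun c => c.R) w d e s x]
  · refine Lab.ext (funext ?_)
    rintro (((x | ⟨r, x⟩) | ⟨r, x⟩) | ⟨s, x⟩)
    exacts [rfl, rfl, congrArg (fun y => Sum.inl ((Equiv.sumAssoc _ _ _).symm (Sum.inr y)))
      (fibMove_inl (fun c => c.N) w d e r x), congrArg (fun y => Sum.inl ((Equiv.sumAssoc _ _ _).symm
        (Sum.inr y))) (fibMove_inr (fun c => c.N) w d e s x)]

/-- Translates the bijection `move`, in which the description of $f_*$ is phrased, into the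
bijections used for cells. -/
theorem move_eq (n : FinBij) {T : FinBij} (d : T → Deg) : (move n d e w : DHom k _ _) =
    ((split n d fun r => e (w (.inl r))).sum id).comp (ungroup w (Deg.circ n d) e) := by
  rw [← move_group, comp_assoc, group_ungroup, comp_id]

theorem sum_sigma_group {Q' : FinBij} (w : N ⊕ S ≃ Q') (τ : Q' ≃ Q) :
    ((id : DHom k c c).sum (sigma τ fun q => (id : DHom k (e (τ q)) (e (τ q))))).comp
      (group w c fun q => e (τ q)) = group (w.trans τ) c e := by
  ext1
  · refine Equiv.ext ?_
    rintro ((x | ⟨r, x⟩) | ⟨s, x⟩) <;> rfl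
  · refine Lab.ext (funext ?_)
    rintro ((x | ⟨r, x⟩) | ⟨s, x⟩) <;> rfl

theorem sum_fam_group {c' : Deg} {e' : Q → Deg} (h : DHom k c c') (f : ∀ q, DHom k (e q) (e' q)) :
    (h.sum (fam f)).comp (group w c' e') = (group w c e).comp
      ((h.sum (fam fun r : N => f (w (.inl r)))).sum (fam fun s : S => f (w (.inr s)))) := by
  ext1
  · refine Equiv.ext ?_
    rintro ((x | ⟨r, x⟩) | ⟨s, x⟩) <;> rfl
  · refine Lab.ext (funext ?_)
    rintro ((x | ⟨r, x⟩) | ⟨s, x⟩)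
    · rcases h' : h.lab.g x with y | y <;> simp [DHom.comp, group, ofEquiv, DHom.sum, Lab.comp,
        Lab.sum, Lab.ofEquiv, fibGroup, h']
    · rcases h' : (f (w (.inl r))).lab.g x with y | y <;> simp [DHom.comp, group, ofEquiv, DHom.sum,
        Lab.comp, Lab.sum, Lab.ofEquiv, fibGroup, fam, sigma, Lab.sigma, h']
    · rcases h' : (f (w (.inr s))).lab.g x with y | y <;> simp [DHom.comp, group, ofEquiv, DHom.sum,
        Lab.comp, Lab.sum, Lab.ofEquiv, fibGroup, fam, sigma, Lab.sigma, h']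

theorem group_congr {N' S' : FinBij} (σ : N' ≃ N) (τ : S' ≃ S) :
    (group ((Equiv.sumCongr σ τ).trans w) c e : DHom k _ _) = (group w c e).comp
      (((id : DHom k c c).sum (sigma (c := fun r => e (w (.inl r))) σ fun _ => id)).sum
        (sigma (c := fun s => e (w (.inr s))) τ fun _ => id)) := by
  ext1
  · refine Equiv.ext ?_
    rintro ((x | ⟨r, x⟩) | ⟨s, x⟩) <;> rfl
  · refine Lab.ext (funext ?_)
    rintro ((x | ⟨r, x⟩) | ⟨s, x⟩) <;> rfl

/-- Splitting off `N` and then `N'` agrees with splitting off `N ⊔ N'` at once: the index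
counterpart of `env.plug_plug`. -/
theorem group_group {N' : FinBij} (w : N ⊕ (N'.sum S) ≃ Q) :
    ((group w c e).comp (group (N := N') (S := S) (Q := N'.sum S) (Equiv.refl _) _
      fun s => e (w (.inr s))) : DHom k _ _) =
      (group (N := N.sum N') ((Equiv.sumAssoc N N' S).trans w) c e).comp
        (((id.sum (sigma (T' := N.sum N') (Equiv.refl _)
          (elimId fun r => e (w ((Equiv.sumAssoc N N' S) (.inl r)))))).comp
            (assocSum _ _ _)).sum id) := by
  ext1
  · refine Equiv.ext ?_
    rintro (((x | ⟨r, x⟩) | ⟨r, x⟩) | ⟨s, x⟩) <;> rfl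
  · refine Lab.ext (funext ?_)
    rintro (((x | ⟨r, x⟩) | ⟨r, x⟩) | ⟨s, x⟩) <;> rfl

end DHom

namespace SymSeq
variable {X : SymSeq.{u}} {c d : Deg} {k : Dop}
-- Equalities of elements may be checked after an index map that can be undone. Thereby a regrouping
-- bijection can be moved to whichever side is convenient.
theorem act_injective {f : DHom k c d} {g : DHom k d c} (h : f.comp g = DHom.id) {x y : X.el c k}
    (hxy : X.act f x = X.act f y) : x = y := by
  rw [← act_id x, ← act_id y, ← h, ← act_act, hxy, act_act]
end SymSeq

section Balanced
variable {M W : FinBijᵒᵖ ⥤ SymSeq.{u}} {T : FinBij} {Z : SymSeq.{u}}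

/-- Balancing moves `τ` off `x` as its inverse, where it cancels against the `τ` acting on `w`. -/
theorem bal.mk_map_map (τ : T ≃ T) {c d : Deg} {k : Dop} (x : (M.obj (op T)).el c k)
    (w : (W.obj (op T)).el d k) :
    bal.mk (SymSeq.ap (M.map (Quiver.Hom.op (X := T) (Y := T) τ)) x)
      (SymSeq.ap (W.map (Quiver.Hom.op (X := T) (Y := T) τ)) w) = bal.mk x w := by
  rw [bal.condition]
  refine congrArg (bal.mk x) ((SymSeq.ap_comp _ _ _).symm.trans ?_)
  have h := W.map_comp (Quiver.Hom.op (X := T) (Y := T) τ) (Quiver.Hom.op (X := T) (Y := T) τ.symm)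
  refine (congrArg (fun f => SymSeq.ap f w) h.symm).trans ?_
  refine (congrArg (fun f => SymSeq.ap (W.map (Quiver.Hom.op (X := T) (Y := T) f)) w)
    (Equiv.symm_trans_self τ)).trans ?_
  exact congrArg (fun f => SymSeq.ap f w) (W.map_id (op T))

/-- Morphisms out of `M[T] ⊗_{Σ_T} W[T]`, given by invariant bilinear functions. -/
noncomputable def bal.descInv (F : Pairing (M.obj (op T)) (W.obj (op T)) Z)
    (hF : ∀ (τ : T ≃ T) {c d : Deg} {k : Dop} (x : (M.obj (op T)).el c k)
      (w : (W.obj (op T)).el d k),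
      F.f (SymSeq.ap (M.map (Quiver.Hom.op (X := T) (Y := T) τ)) x)
        (SymSeq.ap (W.map (Quiver.Hom.op (X := T) (Y := T) τ)) w) = F.f x w) : bal M W T ⟶ Z :=
  bal.desc F fun τ c d k x w => by
    -- Diagonal invariance, applied to `x` and $\tau^{-1}w$, is the balancing condition.
    rw [← hF τ x (SymSeq.ap (W.map (Quiver.Hom.op (X := T) (Y := T) τ.symm)) w)]
    refine congrArg (F.f _) (Eq.symm ((SymSeq.ap_comp _ _ _).symm.trans ?_))
    have h := W.map_comp (Quiver.Hom.op (X := T) (Y := T) τ.symm)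
      (Quiver.Hom.op (X := T) (Y := T) τ)
    refine (congrArg (fun f => SymSeq.ap f w) h.symm).trans ?_
    refine (congrArg (fun f => SymSeq.ap (W.map (Quiver.Hom.op (X := T) (Y := T) f)) w)
      (Equiv.self_trans_symm τ)).trans ?_
    exact congrArg (fun f => SymSeq.ap f w) (W.map_id (op T))

@[simp] theorem bal.ap_descInv (F : Pairing (M.obj (op T)) (W.obj (op T)) Z) (hF)
    {c d : Deg} {k : Dop} (x : (M.obj (op T)).el c k) (w : (W.obj (op T)).el d k) :
    SymSeq.ap (bal.descInv F hF) (bal.mk x w) = F.f x w := bal.ap_desc _ _ _ _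

theorem pow.mk_reindex {Y : SymSeq.{u}} {T' : FinBij} {k : Dop} (σ : T' ≃ T) {e : T → Deg}
    (y : ∀ t, Y.el (e t) k) : pow.mk (T := T') (fun t => y (σ t)) =
      SymSeq.act _ (DHom.sigma σ fun t' => (DHom.id : DHom k (e (σ t')) (e (σ t'))))
        (SymSeq.ap ((pow Y).map (Quiver.Hom.op (X := T') (Y := T) σ)) (pow.mk y)) := by
  rw [pow.map_mk, SymSeq.act_act, DHom.reindex_inv, SymSeq.act_id]

end Balanced

/-! ### Cells: symbols $x\otimes y$ modulo naturality and plugging -/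

namespace Operad

/-- Shapes of generators of the cells in filtration degrees satisfying `p`. -/
structure CellSh (p : ℕ → Prop) : Type 1 where
  Q : FinBij
  c : Deg
  e : Q → Deg
  hQ : p (Nat.card Q)

abbrev CellSh.deg {p : ℕ → Prop} (s : CellSh p) : Deg := s.c.sum (Deg.sigma s.e)

section Cell
variable {O : Operad.{u}} {A : O.Lt} {X Y : SymSeq.{u}} (i : X ⟶ Y) (φ : X ⟶ A.A) {p q : ℕ → Prop}

variable (A Y) in
abbrev CellSh.val (s : CellSh p) (k : Dop) : Type (u + 1) :=
  ((O.env A).obj (op s.Q)).el s.c k × ∀ t, Y.el (s.e t) k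

/-- The relations between the generators `x ⊗ y`: naturality, and plugging in elements of `A` for
elements of `Y` that come from `X`. -/
inductive CellStep : ∀ {k : Dop} (s s' : CellSh p), DHom k s.deg s'.deg →
    s.val A Y k → s'.val A Y k → Prop
  | move {k : Dop} {Q Q' : FinBij} {c c' : Deg} {e : Q → Deg} {e' : Q' → Deg} (hQ : p (Nat.card Q))
      (hQ' : p (Nat.card Q')) (σ : Q' ≃ Q) (h : DHom k c c') (f : ∀ t, DHom k (e (σ t)) (e' t))
      (x : ((O.env A).obj (op Q)).el c k) (y : ∀ t, Y.el (e t) k) :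
      CellStep ⟨Q, c, e, hQ⟩ ⟨Q', c', e', hQ'⟩ (h.sum (DHom.sigma σ f)) (x, y)
        (SymSeq.ap ((O.env A).map (Quiver.Hom.op (X := Q') (Y := Q) σ)) (SymSeq.act _ h x),
          fun t => Y.act (f t) (y (σ t)))
  -- As `N` is nonempty, plugging strictly lowers the number of remaining inputs. The index of the
  -- plugged elements moves from the second factor to the first, which is what `DHom.group` records.
  | plug {k : Dop} {Q N S : FinBij} {c : Deg} {e : Q → Deg} (hQ : p (Nat.card Q))
      (hS : p (Nat.card S)) (w : N ⊕ S ≃ Q) (hN : Nonempty N) (x : ((O.env A).obj (op Q)).el c k)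
      (y : ∀ t, Y.el (e t) k) (xs : ∀ r, X.el (e (w (.inl r))) k)
      (hy : ∀ r, y (w (.inl r)) = SymSeq.ap i (xs r)) :
      CellStep ⟨Q, c, e, hQ⟩ ⟨S, c.sum (Deg.sigma fun r : N => e (w (.inl r))),
        fun s => e (w (.inr s)), hS⟩ (DHom.group w c e) (x, y)
        (env.plug w x fun r => SymSeq.ap φ (xs r), fun s => y (w (.inr s)))

variable (p) in
-- One presentation serves for all stages and for their colimit: `p` is `(· ≤ t)` for the stage
-- $A_t$ and constantly true for the colimit. A relation is imposed only if both of its ends satisfy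
-- `p`.
noncomputable abbrev cellPres : Pres.{u} where
  Sh := CellSh p
  deg s := s.deg
  val s k := s.val A Y k
  sm α v := (SymSeq.sm _ α v.1, fun t => Y.sm α (v.2 t))
  sm_id v := by simp
  sm_sm α β v := by simp
  step s s' h v v' := CellStep i φ s s' h v v'
  null v := v.1 = SymSeq.pt _ ∨ ∃ t, v.2 t = Y.pt
  step_sm α s s' h v v' := by
    rintro (⟨hQ, hQ', σ, h, f, x, y⟩ | ⟨hQ, hS, w, hN, x, y, xs, hy⟩)
    · have := CellStep.move (i := i) (φ := φ) hQ hQ' σ (h.push α) (fun t => (f t).push α)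
        (SymSeq.sm _ α x) (fun t => Y.sm α (y t))
      simpa [DHom.push_sum, DHom.push_sigma] using this
    · have := CellStep.plug (i := i) (φ := φ) hQ hS w hN (SymSeq.sm _ α x)
        (fun t => Y.sm α (y t)) (fun r => X.sm α (xs r)) (fun r => by simp [hy])
      simpa [env.sm_plug, DHom.push_group] using this
  null_sm α v := by
    rintro (h | ⟨t, h⟩)
    · exact .inl (by simp [h])
    · exact .inr ⟨t, by simp [h]⟩

variable (p) in
/-- The symmetric sequence generated by `x ⊗ y`, with `x ∈ O_A[t]` and `y ∈ Y^{⊗ t}`, for all `t`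
satisfying `p`, modulo naturality and plugging in. -/
noncomputable def cell : SymSeq.{u} := (cellPres i φ p).obj

variable {k : Dop} {Q Q' N S : FinBij} {c c' : Deg} {e : Q → Deg} {e' : Q' → Deg}

/-- The element `x ⊗ y`. -/
noncomputable def cell.mk (hQ : p (Nat.card Q)) (x : ((O.env A).obj (op Q)).el c k) (y : ∀ t, Y.el (e t) k) :
    (cell i φ p).el (c.sum (Deg.sigma e)) k :=
  Pres.gen (P := cellPres i φ p) ⟨Q, c, e, hQ⟩ (x, y) DHom.id

namespace cell
variable {i φ}

theorem act_mk {d : Deg} (hQ : p (Nat.card Q)) (x : ((O.env A).obj (op Q)).el c k)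
    (y : ∀ t, Y.el (e t) k) (h : DHom k (c.sum (Deg.sigma e)) d) :
    SymSeq.act _ h (mk i φ hQ x y) = Pres.gen (P := cellPres i φ p) ⟨Q, c, e, hQ⟩ (x, y) h :=
  (Pres.act_gen (P := cellPres i φ p) _ _ _ _).trans (by rw [DHom.id_comp])

theorem hom_ext {Z : SymSeq.{u}} {f g : cell i φ p ⟶ Z} (h : ∀ (k : Dop) (Q : FinBij) (c : Deg)
    (e : Q → Deg) (hQ : p (Nat.card Q)) (x : ((O.env A).obj (op Q)).el c k)
    (y : ∀ t, Y.el (e t) k), SymSeq.ap f (mk i φ hQ x y) = SymSeq.ap g (mk i φ hQ x y)) : f = g :=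
  Pres.hom_ext (P := cellPres i φ p) fun _ s v => h _ s.Q s.c s.e s.hQ v.1 v.2

theorem mk_move (hQ : p (Nat.card Q)) (hQ' : p (Nat.card Q')) (σ : Q' ≃ Q) (h : DHom k c c')
    (f : ∀ t, DHom k (e (σ t)) (e' t)) (x : ((O.env A).obj (op Q)).el c k)
    (y : ∀ t, Y.el (e t) k) :
    mk i φ hQ' (SymSeq.ap ((O.env A).map (Quiver.Hom.op (X := Q') (Y := Q) σ)) (SymSeq.act _ h x))
      (fun t => Y.act (f t) (y (σ t))) =
      SymSeq.act _ (h.sum (DHom.sigma σ f)) (mk i φ hQ x y) := by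
  rw [act_mk]
  refine (Pres.gen_step (P := cellPres i φ p) (CellStep.move hQ hQ' σ h f x y) DHom.id).symm.trans ?_
  rw [DHom.comp_id]

theorem mk_act (hQ : p (Nat.card Q)) {e' : Q → Deg} (h : DHom k c c')
    (f : ∀ t, DHom k (e t) (e' t)) (x : ((O.env A).obj (op Q)).el c k) (y : ∀ t, Y.el (e t) k) :
    mk i φ hQ (SymSeq.act _ h x) (fun t => Y.act (f t) (y t)) =
      SymSeq.act _ (h.sum (DHom.fam f)) (mk i φ hQ x y) := by
  refine Eq.trans ?_ (mk_move hQ hQ (Equiv.refl Q) h f x y)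
  exact congrArg (fun g => mk i φ hQ (SymSeq.ap g (SymSeq.act _ h x)) fun t => Y.act (f t) (y t))
    ((O.env A).map_id (op Q)).symm

theorem mk_act_left (hQ : p (Nat.card Q)) (h : DHom k c c') (x : ((O.env A).obj (op Q)).el c k)
    (y : ∀ t, Y.el (e t) k) : mk i φ hQ (SymSeq.act _ h x) y =
      SymSeq.act _ (h.sum DHom.id) (mk i φ hQ x y) := by
  have := mk_act (i := i) (φ := φ) hQ h (fun t => (DHom.id : DHom k (e t) (e t))) x y
  simp only [SymSeq.act_id] at this
  exact this

theorem mk_reindex (hQ : p (Nat.card Q)) (hQ' : p (Nat.card Q')) (σ : Q' ≃ Q)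
    (x : ((O.env A).obj (op Q)).el c k) (y : ∀ t, Y.el (e t) k) :
    mk i φ hQ' (SymSeq.ap ((O.env A).map (Quiver.Hom.op (X := Q') (Y := Q) σ)) x)
      (fun t => y (σ t)) = SymSeq.act _ ((DHom.id : DHom k c c).sum
        (DHom.sigma σ fun t => (DHom.id : DHom k (e (σ t)) (e (σ t))))) (mk i φ hQ x y) := by
  have := mk_move (i := i) (φ := φ) hQ hQ' σ DHom.id (fun t => (DHom.id : DHom k (e (σ t)) (e (σ t)))) x y
  simpa using this

theorem mk_plug (hQ : p (Nat.card Q)) (hS : p (Nat.card S)) (w : N ⊕ S ≃ Q) (hN : Nonempty N)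
    (x : ((O.env A).obj (op Q)).el c k) (y : ∀ t, Y.el (e t) k)
    (xs : ∀ r, X.el (e (w (.inl r))) k) (hy : ∀ r, y (w (.inl r)) = SymSeq.ap i (xs r)) :
    mk i φ hS (env.plug w x fun r => SymSeq.ap φ (xs r)) (fun s => y (w (.inr s))) =
      SymSeq.act _ (DHom.group w c e) (mk i φ hQ x y) := by
  rw [act_mk]
  refine (Pres.gen_step (P := cellPres i φ p)
    (CellStep.plug hQ hS w hN x y xs hy) DHom.id).symm.trans ?_
  rw [DHom.comp_id]

theorem mk_pt_left (hQ : p (Nat.card Q)) (y : ∀ t, Y.el (e t) k) :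
    mk i φ hQ (SymSeq.pt _ : ((O.env A).obj (op Q)).el c k) y = SymSeq.pt _ :=
  Pres.gen_null (P := cellPres i φ p) (.inl rfl) _

theorem mk_pt_right (hQ : p (Nat.card Q)) (x : ((O.env A).obj (op Q)).el c k)
    (y : ∀ t, Y.el (e t) k) (t : Q) (h : y t = Y.pt) : mk i φ hQ x y = SymSeq.pt _ :=
  Pres.gen_null (P := cellPres i φ p) (.inr ⟨t, h⟩) _

theorem sm_mk {l : Dop} (α : k ⟶ l) (hQ : p (Nat.card Q)) (x : ((O.env A).obj (op Q)).el c k)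
    (y : ∀ t, Y.el (e t) k) : SymSeq.sm _ α (mk i φ hQ x y) =
      mk i φ hQ (SymSeq.sm _ α x) fun t => Y.sm α (y t) :=
  Pres.sm_gen (P := cellPres i φ p) _ _ _ _

/-- Morphisms out of a cell sequence. -/
structure Desc (i : X ⟶ Y) (φ : X ⟶ A.A) (p : ℕ → Prop) (Z : SymSeq.{u}) where
  f : ∀ {Q : FinBij} {c : Deg} {e : Q → Deg} {k : Dop}, p (Nat.card Q) →
    ((O.env A).obj (op Q)).el c k → (∀ t, Y.el (e t) k) → Z.el (c.sum (Deg.sigma e)) k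
  sm : ∀ {Q : FinBij} {c : Deg} {e : Q → Deg} {k l : Dop} (α : k ⟶ l) (hQ : p (Nat.card Q))
    (x : ((O.env A).obj (op Q)).el c k) (y : ∀ t, Y.el (e t) k),
    f hQ (SymSeq.sm _ α x) (fun t => Y.sm α (y t)) = Z.sm α (f hQ x y)
  move : ∀ {Q Q' : FinBij} {c c' : Deg} {e : Q → Deg} {e' : Q' → Deg} {k : Dop}
    (hQ : p (Nat.card Q)) (hQ' : p (Nat.card Q')) (σ : Q' ≃ Q) (h : DHom k c c')
    (g : ∀ t, DHom k (e (σ t)) (e' t)) (x : ((O.env A).obj (op Q)).el c k) (y : ∀ t, Y.el (e t) k),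
    f hQ' (SymSeq.ap ((O.env A).map (Quiver.Hom.op (X := Q') (Y := Q) σ)) (SymSeq.act _ h x))
      (fun t => Y.act (g t) (y (σ t))) = Z.act (h.sum (DHom.sigma σ g)) (f hQ x y)
  plug : ∀ {Q N S : FinBij} {c : Deg} {e : Q → Deg} {k : Dop} (hQ : p (Nat.card Q))
    (hS : p (Nat.card S)) (w : N ⊕ S ≃ Q), Nonempty N → ∀ (x : ((O.env A).obj (op Q)).el c k)
    (y : ∀ t, Y.el (e t) k) (xs : ∀ r, X.el (e (w (.inl r))) k),
    (∀ r, y (w (.inl r)) = SymSeq.ap i (xs r)) →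
    f hS (env.plug w x fun r => SymSeq.ap φ (xs r)) (fun s => y (w (.inr s))) =
      Z.act (DHom.group w c e) (f hQ x y)
  pt_left : ∀ {Q : FinBij} {c : Deg} {e : Q → Deg} {k : Dop} (hQ : p (Nat.card Q))
    (y : ∀ t, Y.el (e t) k), f hQ (SymSeq.pt _ : ((O.env A).obj (op Q)).el c k) y = Z.pt
  pt_right : ∀ {Q : FinBij} {c : Deg} {e : Q → Deg} {k : Dop} (hQ : p (Nat.card Q))
    (x : ((O.env A).obj (op Q)).el c k) (y : ∀ t, Y.el (e t) k) (t : Q), y t = Y.pt →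
    f hQ x y = Z.pt

noncomputable def Desc.hom {Z : SymSeq.{u}} (F : Desc i φ p Z) : cell i φ p ⟶ Z :=
  Pres.lift (P := cellPres i φ p) Z (fun s k v => F.f s.hQ v.1 v.2)
    (fun s k l α v => F.sm α s.hQ v.1 v.2)
    (fun k s s' h v v' hs => by
      rcases hs with ⟨hQ, hQ', σ, h, g, x, y⟩ | ⟨hQ, hS, w, hN, x, y, xs, hy⟩
      · exact F.move hQ hQ' σ h g x y
      · exact F.plug hQ hS w hN x y xs hy)
    (fun s k v hv => by
      rcases hv with h | ⟨t, h⟩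
      · rw [h, F.pt_left]
      · exact F.pt_right _ _ _ t h)

@[simp] theorem Desc.hom_mk {Z : SymSeq.{u}} (F : Desc i φ p Z) (hQ : p (Nat.card Q))
    (x : ((O.env A).obj (op Q)).el c k) (y : ∀ t, Y.el (e t) k) :
    SymSeq.ap F.hom (cell.mk i φ hQ x y) = F.f hQ x y := SymSeq.act_id (X := Z) _

variable (i φ) in
/-- The inclusion of the cells of some degrees into those of more degrees. -/
noncomputable def map (hpq : ∀ n, p n → q n) : cell i φ p ⟶ cell i φ q :=
  Desc.hom
    { f := fun hQ x y => mk i φ (hpq _ hQ) x y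
      sm := fun α _ x y => (sm_mk α _ x y).symm
      move := fun _ _ σ h g x y => mk_move _ _ σ h g x y
      plug := fun _ _ w hN x y xs hy => mk_plug _ _ w hN x y xs hy
      pt_left := fun _ y => mk_pt_left _ y
      pt_right := fun _ x y t h => mk_pt_right _ x y t h }

@[simp] theorem map_mk (hpq : ∀ n, p n → q n) (hQ : p (Nat.card Q))
    (x : ((O.env A).obj (op Q)).el c k) (y : ∀ t, Y.el (e t) k) :
    SymSeq.ap (map i φ hpq) (mk i φ hQ x y) = mk i φ (hpq _ hQ) x y := Desc.hom_mk _ _ _ _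

variable (i φ) in
/-- The multilinear function `x ⊗ y`. -/
noncomputable def multi (hQ : p (Nat.card Q)) :
    MultiPairing ((O.env A).obj (op Q)) (fun _ : Q => Y) (cell i φ p) where
  f x y := mk i φ hQ x y
  sm α x y := (sm_mk α hQ x y).symm
  act h f x y := mk_act hQ h f x y
  pt_left y := mk_pt_left hQ y
  pt_right x y t h := mk_pt_right hQ x y t h

variable (i φ) in
/-- The map `O_A[Q] ⊗_{Σ_Q} Y^{⊗ Q} ⟶ cell`. -/
noncomputable def ξ (hQ : p (Nat.card Q)) : bal (O.env A) (pow Y) Q ⟶ cell i φ p :=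
  -- Invariance under permutations reduces to pure tensors with an index map, where it is the
  -- naturality relation of cells. The sorting bijections of the two sides then cancel.
  bal.descInv (multi i φ hQ).pairing fun τ c d k x w => by
    rcases tensor.cases (X := fun _ : Q => Y) w with rfl | ⟨e, y, h, rfl⟩
    · exact ((congrArg _ (SymSeq.ap_pt _)).trans (Pairing.pt_right _ _)).trans
        (Pairing.pt_right _ _).symm
    · have h₁ : SymSeq.ap ((pow Y).map (Quiver.Hom.op (X := Q) (Y := Q) τ)) (SymSeq.act
          ((pow Y).obj (op Q)) h (pow.mk y)) = SymSeq.act ((pow Y).obj (op Q))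
            ((DHom.reindex τ e).comp h) (pow.mk (T := Q) fun t => y (τ t)) := by
        rw [SymSeq.ap_act, pow.map_mk, SymSeq.act_act]
      refine (congrArg (Pairing.f _ _) h₁).trans ?_
      have h₂ := (multi i φ hQ).pairing.act DHom.id ((DHom.reindex τ e).comp h)
        (SymSeq.ap ((O.env A).map (Quiver.Hom.op (X := Q) (Y := Q) τ)) x)
        (pow.mk (T := Q) fun t => y (τ t))
      have h₃ := (multi i φ hQ).pairing.act DHom.id h x (pow.mk y)
      rw [SymSeq.act_id] at h₂ h₃
      refine h₂.trans (Eq.trans ?_ h₃.symm)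
      refine (congrArg (SymSeq.act _ _) ((MultiPairing.pairing_mk _ _ _).trans
        (mk_reindex hQ hQ τ x y))).trans
        (Eq.trans ?_ (congrArg (SymSeq.act _ _) (MultiPairing.pairing_mk _ _ _)).symm)
      rw [SymSeq.act_act, DHom.sum_comp, DHom.id_comp, ← DHom.comp_assoc, DHom.inv_reindex,
        DHom.id_comp]
      rfl

theorem ξ_mk (hQ : p (Nat.card Q)) (x : ((O.env A).obj (op Q)).el c k) (y : ∀ t, Y.el (e t) k) :
    SymSeq.ap (ξ i φ hQ) (bal.mk x (pow.mk y)) = mk i φ hQ x y :=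
  (bal.ap_descInv _ _ _ _).trans (MultiPairing.pairing_mk _ _ _)

end cell

end Cell
end Operad
end SymSpectra

/-! ### Mixed families from $X$ and $Y$, and the attaching map -/

namespace SymSpectra

section InArrow
variable {X Y : SymSeq.{u}} {i : X ⟶ Y} {b b' : Bool} {c d : Deg} {k l : Dop}

theorem inArrow_sm (α : k ⟶ l) (h : b = b') (z : ((arrow i).obj b).el c k) :
    inArrow (i := i) h (SymSeq.sm _ α z) = SymSeq.sm _ α (inArrow h z) := SymSeq.ap_sm _ _ _

theorem inArrow_act (f : DHom k c d) (h : b = b') (z : ((arrow i).obj b).el c k) :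
    inArrow (i := i) h (SymSeq.act _ f z) = SymSeq.act _ f (inArrow h z) := SymSeq.ap_act _ _ _

theorem inArrow_pt (h : b = b') :
    inArrow (i := i) h (SymSeq.pt _ : ((arrow i).obj b).el c k) = SymSeq.pt _ := SymSeq.ap_pt _

theorem inArrow_map {b'' : Bool} (f : b ⟶ b') (h' : b' = b'') (h : b = b'')
    (z : ((arrow i).obj b).el c k) :
    inArrow (i := i) h' (SymSeq.ap ((arrow i).map f) z) = inArrow h z := by
  subst h
  subst h'
  rw [Subsingleton.elim f (𝟙 _), (arrow i).map_id]
  rfl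

theorem inArrow_map_of_false (f : b ⟶ b') (h' : b' = true) (h : b = false)
    (z : ((arrow i).obj b).el c k) : inArrow (i := i) (b' := true) h'
      (SymSeq.ap ((arrow i).map f) z) = SymSeq.ap i (inArrow (b' := false) h z) := by
  subst h
  subst h'
  rfl

end InArrow

namespace Operad
variable {O : Operad.{u}} {A : O.Lt} {k : Dop} {Q Q' N N' S S' : FinBij} {c c' : Deg}

theorem env.plug_act_fam (w : N ⊕ S ≃ Q) {d d' : N → Deg} (g : ∀ r, DHom k (d r) (d' r))
    (x : ((O.env A).obj (op Q)).el c k) (b : ∀ r, A.A.el (d r) k) :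
    env.plug w x (fun r => A.A.act (g r) (b r)) =
      SymSeq.act _ ((DHom.id : DHom k c c).sum (DHom.fam g)) (env.plug (S := S) w x b) := by
  have h := env.plug_act_right w (Equiv.refl N) g x b
  rwa [show (Equiv.sumCongr (Equiv.refl N).symm (Equiv.refl S)).trans w = w from
    Equiv.ext (by rintro (r | s) <;> rfl)] at h

namespace cell
variable {X Y : SymSeq.{u}} {i : X ⟶ Y} {φ : X ⟶ A.A} {p q : ℕ → Prop}

section
variable (i φ)

/-- The element of filtration `|S|` obtained by plugging elements of `X` into the inputs `N` of an
element of `O_A[Q]`, with elements of `Y` at the other inputs. -/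
noncomputable def plugged (hS : p (Nat.card S)) (e : Q → Deg) (w : N ⊕ S ≃ Q)
    (x : ((O.env A).obj (op Q)).el c k) (xs : ∀ r, X.el (e (w (.inl r))) k)
    (ys : ∀ s, Y.el (e (w (.inr s))) k) : (cell i φ p).el (c.sum (Deg.sigma e)) k :=
  SymSeq.act _ (DHom.ungroup w c e) (mk i φ hS (env.plug w x fun r => SymSeq.ap φ (xs r)) ys)
end

/-- The element `plugged` is a cell symbol transported back to the index of $x$ and the full family.
Identities for it are proved after `group`, where the symbol itself is visible. -/
theorem act_group_plugged (hS : p (Nat.card S)) (e : Q → Deg) (w : N ⊕ S ≃ Q)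
    (x : ((O.env A).obj (op Q)).el c k) (xs : ∀ r, X.el (e (w (.inl r))) k)
    (ys : ∀ s, Y.el (e (w (.inr s))) k) :
    SymSeq.act _ (DHom.group w c e) (plugged i φ hS e w x xs ys) =
      mk i φ hS (env.plug w x fun r => SymSeq.ap φ (xs r)) ys := by
  unfold plugged
  rw [SymSeq.act_act, DHom.ungroup_group, SymSeq.act_id]

theorem plugged_act (hS : p (Nat.card S)) {e e' : Q → Deg} (w : N ⊕ S ≃ Q) (h : DHom k c c')
    (f : ∀ t, DHom k (e t) (e' t)) (x : ((O.env A).obj (op Q)).el c k)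
    (xs : ∀ r, X.el (e (w (.inl r))) k) (ys : ∀ s, Y.el (e (w (.inr s))) k) :
    plugged i φ hS e' w (SymSeq.act _ h x) (fun r => X.act (f _) (xs r))
      (fun s => Y.act (f _) (ys s)) =
      SymSeq.act _ (h.sum (DHom.fam f)) (plugged i φ hS e w x xs ys) := by
  refine SymSeq.act_injective (DHom.group_ungroup w c' e') ?_
  rw [act_group_plugged, SymSeq.act_act, DHom.sum_fam_group, ← SymSeq.act_act, act_group_plugged]
  refine Eq.trans ?_ (mk_act hS _ _ _ _)
  refine congrArg (fun x => mk i φ hS x _) ?_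
  simp only [SymSeq.ap_act]
  rw [env.plug_act_fam w (fun r => f (w (.inl r))), env.plug_act, SymSeq.act_act, DHom.sum_comp,
    DHom.comp_id, DHom.id_comp]

theorem sm_plugged {l : Dop} (α : k ⟶ l) (hS : p (Nat.card S)) (e : Q → Deg) (w : N ⊕ S ≃ Q)
    (x : ((O.env A).obj (op Q)).el c k) (xs : ∀ r, X.el (e (w (.inl r))) k)
    (ys : ∀ s, Y.el (e (w (.inr s))) k) : SymSeq.sm _ α (plugged i φ hS e w x xs ys) =
      plugged i φ hS e w (SymSeq.sm _ α x) (fun r => X.sm α (xs r)) fun s => Y.sm α (ys s) := by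
  unfold plugged
  rw [SymSeq.sm_act, sm_mk, env.sm_plug]
  simp only [SymSeq.ap_sm]
  rfl

theorem plugged_pt_left (hS : p (Nat.card S)) (e : Q → Deg) (w : N ⊕ S ≃ Q)
    (xs : ∀ r, X.el (e (w (.inl r))) k) (ys : ∀ s, Y.el (e (w (.inr s))) k) :
    plugged i φ hS e w (SymSeq.pt _ : ((O.env A).obj (op Q)).el c k) xs ys = SymSeq.pt _ := by
  unfold plugged
  rw [env.plug_pt, mk_pt_left, SymSeq.act_pt]

theorem plugged_pt_X (hS : p (Nat.card S)) (e : Q → Deg) (w : N ⊕ S ≃ Q)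
    (x : ((O.env A).obj (op Q)).el c k) (xs : ∀ r, X.el (e (w (.inl r))) k)
    (ys : ∀ s, Y.el (e (w (.inr s))) k) (r : N) (h : xs r = X.pt) :
    plugged i φ hS e w x xs ys = SymSeq.pt _ := by
  unfold plugged
  rw [env.plug_pt_right _ _ _ r (by rw [h, SymSeq.ap_pt]), mk_pt_left, SymSeq.act_pt]

theorem plugged_pt_Y (hS : p (Nat.card S)) (e : Q → Deg) (w : N ⊕ S ≃ Q)
    (x : ((O.env A).obj (op Q)).el c k) (xs : ∀ r, X.el (e (w (.inl r))) k)
    (ys : ∀ s, Y.el (e (w (.inr s))) k) (s : S) (h : ys s = Y.pt) :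
    plugged i φ hS e w x xs ys = SymSeq.pt _ := by
  unfold plugged
  rw [mk_pt_right _ _ _ s h, SymSeq.act_pt]

/-- The labels of the two parts of `Q` do not matter: a relabelling of `N` is absorbed by plugging,
one of `S` by naturality of the cell symbols. -/
theorem plugged_congr (hS : p (Nat.card S)) (hS' : p (Nat.card S')) (e : Q → Deg) (w : N ⊕ S ≃ Q)
    (σ : N' ≃ N) (τ : S' ≃ S) (x : ((O.env A).obj (op Q)).el c k)
    (xs : ∀ r, X.el (e (w (.inl r))) k) (ys : ∀ s, Y.el (e (w (.inr s))) k) :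
    plugged i φ hS' e ((Equiv.sumCongr σ τ).trans w) x (fun r => xs (σ r)) (fun s => ys (τ s)) =
      plugged i φ hS e w x xs ys := by
  refine SymSeq.act_injective (DHom.group_ungroup ((Equiv.sumCongr σ τ).trans w) c e) ?_
  refine (act_group_plugged hS' e ((Equiv.sumCongr σ τ).trans w) x (fun r => xs (σ r))
    fun s => ys (τ s)).trans (Eq.trans ?_ (Eq.trans (congrArg (fun h => SymSeq.act _ h _)
      (DHom.group_congr w c e σ τ)) ((SymSeq.act_act _ _ _).symm.trans (congrArg (SymSeq.act _ _)
        (act_group_plugged hS e w x xs ys)))).symm)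
  refine Eq.trans ?_ (mk_move hS hS' (e := fun s => e (w (.inr s)))
    (e' := fun s => e (w (.inr (τ s)))) τ ((DHom.id : DHom k c c).sum
      (DHom.sigma (c := fun r => e (w (.inl r))) σ fun _ => DHom.id)) (fun _ => DHom.id)
    (env.plug w x fun r => SymSeq.ap φ (xs r)) ys)
  have h₁ := env.plug_act_right (S := S) ((Equiv.sumCongr σ (Equiv.refl S)).trans w) σ
    (d := fun r => e (w (.inl r))) (fun r => DHom.id) x fun r => SymSeq.ap φ (xs r)
  rw [show (Equiv.sumCongr σ.symm (Equiv.refl S)).trans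
    ((Equiv.sumCongr σ (Equiv.refl S)).trans w) = w from
    Equiv.ext (by rintro (r | s) <;> simp)] at h₁
  have h₂ := env.map_plug (S' := S') ((Equiv.sumCongr σ (Equiv.refl S)).trans w) τ x
    fun r => SymSeq.ap φ (xs (σ r))
  simp only [SymSeq.act_id] at h₁ ⊢
  rw [← h₁, h₂]
  rw [show (Equiv.sumCongr (Equiv.refl N') τ).trans
    ((Equiv.sumCongr σ (Equiv.refl S)).trans w) = (Equiv.sumCongr σ τ).trans w from
    Equiv.ext (by rintro (r | s) <;> rfl)]
  rfl

theorem plugged_reindex (hS : p (Nat.card S)) (e : Q → Deg) (w : N ⊕ S ≃ Q') (τ : Q' ≃ Q)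
    (x : ((O.env A).obj (op Q)).el c k) (xs : ∀ r, X.el (e (τ (w (.inl r)))) k)
    (ys : ∀ s, Y.el (e (τ (w (.inr s)))) k) :
    plugged i φ hS (fun t => e (τ t)) w
      (SymSeq.ap ((O.env A).map (Quiver.Hom.op (X := Q') (Y := Q) τ)) x) xs ys =
      SymSeq.act _ ((DHom.id : DHom k c c).sum (DHom.sigma τ fun t =>
        (DHom.id : DHom k (e (τ t)) (e (τ t))))) (plugged i φ hS e (w.trans τ) x xs ys) := by
  refine SymSeq.act_injective (DHom.group_ungroup w c fun t => e (τ t)) ?_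
  refine (act_group_plugged hS (fun t => e (τ t)) w _ xs ys).trans (Eq.trans ?_ (Eq.symm
    ((SymSeq.act_act _ _ _).trans ((congrArg (fun h => SymSeq.act _ h _)
      (DHom.sum_sigma_group c e w τ)).trans (act_group_plugged hS e (w.trans τ) x xs ys)))))
  rw [env.plug_map]
  rfl

/-- The plugging relation, with both sides at the same index. -/
theorem mk_eq_plugged (hQ : p (Nat.card Q)) (hS : p (Nat.card S)) (e : Q → Deg) (w : N ⊕ S ≃ Q)
    (hN : Nonempty N) (x : ((O.env A).obj (op Q)).el c k) (y : ∀ t, Y.el (e t) k)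
    (xs : ∀ r, X.el (e (w (.inl r))) k) (hy : ∀ r, y (w (.inl r)) = SymSeq.ap i (xs r)) :
    mk i φ hQ x y = plugged i φ hS e w x xs fun s => y (w (.inr s)) := by
  refine SymSeq.act_injective (DHom.group_ungroup w c e) ?_
  rw [act_group_plugged, mk_plug hQ hS w hN x y xs hy]

/-- If further entries, at `N'`, come from $X$, then the relation of cells allows them to be plugged
in as well, and `env.plug_plug` merges the two insertions. The joint family enters as `zs` with
equations for its two parts, so that it may be any family with these restrictions. -/
theorem plugged_plug (e : Q → Deg) (w : N ⊕ (N'.sum S) ≃ Q) (hS : p (Nat.card S))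
    (hS' : p (Nat.card (N'.sum S))) (hN : Nonempty N')
    (x : ((O.env A).obj (op Q)).el c k) (xs : ∀ r, X.el (e (w (.inl r))) k)
    (ys : ∀ s, Y.el (e (w (.inr s))) k) (xs' : ∀ r, X.el (e (w (.inr (.inl r)))) k)
    (hy : ∀ r, ys (.inl r) = SymSeq.ap i (xs' r)) (zs : ∀ r : N ⊕ N', X.el (e
      (w (Equiv.sumAssoc N N' S (.inl r)))) k) (hz : ∀ r, zs (.inl r) = xs r)
    (hz' : ∀ r, zs (.inr r) = xs' r) :
    plugged i φ (S := N'.sum S) hS' e w x xs ys =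
      plugged i φ (N := N.sum N') hS e ((Equiv.sumAssoc N N' S).trans w) x zs
        fun s => ys (.inr s) := by
  refine SymSeq.act_injective (DHom.group_ungroup (S := N'.sum S) w c e) ?_
  refine SymSeq.act_injective (DHom.group_ungroup (N := N') (S := S) (Q := N'.sum S)
    (Equiv.refl _) _ fun s => e (w (.inr s))) ?_
  rw [act_group_plugged]
  refine (mk_plug (N := N') (Q := N'.sum S) hS' hS (Equiv.refl _) hN _ ys xs' hy).symm.trans ?_
  refine Eq.trans ?_ (Eq.symm ((SymSeq.act_act _ _ _).trans ((congrArg (fun h => SymSeq.act _ h _)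
    (DHom.group_group c e w)).trans ((SymSeq.act_act _ _ _).symm.trans (congrArg (SymSeq.act _ _)
      (act_group_plugged (N := N.sum N') (S := S) hS e ((Equiv.sumAssoc N N' S).trans w) x zs
        fun s => ys (.inr s)))))))
  refine Eq.trans ?_ (mk_act_left hS _ _ _)
  refine congrArg (fun x => mk i φ hS x fun s => ys (.inr s)) ?_
  refine (env.plug_plug (N := N) (N' := N') (S := S) (Q' := N'.sum S) w (Equiv.refl _) x _ _).trans
    (Eq.trans ?_ (SymSeq.act_act _ _ _))
  refine congrArg (SymSeq.act _ _) ?_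
  have h := env.plug_act_fam (N := N.sum N') ((Equiv.sumAssoc N N' S).trans w)
    (DHom.elimId fun r => e (w ((Equiv.sumAssoc N N' S) (.inl r)))) x fun r => SymSeq.ap φ (zs r)
  refine Eq.trans ?_ h
  refine (congrArg (fun w => env.plug (N := N.sum N') (S := S) w x _) (show _ =
    (Equiv.sumAssoc N N' S).trans w from Equiv.ext (by rintro ((r | r) | s) <;> rfl))).trans ?_
  refine congrArg (env.plug (N := N.sum N') (S := S) _ x) (funext ?_)
  rintro (r | r)
  · exact (congrArg (SymSeq.ap φ) (hz r).symm).trans (SymSeq.act_id _).symm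
  · exact (congrArg (SymSeq.ap φ) (hz' r).symm).trans (SymSeq.act_id _).symm

section Mixed
variable {e : Q → Deg} {χ χ' : Q → Bool}

/-- Any splitting of `Q` adapted to `χ` is a relabelling of the canonical one into the two fibres of
`χ`. Through `plugged_congr`, `mixed` can therefore be computed with any adapted splitting
(`mixed_eq`). -/
theorem exists_sumCongr (χ : Q → Bool) (w : N ⊕ S ≃ Q) (hX : ∀ r, χ (w (.inl r)) = false)
    (hY : ∀ s, χ (w (.inr s)) = true) : ∃ (σ : N ≃ {t // χ t = false}) (τ : S ≃ {t // ¬ χ t = false}),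
      w = (Equiv.sumCongr σ τ).trans (Equiv.sumCompl fun t => χ t = false) := by
  obtain ⟨σ, τ, h⟩ := sumCongr_of_isLeft (w.trans (Equiv.sumCompl fun t => χ t = false).symm)
    (fun r => by simp [Equiv.sumCompl_symm_apply_of_pos (p := fun t => χ t = false) (hX r)])
    (fun r => by simp [Equiv.sumCompl_symm_apply_of_neg (p := fun t => χ t = false)
      (a := w (.inr r)) (by simp [hY r])])
  refine ⟨σ, τ, ?_⟩
  rw [← h, Equiv.trans_assoc, Equiv.symm_trans_self, Equiv.trans_refl]

theorem card_eq_of_split (χ : Q → Bool) (w : N ⊕ S ≃ Q) (hX : ∀ r, χ (w (.inl r)) = false)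
    (hY : ∀ s, χ (w (.inr s)) = true) : Nat.card S = Nat.card {t // ¬ χ t = false} := by
  obtain ⟨σ, τ, -⟩ := exists_sumCongr χ w hX hY
  exact Nat.card_congr τ

variable (i φ) in
/-- Plugging in the elements of `X` of a mixed family of elements of `X` and `Y`. -/
noncomputable def mixed (χ : Q → Bool) (hp : p (Nat.card {t // ¬ χ t = false}))
    (x : ((O.env A).obj (op Q)).el c k) (z : ∀ t, ((arrow i).obj (χ t)).el (e t) k) :
    (cell i φ p).el (c.sum (Deg.sigma e)) k :=
  plugged i φ (N := ⟨{t // χ t = false}⟩) (S := ⟨{t // ¬ χ t = false}⟩) hp e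
    (Equiv.sumCompl fun t => χ t = false) x (fun r => inArrow (b' := false) r.2 (z r.1))
    fun s => inArrow (b' := true) (Bool.eq_true_of_not_eq_false s.2) (z s.1)

theorem mixed_eq (hp : p (Nat.card {t // ¬ χ t = false})) (hS : p (Nat.card S)) (w : N ⊕ S ≃ Q)
    (hX : ∀ r, χ (w (.inl r)) = false) (hY : ∀ s, χ (w (.inr s)) = true)
    (x : ((O.env A).obj (op Q)).el c k) (z : ∀ t, ((arrow i).obj (χ t)).el (e t) k) :
    mixed i φ χ hp x z = plugged i φ hS e w x (fun r => inArrow (b' := false) (hX r) (z _))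
      fun s => inArrow (b' := true) (hY s) (z _) := by
  obtain ⟨σ, τ, rfl⟩ := exists_sumCongr χ w hX hY
  exact (plugged_congr (N := ⟨{t // χ t = false}⟩) (S := ⟨{t // ¬ χ t = false}⟩) hp hS e
    (Equiv.sumCompl fun t => χ t = false) σ τ x (fun r => inArrow (b' := false) r.2 (z r.1))
    fun s => inArrow (b' := true) (Bool.eq_true_of_not_eq_false s.2) (z s.1)).symm

variable (i φ) in
-- The component of the attaching map at the vertex `χ` of the cube.
noncomputable def mixedMulti (χ : Q → Bool) (hp : p (Nat.card {t // ¬ χ t = false})) :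
    MultiPairing ((O.env A).obj (op Q)) (fun t => (arrow i).obj (χ t)) (cell i φ p) where
  f x z := mixed i φ χ hp x z
  sm α x v := (congrArg₂ (plugged i φ (N := ⟨{t // χ t = false}⟩) (S := ⟨{t // ¬ χ t = false}⟩) hp _
      (Equiv.sumCompl fun t => χ t = false) (SymSeq.sm _ α x))
    (funext fun r => inArrow_sm α _ (v r.1)) (funext fun s => inArrow_sm α _ (v s.1))).trans
      (sm_plugged (N := ⟨{t // χ t = false}⟩) (S := ⟨{t // ¬ χ t = false}⟩) α hp _
        (Equiv.sumCompl fun t => χ t = false) x _ _).symm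
  act h f x v := (congrArg₂ (plugged i φ (N := ⟨{t // χ t = false}⟩)
      (S := ⟨{t // ¬ χ t = false}⟩) hp _ (Equiv.sumCompl fun t => χ t = false) (SymSeq.act _ h x))
    (funext fun r => inArrow_act (f r.1) _ (v r.1))
    (funext fun s => inArrow_act (f s.1) _ (v s.1))).trans
      (plugged_act (N := ⟨{t // χ t = false}⟩) (S := ⟨{t // ¬ χ t = false}⟩) hp
        (Equiv.sumCompl fun t => χ t = false) h f x _ _)
  pt_left v := plugged_pt_left (N := ⟨{t // χ t = false}⟩) (S := ⟨{t // ¬ χ t = false}⟩) hp _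
    (Equiv.sumCompl fun t => χ t = false) _ _
  pt_right x v t h := by
    by_cases ht : χ t = false
    · exact plugged_pt_X (N := ⟨{t // χ t = false}⟩) (S := ⟨{t // ¬ χ t = false}⟩) hp _
        (Equiv.sumCompl fun t => χ t = false) x _ _ ⟨t, ht⟩
        ((congrArg (inArrow (b' := false) ht) h).trans (inArrow_pt _))
    · exact plugged_pt_Y (N := ⟨{t // χ t = false}⟩) (S := ⟨{t // ¬ χ t = false}⟩) hp _
        (Equiv.sumCompl fun t => χ t = false) x _ _ ⟨t, ht⟩
        ((congrArg (inArrow (b' := true) (Bool.eq_true_of_not_eq_false ht)) h).trans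
          (inArrow_pt _))

/-- The splitting by the fibres of `χ ∘ τ` becomes, after composition with `τ`, a splitting adapted
to `χ`. Thus `mixed_eq` reduces the claim to `plugged_reindex`. -/
theorem mixed_reindex {χ : Q → Bool} (τ : Q' ≃ Q) (hp : p (Nat.card {t // ¬ χ t = false}))
    (hp' : p (Nat.card {t // ¬ χ (τ t) = false})) (x : ((O.env A).obj (op Q)).el c k)
    (z : ∀ t, ((arrow i).obj (χ t)).el (e t) k) :
    mixed i φ (fun t => χ (τ t)) hp'
      (SymSeq.ap ((O.env A).map (Quiver.Hom.op (X := Q') (Y := Q) τ)) x) (fun t => z (τ t)) =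
      SymSeq.act _ ((DHom.id : DHom k c c).sum (DHom.sigma τ fun t =>
        (DHom.id : DHom k (e (τ t)) (e (τ t))))) (mixed i φ χ hp x z) := by
  rw [mixed_eq (N := ⟨{t // χ (τ t) = false}⟩) (S := ⟨{t // ¬ χ (τ t) = false}⟩) hp hp'
    ((Equiv.sumCompl fun t => χ (τ t) = false).trans τ) (fun r => r.2) (fun s => Bool.eq_true_of_not_eq_false s.2)]
  exact plugged_reindex (N := ⟨{t // χ (τ t) = false}⟩) (S := ⟨{t // ¬ χ (τ t) = false}⟩) hp' e
    (Equiv.sumCompl fun t => χ (τ t) = false) τ x _ _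

/-- Compatibility with the edges of the cube. An entry from $X$ may be plugged in directly, or first
be regarded as an entry $i(x)$ from $Y$; in the second case the plugging relation of cells removes
it afterwards. -/
theorem mixed_map (hp : p (Nat.card {t // ¬ χ t = false})) (hp' : p (Nat.card {t // ¬ χ' t = false}))
    (h : ∀ t, χ t ⟶ χ' t) (x : ((O.env A).obj (op Q)).el c k)
    (z : ∀ t, ((arrow i).obj (χ t)).el (e t) k) :
    mixed i φ χ' hp' x (fun t => SymSeq.ap ((arrow i).map (h t)) (z t)) = mixed i φ χ hp x z := by
  have hle (t) (ht : χ' t = false) : χ t = false := by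
    have := leOfHom (h t)
    rw [ht] at this
    exact le_antisymm this (Bool.false_le _)
  -- `N` consists of the factors that are in $X$ at both vertices, `N'` of those passing from $X$ to
  -- $Y$, and `S` of those in $Y$ at both vertices.
  let N : FinBij := ⟨{t // χ' t = false}⟩
  let N' : FinBij := ⟨{s : {t // ¬ χ' t = false} // χ s.1 = false}⟩
  let S : FinBij := ⟨{s : {t // ¬ χ' t = false} // ¬ χ s.1 = false}⟩
  -- The plugging relation requires at least one input to be plugged. If there is none, the two
  -- vertices coincide and the edge is an identity.
  by_cases hN : Nonempty N'
  · let w : N ⊕ (N'.sum S) ≃ Q := (Equiv.sumCongr (Equiv.refl N) (Equiv.sumCompl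
      fun s : {t // ¬ χ' t = false} => χ s.1 = false)).trans (Equiv.sumCompl fun t => χ' t = false)
    have hX' : ∀ r, χ' (w (.inl r)) = false := fun r => r.2
    have hY' : ∀ s, χ' (w (.inr s)) = true := by
      rintro (s | s)
      · exact Bool.eq_true_of_not_eq_false s.1.2
      · exact Bool.eq_true_of_not_eq_false s.1.2
    have hX : ∀ r : N ⊕ N', χ (w (Equiv.sumAssoc N N' S (.inl r))) = false := by
      rintro (r | r)
      · exact hle _ r.2
      · exact r.2
    have hY : ∀ s, χ (w (Equiv.sumAssoc N N' S (.inr s))) = true := fun s => Bool.eq_true_of_not_eq_false s.2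
    have hS' : p (Nat.card (N'.sum S)) := by rwa [card_eq_of_split (S := N'.sum S) χ' w hX' hY']
    have hS : p (Nat.card S) := by
      rwa [card_eq_of_split (N := N.sum N') χ ((Equiv.sumAssoc N N' S).trans w) hX hY]
    rw [mixed_eq (S := N'.sum S) hp' hS' w hX' hY', mixed_eq (N := N.sum N') hp hS
      ((Equiv.sumAssoc N N' S).trans w) hX hY]
    refine (plugged_plug e w hS hS' hN x _ _ (fun r => inArrow (b' := false) (hX (.inr r)) (z _))
      (fun r => inArrow_map_of_false (h _) _ _ _) (fun r => inArrow (b' := false) (hX r) (z _))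
      (fun r => (inArrow_map (h _) _ _ _).symm) fun r => rfl).trans ?_
    exact congrArg (plugged i φ (N := N.sum N') hS e ((Equiv.sumAssoc N N' S).trans w) x _)
      (funext fun s => inArrow_map (h _) _ _ _)
  · obtain rfl : χ = χ' := funext fun t => by
      rcases ht : χ' t with _ | _
      · exact hle t ht
      · by_contra h'
        exact hN ⟨⟨⟨t, by simp [ht]⟩, by simpa using h'⟩⟩
    refine congrArg (mixed i φ χ hp x) (funext fun t => ?_)
    rw [Subsingleton.elim (h t) (𝟙 _), (arrow i).map_id]
    rfl

end Mixed

section FStar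
variable (hp : ∀ χ : Punctured Q, p (Nat.card {t // ¬ χ.obj t = false}))

/-- Extends `mixed_map` from pure tensors to all elements of the vertex, by pulling out index maps.
With it the components form a cocone on the punctured cube. -/
theorem mixedMulti_map {χ χ' : Punctured Q} (h : χ ⟶ χ') {d : Deg}
    (x : ((O.env A).obj (op Q)).el c k) (w : ((puncturedCube i Q).obj χ).el d k) :
    (mixedMulti i φ χ'.obj (hp χ')).pairing.f x (SymSeq.ap ((puncturedCube i Q).map h) w) =
      (mixedMulti i φ χ.obj (hp χ)).pairing.f x w := by
  rcases tensor.cases (X := fun t => (arrow i).obj (χ.obj t)) w with rfl | ⟨e, z, g, rfl⟩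
  · exact ((congrArg _ (SymSeq.ap_pt _)).trans (Pairing.pt_right _ _)).trans
      (Pairing.pt_right _ _).symm
  · have h₁ : SymSeq.ap ((puncturedCube i Q).map h) (SymSeq.act (tensor fun t =>
        (arrow i).obj (χ.obj t)) g (tensor.mk z)) = SymSeq.act (tensor fun t =>
          (arrow i).obj (χ'.obj t)) g (tensor.mk fun t =>
            SymSeq.ap ((arrow i).map (h.hom t)) (z t)) :=
      (SymSeq.ap_act _ _ _).trans (congrArg (SymSeq.act _ g)
        ((tensorMap_mk (X := fun t => (arrow i).obj (χ.obj t))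
          (Y := fun t => (arrow i).obj (χ'.obj t)) (Equiv.refl Q) (fun t => (arrow i).map
          (h.hom t)) e z).trans (SymSeq.act_id _)))
    refine (congrArg (Pairing.f _ _) h₁).trans ?_
    have h₂ := (mixedMulti i φ χ'.obj (hp χ')).pairing.act DHom.id g x (tensor.mk fun t =>
      SymSeq.ap ((arrow i).map (h.hom t)) (z t))
    have h₃ := (mixedMulti i φ χ.obj (hp χ)).pairing.act DHom.id g x (tensor.mk z)
    rw [SymSeq.act_id, MultiPairing.pairing_mk] at h₂ h₃
    refine h₂.trans (Eq.trans ?_ h₃.symm)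
    exact congrArg (SymSeq.act _ _) (mixed_map (hp χ) (hp χ') h.hom x z)

variable [Nonempty Q]

/-- The vertex with all factors from $X$ is punctured as soon as `Q` has a point. -/
instance : Nonempty (Punctured Q) := ⟨⟨fun _ => false, Classical.arbitrary Q, rfl⟩⟩

variable (i φ) in
/-- The bilinear function underlying the attaching map. -/
noncomputable def fStarPairing :
    Pairing ((O.env A).obj (op Q)) ((SymSpectra.Q i).obj (op Q)) (cell i φ p) :=
  Pairing.ofColimit (colimit.isColimit (puncturedCube i Q))
    (fun χ => (mixedMulti i φ χ.obj (hp χ)).pairing) fun h _ _ _ x w => mixedMulti_map hp h x w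

theorem fStarPairing_mk (χ : Punctured Q) {e : Q → Deg} (x : ((O.env A).obj (op Q)).el c k)
    (z : ∀ t, ((arrow i).obj (χ.obj t)).el (e t) k) :
    (fStarPairing i φ hp).f x (SymSpectra.Q.mk χ z) = mixed i φ χ.obj (hp χ) x z :=
  (Pairing.ofColimit_ι (colimit.isColimit (puncturedCube i Q))
    (fun χ => (mixedMulti i φ χ.obj (hp χ)).pairing) (fun h _ _ _ x w => mixedMulti_map hp h x w) χ x (tensor.mk z)).trans
    (MultiPairing.pairing_mk _ _ _)

variable (i φ) in
/-- The attaching map `O_A[Q] ⊗_{Σ_Q} Q^{t}_{t-1} ⟶ cell`. -/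
noncomputable def fStar : bal (O.env A) (SymSpectra.Q i) Q ⟶ cell i φ p :=
  bal.descInv (fStarPairing i φ hp) fun τ c d k x w => by
    rcases QObj.cases (i := i) w with rfl | ⟨χ, e, z, g, rfl⟩
    · exact ((congrArg _ (SymSeq.ap_pt _)).trans (Pairing.pt_right _ _)).trans
        (Pairing.pt_right _ _).symm
    · have h₁ : SymSeq.ap ((SymSpectra.Q i).map (Quiver.Hom.op (X := Q) (Y := Q) τ)) (SymSeq.act
          ((SymSpectra.Q i).obj (op Q)) g (SymSpectra.Q.mk χ z)) = SymSeq.act ((SymSpectra.Q i).obj (op Q))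
            ((DHom.reindex τ e).comp g) (SymSpectra.Q.mk (i := i) (χ.reindex τ) fun t => z (τ t)) := by
        rw [SymSeq.ap_act, SymSpectra.Q.map_mk, SymSeq.act_act]
      refine (congrArg (Pairing.f _ _) h₁).trans ?_
      have h₂ := (fStarPairing i φ hp).act DHom.id ((DHom.reindex τ e).comp g)
        (SymSeq.ap ((O.env A).map (Quiver.Hom.op (X := Q) (Y := Q) τ)) x)
        (SymSpectra.Q.mk (i := i) (χ.reindex τ) fun t => z (τ t))
      have h₃ := (fStarPairing i φ hp).act DHom.id g x (SymSpectra.Q.mk χ z)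
      rw [SymSeq.act_id] at h₂ h₃
      refine h₂.trans (Eq.trans ?_ (h₃.trans (congrArg (SymSeq.act _ _)
        (fStarPairing_mk hp χ x z))).symm)
      refine (congrArg (SymSeq.act _ _) ((fStarPairing_mk hp (χ.reindex τ) _ _).trans
        (mixed_reindex (χ := χ.obj) τ (hp χ) (hp (χ.reindex τ)) x z))).trans ?_
      rw [SymSeq.act_act, DHom.sum_comp, DHom.id_comp, ← DHom.comp_assoc, DHom.inv_reindex,
        DHom.id_comp]

theorem fStar_mk (χ : Punctured Q) {e : Q → Deg} (x : ((O.env A).obj (op Q)).el c k)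
    (z : ∀ t, ((arrow i).obj (χ.obj t)).el (e t) k) :
    SymSeq.ap (fStar i φ hp) (bal.mk x (SymSpectra.Q.mk χ z)) = mixed i φ χ.obj (hp χ) x z :=
  (bal.ap_descInv _ _ _ _).trans (fStarPairing_mk hp χ x z)

end FStar

end cell
end Operad
end SymSpectra

/-! ### Empty sets of inputs, and extensionality on balanced tensor products -/

namespace SymSpectra

namespace DHom
variable {k : Dop} (c : Deg) {Q : FinBij} [IsEmpty Q] (e : Q → Deg)

/-- Adding an empty disjoint union. -/
def sumEmpty : DHom k c (c.sum (Deg.sigma e)) :=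
  ofEquiv (d := c.sum (Deg.sigma e)) (Equiv.sumEmpty c.R (Σ x, (e x).R))
    (Equiv.sumEmpty c.N (Σ x, (e x).N))

/-- Dropping an empty disjoint union. -/
def dropEmpty : DHom k (c.sum (Deg.sigma e)) c :=
  ofEquiv (c := c.sum (Deg.sigma e)) (Equiv.sumEmpty c.R (Σ x, (e x).R)).symm
    (Equiv.sumEmpty c.N (Σ x, (e x).N)).symm

theorem sumEmpty_dropEmpty : (sumEmpty c e : DHom k _ _).comp (dropEmpty c e) = id := by
  unfold sumEmpty dropEmpty
  rw [ofEquiv_comp, Equiv.symm_trans_self, Equiv.symm_trans_self]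
  rfl

theorem dropEmpty_sumEmpty : (dropEmpty c e : DHom k _ _).comp (sumEmpty c e) = id := by
  unfold sumEmpty dropEmpty
  rw [ofEquiv_comp, Equiv.self_trans_symm, Equiv.self_trans_symm]
  rfl

/-- Over empty sets there is nothing for `g` to act on, so it drops out. -/
theorem sumEmpty_nat {Q' : FinBij} [IsEmpty Q'] {c c' : Deg} {e : Q → Deg} {e' : Q' → Deg}
    (h : DHom k c c') (g : DHom k (Deg.sigma e) (Deg.sigma e')) :
    (sumEmpty c e).comp (h.sum g) = h.comp (sumEmpty c' e') := by
  ext1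
  · refine Equiv.ext ?_
    rintro (x | ⟨q, x⟩)
    · rfl
    · exact (IsEmpty.false q).elim
  · refine Lab.ext (funext ?_)
    rintro (x | ⟨q, x⟩)
    · rcases h' : h.lab.g x with y | y <;> simp [DHom.comp, sumEmpty, ofEquiv, DHom.sum, Lab.comp,
        Lab.sum, Lab.ofEquiv, h']
    · exact (IsEmpty.false q).elim

theorem dropEmpty_nat {Q' : FinBij} [IsEmpty Q'] {c c' : Deg} {e : Q → Deg} {e' : Q' → Deg}
    (h : DHom k c c') (g : DHom k (Deg.sigma e) (Deg.sigma e')) :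
    (h.sum g).comp (dropEmpty c' e') = (dropEmpty c e).comp h := by
  rw [← id_comp ((h.sum g).comp _), ← dropEmpty_sumEmpty c e, comp_assoc, ← comp_assoc (sumEmpty c e),
    sumEmpty_nat, comp_assoc, sumEmpty_dropEmpty, comp_id]

end DHom

theorem inArrow_inArrow_symm {X Y : SymSeq.{u}} {i : X ⟶ Y} {b b' : Bool} (h : b = b') {c : Deg}
    {k : Dop} (z : ((arrow i).obj b').el c k) :
    inArrow (i := i) h (inArrow h.symm z) = z := by
  subst h
  rfl

section BalExt
variable {M : FinBijᵒᵖ ⥤ SymSeq.{u}} {T : FinBij} {X Y Z : SymSeq.{u}} {i : X ⟶ Y}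

theorem bal.hom_ext_Q [Nonempty T] {f g : bal M (Q i) T ⟶ Z}
    (h : ∀ k c (x : (M.obj (op T)).el c k) (χ : Punctured T) (e : T → Deg)
      (z : ∀ t, ((arrow i).obj (χ.obj t)).el (e t) k),
      SymSeq.ap f (bal.mk x (Q.mk χ z)) = SymSeq.ap g (bal.mk x (Q.mk χ z))) : f = g :=
  bal.hom_ext fun k c d x w => by
    rcases QObj.cases (i := i) w with rfl | ⟨χ, e, z, a, rfl⟩
    · exact ((congrArg _ (bal.mk_pt_right x)).trans (SymSeq.ap_pt f)).trans
        ((congrArg _ (bal.mk_pt_right x)).trans (SymSeq.ap_pt g)).symm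
    · have h₁ := bal.mk_act (M := M) (W := Q i) DHom.id a x (Q.mk χ z)
      rw [SymSeq.act_id] at h₁
      refine (congrArg (SymSeq.ap f) h₁).trans (Eq.trans ?_ (congrArg (SymSeq.ap g) h₁).symm)
      rw [SymSeq.ap_act, SymSeq.ap_act]
      exact congrArg _ (h k c x χ e z)

theorem bal.hom_ext_pow {f g : bal M (pow Y) T ⟶ Z}
    (h : ∀ k c (x : (M.obj (op T)).el c k) (e : T → Deg) (y : ∀ t, Y.el (e t) k),
      SymSeq.ap f (bal.mk x (pow.mk y)) = SymSeq.ap g (bal.mk x (pow.mk y))) : f = g :=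
  bal.hom_ext fun k c d x w => by
    rcases tensor.cases (X := fun _ : T => Y) w with rfl | ⟨e, y, a, rfl⟩
    · exact ((congrArg _ (bal.mk_pt_right x)).trans (SymSeq.ap_pt f)).trans
        ((congrArg _ (bal.mk_pt_right x)).trans (SymSeq.ap_pt g)).symm
    · have h₁ := bal.mk_act (M := M) (W := pow Y) DHom.id a x (pow.mk y)
      rw [SymSeq.act_id] at h₁
      refine (congrArg (SymSeq.ap f) h₁).trans (Eq.trans ?_ (congrArg (SymSeq.ap g) h₁).symm)
      rw [SymSeq.ap_act, SymSeq.ap_act]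
      exact congrArg _ (h k c x e y)

end BalExt

/-! ### The pushout squares -/

namespace Operad
variable {O : Operad.{u}} {A : O.Lt} {k : Dop} {Q Q' N N' S S' T : FinBij} {c c' : Deg}
namespace cell
variable {X Y : SymSeq.{u}} {i : X ⟶ Y} {φ : X ⟶ A.A} {p q : ℕ → Prop}

theorem map_plugged (hpq : ∀ n, p n → q n) (hS : p (Nat.card S)) (e : Q → Deg) (w : N ⊕ S ≃ Q)
    (x : ((O.env A).obj (op Q)).el c k) (xs : ∀ r, X.el (e (w (.inl r))) k)
    (ys : ∀ s, Y.el (e (w (.inr s))) k) :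
    SymSeq.ap (map i φ hpq) (plugged i φ hS e w x xs ys) = plugged i φ (hpq _ hS) e w x xs ys := by
  unfold plugged
  rw [SymSeq.ap_act, map_mk]

/-- The attaching map is defined on a model set `T`. A symbol over any `Q` of the same size can be
transported to `T`, and the result does not depend on the bijection. -/
theorem fStar_map [Nonempty T] (hp : ∀ χ : Punctured T, p (Nat.card {t // ¬ χ.obj t = false}))
    (σ : T ≃ Q) (χ : Punctured Q) (hp' : p (Nat.card {t // ¬ χ.obj t = false})) {e : Q → Deg}
    (x : ((O.env A).obj (op Q)).el c k) (z : ∀ t, ((arrow i).obj (χ.obj t)).el (e t) k) :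
    SymSeq.ap (fStar i φ hp) (bal.mk
      (SymSeq.ap ((O.env A).map (Quiver.Hom.op (X := T) (Y := Q) σ)) x)
      (SymSeq.ap ((SymSpectra.Q i).map (Quiver.Hom.op (X := T) (Y := Q) σ))
        (SymSpectra.Q.mk χ z))) = mixed i φ χ.obj hp' x z := by
  have h := bal.mk_act (M := O.env A) (W := SymSpectra.Q i) DHom.id (DHom.reindex σ e)
    (SymSeq.ap ((O.env A).map (Quiver.Hom.op (X := T) (Y := Q) σ)) x)
    (SymSpectra.Q.mk (i := i) (χ.reindex σ) fun t => z (σ t))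
  rw [SymSeq.act_id] at h
  refine (congrArg (SymSeq.ap (fStar i φ hp)) ((congrArg (bal.mk _)
    (SymSpectra.Q.map_mk (i := i) σ χ z)).trans h)).trans ?_
  refine (SymSeq.ap_act _ _ _).trans ((congrArg (SymSeq.act _ _) ((fStar_mk hp (χ.reindex σ) _ _).trans
    (mixed_reindex (χ := χ.obj) σ hp' (hp (χ.reindex σ)) x z))).trans ?_)
  rw [SymSeq.act_act, DHom.sum_comp, DHom.id_comp, DHom.inv_reindex, DHom.id_sum_id, SymSeq.act_id]

theorem ξ_map (hT : p (Nat.card T)) (hQ : p (Nat.card Q)) (σ : T ≃ Q) {e : Q → Deg}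
    (x : ((O.env A).obj (op Q)).el c k) (y : ∀ t, Y.el (e t) k) :
    SymSeq.ap (ξ i φ hT) (bal.mk
      (SymSeq.ap ((O.env A).map (Quiver.Hom.op (X := T) (Y := Q) σ)) x)
      (SymSeq.ap ((pow Y).map (Quiver.Hom.op (X := T) (Y := Q) σ)) (pow.mk y))) =
      mk i φ hQ x y := by
  have h := bal.mk_act (M := O.env A) (W := pow Y) DHom.id (DHom.reindex σ e)
    (SymSeq.ap ((O.env A).map (Quiver.Hom.op (X := T) (Y := Q) σ)) x)
    (pow.mk (T := T) fun t => y (σ t))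
  rw [SymSeq.act_id, ← pow.map_mk] at h
  rw [h, SymSeq.ap_act, ξ_mk, mk_reindex hQ hT σ x y, SymSeq.act_act, DHom.sum_comp, DHom.id_comp,
    DHom.inv_reindex, DHom.id_sum_id, SymSeq.act_id]

section Pushout
variable {t : ℕ}

/-- A punctured vertex has a factor from $X$, so at most `t` factors from $Y$ remain. For this
reason the attaching map lands in the stage $A_t$. -/
theorem card_compl_le (hT : Nat.card T = t + 1) (χ : Punctured T) :
    Nat.card {s // ¬ χ.obj s = false} ≤ t := by
  obtain ⟨s, hs⟩ := χ.property
  have : Nat.card {s // ¬ χ.obj s = false} < Nat.card T :=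
    Finite.card_subtype_lt (p := fun s => ¬ χ.obj s = false) (x := s) (by simpa using hs)
  omega

/-- In degree at most `t + 1` both composites are available as cell symbols: one has the factors
from $X$ plugged in, the other has them mapped to $Y$ by `i`. They agree by the plugging relation.
-/
theorem fStar_comp_map [Nonempty T] (hT : Nat.card T = t + 1) :
    fStar i φ (p := (· ≤ t)) (card_compl_le hT) ≫ map i φ (fun _ h => Nat.le_succ_of_le h) =
      balMap (O.env A) (iStar i) T ≫ ξ i φ (p := (· ≤ t + 1)) hT.le := by
  refine bal.hom_ext_Q fun k c x χ e z => ?_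
  rw [SymSeq.ap_comp, SymSeq.ap_comp, fStar_mk, balMap_mk, iStar_mk]
  refine Eq.trans ?_ (ξ_mk (i := i) (φ := φ) (p := (· ≤ t + 1)) hT.le x fun s =>
    SymSeq.ap ((arrow i).map (homOfLE (Bool.le_true (χ.obj s)))) (z s)).symm
  obtain ⟨s, hs⟩ := χ.property
  refine (map_plugged (N := ⟨{t // χ.obj t = false}⟩) (S := ⟨{t // ¬ χ.obj t = false}⟩) _
    (card_compl_le hT χ) e (Equiv.sumCompl fun t => χ.obj t = false) x _ _).trans ?_
  refine Eq.trans ?_ (mk_eq_plugged (N := ⟨{t // χ.obj t = false}⟩)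
    (S := ⟨{t // ¬ χ.obj t = false}⟩) hT.le (Nat.le_succ_of_le (card_compl_le hT χ)) e
    (Equiv.sumCompl fun t => χ.obj t = false) ⟨⟨s, hs⟩⟩ x _
    (fun r => inArrow (b' := false) r.2 (z r.1)) fun r =>
      inArrow_map_of_false (homOfLE (Bool.le_true (χ.obj r.1))) rfl r.2 (z r.1)).symm
  refine congrArg (plugged i φ (N := ⟨{t // χ.obj t = false}⟩) (S := ⟨{t // ¬ χ.obj t = false}⟩)
    _ e (Equiv.sumCompl fun t => χ.obj t = false) x _) (funext fun s => ?_)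
  exact (inArrow_map (homOfLE (Bool.le_true (χ.obj s.1))) rfl
    (Bool.eq_true_of_not_eq_false s.2) (z s.1)).symm

section Desc
variable {Z : SymSeq.{u}} (v : bal (O.env A) (pow Y) T ⟶ Z)

/-- The value of `v` on a symbol over a set `Q` of the size of `T`, by transport to `T` along `σ`.
-/
noncomputable def top (σ : T ≃ Q) {d : Deg} (x : ((O.env A).obj (op Q)).el c k)
    (w : ((pow Y).obj (op Q)).el d k) : Z.el (c.sum d) k :=
  SymSeq.ap v (bal.mk (SymSeq.ap ((O.env A).map (Quiver.Hom.op (X := T) (Y := Q) σ)) x)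
    (SymSeq.ap ((pow Y).map (Quiver.Hom.op (X := T) (Y := Q) σ)) w))

theorem ap_map_map (F : FinBijᵒᵖ ⥤ SymSeq.{u}) {d : Deg} (σ : T ≃ Q') (ρ : Q' ≃ Q)
    (x : (F.obj (op Q)).el d k) :
    SymSeq.ap (F.map (Quiver.Hom.op (X := T) (Y := Q') σ))
      (SymSeq.ap (F.map (Quiver.Hom.op (X := Q') (Y := Q) ρ)) x) =
      SymSeq.ap (F.map (Quiver.Hom.op (X := T) (Y := Q) (σ.trans ρ))) x :=
  (SymSeq.ap_comp _ _ _).symm.trans (congrArg (fun f => SymSeq.ap f x)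
    (F.map_comp (Quiver.Hom.op (X := Q') (Y := Q) ρ) (Quiver.Hom.op (X := T) (Y := Q') σ)).symm)

/-- Two bijections differ by a permutation of `T`, and this acts diagonally on the balanced tensor
product. -/
theorem top_eq (σ σ' : T ≃ Q) {d : Deg} (x : ((O.env A).obj (op Q)).el c k)
    (w : ((pow Y).obj (op Q)).el d k) : top v σ x w = top v σ' x w := by
  have h : σ = (σ.trans σ'.symm).trans σ' := Equiv.ext fun t => by simp
  refine (congrArg (fun s => top v s x w) h).trans ?_
  unfold top
  rw [← ap_map_map (O.env A) (σ.trans σ'.symm) σ' x, ← ap_map_map (pow Y) (σ.trans σ'.symm) σ' w,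
    bal.mk_map_map]

theorem top_map (σ : T ≃ Q) (σ' : T ≃ Q') (ρ : Q' ≃ Q) {d : Deg}
    (x : ((O.env A).obj (op Q)).el c k) (w : ((pow Y).obj (op Q)).el d k) :
    top v σ' (SymSeq.ap ((O.env A).map (Quiver.Hom.op (X := Q') (Y := Q) ρ)) x)
      (SymSeq.ap ((pow Y).map (Quiver.Hom.op (X := Q') (Y := Q) ρ)) w) = top v σ x w := by
  rw [top_eq v σ (σ'.trans ρ)]
  unfold top
  rw [ap_map_map, ap_map_map]

theorem top_act (σ : T ≃ Q) {d d' : Deg} (a : DHom k c c') (b : DHom k d d')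
    (x : ((O.env A).obj (op Q)).el c k) (w : ((pow Y).obj (op Q)).el d k) :
    top v σ (SymSeq.act _ a x) (SymSeq.act _ b w) = SymSeq.act _ (a.sum b) (top v σ x w) := by
  unfold top
  rw [SymSeq.ap_act, SymSeq.ap_act, bal.mk_act, SymSeq.ap_act]

theorem _root_.SymSpectra.pow.mk_act_reindex (ρ : Q' ≃ Q) {e : Q → Deg} {e' : Q' → Deg}
    (g : ∀ t, DHom k (e (ρ t)) (e' t)) (y : ∀ t, Y.el (e t) k) :
    pow.mk (T := Q') (fun t => Y.act (g t) (y (ρ t))) = SymSeq.act _ (DHom.sigma ρ g)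
      (SymSeq.ap ((pow Y).map (Quiver.Hom.op (X := Q') (Y := Q) ρ)) (pow.mk y)) := by
  have h : (DHom.sigma ρ fun t => (DHom.id : DHom k (e (ρ t)) (e (ρ t)))).comp
      (DHom.sigma (Equiv.refl Q') g) = DHom.sigma ρ g := by
    ext1
    · exact Equiv.ext fun ⟨t, x⟩ => rfl
    · refine Lab.ext (funext fun ⟨t, x⟩ => ?_)
      rcases h' : (g t).lab.g x with y | y <;>
        simp [DHom.comp, DHom.sigma, DHom.id, Lab.comp, Lab.sigma, Lab.id, Lab.ofEquiv, h']
  have h₁ : pow.mk (T := Q') (fun t => Y.act (g t) (y (ρ t))) =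
      SymSeq.act _ (DHom.sigma (Equiv.refl Q') g) (pow.mk (T := Q') fun t => y (ρ t)) :=
    tensor.mk_act (X := fun _ : Q' => Y) (d := fun t => e (ρ t)) g fun t => y (ρ t)
  rw [h₁, pow.mk_reindex ρ y, SymSeq.act_act, h]

theorem top_move (σ : T ≃ Q) (σ' : T ≃ Q') (ρ : Q' ≃ Q) {e : Q → Deg} {e' : Q' → Deg}
    (h : DHom k c c') (g : ∀ t, DHom k (e (ρ t)) (e' t))
    (x : ((O.env A).obj (op Q)).el c k) (y : ∀ t, Y.el (e t) k) :
    top v σ' (SymSeq.ap ((O.env A).map (Quiver.Hom.op (X := Q') (Y := Q) ρ)) (SymSeq.act _ h x))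
      (pow.mk (T := Q') fun t => Y.act (g t) (y (ρ t))) =
      SymSeq.act _ (h.sum (DHom.sigma ρ g)) (top v σ x (pow.mk y)) := by
  rw [pow.mk_act_reindex, SymSeq.ap_act, top_act, top_map v σ σ']

variable [Nonempty T] (hT : Nat.card T = t + 1) (f : cell i φ (· ≤ t) ⟶ Z)
    (hfv : fStar i φ (p := (· ≤ t)) (card_compl_le hT) ≫ f = balMap (O.env A) (iStar i) T ≫ v)
include hfv

/-- On symbols that come from the punctured cube, `v` is already determined by `f`, by commutativity
of the square. -/
theorem top_iStar (σ : T ≃ Q) (χ : Punctured Q)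
    (hχ : Nat.card {t // ¬ χ.obj t = false} ≤ t) {e : Q → Deg} (x : ((O.env A).obj (op Q)).el c k)
    (z : ∀ t, ((arrow i).obj (χ.obj t)).el (e t) k) :
    top v σ x (SymSeq.ap ((iStar i).app (op Q)) (SymSpectra.Q.mk χ z)) =
      SymSeq.ap f (mixed i φ χ.obj hχ x z) := by
  rw [← fStar_map (card_compl_le hT) σ, ← SymSeq.ap_comp, hfv, SymSeq.ap_comp, balMap_mk]
  unfold top
  refine congrArg (SymSeq.ap v) (congrArg (bal.mk _) ?_)
  rw [← SymSeq.ap_comp, ← SymSeq.ap_comp]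
  exact congrArg (fun g => SymSeq.ap g (SymSpectra.Q.mk χ z)) ((iStar i).naturality _).symm

/-- The plugging relation from degree `t + 1` to lower degrees. A family `y` whose entries over `N`
come from $X$ lifts to the punctured cube, where `top_iStar` compares `v` with `f`. -/
theorem group_top (hS : Nat.card S ≤ t) (σ : T ≃ Q) (w : N ⊕ S ≃ Q) (hN : Nonempty N) {e : Q → Deg}
    (x : ((O.env A).obj (op Q)).el c k) (y : ∀ t, Y.el (e t) k) (xs : ∀ r, X.el (e (w (.inl r))) k)
    (hy : ∀ r, y (w (.inl r)) = SymSeq.ap i (xs r)) :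
    SymSeq.ap f (mk i φ (p := (· ≤ t)) hS (env.plug w x fun r => SymSeq.ap φ (xs r))
      fun s => y (w (.inr s))) =
      SymSeq.act _ (DHom.group w c e) (top v σ x (pow.mk y)) := by
  -- The vertex with factors from $X$ exactly over `N`. It is punctured because `N` is nonempty.
  let χ : Punctured Q := ⟨fun q => Sum.elim (fun _ => false) (fun _ => true) (w.symm q),
    w (.inl hN.some), by simp⟩
  have hX : ∀ r, χ.obj (w (.inl r)) = false := fun r => by simp [χ]
  have hY : ∀ s, χ.obj (w (.inr s)) = true := fun s => by simp [χ]
  have hχ : Nat.card {s // ¬ χ.obj s = false} ≤ t := by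
    rwa [← card_eq_of_split (Q := Q) χ.obj w hX hY]
  -- The lift of `y` to this vertex consists of `xs` over `N` and of `y` over `S`. It is built over
  -- `N ⊕ S` and carried along `w`, since the type of an entry depends on `χ`.
  obtain ⟨z, hz⟩ : ∃ z : ∀ q, ((arrow i).obj (χ.obj q)).el (e q) k,
      (∀ r, z (w (.inl r)) = inArrow (b := false) (hX r).symm (xs r)) ∧
      ∀ s, z (w (.inr s)) = inArrow (b := true) (hY s).symm (y (w (.inr s))) :=
    ⟨Equiv.piCongrLeft (fun q => ((arrow i).obj (χ.obj q)).el (e q) k) w (Sum.rec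
      (fun r => inArrow (b := false) (hX r).symm (xs r))
      fun s => inArrow (b := true) (hY s).symm (y (w (.inr s)))),
      fun r => Equiv.piCongrLeft_apply_apply _ _ _ _,
      fun s => Equiv.piCongrLeft_apply_apply _ _ _ _⟩
  have h₁ : ∀ q, SymSeq.ap ((arrow i).map (homOfLE (Bool.le_true (χ.obj q)))) (z q) = y q := by
    -- Each `q` is replaced by a point in the image of `w`, without transporting the dependent
    -- family `z`.
    refine fun q => (w.apply_symm_apply q).rec (motive := fun q _ => SymSeq.ap ((arrow i).map
      (homOfLE (Bool.le_true (χ.obj q)))) (z q) = y q) ?_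
    rcases w.symm q with r | s
    · rw [hz.1 r, hy r]
      exact (inArrow_map_of_false (i := i) (homOfLE (Bool.le_true _)) rfl (hX r)
        (inArrow (b := false) (hX r).symm (xs r))).trans (congrArg (SymSeq.ap i)
          (inArrow_inArrow_symm (i := i) (b' := false) (hX r) (xs r)))
    · rw [hz.2 s]
      exact (inArrow_map (i := i) (homOfLE (Bool.le_true _)) rfl (hY s)
        (inArrow (b := true) (hY s).symm (y (w (.inr s))))).trans
          (inArrow_inArrow_symm (i := i) (b' := true) (hY s) _)
  have h₂ : pow.mk y = SymSeq.ap ((iStar i).app (op Q)) (SymSpectra.Q.mk χ z) :=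
    (congrArg (pow.mk (T := Q)) (funext fun q => (h₁ q).symm)).trans (iStar_mk χ z).symm
  rw [h₂, top_iStar v hT f hfv σ χ hχ, ← SymSeq.ap_act]
  refine congrArg (SymSeq.ap f) (Eq.trans ?_ ((congrArg (SymSeq.act _ _)
    (mixed_eq (N := N) (S := S) hχ hS w hX hY x z)).trans
    (act_group_plugged (i := i) (φ := φ) hS e w x (fun r => inArrow (b' := false) (hX r) (z _))
      fun s => inArrow (b' := true) (hY s) (z _))).symm)
  have h₃ : (fun r => inArrow (b' := false) (hX r) (z (w (.inl r)))) = xs :=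
    funext fun r => by rw [hz.1 r]; exact inArrow_inArrow_symm _ _
  have h₄ : (fun s => inArrow (b' := true) (hY s) (z (w (.inr s)))) = fun s => y (w (.inr s)) :=
    funext fun s => by rw [hz.2 s]; exact inArrow_inArrow_symm _ _
  exact (congrArg₂ (fun xs (ys : ∀ s, Y.el (e (w (.inr s))) k) => mk i φ (p := (· ≤ t)) hS
    (env.plug w x fun r => SymSeq.ap φ (xs r)) ys) h₃ h₄).symm

open Classical in
-- The morphism out of $A_{t+1}$ defined by a cocone: `f` on symbols with at most `t` inputs, and
-- `v` on those with `t + 1` inputs. Naturality does not mix the two cases, as it preserves the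
-- number of inputs. A plugging relation ends among the first; it starts there too, or is covered by
-- `group_top`.
noncomputable def descData : Desc i φ (· ≤ t + 1) Z where
  f {Q c e k} hQ x y := if h : Nat.card Q ≤ t then SymSeq.ap f (mk i φ (p := (· ≤ t)) h x y) else
    top v ((((Finite.card_eq (α := T) (β := Q)).1 (hT.trans (by omega))).some)) x (pow.mk y)
  sm {Q c e k l} α hQ x y := by
    by_cases h : Nat.card Q ≤ t
    · rw [dif_pos h, dif_pos h, ← SymSeq.ap_sm, sm_mk]
    · rw [dif_neg h, dif_neg h]
      unfold top
      rw [← SymSeq.ap_sm, bal.sm_mk, ← SymSeq.ap_sm, ← SymSeq.ap_sm]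
      refine congrArg (SymSeq.ap v) (congrArg (bal.mk _) (congrArg _ ?_))
      exact (tensor.sm_mk (X := fun _ : Q => Y) α y).symm
  move {Q Q' c c' e e' k} hQ hQ' σ h g x y := by
    have hc : Nat.card Q' = Nat.card Q := Nat.card_congr σ
    by_cases hn : Nat.card Q ≤ t
    · rw [dif_pos hn, dif_pos (hc.le.trans hn), mk_move hn, SymSeq.ap_act]
    · rw [dif_neg hn, dif_neg (by omega), top_move]
  plug {Q N S c e k} hQ hS w hN x y xs hy := by
    -- From $|N|+|S|=|Q|\le t+1$ and $|N|>0$ it follows that $|S|\le t$, so the target of the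
    -- relation falls under `f`.
    have hc : Nat.card N + Nat.card S = Nat.card Q := by
      rw [← Nat.card_sum, Nat.card_congr w]
    have hN' : 0 < Nat.card N := Finite.card_pos
    have hS' : Nat.card S ≤ t := by omega
    rw [dif_pos hS']
    by_cases hn : Nat.card Q ≤ t
    · rw [dif_pos hn, mk_plug (p := (· ≤ t)) hn hS' w hN x y xs hy, SymSeq.ap_act]
    · rw [dif_neg hn, group_top v hT f hfv hS' _ w hN x y xs hy]
  pt_left {Q c e k} hQ y := by
    by_cases h : Nat.card Q ≤ t
    · rw [dif_pos h, mk_pt_left, SymSeq.ap_pt]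
    · rw [dif_neg h]
      unfold top
      rw [SymSeq.ap_pt, bal.mk_pt_left, SymSeq.ap_pt]
  pt_right {Q c e k} hQ x y s hs := by
    by_cases h : Nat.card Q ≤ t
    · rw [dif_pos h, mk_pt_right _ _ _ s hs, SymSeq.ap_pt]
    · rw [dif_neg h]
      unfold top
      rw [show pow.mk y = SymSeq.pt _ from tensor.mk_pt (X := fun _ : Q => Y) y s hs, SymSeq.ap_pt,
        bal.mk_pt_right, SymSeq.ap_pt]

end Desc

variable (i φ) in
theorem isPushout [Nonempty T] (hT : Nat.card T = t + 1) :
    IsPushout (fStar i φ (p := (· ≤ t)) (card_compl_le hT)) (balMap (O.env A) (iStar i) T)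
      (map i φ (p := (· ≤ t)) (q := (· ≤ t + 1)) fun _ h => Nat.le_succ_of_le h)
      (ξ i φ (p := (· ≤ t + 1)) hT.le) where
  w := fStar_comp_map hT
  isColimit' := ⟨PushoutCocone.IsColimit.mk _ (fun s => (descData s.inr hT s.inl s.condition).hom)
    (fun s => hom_ext fun k Q c e hQ x y => by
      rw [SymSeq.ap_comp, map_mk, Desc.hom_mk]
      exact dif_pos hQ)
    (fun s => bal.hom_ext_pow fun k c x e y => by
      rw [SymSeq.ap_comp, ξ_mk, Desc.hom_mk]
      -- The set `T` has `t + 1` elements, so `v` is used here. The bijection chosen in `descData`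
      -- is replaced by the identity.
      refine (dif_neg (by omega)).trans ((top_eq _ _ (Equiv.refl T) x _).trans ?_)
      unfold top
      exact congrArg (SymSeq.ap s.inr) (bal.mk_map_map (Equiv.refl T) x _))
    -- Uniqueness: a symbol with at most `t` inputs comes from $A_t$, and any other is an image of
    -- `ξ` after transport to `T`.
    (fun s m h₁ h₂ => hom_ext fun k Q c e hQ x y => by
      rw [Desc.hom_mk]
      by_cases h : Nat.card Q ≤ t
      · refine Eq.trans ?_ (dif_pos h).symm
        rw [← h₁, SymSeq.ap_comp, map_mk]
      · refine Eq.trans ?_ (dif_neg h).symm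
        unfold top
        rw [← h₂, SymSeq.ap_comp, ξ_map _ hQ])⟩

end Pushout
end cell
end Operad
end SymSpectra

/-! ### Degree zero and the colimit of the stages -/

namespace SymSpectra
namespace Operad
variable {O : Operad.{u}} {A : O.Lt} {k : Dop} {Q Q' N N' S S' T : FinBij} {c c' : Deg}
namespace cell
variable {X Y : SymSeq.{u}} (i : X ⟶ Y) (φ : X ⟶ A.A) {p q : ℕ → Prop}

/-- The part of degree zero. -/
noncomputable def zeroHom [IsEmpty Q] (hQ : p (Nat.card Q)) : (O.env A).obj (op Q) ⟶ cell i φ p :=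
  SymSeq.mkHom (fun d _ x => SymSeq.act _ (DHom.dropEmpty d (Q := Q) isEmptyElim)
      (cell.mk i φ hQ (e := isEmptyElim) x isEmptyElim))
    (fun _ _ => by rw [mk_pt_left, SymSeq.act_pt])
    (fun d k l α x => by
      rw [SymSeq.sm_act, sm_mk]
      exact congrArg (fun y => SymSeq.act _ (DHom.dropEmpty d (Q := Q) isEmptyElim)
        (cell.mk i φ hQ (e := isEmptyElim) (SymSeq.sm _ α x) y)) (Subsingleton.elim _ _))
    (fun c d k h x => by
      rw [mk_act_left, SymSeq.act_act, SymSeq.act_act, DHom.dropEmpty_nat])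

variable {i φ}

/-- Families over an empty set are unique, so the symbol is determined by `x`. -/
theorem mk_of_isEmpty [IsEmpty Q] (hQ : p (Nat.card Q)) {e : Q → Deg}
    (x : ((O.env A).obj (op Q)).el c k) (y : ∀ t, Y.el (e t) k) :
    cell.mk i φ hQ x y = SymSeq.act _ (DHom.sumEmpty c e) (SymSeq.ap (zeroHom i φ hQ) x) := by
  obtain rfl : e = isEmptyElim := Subsingleton.elim _ _
  obtain rfl : y = isEmptyElim := Subsingleton.elim _ _
  unfold zeroHom
  rw [SymSeq.ap_mkHom, SymSeq.act_act, DHom.dropEmpty_sumEmpty, SymSeq.act_id]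

theorem ap_map_zeroHom [IsEmpty Q] [IsEmpty Q'] (hQ : p (Nat.card Q)) (hQ' : p (Nat.card Q'))
    (σ : Q' ≃ Q) (x : ((O.env A).obj (op Q)).el c k) :
    SymSeq.ap (zeroHom i φ hQ')
      (SymSeq.ap ((O.env A).map (Quiver.Hom.op (X := Q') (Y := Q) σ)) x) =
      SymSeq.ap (zeroHom i φ hQ) x := by
  have h := mk_reindex (i := i) (φ := φ) hQ hQ' σ x (e := isEmptyElim) isEmptyElim
  rw [mk_of_isEmpty, mk_of_isEmpty hQ, SymSeq.act_act, DHom.sumEmpty_nat, DHom.id_comp] at h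
  exact SymSeq.act_injective (DHom.sumEmpty_dropEmpty _ _) h

variable (i φ) in
/-- The inverse of the inclusion of the part of degree zero, if there are no other degrees. -/
noncomputable def zeroDesc [IsEmpty T] (hp : ∀ n, p n → n = 0) :
    Desc i φ p ((O.env A).obj (op T)) where
  f {Q c e k} hQ x y :=
    have : IsEmpty Q := Finite.card_eq_zero_iff.1 (hp _ hQ)
    SymSeq.act _ (DHom.sumEmpty c e) (SymSeq.ap ((O.env A).map
      (Quiver.Hom.op (X := T) (Y := Q) (Equiv.equivOfIsEmpty T Q))) x)
  sm α hQ x y := by dsimp only; rw [SymSeq.ap_sm, SymSeq.sm_act]; rfl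
  move {Q Q' c c' e e' k} hQ hQ' σ h g x y := by
    have : IsEmpty Q := Finite.card_eq_zero_iff.1 (hp _ hQ)
    have : IsEmpty Q' := Finite.card_eq_zero_iff.1 (hp _ hQ')
    dsimp only
    rw [ap_map_map, SymSeq.ap_act, SymSeq.act_act, SymSeq.act_act, DHom.sumEmpty_nat]
    exact congrArg (fun s => SymSeq.act _ _ (SymSeq.ap ((O.env A).map
      (Quiver.Hom.op (X := T) (Y := Q) s)) x)) (Subsingleton.elim (α := T ≃ Q) _ _)
  -- Here `Q` is empty and `N` is not, so no plugging relation occurs in degree zero.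
  plug hQ hS w hN x y xs hy := by
    have := Finite.card_eq_zero_iff.1 (hp _ hQ)
    exact (this.false (w (.inl hN.some))).elim
  pt_left hQ y := by dsimp only; rw [SymSeq.ap_pt, SymSeq.act_pt]
  pt_right hQ x y t h := ((Finite.card_eq_zero_iff.1 (hp _ hQ)).false t).elim

variable (i φ) in
/-- The part of degree zero. -/
noncomputable def zeroIso [IsEmpty T] (hp : ∀ n, p n → n = 0) (hT : p (Nat.card T)) :
    (O.env A).obj (op T) ≅ cell i φ p where
  hom := zeroHom i φ hT
  inv := (zeroDesc i φ hp).hom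
  hom_inv_id := SymSeq.hom_ext fun d k x => by
    unfold zeroHom
    rw [SymSeq.ap_comp, SymSeq.ap_mkHom, SymSeq.ap_act, Desc.hom_mk]
    refine (SymSeq.act_act _ _ _).trans ?_
    rw [DHom.sumEmpty_dropEmpty, SymSeq.act_id]
    refine (congrArg (fun s => SymSeq.ap ((O.env A).map
      (Quiver.Hom.op (X := T) (Y := T) s)) x) (Subsingleton.elim _ (Equiv.refl T))).trans ?_
    exact congrArg (fun f => SymSeq.ap f x) ((O.env A).map_id (op T))
  inv_hom_id := hom_ext fun k Q c e hQ x y => by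
    have : IsEmpty Q := Finite.card_eq_zero_iff.1 (hp _ hQ)
    rw [SymSeq.ap_comp, Desc.hom_mk]
    refine (SymSeq.ap_act _ _ _).trans ?_
    rw [ap_map_zeroHom hQ]
    exact (mk_of_isEmpty hQ x y).symm

theorem map_comp_map {r : ℕ → Prop} (hpq : ∀ n, p n → q n) (hqr : ∀ n, q n → r n) :
    map i φ hpq ≫ map i φ hqr = map i φ fun n h => hqr n (hpq n h) :=
  hom_ext fun k Q c e hQ x y => by rw [SymSeq.ap_comp, map_mk, map_mk, map_mk]

variable (i φ) in
/-- The filtration by degree. -/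
noncomputable def stage : ℕ ⥤ SymSeq.{u} where
  obj t := cell i φ (· ≤ t)
  map f := map i φ fun _ h => h.trans (leOfHom f)
  map_id t := hom_ext fun k Q c e hQ x y => by rw [map_mk, SymSeq.ap_id]
  map_comp f g := (map_comp_map _ _).symm

variable (i φ) in
/-- The filtration by degree, as a cocone. -/
noncomputable def stageCocone : Cocone (stage (A := A) i φ) where
  pt := cell i φ fun _ => True
  ι := { app := fun _ => map i φ fun _ _ => trivial
         naturality := fun _ _ f => (map_comp_map (fun _ h => h.trans (leOfHom f))
           fun _ _ => trivial).trans (Category.comp_id _).symm }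

theorem stage_map_mk {s t : ℕ} (f : s ⟶ t) (hQ : Nat.card Q ≤ s) {e : Q → Deg}
    (x : ((O.env A).obj (op Q)).el c k) (y : ∀ t, Y.el (e t) k) :
    SymSeq.ap ((stage i φ).map f) (cell.mk i φ (p := (· ≤ s)) hQ x y) =
      cell.mk i φ (p := (· ≤ t)) (hQ.trans (leOfHom f)) x y :=
  map_mk (i := i) (φ := φ) (q := (· ≤ t)) (fun _ h => h.trans (leOfHom f)) hQ x y

theorem stageCocone_ι_mk {t : ℕ} (hQ : Nat.card Q ≤ t) {e : Q → Deg}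
    (x : ((O.env A).obj (op Q)).el c k) (y : ∀ t, Y.el (e t) k) :
    SymSeq.ap ((stageCocone i φ).ι.app t) (cell.mk i φ (p := (· ≤ t)) hQ x y) =
      cell.mk i φ (p := fun _ => True) trivial x y :=
  map_mk (i := i) (φ := φ) (q := fun _ => True) (fun _ _ => trivial) hQ x y

section
variable (s : Cocone (stage (A := A) i φ)) {e : Q → Deg}

/-- A cocone takes the same value on a symbol in every stage that contains it. -/
theorem ap_stage_ι {t t' : ℕ} (h : t ≤ t') (hQ : Nat.card Q ≤ t) (x : ((O.env A).obj (op Q)).el c k)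
    (y : ∀ t, Y.el (e t) k) :
    SymSeq.ap (s.ι.app t') (cell.mk i φ (p := (· ≤ t')) (hQ.trans h) x y) =
      SymSeq.ap (s.ι.app t) (cell.mk i φ (p := (· ≤ t)) hQ x y) := by
  rw [← s.w (homOfLE h)]
  refine Eq.trans ?_ (SymSeq.ap_comp _ _ _).symm
  exact congrArg (SymSeq.ap (s.ι.app t')) (stage_map_mk (i := i) (φ := φ) (homOfLE h) hQ x y).symm

/-- The map out of the colimit of the filtration by degree. -/
noncomputable def stageDesc : Desc i φ (fun _ => True) s.pt where
  -- A symbol over `Q` is evaluated at the first stage containing it, of degree $|Q|$.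
  f {Q c e k} _ x y := SymSeq.ap (s.ι.app (Nat.card Q)) (cell.mk i φ (p := (· ≤ Nat.card Q))
    le_rfl x y)
  sm α hQ x y := (congrArg (SymSeq.ap (s.ι.app _)) (sm_mk (i := i) (φ := φ) α _ x y).symm).trans
    (SymSeq.ap_sm _ _ _)
  move {Q Q' c c' e e' k} hQ hQ' σ h g x y := by
    have hc := Nat.card_congr σ
    refine (ap_stage_ι s hc.le le_rfl _ _).symm.trans ?_
    exact (congrArg (SymSeq.ap (s.ι.app _)) (mk_move (i := i) (φ := φ) (p := (· ≤ Nat.card Q)) le_rfl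
      hc.le σ h g x y)).trans (SymSeq.ap_act _ _ _)
  plug {Q N S c e k} hQ hS w hN x y xs hy := by
    have hc : Nat.card S ≤ Nat.card Q := by
      rw [← Nat.card_congr w, Nat.card_sum]
      exact Nat.le_add_left _ _
    -- The two ends of the relation are evaluated at different stages; both are compared in the
    -- stage $|Q|$, where the relation holds.
    refine (ap_stage_ι s hc le_rfl _ _).symm.trans ?_
    exact (congrArg (SymSeq.ap (s.ι.app _)) (mk_plug (i := i) (φ := φ) (p := (· ≤ Nat.card Q)) le_rfl
      hc w hN x y xs hy)).trans (SymSeq.ap_act _ _ _)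
  pt_left hQ y := (congrArg (SymSeq.ap (s.ι.app _)) (mk_pt_left (i := i) (φ := φ) _ y)).trans
    (SymSeq.ap_pt _)
  pt_right hQ x y t h := (congrArg (SymSeq.ap (s.ι.app _))
    (mk_pt_right (i := i) (φ := φ) _ x y t h)).trans (SymSeq.ap_pt _)

end

variable (i φ) in
-- Every symbol, and every relation between symbols, lies in some finite stage. So a compatible
-- family of maps on the stages is a map out of the unrestricted `cell`.
theorem isColimit_stageCocone : Nonempty (IsColimit (stageCocone (A := A) i φ)) := ⟨{
  desc := fun s => (stageDesc s).hom
  fac := fun s t => hom_ext fun k Q c e hQ x y => by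
    refine (SymSeq.ap_comp _ _ _).trans ((congrArg _ (stageCocone_ι_mk hQ x y)).trans
      ((Desc.hom_mk (stageDesc s) trivial x y).trans ?_))
    exact (ap_stage_ι s hQ le_rfl x y).symm
  uniq := fun s m hm => hom_ext (i := i) (φ := φ) (p := fun _ => True) fun k Q c e hQ x y => by
    refine Eq.trans ?_ (Desc.hom_mk (stageDesc s) trivial x y).symm
    refine Eq.trans ?_ (congrArg (fun f => SymSeq.ap f (cell.mk i φ (p := (· ≤ Nat.card Q)) le_rfl x y))
      (hm (Nat.card Q)))
    exact (congrArg (SymSeq.ap m) (stageCocone_ι_mk le_rfl x y).symm) }⟩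

/-- Rewrites a plugged symbol on a representative of $\mathcal O_A[Q]$ in the form required by the
field `fStar_mk` of `CellFiltration`. -/
theorem plugged_env_mk (hS : p (Nat.card S)) (w : N ⊕ S ≃ Q) {n : FinBij} {d : T → Deg}
    {e : Q → Deg} (o : O.S.el ⟨T.sum Q, n⟩ k) (a : ∀ r, A.A.el (d r) k)
    (xs : ∀ r, X.el (e (w (.inl r))) k) (ys : ∀ s, Y.el (e (w (.inr s))) k) :
    plugged i φ hS e w (env.mk O A o a) xs ys = SymSeq.act _ (DHom.move n d e w)
      (cell.mk i φ hS (env.mk O A (O.S.act (DHom.moveInputs T n w) o)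
        (famSum a fun r => SymSeq.ap φ (xs r))) ys) := by
  unfold plugged
  rw [DHom.move_eq, ← SymSeq.act_act, ← mk_act_left, env.plug_mk]

theorem fStar_env_mk [Nonempty Q] (hp : ∀ χ : Punctured Q, p (Nat.card {t // ¬ χ.obj t = false}))
    (hS : p (Nat.card S)) (w : N ⊕ S ≃ Q) (χ : Punctured Q) (hX : ∀ r, χ.obj (w (.inl r)) = false)
    (hY : ∀ q, χ.obj (w (.inr q)) = true) {n : FinBij} {d : T → Deg} {e : Q → Deg}
    (o : O.S.el ⟨T.sum Q, n⟩ k) (a : ∀ r, A.A.el (d r) k)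
    (z : ∀ q, ((arrow i).obj (χ.obj q)).el (e q) k) :
    SymSeq.ap (fStar i φ hp) (bal.mk (env.mk O A o a) (SymSpectra.Q.mk χ z)) =
      SymSeq.act _ (DHom.move n d e w) (cell.mk i φ hS
        (env.mk O A (O.S.act (DHom.moveInputs T n w) o)
          (famSum a fun r => SymSeq.ap φ (inArrow (b' := false) (hX r) (z (w (.inl r))))))
        fun q => inArrow (i := i) (b' := true) (hY q) (z (w (.inr q)))) := by
  rw [fStar_mk, mixed_eq (hp χ) hS w hX hY]
  exact plugged_env_mk hS w o a _ _

end cell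
end Operad
end SymSpectra

/-! ### Evaluation of cell symbols in $P$ -/

namespace SymSpectra
namespace Operad
variable {O : Operad.{u}} {A P : O.Lt} {k : Dop} {Q Q' N N' S S' T n : FinBij} {c c' : Deg}

/-- Evaluating an element of `O_A[Q]` on a family of elements of `A`. -/
noncomputable def env.ev {d : Q → Deg} (x : ((O.env A).obj (op Q)).el c k)
    (b : ∀ q, A.A.el (d q) k) : A.A.el (c.sum (Deg.sigma d)) k :=
  SymSeq.ap (augHom A) (env.plug (S := FinBij.std 0) (Equiv.sumEmpty Q (Fin 0)) x b)

namespace env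

/-- Plugging all inputs and then applying the augmentation gives $o(a,b)$. The regrouping of inputs
and the removal of the empty remainder compose to the identity. -/
theorem ev_mk {d : T → Deg} {e : Q → Deg} (o : O.S.el ⟨T.sum Q, n⟩ k)
    (a : ∀ t, A.A.el (d t) k) (b : ∀ q, A.A.el (e q) k) : ev (env.mk O A o a) b =
      A.A.act (DHom.split n d e) (O.eval (T := T.sum Q) o (famSum a b)) := by
  unfold ev
  rw [plug_mk, SymSeq.ap_act, augHom_mk, SymSeq.act_act (X := O.S)]
  refine congrArg (A.A.act (DHom.split n d e)) (congrArg (fun o => O.eval (T := T.sum Q) o _)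
    (Eq.trans (congrArg (fun h => SymSeq.act _ h o) ?_) (SymSeq.act_id (X := O.S) o)))
  ext1
  · refine Equiv.ext ?_
    rintro (t | q) <;> rfl
  · exact Lab.comp_id _

theorem ev_move {e : Q → Deg} {e' : Q' → Deg} (σ : Q' ≃ Q) (h : DHom k c c')
    (g : ∀ q, DHom k (e (σ q)) (e' q)) (x : ((O.env A).obj (op Q)).el c k)
    (b : ∀ q, A.A.el (e q) k) :
    ev (SymSeq.ap ((O.env A).map (Quiver.Hom.op (X := Q') (Y := Q) σ)) (SymSeq.act _ h x))
      (fun q => A.A.act (g q) (b (σ q))) = A.A.act (h.sum (DHom.sigma σ g)) (ev x b) := by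
  have hw : ((Equiv.sumCongr σ.symm (Equiv.refl (Fin 0))).trans
      (Equiv.sumEmpty Q' (Fin 0))).trans σ = Equiv.sumEmpty Q (Fin 0) := by
    refine Equiv.ext ?_
    rintro (q | q)
    · exact σ.apply_symm_apply q
    · exact q.elim0
  have h₁ := plug_act_right (S := FinBij.std 0) (Equiv.sumEmpty Q' (Fin 0)) σ g
    (SymSeq.ap ((O.env A).map (Quiver.Hom.op (X := Q') (Y := Q) σ)) (SymSeq.act _ h x)) b
  have h₂ := plug_map (S := FinBij.std 0) ((Equiv.sumCongr σ.symm (Equiv.refl (Fin 0))).trans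
    (Equiv.sumEmpty Q' (Fin 0))) σ (SymSeq.act _ h x) b
  rw [hw] at h₂
  unfold ev
  rw [h₁.trans (congrArg (SymSeq.act _ _) h₂), plug_act, SymSeq.act_act, DHom.sum_comp, DHom.id_comp, DHom.comp_id, SymSeq.ap_act]

/-- Filling the inputs `N` first and the inputs `S` afterwards is evaluation on the whole family, by
`env.plug_plug`. This is what makes evaluation respect the plugging relation of cells. -/
theorem ev_plug {e : Q → Deg} (w : N ⊕ S ≃ Q) (x : ((O.env A).obj (op Q)).el c k)
    (b : ∀ q, A.A.el (e q) k) :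
    ev (plug (S := S) w x fun r => b (w (.inl r))) (fun s => b (w (.inr s))) =
      A.A.act (DHom.group w c e) (ev x b) := by
  have hb : famSum (fun r => b (w (.inl r))) (fun s => b (w (.inr s))) =
      fun t : N.sum S => A.A.act (DHom.elimId (fun t => e (w t)) t) (b (w t)) := by
    funext t
    rcases t with r | s <;> exact (SymSeq.act_id (X := A.A) _).symm
  have hw : (Equiv.sumCongr w.symm (Equiv.refl (Fin 0))).trans ((Equiv.sumAssoc N S (Fin 0)).trans
      ((Equiv.sumCongr (Equiv.refl N) (Equiv.sumEmpty S (Fin 0))).trans w)) =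
      Equiv.sumEmpty Q (Fin 0) := by
    refine Equiv.ext ?_
    rintro (q | q)
    · obtain ⟨t, rfl⟩ := w.surjective q
      rcases t with r | s <;> simp
    · exact q.elim0
  have h₁ := plug_act_right (N' := N.sum S) (S := FinBij.std 0) ((Equiv.sumAssoc N S (Fin 0)).trans
      ((Equiv.sumCongr (Equiv.refl N) (Equiv.sumEmpty S (Fin 0))).trans w)) w
      (DHom.elimId fun t => e (w t)) x b
  unfold ev
  rw [plug_plug (S := FinBij.std 0), SymSeq.ap_act, hb]
  refine (congrArg (fun y => A.A.act _ (SymSeq.ap (augHom A) y)) (h₁.trans (congrArg (fun w =>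
    SymSeq.act _ _ (plug (N := Q) (S := FinBij.std 0) w x b)) hw))).trans ?_
  rw [SymSeq.ap_act, SymSeq.act_act, DHom.group_eq]

theorem ev_pt_left {e : Q → Deg} (b : ∀ q, A.A.el (e q) k) :
    ev (SymSeq.pt _ : ((O.env A).obj (op Q)).el c k) b = A.A.pt := by
  unfold ev
  rw [plug_pt, SymSeq.ap_pt]

theorem ev_pt_right {e : Q → Deg} (x : ((O.env A).obj (op Q)).el c k) (b : ∀ q, A.A.el (e q) k)
    (q : Q) (h : b q = A.A.pt) : ev x b = A.A.pt := by
  unfold ev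
  rw [plug_pt_right _ _ _ q h, SymSeq.ap_pt]

theorem sm_ev {l : Dop} (α : k ⟶ l) {e : Q → Deg} (x : ((O.env A).obj (op Q)).el c k)
    (b : ∀ q, A.A.el (e q) k) :
    A.A.sm α (ev x b) = ev (SymSeq.sm _ α x) fun q => A.A.sm α (b q) := by
  unfold ev
  rw [← SymSeq.ap_sm, sm_plug]

end env

namespace cell
variable {X Y : SymSeq.{u}} {i : X ⟶ Y} {φ : X ⟶ A.A} {p : ℕ → Prop} {j : A ⟶ P} {γ : Y ⟶ P.A}
  (hj : φ ≫ j.f = i ≫ γ)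

/-- The map to `P`, sending `[o; a] ⊗ y` to `o(j(a), γ(y))`. -/
noncomputable def toDesc : Desc i φ p P.A where
  f {Q _ _ _} _ x y := env.ev (SymSeq.ap ((envMap j).app (op Q)) x) fun t => SymSeq.ap γ (y t)
  sm α _ x y := by
    dsimp only
    rw [env.sm_ev]
    simp only [SymSeq.ap_sm]
  move {Q Q' c c' e e' k} _ _ σ h g x y := by
    have h₁ : SymSeq.ap ((envMap j).app (op Q'))
        (SymSeq.ap ((O.env A).map (Quiver.Hom.op (X := Q') (Y := Q) σ)) (SymSeq.act _ h x)) =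
        SymSeq.ap ((O.env P).map (Quiver.Hom.op (X := Q') (Y := Q) σ))
          (SymSeq.act _ h (SymSeq.ap ((envMap j).app (op Q)) x)) := by
      rw [← SymSeq.ap_act]
      exact congrArg (fun f => SymSeq.ap f (SymSeq.act _ h x))
        ((envMap j).naturality (Quiver.Hom.op (X := Q') (Y := Q) σ))
    have h₂ : (fun t => SymSeq.ap γ (Y.act (g t) (y (σ t)))) =
      fun t => P.A.act (g t) (SymSeq.ap γ (y (σ t))) := funext fun t => SymSeq.ap_act _ _ _
    dsimp only
    rw [h₁, h₂]
    exact env.ev_move σ h g (SymSeq.ap ((envMap j).app (op Q)) x) fun t => SymSeq.ap γ (y t)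
  plug {Q N S c e k} _ _ w _ x y xs hy := by
    dsimp only
    rw [env.envMap_plug]
    -- Commutativity of the square: an entry plugged in through `φ` and the corresponding entry
    -- `i(x)` of `y` have the same image in $P$.
    have h₁ : (fun r => SymSeq.ap j.f (SymSeq.ap φ (xs r))) =
        fun r => SymSeq.ap γ (y (w (.inl r))) := funext fun r => by
      rw [← SymSeq.ap_comp, hj, SymSeq.ap_comp, hy]
    rw [h₁]
    exact env.ev_plug w (SymSeq.ap ((envMap j).app (op Q)) x) fun q => SymSeq.ap γ (y q)
  pt_left _ y := by
    rw [SymSeq.ap_pt, env.ev_pt_left]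
  pt_right _ x y t h := env.ev_pt_right _ _ t (by rw [h, SymSeq.ap_pt])

variable (p) in
/-- The map to `P`. -/
noncomputable def toP : cell i φ p ⟶ P.A := (toDesc hj).hom

theorem toP_mk (hQ : p (Nat.card Q)) {e : Q → Deg} (x : ((O.env A).obj (op Q)).el c k)
    (y : ∀ t, Y.el (e t) k) : SymSeq.ap (toP p hj) (cell.mk i φ hQ x y) =
      env.ev (SymSeq.ap ((envMap j).app (op Q)) x) fun t => SymSeq.ap γ (y t) :=
  Desc.hom_mk _ _ _ _

theorem toP_env_mk (hQ : p (Nat.card Q)) {d : T → Deg} {e : Q → Deg} (o : O.S.el ⟨T.sum Q, n⟩ k)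
    (a : ∀ t, A.A.el (d t) k) (y : ∀ t, Y.el (e t) k) :
    SymSeq.ap (toP p hj) (cell.mk i φ hQ (env.mk O A o a) y) = P.A.act (DHom.split n d e)
      (O.eval (T := T.sum Q) o (famSum (fun r => SymSeq.ap j.f (a r))
        fun s => SymSeq.ap γ (y s))) := by
  rw [toP_mk, envMap_mk, env.ev_mk]

end cell
end Operad
end SymSpectra

/-! ### Composition products with a coproduct -/

namespace SymSpectra

namespace DHom
variable {k : Dop} {T T' n n' : FinBij}

/-- Reindexing the inputs of a generator of a composition product along a bijection. -/
def circReindex (σ : T' ≃ T) (n : FinBij) (d : T → Deg) :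
    DHom k (Deg.circ n fun t => d (σ t)) (Deg.circ n d) :=
  ofEquiv (c := Deg.circ n fun t => d (σ t)) (d := Deg.circ n d)
    (Equiv.sigmaCongrLeft (β := fun t => (d t).R) σ).symm
    (Equiv.sumCongr (Equiv.refl n) (Equiv.sigmaCongrLeft (β := fun t => (d t).N) σ).symm)

theorem circ_id_eq_ofEquiv (σ : T' ≃ T) (d : T → Deg) :
    circ σ (Lab.id : Lab n n k) (fun t => (id : DHom k (d (σ t)) (d (σ t)))) =
      ofEquiv (c := Deg.circ n d) (d := Deg.circ n fun t => d (σ t))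
        (Equiv.sigmaCongrLeft (β := fun t => (d t).R) σ)
        (Equiv.sumCongr (Equiv.refl n) (Equiv.sigmaCongrLeft (β := fun t => (d t).N) σ)) := by
  ext1
  · rfl
  · refine Lab.ext (funext ?_)
    rintro (x | ⟨t, x⟩) <;> rfl

theorem circReindex_inv (σ : T' ≃ T) (d : T → Deg) : (circReindex σ n d : DHom k _ _).comp
    (circ σ Lab.id fun t => (id : DHom k (d (σ t)) (d (σ t)))) = id := by
  rw [circ_id_eq_ofEquiv, circReindex, ofEquiv_comp]
  ext1
  · exact Equiv.self_trans_symm _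
  · refine congrArg Lab.ofEquiv (Equiv.ext ?_)
    rintro (x | x) <;> simp

theorem inv_circReindex (σ : T' ≃ T) (d : T → Deg) :
    (circ σ Lab.id fun t => (id : DHom k (d (σ t)) (d (σ t)))).comp (circReindex σ n d) = id := by
  rw [circ_id_eq_ofEquiv, circReindex, ofEquiv_comp]
  ext1
  · exact Equiv.symm_trans_self _
  · refine congrArg Lab.ofEquiv (Equiv.ext ?_)
    rintro (x | x) <;> simp

theorem circ_id_comp_circ {T'' : FinBij} {d : T → Deg} {e : T'' → Deg} (w : T' ≃ T) (ρ : T'' ≃ T')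
    (a : Lab n n' k) (g : ∀ t, DHom k (d (w (ρ t))) (e t)) :
    (circ w (Lab.id : Lab n n k) fun t => (id : DHom k (d (w t)) (d (w t)))).comp (circ ρ a g) =
      circ (ρ.trans w) a g := by
  ext1
  · exact Equiv.ext fun ⟨t, x⟩ => rfl
  · refine Lab.ext (funext ?_)
    rintro (x | ⟨t, x⟩)
    · rcases h : a.g x with y | y <;> simp [comp, circ, Lab.comp, Lab.sum, Lab.id, Lab.ofEquiv, h]
    · rcases h : (g t).lab.g x with y | y <;>
        simp [comp, circ, id, Lab.comp, Lab.sum, Lab.sigma, Lab.id, Lab.ofEquiv, h]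

theorem circ_comp_circ_id {T'' : FinBij} {d : T → Deg} {d' : T' → Deg} (σ : T' ≃ T) (w : T'' ≃ T')
    (a : Lab n n' k) (f : ∀ t, DHom k (d (σ t)) (d' t)) :
    (circ σ a f).comp (circ w Lab.id fun t => (id : DHom k (d' (w t)) (d' (w t)))) =
      circ (w.trans σ) a fun t => f (w t) := by
  ext1
  · exact Equiv.ext fun ⟨t, x⟩ => rfl
  · refine Lab.ext (funext ?_)
    rintro (x | ⟨t, x⟩) <;>
      simp [comp, circ, id, Lab.comp, Lab.sum, Lab.sigma, Lab.id, Lab.ofEquiv]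

theorem circ_trans_circReindex {T'' : FinBij} {d : T → Deg} (w : T' ≃ T) (ρ : T'' ≃ T') :
    (circ (d := fun t => d (w (ρ t))) ρ (Lab.id : Lab n n k) fun t =>
      (id : DHom k (d (w (ρ t))) (d (w (ρ t))))).comp (circReindex (ρ.trans w) n d) =
        circReindex w n d := by
  have h := circ_id_comp_circ (n := n) (k := k) (d := d) (e := fun t => d (w (ρ t))) w ρ Lab.id
    fun t => id
  have h₂ := congrArg (fun g => (circReindex w n d).comp (g.comp (circReindex (ρ.trans w) n d))) h
  refine Eq.trans ?_ (h₂.trans (Eq.trans (congrArg _ (inv_circReindex (ρ.trans w) d)) (comp_id _)))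
  refine Eq.trans ?_ (congrArg _ (comp_assoc _ _ _).symm)
  refine Eq.trans ?_ (comp_assoc _ _ _)
  rw [circReindex_inv]
  exact (id_comp _).symm

/-- A family of maps of indices, and a map of the first index. -/
def circLab {c d : T → Deg} (a : Lab n n' k) (f : ∀ t, DHom k (c t) (d t)) :
    DHom k (Deg.circ n c) (Deg.circ n' d) := circ (Equiv.refl T) a f

/-- The reindexing maps are invertible, so the claim follows from the composition laws of `circ`
with inverse reindexings on both sides. This avoids computing in the inverse of `sigmaCongrLeft`. -/
theorem circLab_circReindex {T'' : FinBij} {d : T → Deg} {d' : T' → Deg} (σ : T' ≃ T)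
    (a : Lab n n' k) (f : ∀ t, DHom k (d (σ t)) (d' t)) (w : T'' ≃ T') :
    (circLab (c := fun t => d (σ (w t))) a fun t => f (w t)).comp
      (circReindex w n' d') = (circReindex (w.trans σ) n d).comp (circ σ a f) := by
  have h := circ_id_comp_circ (d := d) (e := fun t => d' (w t)) (w.trans σ) (Equiv.refl T'') a
    fun t => f (w t)
  have h₂ := congrArg (fun g => (circReindex (w.trans σ) n d).comp (g.comp (circReindex w n' d')))
    (h.trans (circ_comp_circ_id σ w a f).symm)
  refine Eq.trans ?_ (h₂.trans ?_)
  · refine Eq.trans ?_ (congrArg _ (comp_assoc _ _ _).symm)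
    refine Eq.trans ?_ (comp_assoc _ _ _)
    exact (id_comp _).symm.trans
      (congrArg (fun g => DHom.comp g _) (circReindex_inv (w.trans σ) d).symm)
  · exact congrArg _ ((comp_assoc _ _ _).trans ((congrArg _ (inv_circReindex w d')).trans (comp_id _)))

end DHom

variable {B V V₁ V₂ Z : SymSeq.{u}}

/-- A symmetric sequence is the coproduct of two others, on elements. -/
structure IsWedge (ι₁ : V₁ ⟶ V) (ι₂ : V₂ ⟶ V) : Prop where
  inl_inj : ∀ {d k} {a b : V₁.el d k}, SymSeq.ap ι₁ a = SymSeq.ap ι₁ b → a = b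
  inr_inj : ∀ {d k} {a b : V₂.el d k}, SymSeq.ap ι₂ a = SymSeq.ap ι₂ b → a = b
  disjoint : ∀ {d k} {a : V₁.el d k} {b : V₂.el d k},
    SymSeq.ap ι₁ a = SymSeq.ap ι₂ b → SymSeq.ap ι₁ a = V.pt
  cases : ∀ {d k} (v : V.el d k), (∃ a, v = SymSeq.ap ι₁ a) ∨ ∃ b, v = SymSeq.ap ι₂ b

/-- The morphism sending everything to the basepoint. -/
def SymSeq.null (V Z : SymSeq.{u}) : V ⟶ Z :=
  SymSeq.mkHom (fun _ _ _ => Z.pt) (fun _ _ => rfl) (fun _ _ _ _ _ => (SymSeq.sm_pt _).symm)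
    fun _ _ _ _ _ => (SymSeq.act_pt _).symm

/-- Collapsing one summand to the basepoint gives a retraction onto the other. The retractions show
injectivity, and that only the basepoint lies in both summands. -/
theorem isWedge_coprod (V₁ V₂ : SymSeq.{u}) :
    IsWedge (coprod.inl : V₁ ⟶ V₁ ⨿ V₂) (coprod.inr : V₂ ⟶ V₁ ⨿ V₂) where
  inl_inj {d k a b} h := by
    have := congrArg (SymSeq.ap (coprod.desc (𝟙 V₁) (SymSeq.null V₂ V₁))) h
    rwa [← SymSeq.ap_comp, ← SymSeq.ap_comp, coprod.inl_desc] at this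
  inr_inj {d k a b} h := by
    have := congrArg (SymSeq.ap (coprod.desc (SymSeq.null V₁ V₂) (𝟙 V₂))) h
    rwa [← SymSeq.ap_comp, ← SymSeq.ap_comp, coprod.inr_desc] at this
  disjoint {d k a b} h := by
    have := congrArg (SymSeq.ap (coprod.desc (𝟙 V₁) (SymSeq.null V₂ V₁))) h
    rw [← SymSeq.ap_comp, ← SymSeq.ap_comp, coprod.inl_desc, coprod.inr_desc] at this
    exact (congrArg _ this).trans (SymSeq.ap_pt _)
  cases {d k} v := by
    rcases el_cases_of_isColimit (colimit.isColimit (pair V₁ V₂)) v with h | ⟨⟨_ | _⟩, x, h⟩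
    · exact .inl ⟨V₁.pt, h.trans (SymSeq.ap_pt _).symm⟩
    · exact .inl ⟨x, h.symm⟩
    · exact .inr ⟨x, h.symm⟩

/-- A family of elements of two symmetric sequences, from a family of elements of a wedge. -/
structure WedgeSplit (ι₁ : V₁ ⟶ V) (ι₂ : V₂ ⟶ V) {T : FinBij} {d : T → Deg} {k : Dop}
    (z : ∀ t, V.el (d t) k) where
  {N S : FinBij}
  w : N ⊕ S ≃ T
  a : ∀ r, V₁.el (d (w (.inl r))) k
  b : ∀ s, V₂.el (d (w (.inr s))) k
  ha : ∀ r, z (w (.inl r)) = SymSeq.ap ι₁ (a r)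
  hb : ∀ s, z (w (.inr s)) = SymSeq.ap ι₂ (b s)

/-- Each entry is assigned to a summand containing it. A basepoint lies in both and is put into the
first here; `WedgeData.val_eq` shows that other choices give the same values. -/
theorem IsWedge.exists_split {ι₁ : V₁ ⟶ V} {ι₂ : V₂ ⟶ V} (h : IsWedge ι₁ ι₂) {T : FinBij}
    {d : T → Deg} {k : Dop} (z : ∀ t, V.el (d t) k) : Nonempty (WedgeSplit ι₁ ι₂ z) := by
  classical
  have h₂ : ∀ t : {t // ¬ ∃ a, z t = SymSeq.ap ι₁ a}, ∃ b, z t = SymSeq.ap ι₂ b := fun t =>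
    (h.cases (z t)).resolve_left t.2
  exact ⟨{ N := ⟨{t // ∃ a, z t = SymSeq.ap ι₁ a}⟩
           S := ⟨{t // ¬ ∃ a, z t = SymSeq.ap ι₁ a}⟩
           w := Equiv.sumCompl _
           a := fun r => r.2.choose
           b := fun s => (h₂ s).choose
           ha := fun r => r.2.choose_spec
           hb := fun s => (h₂ s).choose_spec }⟩

variable (B V₁ V₂ Z) in
/-- Data defining a morphism out of `B ∘ (V₁ ⨿ V₂)`. -/
structure WedgeData where
  f : ∀ {N S n : FinBij} {d : N ⊕ S → Deg} {k : Dop}, B.el ⟨N.sum S, n⟩ k →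
    (∀ r, V₁.el (d (.inl r)) k) → (∀ s, V₂.el (d (.inr s)) k) →
      Z.el (Deg.circ n (T := N.sum S) d) k
  sm : ∀ {N S n : FinBij} {d : N ⊕ S → Deg} {k l : Dop} (α : k ⟶ l) (o : B.el ⟨N.sum S, n⟩ k)
    (a : ∀ r, V₁.el (d (.inl r)) k) (b : ∀ s, V₂.el (d (.inr s)) k),
    f (B.sm α o) (fun r => V₁.sm α (a r)) (fun s => V₂.sm α (b s)) = Z.sm α (f o a b)
  act : ∀ {N S N' S' n n' : FinBij} {d : N ⊕ S → Deg} {d' : N' ⊕ S' → Deg} {k : Dop}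
    (σ : N' ≃ N) (τ : S' ≃ S) (l : Lab n n' k)
    (g : ∀ x, DHom k (d (Equiv.sumCongr σ τ x)) (d' x)) (o : B.el ⟨N.sum S, n⟩ k)
    (a : ∀ r, V₁.el (d (.inl r)) k) (b : ∀ s, V₂.el (d (.inr s)) k),
    f (B.act (c := ⟨N.sum S, n⟩) (d := ⟨N'.sum S', n'⟩) ⟨Equiv.sumCongr σ τ, l⟩ o)
      (fun r => V₁.act (g (.inl r)) (a (σ r))) (fun s => V₂.act (g (.inr s)) (b (τ s))) =
      Z.act (DHom.circ (T := N.sum S) (T' := N'.sum S') (Equiv.sumCongr σ τ) l g) (f o a b)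
  pt : ∀ {N S n : FinBij} {d : N ⊕ S → Deg} {k : Dop} (a : ∀ r, V₁.el (d (.inl r)) k)
    (b : ∀ s, V₂.el (d (.inr s)) k), f (B.pt : B.el ⟨N.sum S, n⟩ k) a b = Z.pt
  pt_left : ∀ {N S n : FinBij} {d : N ⊕ S → Deg} {k : Dop} (o : B.el ⟨N.sum S, n⟩ k)
    (a : ∀ r, V₁.el (d (.inl r)) k) (b : ∀ s, V₂.el (d (.inr s)) k) (r : N),
    a r = V₁.pt → f o a b = Z.pt
  pt_right : ∀ {N S n : FinBij} {d : N ⊕ S → Deg} {k : Dop} (o : B.el ⟨N.sum S, n⟩ k)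
    (a : ∀ r, V₁.el (d (.inl r)) k) (b : ∀ s, V₂.el (d (.inr s)) k) (s : S),
    b s = V₂.pt → f o a b = Z.pt

namespace WedgeData
variable (F : WedgeData B V₁ V₂ Z) {T T' n n' N S : FinBij} {k : Dop} {d : T → Deg} {d' : T' → Deg}

/-- The value on a family with a given splitting. -/
def val (w : N ⊕ S ≃ T) (o : B.el ⟨T, n⟩ k) (a : ∀ r, V₁.el (d (w (.inl r))) k)
    (b : ∀ s, V₂.el (d (w (.inr s))) k) : Z.el (Deg.circ n d) k :=
  Z.act (DHom.circReindex (T' := N.sum S) w n d) (F.f (d := fun x => d (w x))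
    (B.act (c := ⟨T, n⟩) (d := ⟨N.sum S, n⟩) ⟨w, Lab.id⟩ o) a b)

/-- Relabelling the two parts does not change the value, by naturality of `F` along `Equiv.sumCongr
σ τ`. The remaining reindexing is absorbed by `circReindex`. -/
theorem val_congr {N' S' : FinBij} (σ : N' ≃ N) (τ : S' ≃ S) (w : N ⊕ S ≃ T) (o : B.el ⟨T, n⟩ k)
    (a : ∀ r, V₁.el (d (w (.inl r))) k) (b : ∀ s, V₂.el (d (w (.inr s))) k) :
    F.val ((Equiv.sumCongr σ τ).trans w) o (fun r => a (σ r)) (fun s => b (τ s)) =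
      F.val w o a b := by
  have h := F.act (d := fun x => d (w x)) (d' := fun x => d (w (Equiv.sumCongr σ τ x))) σ τ Lab.id
    (fun x => DHom.id) (B.act (c := ⟨T, n⟩) (d := ⟨N.sum S, n⟩) ⟨w, Lab.id⟩ o) a b
  have ha : (fun r => V₁.act DHom.id (a (σ r))) = fun r => a (σ r) :=
    funext fun r => SymSeq.act_id (a (σ r))
  have hb : (fun r => V₂.act DHom.id (b (τ r))) = fun r => b (τ r) :=
    funext fun r => SymSeq.act_id (b (τ r))
  rw [SymSeq.act_act] at h
  have h₁ : DHom.comp (k := k) (c := ⟨T, n⟩) (d := ⟨N.sum S, n⟩) (e := ⟨N'.sum S', n⟩) ⟨w, Lab.id⟩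
      ⟨Equiv.sumCongr σ τ, Lab.id⟩ = ⟨(Equiv.sumCongr σ τ).trans w, Lab.id⟩ := by
    ext1
    · rfl
    · exact Lab.comp_id _
  unfold val
  refine Eq.trans ?_ (congrArg (fun h => Z.act h _) (DHom.circ_trans_circReindex (T' := N.sum S)
    (T'' := N'.sum S') w (Equiv.sumCongr σ τ)))
  refine Eq.trans ?_ (SymSeq.act_act (X := Z) _ _ _)
  refine congrArg (Z.act _) ((congrArg (fun h => F.f (N := N') (S := S')
    (d := fun x => d (w (Equiv.sumCongr σ τ x))) (SymSeq.act B h o) (fun r => a (σ r))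
      fun s => b (τ s)) h₁.symm).trans (Eq.trans ?_ h))
  exact congrArg₂ (fun a b => F.f (N := N') (S := S') (d := fun x => d (w (Equiv.sumCongr σ τ x)))
    (B.act _ o) a b) ha.symm hb.symm

theorem val_act (σ : T' ≃ T) (l : Lab n n' k) (f : ∀ t, DHom k (d (σ t)) (d' t)) (w : N ⊕ S ≃ T')
    (o : B.el ⟨T, n⟩ k) (a : ∀ r, V₁.el (d (σ (w (.inl r)))) k)
    (b : ∀ s, V₂.el (d (σ (w (.inr s)))) k) :
    F.val (d := d') w (B.act (c := ⟨T, n⟩) (d := ⟨T', n'⟩) ⟨σ, l⟩ o)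
      (fun r => V₁.act (f _) (a r)) (fun s => V₂.act (f _) (b s)) =
      Z.act (DHom.circ σ l f) (F.val (w.trans σ) o a b) := by
  have h := F.act (d := fun x => d (σ (w x))) (d' := fun x => d' (w x)) (Equiv.refl N)
    (Equiv.refl S) l (fun | .inl r => f (w (.inl r)) | .inr s => f (w (.inr s)))
    (B.act (c := ⟨T, n⟩) (d := ⟨N.sum S, n⟩) ⟨w.trans σ, Lab.id⟩ o) a b
  have h₁ : DHom.comp (k := k) (c := ⟨T, n⟩) (d := ⟨T', n'⟩) (e := ⟨N.sum S, n'⟩) ⟨σ, l⟩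
      ⟨w, Lab.id⟩ = DHom.comp (c := ⟨T, n⟩) (d := ⟨N.sum S, n⟩) (e := ⟨N.sum S, n'⟩)
        ⟨w.trans σ, Lab.id⟩ ⟨Equiv.sumCongr (Equiv.refl N) (Equiv.refl S), l⟩ := by
    ext1
    · exact Equiv.ext (by rintro (r | s) <;> rfl)
    · exact (Lab.comp_id _).trans (Lab.id_comp _).symm
  have h₂ : DHom.circ (k := k) (T := N.sum S) (T' := N.sum S) (c := fun x => d (σ (w x)))
      (d := fun x => d' (w x)) (Equiv.sumCongr (Equiv.refl N)
      (Equiv.refl S)) l (fun | .inl r => f (w (.inl r)) | .inr s => f (w (.inr s))) =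
      DHom.circLab (T := N.sum S) (c := fun x => d (σ (w x))) l fun x => f (w x) := by
    ext1
    · exact Equiv.ext (by rintro ⟨r | s, x⟩ <;> rfl)
    · refine Lab.ext (funext ?_)
      rintro (x | ⟨r | s, x⟩) <;> rfl
  unfold val
  refine Eq.trans ?_ ((congrArg (fun h => Z.act h _)
    (DHom.circLab_circReindex (T'' := N.sum S) σ l f w)).trans (SymSeq.act_act (X := Z) _ _ _).symm)
  refine Eq.trans ?_ (SymSeq.act_act (X := Z) _ _ _)
  refine congrArg (Z.act _) (Eq.trans ?_ (h.trans (congrArg (fun h => Z.act h _) h₂)))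
  rw [SymSeq.act_act, SymSeq.act_act, h₁]
  rfl

theorem val_pt_left (w : N ⊕ S ≃ T) (o : B.el ⟨T, n⟩ k) (a : ∀ r, V₁.el (d (w (.inl r))) k)
    (b : ∀ s, V₂.el (d (w (.inr s))) k) (r : N) (h : a r = V₁.pt) : F.val w o a b = Z.pt := by
  unfold val
  rw [F.pt_left _ _ _ r h, SymSeq.act_pt]

theorem val_pt_right (w : N ⊕ S ≃ T) (o : B.el ⟨T, n⟩ k) (a : ∀ r, V₁.el (d (w (.inl r))) k)
    (b : ∀ s, V₂.el (d (w (.inr s))) k) (s : S) (h : b s = V₂.pt) : F.val w o a b = Z.pt := by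
  unfold val
  rw [F.pt_right _ _ _ s h, SymSeq.act_pt]

theorem sm_val {l : Dop} (α : k ⟶ l) (w : N ⊕ S ≃ T) (o : B.el ⟨T, n⟩ k)
    (a : ∀ r, V₁.el (d (w (.inl r))) k) (b : ∀ s, V₂.el (d (w (.inr s))) k) :
    Z.sm α (F.val w o a b) = F.val w (B.sm α o) (fun r => V₁.sm α (a r)) fun s => V₂.sm α (b s) := by
  unfold val
  rw [SymSeq.sm_act, ← F.sm, SymSeq.sm_act]
  rfl

variable {ι₁ : V₁ ⟶ V} {ι₂ : V₂ ⟶ V} (hV : IsWedge ι₁ ι₂)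
include hV

theorem val_of_pt {z : ∀ t, V.el (d t) k} (D : WedgeSplit ι₁ ι₂ z) (o : B.el ⟨T, n⟩ k) (t : T)
    (ht : z t = V.pt) : F.val D.w o D.a D.b = Z.pt := by
  obtain ⟨x, rfl⟩ := D.w.surjective t
  rcases x with r | s
  · exact F.val_pt_left D.w o D.a D.b r (hV.inl_inj ((D.ha r).symm.trans
      (ht.trans (SymSeq.ap_pt _).symm)))
  · exact F.val_pt_right D.w o D.a D.b s (hV.inr_inj ((D.hb s).symm.trans
      (ht.trans (SymSeq.ap_pt _).symm)))

/-- Splittings are ambiguous only at basepoints. If one entry is the basepoint, both values are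
basepoints. Otherwise the parts of both splittings are the same, and they differ by a relabelling as
in `val_congr`. -/
theorem val_eq {z : ∀ t, V.el (d t) k} (D D' : WedgeSplit ι₁ ι₂ z) (o : B.el ⟨T, n⟩ k) :
    F.val D.w o D.a D.b = F.val D'.w o D'.a D'.b := by
  by_cases h : ∃ t, z t = V.pt
  · obtain ⟨t, ht⟩ := h
    rw [F.val_of_pt hV D o t ht, F.val_of_pt hV D' o t ht]
  obtain ⟨w, a, b, ha, hb⟩ := D
  obtain ⟨w', a', b', ha', hb'⟩ := D'
  have key : ∀ t, (∃ a, z t = SymSeq.ap ι₁ a) → (∃ b, z t = SymSeq.ap ι₂ b) → z t = V.pt :=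
    fun t ⟨a, ha⟩ ⟨b, hb⟩ => ha.trans (hV.disjoint (ha.symm.trans hb))
  have hl : ∀ r, ((w'.trans w.symm) (.inl r)).isLeft := fun r => by
    rcases hx : (w'.trans w.symm) (.inl r) with x | x
    · rfl
    · have hx' : w' (.inl r) = w (.inr x) := by rw [← hx]; simp
      exact (h ⟨_, key (w' (.inl r)) ⟨_, ha' r⟩ (hx' ▸ ⟨_, hb x⟩)⟩).elim
  have hr : ∀ s, ((w'.trans w.symm) (.inr s)).isRight := fun s => by
    rcases hx : (w'.trans w.symm) (.inr s) with x | x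
    · have hx' : w' (.inr s) = w (.inl x) := by rw [← hx]; simp
      exact (h ⟨_, key (w' (.inr s)) (hx' ▸ ⟨_, ha x⟩) ⟨_, hb' s⟩⟩).elim
    · rfl
  -- The comparison of the two splittings respects the summands, hence is a pair of relabellings.
  obtain ⟨σ, τ, hστ⟩ := sumCongr_of_isLeft _ hl hr
  obtain rfl : w' = (Equiv.sumCongr σ τ).trans w := by
    rw [← hστ]
    exact Equiv.ext fun x => by simp
  have h₁ : a' = fun r => a (σ r) := funext fun r => hV.inl_inj ((ha' r).symm.trans (ha (σ r)))
  have h₂ : b' = fun s => b (τ s) := funext fun s => hV.inr_inj ((hb' s).symm.trans (hb (τ s)))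
  subst h₁ h₂
  exact (F.val_congr σ τ w o a b).symm

/-- The morphism out of `B ∘ (V₁ ⨿ V₂)`. -/
noncomputable def lift : circ B V ⟶ Z :=
  circ.lift Z (fun k T n d o z => F.val (hV.exists_split z).some.w o
      (hV.exists_split z).some.a (hV.exists_split z).some.b)
    (fun k l α T n d o z => by
      rw [F.sm_val]
      let D := (hV.exists_split z).some
      exact F.val_eq hV (z := fun t => V.sm α (z t)) _ ⟨D.w, fun r => V₁.sm α (D.a r), fun s => V₂.sm α (D.b s),
        fun r => by rw [D.ha, SymSeq.ap_sm], fun s => by rw [D.hb, SymSeq.ap_sm]⟩ (B.sm α o))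
    (fun k T T' n n' d d' σ l f o z => by
      let D := (hV.exists_split fun t => z (σ t)).some
      refine (F.val_eq hV (z := fun t => V.act (f t) (z (σ t))) _ ⟨D.w, fun r => V₁.act (f _) (D.a r),
        fun s => V₂.act (f _) (D.b s), fun r => by rw [D.ha, SymSeq.ap_act],
        fun s => by rw [D.hb, SymSeq.ap_act]⟩ _).trans ((F.val_act σ l f D.w o D.a D.b).trans ?_)
      exact congrArg (Z.act _) (F.val_eq hV (z := z) ⟨D.w.trans σ, D.a, D.b, D.ha, D.hb⟩ _ o))
    (fun k T n d z => by
      unfold val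
      rw [SymSeq.act_pt (X := B), F.pt, SymSeq.act_pt])
    (fun k T n d o z t h => F.val_of_pt hV _ o t h)

theorem lift_mk {z : ∀ t, V.el (d t) k} (D : WedgeSplit ι₁ ι₂ z) (o : B.el ⟨T, n⟩ k) :
    SymSeq.ap (F.lift hV) (circ.mk T n d o z) = F.val D.w o D.a D.b :=
  (circ.ap_lift _ _ _ _ _ _ _ _ _ _ _).trans (F.val_eq hV _ D o)

theorem lift_mk_sum {N S : FinBij} {d : N ⊕ S → Deg} (o : B.el ⟨N.sum S, n⟩ k)
    (a : ∀ r, V₁.el (d (.inl r)) k) (b : ∀ s, V₂.el (d (.inr s)) k) :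
    SymSeq.ap (F.lift hV) (circ.mk (N.sum S) n d o
      (Sum.rec (fun r => SymSeq.ap ι₁ (a r)) fun s => SymSeq.ap ι₂ (b s))) = F.f o a b := by
  refine (F.lift_mk hV (T := N.sum S) ⟨Equiv.refl _, a, b, fun r => rfl, fun s => rfl⟩ o).trans ?_
  unfold val
  have h₁ : (⟨Equiv.refl _, Lab.id⟩ : DHom k ⟨N.sum S, n⟩ ⟨N.sum S, n⟩) = DHom.id := rfl
  have h₂ : (DHom.circReindex (k := k) (T := N.sum S) (Equiv.refl _) n d) = DHom.id := by
    ext1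
    · exact Equiv.ext fun x => rfl
    · refine Lab.ext (funext ?_)
      rintro (x | x) <;> rfl
  exact (congrArg (fun h => Z.act h _) h₂).trans ((SymSeq.act_id _).trans
    (congrArg (fun o => F.f o a b) (SymSeq.act_id (X := B) o)))

end WedgeData

/-- After a reindexing, which acts injectively, the inputs of any generator are sorted by summand.
So sorted generators detect equality of morphisms. -/
theorem IsWedge.circ_hom_ext {ι₁ : V₁ ⟶ V} {ι₂ : V₂ ⟶ V} (hV : IsWedge ι₁ ι₂) {f g : circ B V ⟶ Z}
    (h : ∀ (k : Dop) (N S n : FinBij) (d : N ⊕ S → Deg) (o : B.el ⟨N.sum S, n⟩ k)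
      (a : ∀ r, V₁.el (d (.inl r)) k) (b : ∀ s, V₂.el (d (.inr s)) k),
      SymSeq.ap f (circ.mk (N.sum S) n d o
        (Sum.rec (fun r => SymSeq.ap ι₁ (a r)) fun s => SymSeq.ap ι₂ (b s))) =
      SymSeq.ap g (circ.mk (N.sum S) n d o
        (Sum.rec (fun r => SymSeq.ap ι₁ (a r)) fun s => SymSeq.ap ι₂ (b s)))) : f = g :=
  circ.hom_ext fun k T n d o z => by
    obtain ⟨D⟩ := hV.exists_split z
    have h₁ := h k D.N D.S n (fun x => d (D.w x))
      (B.act (c := ⟨T, n⟩) (d := ⟨D.N.sum D.S, n⟩) ⟨D.w, Lab.id⟩ o) D.a D.b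
    have h₂ : Sum.rec (fun r => SymSeq.ap ι₁ (D.a r)) (fun s => SymSeq.ap ι₂ (D.b s)) =
      fun x => z (D.w x) := funext (by
        rintro (r | s)
        exacts [(D.ha r).symm, (D.hb s).symm])
    rw [h₂] at h₁
    have h₃ := circ.mk_act_left (T := T) (T' := D.N.sum D.S) (n := n) D.w Lab.id o z
    refine SymSeq.act_injective (DHom.inv_circReindex (T' := D.N.sum D.S) (n := n) D.w d) ?_
    rw [← SymSeq.ap_act, ← SymSeq.ap_act]
    exact ((congrArg (SymSeq.ap f) h₃).symm.trans h₁).trans (congrArg (SymSeq.ap g) h₃)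

/-! ### Sorting inputs: the map $\mathcal O\circ(A\amalg Y)\to$ `cell` -/

namespace DHom
variable {k : Dop} {N S n : FinBij}

/-- Splitting the inputs of a generator of a composition product. -/
def resplit (n : FinBij) (d : N ⊕ S → Deg) : DHom k (Deg.circ n (T := N.sum S) d)
    ((Deg.circ n fun r : N => d (.inl r)).sum (Deg.sigma fun s : S => d (.inr s))) :=
  ofEquiv (c := Deg.circ n (T := N.sum S) d)
    (d := (Deg.circ n fun r : N => d (.inl r)).sum (Deg.sigma fun s : S => d (.inr s)))
    (Equiv.sumSigmaDistrib fun x => (d x).R).symm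
    ((Equiv.sumAssoc _ _ _).trans (Equiv.sumCongr (Equiv.refl n)
      (Equiv.sumSigmaDistrib fun x => (d x).N).symm))

/-- The inverse of `resplit`. -/
def unsplit (n : FinBij) (d : N ⊕ S → Deg) : DHom k
    ((Deg.circ n fun r : N => d (.inl r)).sum (Deg.sigma fun s : S => d (.inr s)))
    (Deg.circ n (T := N.sum S) d) :=
  ofEquiv (d := Deg.circ n (T := N.sum S) d)
    (c := (Deg.circ n fun r : N => d (.inl r)).sum (Deg.sigma fun s : S => d (.inr s)))
    (Equiv.sumSigmaDistrib fun x => (d x).R)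
    ((Equiv.sumCongr (Equiv.refl n) (Equiv.sumSigmaDistrib fun x => (d x).N)).trans
      (Equiv.sumAssoc _ _ _).symm)

theorem unsplit_resplit (d : N ⊕ S → Deg) : (unsplit n d : DHom k _ _).comp (resplit n d) = id := by
  ext1
  · refine Equiv.ext ?_
    rintro (⟨r, x⟩ | ⟨s, x⟩) <;> rfl
  · refine Lab.ext (funext ?_)
    rintro ((x | ⟨r, x⟩) | ⟨s, x⟩) <;> rfl

theorem unsplit_nat {N' S' n' : FinBij} {d : N ⊕ S → Deg} {d' : N' ⊕ S' → Deg}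
    (σ : N' ≃ N) (τ : S' ≃ S) (l : Lab n n' k)
    (g : ∀ x, DHom k (d (Equiv.sumCongr σ τ x)) (d' x)) :
    (unsplit n d).comp (circ (T := N.sum S) (T' := N'.sum S') (Equiv.sumCongr σ τ) l g) =
      ((circ (c := fun r => d (.inl r)) σ l fun r => g (.inl r)).sum
        (sigma (c := fun s => d (.inr s)) τ fun s => g (.inr s))).comp (unsplit n' d') := by
  ext1
  · exact Equiv.ext (by rintro ⟨r | s, x⟩ <;> rfl)
  · refine Lab.ext (funext ?_)
    rintro (x | ⟨r | s, x⟩)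
    · rcases h : l.g x with y | y <;> simp [comp, circ, unsplit, sum, ofEquiv, Lab.comp, Lab.sum,
        Lab.ofEquiv, h]
    · rcases h : (g (.inl r)).lab.g x with y | y <;> (simp [comp, circ, unsplit, sum, ofEquiv,
        Lab.comp, Lab.sum, Lab.sigma, Lab.ofEquiv, h]; rfl)
    · rcases h : (g (.inr s)).lab.g x with y | y <;> (simp [comp, circ, sigma, unsplit, sum, ofEquiv,
        Lab.comp, Lab.sum, Lab.sigma, Lab.ofEquiv, h]; rfl)

/-- The identities, from a pair of families to a family on a disjoint union. -/
def idElim (e : N ⊕ S → Deg) : ∀ x, DHom k (Sum.elim (fun r => e (.inl r)) (fun s => e (.inr s)) x)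
    (e x)
  | .inl _ => id
  | .inr _ => id

/-- Moving the last part of the inputs, from a family on a disjoint union. -/
def joinInputs {N' : FinBij} (n : FinBij) (d : (N ⊕ N') ⊕ S → Deg) :
    DHom k (((Deg.circ n fun r : N => d (.inl (.inl r))).sum
      (Deg.sigma fun r : N' => d (.inl (.inr r)))).sum (Deg.sigma fun s : S => d (.inr s)))
      (Deg.circ n (T := (N.sum N').sum S) d) :=
  (ungroup (N := N') (S := S) (Q := N'.sum S) (Equiv.refl _)
    (Deg.circ n fun r : N => d (.inl (.inl r)))
    (fun x => d ((Equiv.sumAssoc N N' S).symm (.inr x)))).comp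
  ((unsplit (N := N) (S := N'.sum S) n fun x => d ((Equiv.sumAssoc N N' S).symm x)).comp
    (circReindex (T := (N.sum N').sum S) (T' := N.sum (N'.sum S))
      (Equiv.sumAssoc N N' S).symm n d))

theorem group_joinInputs {N' : FinBij} (d : (N ⊕ N') ⊕ S → Deg) :
    (group (N := N') (S := S) (Q := N'.sum S) (Equiv.refl _)
      (Deg.circ n fun r : N => d (.inl (.inl r)))
      (fun x => d ((Equiv.sumAssoc N N' S).symm (.inr x))) : DHom k _ _).comp (joinInputs n d) =
    (unsplit (N := N) (S := N'.sum S) n fun x => d ((Equiv.sumAssoc N N' S).symm x)).comp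
      (circReindex (T := (N.sum N').sum S) (T' := N.sum (N'.sum S))
        (Equiv.sumAssoc N N' S).symm n d) :=
  (comp_assoc _ _ _).symm.trans
    ((congrArg (fun h => DHom.comp h _) (group_ungroup _ _ _)).trans (id_comp _))

/-- Index identity behind `wedgeData_plug`: it compares treating `N'` as part of the inputs from $A$
with splitting it off from them. -/
theorem idElim_unsplit {N' : FinBij} (d : (N ⊕ N') ⊕ S → Deg) :
    ((circFam (T := N.sum N') n (idElim (k := k) fun x => d (.inl x))).sum
      (id : DHom k (Deg.sigma fun s : S => d (.inr s)) _)).comp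
        (unsplit (N := N.sum N') (S := S) n d) =
      ((split (T := N) (Q := N') n (fun r => d (.inl (.inl r))) fun r => d (.inl (.inr r))).sum
        (id : DHom k (Deg.sigma fun s : S => d (.inr s)) _)).comp (joinInputs n d) := by
  ext1
  · refine Equiv.ext ?_
    rintro ⟨(r | r) | s, x⟩ <;> rfl
  · refine Lab.ext (funext ?_)
    rintro (x | ⟨(r | r) | s, x⟩) <;> rfl

end DHom

namespace Operad
variable {O : Operad.{u}} {A : O.Lt} {k : Dop} {N N' S T n Q : FinBij} {X Y V : SymSeq.{u}}
namespace cell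
variable (i : X ⟶ Y) (φ : X ⟶ A.A)

/-- The map `O ∘ (A ⨿ Y) ⟶ cell`. -/
noncomputable def wedgeData : WedgeData O.S A.A Y (cell i φ fun _ => True) where
  f {N S n d k} o a b := SymSeq.act _ (DHom.unsplit n d)
    (cell.mk i φ (p := fun _ => True) trivial (env.mk O A (T := N) (Q := S) o a) b)
  sm α o a b := by
    rw [SymSeq.sm_act, sm_mk, env.sm_mk]
    rfl
  act {N S N' S' n n' d d' k} σ τ l g o a b := by
    have h₁ : env.mk O A (T := N') (Q := S') (O.S.act (c := ⟨N.sum S, n⟩) (d := ⟨N'.sum S', n'⟩)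
        ⟨Equiv.sumCongr σ τ, l⟩ o) (fun r => A.A.act (g (.inl r)) (a (σ r))) =
        SymSeq.ap ((O.env A).map (Quiver.Hom.op (X := S') (Y := S) τ))
          (SymSeq.act _ (DHom.circ (c := fun r => d (.inl r)) σ l fun r => g (.inl r))
            (env.mk O A o a)) := by
      have h := env.mk_act (A := A) (Q := S) (d := fun r => d (.inl r)) (d' := fun r => d' (.inl r))
        σ l (fun r => g (.inl r)) o a
      refine Eq.trans ?_ (congrArg (SymSeq.ap _) h)
      rw [env.map_mk, SymSeq.act_act (X := O.S)]
      refine congrArg (fun h => env.mk O A (T := N') (Q := S') (O.S.act h o)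
        fun r => A.A.act (g (.inl r)) (a (σ r))) ?_
      ext1
      · exact Equiv.ext (by rintro (r | s) <;> rfl)
      · exact (Lab.comp_id _).symm
    have h₂ := mk_move (i := i) (φ := φ) (p := fun _ => True) (Q := S) (Q' := S')
      (e := fun s => d (.inr s)) (e' := fun s => d' (.inr s)) trivial trivial τ
      (DHom.circ (c := fun r => d (.inl r)) σ l fun r => g (.inl r)) (fun s => g (.inr s))
      (env.mk O A o a) b
    refine (congrArg (SymSeq.act _ _) ((congrArg (fun x => cell.mk i φ (p := fun _ => True) trivial
      x _) h₁).trans h₂)).trans ?_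
    rw [SymSeq.act_act, SymSeq.act_act, DHom.unsplit_nat]
  pt a b := by rw [env.mk_pt_left, mk_pt_left, SymSeq.act_pt]
  pt_left o a b r h := by rw [env.mk_pt o a r h, mk_pt_left, SymSeq.act_pt]
  pt_right o a b s h := by rw [mk_pt_right _ _ _ s h, SymSeq.act_pt]

variable {i φ}

/-- An element $x$ of $X$ may enter as the entry $\varphi(x)$ from $A$ or as the entry $i(x)$ from
$Y$. The resulting symbols agree by the plugging relation. -/
theorem wedgeData_plug {d : (N ⊕ N') ⊕ S → Deg} (o : O.S.el ⟨(N.sum N').sum S, n⟩ k)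
    (a : ∀ r, A.A.el (d (.inl (.inl r))) k) (x : ∀ r, X.el (d (.inl (.inr r))) k)
    (y : ∀ s, Y.el (d (.inr s)) k) :
    (wedgeData i φ).f (N := N.sum N') o (Sum.rec a fun r => SymSeq.ap φ (x r)) y =
      (wedgeData i φ).val (T := (N.sum N').sum S) (N := N) (S := N'.sum S) (d := d)
        (Equiv.sumAssoc N N' S).symm o a (Sum.rec (fun r => SymSeq.ap i (x r)) y) := by
  -- The plugging relation needs a nonempty `N'`. If `N'` is empty, both sides are values on the
  -- same generator of $\mathcal O\circ(A\amalg Y)$ with respect to two splittings.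
  rcases isEmpty_or_nonempty N' with hN | hN
  · have hV := isWedge_coprod A.A Y
    refine ((wedgeData i φ).lift_mk_sum hV (N := N.sum N') o
      (Sum.rec a fun r => SymSeq.ap φ (x r)) y).symm.trans ?_
    refine (wedgeData i φ).lift_mk hV (T := (N.sum N').sum S) (d := d)
      (WedgeSplit.mk (T := (N.sum N').sum S) (N := N) (S := N'.sum S) (d := d)
        (Equiv.sumAssoc N N' S).symm a (Sum.rec (fun r => SymSeq.ap i (x r)) y)
        ?_ ?_) o
    · exact fun r => rfl
    · rintro (r | s)
      exacts [hN.elim r, rfl]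
  have h₁ : (Sum.rec a fun r => SymSeq.ap φ (x r) : ∀ r : N.sum N', A.A.el (d (.inl r)) k) =
      fun r => A.A.act (DHom.idElim (fun x => d (.inl x)) r)
        (famSum a (fun r => SymSeq.ap φ (x r)) r) := by
    refine funext ?_
    rintro (r | r) <;> exact (SymSeq.act_id (X := A.A) _).symm
  -- The relation is applied to the symbol over `N' ⊔ S`, whose entries over `N'` are the `i(x)`.
  have h₂ := mk_plug (i := i) (φ := φ) (p := fun _ => True) (N := N') (S := S) (Q := N'.sum S)
    (c := Deg.circ n fun r : N => d (.inl (.inl r)))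
    (e := fun x => d ((Equiv.sumAssoc N N' S).symm (.inr x))) trivial trivial (Equiv.refl _) hN
    (env.mk O A (Q := N'.sum S) (O.S.act (c := ⟨(N.sum N').sum S, n⟩) (d := ⟨N.sum (N'.sum S), n⟩)
      ⟨(Equiv.sumAssoc N N' S).symm, Lab.id⟩ o) a) (Sum.rec (fun r => SymSeq.ap i (x r)) y) x
    (fun r => rfl)
  rw [env.plug_mk, mk_act_left] at h₂
  have h₃ := (SymSeq.act_act _ _ _).symm.trans
    ((congrArg (SymSeq.act _ (DHom.joinInputs n d)) h₂).trans (SymSeq.act_act _ _ _))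
  have h₄ := congrArg (fun z => SymSeq.act _ (DHom.unsplit (N := N.sum N') (S := S) n d) (cell.mk i φ (Q := S)
    (p := fun _ => True) trivial z y)) ((congrArg (env.mk O A (T := N.sum N') (Q := S) o) h₁).trans
      (env.mk_act_right (T := N.sum N') _ o _))
  have h₅ := h₄.trans ((congrArg (SymSeq.act _ _) (mk_act_left trivial _ _ y)).trans
    ((SymSeq.act_act _ _ _).trans (congrArg (fun h => SymSeq.act _ h _) (DHom.idElim_unsplit d))))
  refine h₅.trans (Eq.trans ?_ (h₃.trans ((congrArg (fun h => SymSeq.act _ h _)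
    (DHom.group_joinInputs d)).trans (SymSeq.act_act _ _ _).symm)))
  refine congrArg (fun o => SymSeq.act _ _ (cell.mk i φ (Q := S) (p := fun _ => True) trivial
    (env.mk O A (T := N.sum N') (Q := S) o (famSum a fun r => SymSeq.ap φ (x r))) y)) ?_
  refine Eq.trans ?_ (SymSeq.act_act (X := O.S) _ _ _).symm
  refine (SymSeq.act_id (X := O.S) o).symm.trans (congrArg (fun h => O.S.act h o) ?_)
  ext1
  · refine Equiv.ext ?_
    rintro ((r | r) | s) <;> rfl
  · rfl

end cell
end Operad
end SymSpectra

/-! ### Sorting inputs is compatible with the operad multiplication -/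

namespace SymSpectra

theorem DHom.unsplit_withUnits {k : Dop} {N S : FinBij} (n : FinBij) (s : N → CircSh) (e : S → Deg) :
    ((DHom.unsplit (N := (CircSh.assoc n s).T) (S := S) (CircSh.assoc n s).n
      (Sum.elim (CircSh.assoc n s).d e)).comp
    (DHom.circ (T := (CircSh.assoc n s).T.sum S)
      (T' := (CircSh.assoc n (Operad.withUnits s e)).T) (n := (CircSh.assoc n s).n)
      (n' := (CircSh.assoc n (Operad.withUnits s e)).n)
      (c := Sum.elim (fun x : (Σ t, (s t).T) => (s x.1).d x.2) e)
      (d := (CircSh.assoc n (Operad.withUnits s e)).d)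
      (Operad.withUnitsT s e) (Lab.ofEquiv (Operad.withUnitsN s e n))
        (Operad.withUnitsId (k := k) s e))).comp
      ((DHom.assoc n (Operad.withUnits s e)).comp (DHom.circFam n (Operad.withUnitsId'' s e))) =
    ((DHom.assoc n s).sum DHom.id).comp
      (DHom.unsplit n (Sum.elim (fun t => (s t).deg) e)) := by
  ext1
  · exact Equiv.ext (by rintro ⟨t | r, x⟩ <;> rfl)
  · refine Lab.ext (funext ?_)
    rintro (x | ⟨t | r, x⟩)
    · rfl
    · rcases x with x | x <;> rfl
    · rfl

namespace Operad
variable {O : Operad.{u}} {A : O.Lt} {k : Dop} {N S n : FinBij} {X Y V : SymSeq.{u}}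

/-- The family `withUnitsO` gives each entry its actual index, while `plug` uses a disjoint union of
two families. The two multiplications agree up to reindexing. -/
theorem mu_withUnits (s : N → CircSh) (e : S → Deg) (o : O.S.el ⟨N.sum S, n⟩ k)
    (os : ∀ t, O.S.el ⟨(s t).T, (s t).n⟩ k) :
    SymSeq.ap O.μ (circ.mk (N.sum S) n
      (fun x => ⟨(withUnits s e x).T, (withUnits s e x).n⟩) o (withUnitsO s e os)) =
    O.S.act (c := ⟨(FinBij.sigma fun t => (s t).T).sum S, n.sum (FinBij.sigma fun t => (s t).n)⟩)
      (d := Deg.circ n (T := N.sum S) fun x => ⟨(withUnits s e x).T, (withUnits s e x).n⟩)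
      ⟨withUnitsT s e, Lab.ofEquiv (withUnitsN s e n)⟩
      (O.plug (Q := S) (d := fun t => ⟨(s t).T, (s t).n⟩) o os) := by
  let f : ∀ x : N.sum S, DHom k (Sum.elim (fun t => ⟨(s t).T, (s t).n⟩) (fun _ : S => Deg.unit) x)
      ⟨(withUnits s e x).T, (withUnits s e x).n⟩ := fun
    | .inl _ => DHom.id
    | .inr _ => DHom.id
  have h₁ : withUnitsO s e os = fun x => O.S.act (f x) (famSum os (fun _ => O.one k) x) := by
    refine funext ?_
    rintro (t | r) <;> exact (SymSeq.act_id (X := O.S) _).symm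
  have h₂ := circ.mk_act_right (B := O.S) (T := N.sum S) f o (famSum os fun _ => O.one k)
  refine (congrArg (SymSeq.ap O.μ) ((congrArg (circ.mk (N.sum S) n _ o) h₁).trans h₂)).trans ?_
  unfold plug
  rw [SymSeq.ap_act, SymSeq.act_act]
  refine congrArg (fun h => SymSeq.act _ h _) ?_
  ext1
  · exact Equiv.ext (by rintro ⟨t | r, x⟩ <;> rfl)
  · refine Lab.ext (funext ?_)
    rintro (x | ⟨t | r, x⟩)
    · rfl
    · rfl
    · exact x.elim

variable {i : X ⟶ Y} {φ : X ⟶ A.A} {ι₁ : A.A ⟶ V} {ι₂ : Y ⟶ V}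

/-- Composing `o` with the operations `os` and with units at the entries from $Y$, and then sorting,
gives the symbol of `plug o os` over `S`. By the relation `env.mk_eval` of $\mathcal O_A$ it equals
the symbol in which each `os t` has been applied to its elements of $A$. -/
theorem mult_lift_mk (hV : IsWedge ι₁ ι₂) {s : N → CircSh} {e : S → Deg}
    (o : O.S.el ⟨N.sum S, n⟩ k) (os : ∀ t, O.S.el ⟨(s t).T, (s t).n⟩ k)
    (as : ∀ t p, A.A.el ((s t).d p) k) (y : ∀ r, Y.el (e r) k) :
    SymSeq.ap ((cell.wedgeData i φ).lift hV) (SymSeq.ap (O.mult V) (circ.mk (N.sum S) n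
      (Sum.elim (fun t => (s t).deg) e) o (famSum (X := circ O.S V)
        (fun t => circ.mk (s t).T (s t).n (s t).d (os t) fun p => SymSeq.ap ι₁ (as t p))
        fun r => SymSeq.ap (O.unit V) (SymSeq.ap ι₂ (y r))))) =
    (cell.wedgeData i φ).f (d := Sum.elim (fun t => (s t).deg) e) o
      (fun t => O.eval (os t) (as t)) y := by
  -- The units supplied by `O.unit V` are made explicit, so that every entry is a generator of a
  -- composition product up to an index map.
  have h₁ : famSum (X := circ O.S V)
        (fun t => circ.mk (s t).T (s t).n (s t).d (os t) fun p => SymSeq.ap ι₁ (as t p))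
        (fun r => SymSeq.ap (O.unit V) (SymSeq.ap ι₂ (y r))) =
      fun x => (circ O.S V).act (withUnitsId'' s e x) (circ.mk (withUnits s e x).T
        (withUnits s e x).n (withUnits s e x).d (withUnitsO s e os x)
        (withUnitsA (fun t p => SymSeq.ap ι₁ (as t p)) (fun r => SymSeq.ap ι₂ (y r)) x)) := by
    refine funext ?_
    rintro (t | r)
    exacts [(SymSeq.act_id _).symm, rfl]
  have h₂ := circ.mk_act_right (B := O.S) (T := N.sum S) (withUnitsId'' (k := k) s e) o
    fun x => circ.mk (Y := V) (withUnits s e x).T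
        (withUnits s e x).n (withUnits s e x).d (withUnitsO s e os x)
        (withUnitsA (fun t p => SymSeq.ap ι₁ (as t p)) (fun r => SymSeq.ap ι₂ (y r)) x)
  have h₃ := ap_circAssoc (T := N.sum S) (s := withUnits s e) o (withUnitsO s e os)
    (withUnitsA (fun t p => SymSeq.ap ι₁ (as t p)) (fun r => SymSeq.ap ι₂ (y r)))
  have h₄ := circ.mk_act (B := O.S) (T := (CircSh.assoc n s).T.sum S)
      (d := Sum.elim (fun x : (Σ t, (s t).T) => (s x.1).d x.2) e)
      (T' := (CircSh.assoc n (withUnits s e)).T) (d' := (CircSh.assoc n (withUnits s e)).d)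
      (n := (CircSh.assoc n s).n) (n' := (CircSh.assoc n (withUnits s e)).n)
      (withUnitsT s e) (Lab.ofEquiv (withUnitsN s e n)) (withUnitsId (k := k) s e)
      (O.plug (Q := S) (d := fun t => ⟨(s t).T, (s t).n⟩) o os)
      (famSum (fun x : (Σ t, (s t).T) => SymSeq.ap ι₁ (as x.1 x.2)) fun r => SymSeq.ap ι₂ (y r))
  have h₅ : (fun x => V.act (withUnitsId (k := k) s e x)
      (famSum (fun x : (Σ t, (s t).T) => SymSeq.ap ι₁ (as x.1 x.2)) (fun r => SymSeq.ap ι₂ (y r))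
        (withUnitsT s e x))) = fun x : (Σ x, (withUnits s e x).T) =>
      withUnitsA (fun t p => SymSeq.ap ι₁ (as t p)) (fun r => SymSeq.ap ι₂ (y r)) x.1 x.2 := by
    refine funext ?_
    rintro ⟨t | r, p⟩
    exacts [SymSeq.act_id _, SymSeq.act_id _]
  rw [h₅, ← mu_withUnits] at h₄
  have h₆ := (cell.wedgeData i φ).lift_mk_sum hV (N := (CircSh.assoc n s).T) (S := S)
    (d := Sum.elim (fun x : (Σ t, (s t).T) => (s x.1).d x.2) e)
    (O.plug (Q := S) (d := fun t => ⟨(s t).T, (s t).n⟩) o os) (fun x => as x.1 x.2) y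
  have h₇ : famSum (fun x : (Σ t, (s t).T) => SymSeq.ap ι₁ (as x.1 x.2)) (fun r => SymSeq.ap ι₂ (y r)) =
      Sum.rec (fun x : (Σ t, (s t).T) => SymSeq.ap ι₁ (as x.1 x.2)) (fun r => SymSeq.ap ι₂ (y r)) := by
    refine funext ?_
    rintro (x | r) <;> rfl
  have h₈ := ap_circMap O.μ (𝟙 V) (CircSh.assoc n (withUnits s e)).T
    (CircSh.assoc n (withUnits s e)).n (CircSh.assoc n (withUnits s e)).d
    (circ.mk (N.sum S) n (fun x => ⟨(withUnits s e x).T, (withUnits s e x).n⟩) o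
      (withUnitsO s e os)) fun x => withUnitsA (fun t p => SymSeq.ap ι₁ (as t p))
        (fun r => SymSeq.ap ι₂ (y r)) x.1 x.2
  have h₉ : SymSeq.ap (O.mult V) (circ.mk (N.sum S) n
      (Sum.elim (fun t => (s t).deg) e) o (famSum (X := circ O.S V)
        (fun t => circ.mk (s t).T (s t).n (s t).d (os t) fun p => SymSeq.ap ι₁ (as t p))
        fun r => SymSeq.ap (O.unit V) (SymSeq.ap ι₂ (y r)))) = _ :=
    (congrArg (SymSeq.ap (O.mult V)) ((congrArg (circ.mk (N.sum S) n _ o) h₁).trans h₂)).trans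
    ((SymSeq.ap_act _ _ _).trans (congrArg (SymSeq.act _ _) ((congrArg (SymSeq.ap (circMap O.μ (𝟙 V)))
      h₃).trans ((SymSeq.ap_act _ _ _).trans (congrArg (SymSeq.act _ _) (h₈.trans h₄))))))
  refine (congrArg _ h₉).trans ((SymSeq.ap_act _ _ _).trans ((congrArg (SymSeq.act _ _)
    ((SymSeq.ap_act _ _ _).trans (congrArg (SymSeq.act _ _) ((SymSeq.ap_act _ _ _).trans
      (congrArg (SymSeq.act _ _) ((congrArg (fun z => SymSeq.ap _ (circ.mk _ _ _ _ z)) h₇).trans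
        h₆)))))).trans ?_))
  have h₀ : (cell.wedgeData i φ).f (d := Sum.elim (fun t => (s t).deg) e) o
      (fun t => O.eval (os t) (as t)) y = _ :=
    congrArg (SymSeq.act _ (DHom.unsplit n (Sum.elim (fun t => (s t).deg) e)))
      ((congrArg (fun x => cell.mk i φ (p := fun _ => True) trivial x y)
        (env.mk_eval (A := A) (Q := S) o os as)).trans (cell.mk_act_left trivial _ _ y))
  refine Eq.trans ?_ h₀.symm
  refine Eq.trans ?_ (SymSeq.act_act _ _ _).symm
  refine Eq.trans ?_ (congrArg (fun h => SymSeq.act (cell i φ fun _ => True) h (cell.mk i φ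
    (p := fun _ => True) trivial (env.mk O A (T := (CircSh.assoc n s).T) (Q := S)
      (n := (CircSh.assoc n s).n) (d := (CircSh.assoc n s).d)
      (O.plug (Q := S) (d := fun t => ⟨(s t).T, (s t).n⟩) o os) fun x => as x.1 x.2) y))
    (DHom.unsplit_withUnits n s e))
  refine Eq.trans ?_ (SymSeq.act_act _ _ _)
  refine Eq.trans ?_ (SymSeq.act_act _ _ _)
  exact congrArg (SymSeq.act _ _) (congrArg (SymSeq.act _ _) (SymSeq.act_act
    (DHom.unsplit (N := (CircSh.assoc n s).T) (S := S) (CircSh.assoc n s).n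
      (Sum.elim (CircSh.assoc n s).d e)) _ (cell.mk i φ
    (p := fun _ => True) trivial (env.mk O A (T := (CircSh.assoc n s).T) (Q := S)
      (n := (CircSh.assoc n s).n) (d := (CircSh.assoc n s).d)
      (O.plug (Q := S) (d := fun t => ⟨(s t).T, (s t).n⟩) o os) fun x => as x.1 x.2) y)))

/-- Extends `mult_lift_mk` to arbitrary entries of $\mathcal O\circ A$: basepoints are treated
separately, and the index maps of generators are pulled out of the family. -/
theorem mult_lift_mk_sum (hV : IsWedge ι₁ ι₂) {d : N ⊕ S → Deg} (o : O.S.el ⟨N.sum S, n⟩ k)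
    (c : ∀ r, (circ O.S A.A).el (d (.inl r)) k) (y : ∀ s, Y.el (d (.inr s)) k) :
    SymSeq.ap ((cell.wedgeData i φ).lift hV) (SymSeq.ap (O.mult V) (circ.mk (N.sum S) n d o
      (Sum.rec (fun r => SymSeq.ap (circMap (𝟙 _) ι₁) (c r))
        fun s => SymSeq.ap (O.unit V) (SymSeq.ap ι₂ (y s))))) =
    (cell.wedgeData i φ).f o (fun r => SymSeq.ap (act₁ A) (c r)) y := by
  rcases Pres.exists_gens (P := circPres O.S A.A) c with ⟨r, hr⟩ | ⟨g, hg⟩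
  · refine Eq.trans ?_ ((cell.wedgeData i φ).pt_left o _ y r
      ((congrArg (SymSeq.ap (act₁ A)) hr).trans (SymSeq.ap_pt _))).symm
    refine (congrArg _ ((congrArg _ (circ.mk_pt (T := N.sum S) o _ (.inl r)
      ((congrArg (SymSeq.ap (circMap (𝟙 _) ι₁)) hr).trans (SymSeq.ap_pt _)))).trans
        (SymSeq.ap_pt _))).trans (SymSeq.ap_pt _)
  · let h : ∀ x : N.sum S, DHom k (Sum.elim (fun t => (g t).s.deg) (fun s => d (.inr s)) x) (d x) :=
      fun
      | .inl r => (g r).ψ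
      | .inr s => DHom.id
    have hc : ∀ r, c r = (circ O.S A.A).act (g r).ψ (circ.mk (g r).s.T (g r).s.n (g r).s.d
        (g r).v.1 (g r).v.2) := fun r => (congrFun hg r).trans (circ.act_mk _ _ _ _ _ _).symm
    have h₁ : (Sum.rec (fun r => SymSeq.ap (circMap (𝟙 _) ι₁) (c r))
        (fun s => SymSeq.ap (O.unit V) (SymSeq.ap ι₂ (y s))) : ∀ x, (circ O.S V).el (d x) k) =
        fun x => (circ O.S V).act (h x) (famSum (X := circ O.S V)
        (fun t => circ.mk (g t).s.T (g t).s.n (g t).s.d (g t).v.1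
          fun p => SymSeq.ap ι₁ ((g t).v.2 p))
        (fun r => SymSeq.ap (O.unit V) (SymSeq.ap ι₂ (y r))) x) := by
      refine funext ?_
      rintro (r | s)
      · exact (congrArg (SymSeq.ap (circMap (𝟙 _) ι₁)) (hc r)).trans ((SymSeq.ap_act _ _ _).trans
          (congrArg (SymSeq.act _ _) (ap_circMap _ _ _ _ _ _ _)))
      · exact (SymSeq.act_id _).symm
    have h₂ := circ.mk_act_right (B := O.S) (T := N.sum S) h o (famSum (X := circ O.S V)
        (fun t => circ.mk (g t).s.T (g t).s.n (g t).s.d (g t).v.1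
          fun p => SymSeq.ap ι₁ ((g t).v.2 p))
        (fun r => SymSeq.ap (O.unit V) (SymSeq.ap ι₂ (y r))))
    have h₃ := mult_lift_mk (i := i) (φ := φ) hV (s := fun t => (g t).s) o (fun t => (g t).v.1)
      (fun t => (g t).v.2) y
    refine (congrArg (fun z => SymSeq.ap ((cell.wedgeData i φ).lift hV) (SymSeq.ap (O.mult V) z))
      ((congrArg (circ.mk (N.sum S) n d o) h₁).trans h₂)).trans ?_
    rw [SymSeq.ap_act, SymSeq.ap_act]
    refine (congrArg (SymSeq.act _ _) h₃).trans ?_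
    have h₄ := (cell.wedgeData i φ).act (N := N) (S := S)
      (d := Sum.elim (fun t => (g t).s.deg) (fun s => d (.inr s))) (d' := d) (Equiv.refl N)
      (Equiv.refl S) Lab.id (fun | .inl r => (g r).ψ | .inr s => DHom.id) o
      (fun t => O.eval (g t).v.1 (g t).v.2) y
    have h₅ : (fun s => Y.act (DHom.id : DHom k (d (.inr s)) _) (y s)) = y :=
      funext fun s => SymSeq.act_id _
    have h₆ : (fun r => A.A.act (g r).ψ (O.eval (g r).v.1 (g r).v.2)) =
        fun r => SymSeq.ap (act₁ A) (c r) := funext fun r =>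
      ((congrArg (SymSeq.ap (act₁ A)) (hc r)).trans (SymSeq.ap_act _ _ _)).symm
    have h₇ : O.S.act (c := ⟨N.sum S, n⟩) (d := ⟨N.sum S, n⟩)
        ⟨Equiv.sumCongr (Equiv.refl N) (Equiv.refl S), Lab.id⟩ o = o := by
      refine Eq.trans (congrArg (fun h => O.S.act h o) ?_) (SymSeq.act_id (X := O.S) o)
      ext1
      · exact Equiv.ext (by rintro (r | s) <;> rfl)
      · rfl
    refine Eq.trans ?_ (h₄.symm.trans ?_)
    · refine congrArg (fun h => SymSeq.act _ h _) ?_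
      ext1
      · exact Equiv.ext (by rintro ⟨r | s, x⟩ <;> rfl)
      · refine Lab.ext (funext ?_)
        rintro (x | ⟨r | s, x⟩) <;> rfl
    · exact (congrArg (fun o => (cell.wedgeData i φ).f o _ _) h₇).trans (congrArg₂
        (fun a b => (cell.wedgeData i φ).f (d := d) o a b) h₆ h₅)

end Operad
end SymSpectra

/-! ### The composition product preserves reflexive coequalizers -/

namespace SymSpectra

section Reflexive
variable {K : WalkingParallelPair ⥤ SymSeq.{u}} {c : Cocone K} {B : SymSeq.{u}}

theorem el_surjective_of_isColimit (hc : IsColimit c) {d : Deg} {k : Dop} (y : c.pt.el d k) :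
    ∃ x, SymSeq.ap (c.ι.app .one) x = y := by
  rcases el_cases_of_isColimit hc y with rfl | ⟨_ | _, x, rfl⟩
  · exact ⟨SymSeq.pt _, SymSeq.ap_pt _⟩
  · exact ⟨SymSeq.ap (K.map .left) x, by rw [← SymSeq.ap_comp, c.w]⟩
  · exact ⟨x, rfl⟩

theorem eq_of_ap_ι_eq (hc : IsColimit c) {d : Deg} {k : Dop} {β : Sort*}
    (G : (K.obj .one).el d k → β)
    (hG : ∀ x, G (SymSeq.ap (K.map .left) x) = G (SymSeq.ap (K.map .right) x))
    {y y' : (K.obj .one).el d k} (h : SymSeq.ap (c.ι.app .one) y = SymSeq.ap (c.ι.app .one) y') :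
    G y = G y' := by
  obtain ⟨φ, hφ, -⟩ := exists_el_desc hc (G (SymSeq.pt _)) (fun j => match j with
    | .zero => fun x => G (SymSeq.ap (K.map .left) x)
    | .one => G) (by
      rintro _ _ (_ | _ | _) x
      · rfl
      · exact (hG x).symm
      · rename_i j
        have h : SymSeq.ap (K.map (𝟙 j)) x = x := by rw [K.map_id, SymSeq.ap_id]
        rcases j with _ | _
        exacts [congrArg (fun x => G (SymSeq.ap (K.map .left) x)) h, congrArg G h]) (by
      rintro (_ | _)
      · exact congrArg G (SymSeq.ap_pt _)
      · rfl)
  exact (hφ .one y).symm.trans ((congrArg φ h).trans (hφ .one y'))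

variable (s : K.obj .one ⟶ K.obj .zero) (hl : s ≫ K.map .left = 𝟙 _) (hr : s ≫ K.map .right = 𝟙 _)
include hl hr

/-- By `piQuot`, entries may be changed one elementary step at a time in each coordinate. The common
section lets unchanged entries be written as images under both maps, so such a simultaneous change
comes from one generator over `K.obj .zero`. This is where reflexivity is used. -/
theorem ap_circ_mk_eq (hc : IsColimit c) {Z : SymSeq.{u}} (h : circ B (K.obj .one) ⟶ Z)
    (hh : circMap (𝟙 B) (K.map .left) ≫ h = circMap (𝟙 B) (K.map .right) ≫ h) {k : Dop}
    {T n : FinBij} {d : T → Deg} (o : B.el ⟨T, n⟩ k) (y y' : ∀ t, (K.obj .one).el (d t) k)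
    (hy : ∀ t, SymSeq.ap (c.ι.app .one) (y t) = SymSeq.ap (c.ι.app .one) (y' t)) :
    SymSeq.ap h (circ.mk T n d o y) = SymSeq.ap h (circ.mk T n d o y') := by
  refine piQuot (r := fun t a b => ∃ x, a = SymSeq.ap (K.map .left) x ∧
    b = SymSeq.ap (K.map .right) x) (fun y => SymSeq.ap h (circ.mk T n d o y)) ?_ y y' fun t => ?_
  · intro y y' hy
    -- An unchanged entry is the image of its value under `s`, by either map.
    have : ∀ t, ∃ x, y t = SymSeq.ap (K.map .left) x ∧ y' t = SymSeq.ap (K.map .right) x :=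
      fun t => (hy t).elim (fun h => ⟨SymSeq.ap s (y t), by
        rw [← SymSeq.ap_comp, hl, SymSeq.ap_id], by
        rw [← SymSeq.ap_comp, hr, SymSeq.ap_id, h]⟩) id
    choose x hx hx' using this
    obtain rfl : y = _ := funext hx
    obtain rfl : y' = _ := funext hx'
    have := congrArg (fun f => SymSeq.ap f (circ.mk T n d o x)) hh
    simpa only [SymSeq.ap_comp, ap_circMap, SymSeq.ap_id] using this
  · exact eq_of_ap_ι_eq hc (Quot.mk _) (fun x => Quot.sound ⟨x, rfl, rfl⟩) (hy t)

/-- Every entry of a generator over the coequalizer lifts to `K.obj .one`. The lifts are chosen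
arbitrarily, and `ap_circ_mk_eq` shows that a cocone does not depend on them. -/
theorem isColimit_circ (O : Operad.{u}) (hc : IsColimit c) :
    Nonempty (IsColimit (O.monad.toFunctor.mapCocone c)) := by
  choose l hl' using fun (d : Deg) (k : Dop) (y : c.pt.el d k) => el_surjective_of_isColimit hc y
  have key : ∀ (σ : Cocone (K ⋙ O.monad.toFunctor)) {k : Dop}
      {T n : FinBij} {d : T → Deg} (o : O.S.el ⟨T, n⟩ k) (y y' : ∀ t, (K.obj .one).el (d t) k)
      (_ : ∀ t, SymSeq.ap (c.ι.app .one) (y t) = SymSeq.ap (c.ι.app .one) (y' t)),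
      SymSeq.ap (X := circ O.S (K.obj .one)) (σ.ι.app .one) (circ.mk T n d o y) =
        SymSeq.ap (X := circ O.S (K.obj .one)) (σ.ι.app .one) (circ.mk T n d o y') :=
    fun σ k T n d o y y' hy => ap_circ_mk_eq s hl hr hc (σ.ι.app .one)
      ((σ.w .left).trans (σ.w .right).symm) o y y' hy
  let D (σ : Cocone (K ⋙ O.monad.toFunctor)) : circ O.S c.pt ⟶ σ.pt :=
    circ.lift _ (fun k T n d o y => SymSeq.ap (X := circ O.S (K.obj .one)) (σ.ι.app .one)
        (circ.mk T n d o fun t => l _ _ (y t)))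
      (fun k k' α T n d o y => by
        refine Eq.trans ?_ (SymSeq.ap_sm _ _ _)
        rw [circ.sm_mk]
        exact key σ _ _ _ fun t => by rw [hl', SymSeq.ap_sm, hl']; rfl)
      (fun k T T' n n' d d' τ a f o y => by
        refine Eq.trans ?_ (SymSeq.ap_act _ _ _)
        rw [← circ.mk_act]
        exact key σ _ _ _ fun t => by rw [hl', SymSeq.ap_act, hl']; rfl)
      (fun k T n d y => (congrArg _ (circ.mk_pt_left _)).trans (SymSeq.ap_pt _))
      -- The chosen lift of a basepoint need not be the basepoint, so it is first replaced by it.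
      (fun k T n d o y t ht => by
        refine Eq.trans (key σ o _ (fun t' => by
          classical exact if t' = t then SymSeq.pt _ else l _ _ (y t')) fun t' => ?_) ?_
        · by_cases h : t' = t
          · subst h
            rw [if_pos rfl, hl', ht, SymSeq.ap_pt]
            rfl
          · rw [if_neg h]
        · exact (congrArg _ (circ.mk_pt _ _ t (if_pos rfl))).trans (SymSeq.ap_pt _))
  have hD : ∀ σ : Cocone (K ⋙ O.monad.toFunctor),
      circMap (𝟙 O.S) (c.ι.app .one) ≫ D σ = σ.ι.app .one := fun σ =>
    circ.hom_ext fun k T n d o y => by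
      rw [SymSeq.ap_comp, ap_circMap]
      refine (circ.ap_lift _ _ _ _ _ _ _ _ _ _ _).trans ?_
      exact key σ _ _ _ fun t => hl' _ _ _
  refine ⟨{ desc := D, fac := fun σ j => ?_, uniq := fun σ m hm => ?_ }⟩
  · rcases j with _ | _
    · have h₁ := (O.monad.toFunctor.mapCocone c).w .left
      have h₂ := σ.w .left
      refine (congrArg (fun f => CategoryStruct.comp (Z := σ.pt) f (D σ)) h₁.symm).trans
        (((Category.assoc _ _ _).trans ?_).trans h₂)
      exact congrArg (fun f => (K ⋙ O.monad.toFunctor).map .left ≫ f) (hD σ)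
    · exact hD σ
  · refine circ.hom_ext fun k T n d o y => ?_
    have h₁ := congrArg (fun f => SymSeq.ap (X := circ O.S (K.obj .one)) f (circ.mk T n d o fun t => l _ _ (y t)))
      ((hm .one).trans (hD σ).symm)
    have h₂ : SymSeq.ap (circMap (𝟙 O.S) (c.ι.app .one)) (circ.mk T n d o fun t => l _ _ (y t)) =
        circ.mk T n d o y := (ap_circMap _ _ _ _ _ _ _).trans
      (congrArg (circ.mk T n d o) (funext fun t => hl' _ _ _))
    exact (congrArg (SymSeq.ap m) h₂).symm.trans (h₁.trans (congrArg (SymSeq.ap (D σ)) h₂))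

theorem preservesColimit_circ (O : Operad.{u}) : PreservesColimit K O.monad.toFunctor :=
  ⟨fun hc => isColimit_circ s hl hr O hc⟩

end Reflexive

/-- The forgetful functor of a monad creates a colimit if the monad functor preserves the colimit of
the underlying diagram and that of its image under the monad. Both pairs are reflexive, with
sections `s` and $\mathcal O\circ s$. The section is only required on underlying sequences, not as a
morphism of modules. -/
theorem preservesColimit_forget (O : Operad.{u}) (K : WalkingParallelPair ⥤ O.Lt)
    (s : (K.obj .one).A ⟶ (K.obj .zero).A)
    (hl : s ≫ (K.map .left).f = 𝟙 _) (hr : s ≫ (K.map .right).f = 𝟙 _) :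
    PreservesColimit K O.monad.forget := by
  have h₁ : PreservesColimit (K ⋙ O.monad.forget) O.monad.toFunctor :=
    preservesColimit_circ (K := K ⋙ O.monad.forget) s hl hr O
  have h₂ : PreservesColimit ((K ⋙ O.monad.forget) ⋙ O.monad.toFunctor) O.monad.toFunctor :=
    preservesColimit_circ (K := (K ⋙ O.monad.forget) ⋙ O.monad.toFunctor)
      (O.monad.toFunctor.map s)
      ((O.monad.toFunctor.map_comp _ _).symm.trans ((congrArg _ hl).trans (O.monad.toFunctor.map_id _)))
      ((O.monad.toFunctor.map_comp _ _).symm.trans ((congrArg _ hr).trans (O.monad.toFunctor.map_id _))) O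
  infer_instance

/-- The form of `IsWedge.circ_hom_ext` for three summands, obtained by sorting first the outer and
then the inner coproduct. -/
theorem IsWedge.circ_hom_ext₃ {B U X Y M R Z : SymSeq.{u}} {κ₁ : M ⟶ R} {κ₂ : Y ⟶ R} {l₁ : U ⟶ M}
    {l₂ : X ⟶ M} (hR : IsWedge κ₁ κ₂) (hM : IsWedge l₁ l₂) {f g : circ B R ⟶ Z}
    (h : ∀ (k : Dop) (N N' S n : FinBij) (d : (N ⊕ N') ⊕ S → Deg) (o : B.el ⟨(N.sum N').sum S, n⟩ k)
      (a : ∀ r, U.el (d (.inl (.inl r))) k) (x : ∀ r, X.el (d (.inl (.inr r))) k)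
      (y : ∀ s, Y.el (d (.inr s)) k),
      SymSeq.ap f (circ.mk ((N.sum N').sum S) n d o
        (Sum.rec (Sum.rec (fun r => SymSeq.ap κ₁ (SymSeq.ap l₁ (a r)))
          fun r => SymSeq.ap κ₁ (SymSeq.ap l₂ (x r))) fun s => SymSeq.ap κ₂ (y s))) =
      SymSeq.ap g (circ.mk ((N.sum N').sum S) n d o
        (Sum.rec (Sum.rec (fun r => SymSeq.ap κ₁ (SymSeq.ap l₁ (a r)))
          fun r => SymSeq.ap κ₁ (SymSeq.ap l₂ (x r))) fun s => SymSeq.ap κ₂ (y s)))) : f = g :=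
  hR.circ_hom_ext fun k N₀ S n d o z y => by
    obtain ⟨D⟩ := hM.exists_split z
    let w : (D.N.sum D.S).sum S ≃ N₀.sum S := Equiv.sumCongr D.w (Equiv.refl S)
    have h₁ := h k D.N D.S S n (fun x => d (w x))
      (B.act (c := ⟨N₀.sum S, n⟩) (d := ⟨(D.N.sum D.S).sum S, n⟩) ⟨w, Lab.id⟩ o) D.a D.b y
    have h₂ : (Sum.rec (Sum.rec (fun r => SymSeq.ap κ₁ (SymSeq.ap l₁ (D.a r)))
          fun r => SymSeq.ap κ₁ (SymSeq.ap l₂ (D.b r))) (fun s => SymSeq.ap κ₂ (y s)) :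
          ∀ x, R.el (d (w x)) k) = fun x => (Sum.rec (fun r => SymSeq.ap κ₁ (z r))
            (fun s => SymSeq.ap κ₂ (y s)) : ∀ x, R.el (d x) k) (w x) := funext (by
        rintro ((r | r) | s)
        exacts [congrArg (SymSeq.ap κ₁) (D.ha r).symm, congrArg (SymSeq.ap κ₁) (D.hb r).symm, rfl])
    rw [h₂] at h₁
    have h₃ := circ.mk_act_left (T := N₀.sum S) (T' := (D.N.sum D.S).sum S) (n := n) w Lab.id o
      (Sum.rec (fun r => SymSeq.ap κ₁ (z r)) (fun s => SymSeq.ap κ₂ (y s)) : ∀ x, R.el (d x) k)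
    refine SymSeq.act_injective (DHom.inv_circReindex (T := N₀.sum S) (T' := (D.N.sum D.S).sum S)
      (n := n) w d) ?_
    rw [← SymSeq.ap_act, ← SymSeq.ap_act]
    exact ((congrArg (SymSeq.ap f) h₃).symm.trans h₁).trans (congrArg (SymSeq.ap g) h₃)

/-! ### The relations presenting $P$ -/

namespace Operad
variable {O : Operad.{u}} {A : O.Lt} {X Y : SymSeq.{u}} (i : X ⟶ Y) (φ : X ⟶ A.A)

/-- The relations of a pushout of a free map: the object of generators. -/
noncomputable abbrev cellRel (A : O.Lt) (X Y : SymSeq.{u}) : SymSeq.{u} := (circ O.S A.A ⨿ X) ⨿ Y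

/-- The relations of a pushout of a free map: the left hand sides. -/
noncomputable def relL : cellRel A X Y ⟶ circ O.S (A.A ⨿ Y) :=
  coprod.desc (coprod.desc (circMap (𝟙 _) coprod.inl) (φ ≫ coprod.inl ≫ O.unit _))
    (coprod.inr ≫ O.unit _)

/-- The relations of a pushout of a free map: the right hand sides. -/
noncomputable def relR : cellRel A X Y ⟶ A.A ⨿ Y :=
  coprod.desc (coprod.desc (act₁ A ≫ coprod.inl) (i ≫ coprod.inr)) coprod.inr

/-- The inclusions of the three kinds of relations. -/
noncomputable def relA (A : O.Lt) (X Y : SymSeq.{u}) : circ O.S A.A ⟶ cellRel A X Y :=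
  coprod.inl ≫ coprod.inl

noncomputable def relX (A : O.Lt) (X Y : SymSeq.{u}) : X ⟶ cellRel A X Y :=
  coprod.inr ≫ coprod.inl

noncomputable def relY (A : O.Lt) (X Y : SymSeq.{u}) : Y ⟶ cellRel A X Y := coprod.inr

theorem relA_relL : relA A X Y ≫ relL φ = circMap (𝟙 _) coprod.inl :=
  (Category.assoc _ _ _).trans ((congrArg _ (coprod.inl_desc _ _)).trans (coprod.inl_desc _ _))

theorem relX_relL : relX A X Y ≫ relL φ = φ ≫ coprod.inl ≫ O.unit _ :=
  (Category.assoc _ _ _).trans ((congrArg _ (coprod.inl_desc _ _)).trans (coprod.inr_desc _ _))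

theorem relY_relL : relY A X Y ≫ relL φ = coprod.inr ≫ O.unit _ := coprod.inr_desc _ _

theorem relA_relR : relA A X Y ≫ relR i = act₁ A ≫ coprod.inl :=
  (Category.assoc _ _ _).trans ((congrArg _ (coprod.inl_desc _ _)).trans (coprod.inl_desc _ _))

theorem relX_relR : relX A X Y ≫ relR i = i ≫ coprod.inr :=
  (Category.assoc _ _ _).trans ((congrArg _ (coprod.inl_desc _ _)).trans (coprod.inr_desc _ _))

theorem relY_relR : relY A X Y ≫ relR i = coprod.inr := coprod.inr_desc _ _

theorem cellRel_hom_ext {Z : SymSeq.{u}} {f g : cellRel A X Y ⟶ Z}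
    (hA : relA A X Y ≫ f = relA A X Y ≫ g) (hX : relX A X Y ≫ f = relX A X Y ≫ g)
    (hY : relY A X Y ≫ f = relY A X Y ≫ g) : f = g :=
  coprod.hom_ext (coprod.hom_ext ((Category.assoc _ _ _).symm.trans (hA.trans (Category.assoc _ _ _)))
    ((Category.assoc _ _ _).symm.trans (hX.trans (Category.assoc _ _ _)))) hY

/-- The common section of the relations. -/
noncomputable def relSection (A : O.Lt) (X Y : SymSeq.{u}) : A.A ⨿ Y ⟶ cellRel A X Y :=
  coprod.desc (O.unit A.A ≫ relA A X Y) (relY A X Y)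

theorem inl_relSection : coprod.inl ≫ relSection A X Y = O.unit A.A ≫ relA A X Y :=
  coprod.inl_desc _ _

theorem inr_relSection : coprod.inr ≫ relSection A X Y = relY A X Y := coprod.inr_desc _ _

/-- The section sends $a$ to $[1;a]$ and $y$ to the trivial relation $y=y$. The summand `Y` of
`cellRel` is there to make this section possible. -/
theorem relSection_relL : relSection A X Y ≫ relL φ = O.unit (A.A ⨿ Y) := by
  refine coprod.hom_ext ?_ ?_
  · rw [← Category.assoc, inl_relSection, Category.assoc, relA_relL, unit_naturality]
  · rw [← Category.assoc, inr_relSection, relY_relL]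

theorem relSection_relR : relSection A X Y ≫ relR i = 𝟙 (A.A ⨿ Y) := by
  refine coprod.hom_ext ?_ ?_
  · rw [← Category.assoc, inl_relSection, Category.assoc, relA_relR, ← Category.assoc, unit_act₁,
      Category.id_comp, Category.comp_id]
  · rw [← Category.assoc, inr_relSection, relY_relR, Category.comp_id]

/-- The map `O ∘ (A ⨿ Y) ⟶ cell`. -/
noncomputable abbrev liftCell : circ O.S (A.A ⨿ Y) ⟶ cell i φ fun _ => True :=
  (cell.wedgeData i φ).lift (isWedge_coprod A.A Y)

/-- The sorting map respects the relations. By extensionality over three summands, entries of all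
three kinds are treated at once: `mult_lift_mk_sum` handles the action on $A$ and
`cell.wedgeData_plug` the exchange of $\varphi(x)$ with $i(x)$. -/
theorem liftCell_condition : circMap (𝟙 O.S) (relL φ) ≫ O.mult (A.A ⨿ Y) ≫ liftCell i φ =
    circMap (𝟙 O.S) (relR i) ≫ liftCell i φ := by
  refine (isWedge_coprod _ _).circ_hom_ext₃ (isWedge_coprod _ _) fun k N N' S n d o c x y => ?_
  rw [SymSeq.ap_comp, SymSeq.ap_comp, SymSeq.ap_comp, ap_circMap, ap_circMap]
  -- On the left-hand side the entries from $X$ become $[1;\varphi(x)]$, so they join the entries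
  -- from $\mathcal O\circ A$.
  let c' : ∀ r : N.sum N', (circ O.S A.A).el (d (.inl r)) k :=
    Sum.rec c fun r => SymSeq.ap (O.unit A.A) (SymSeq.ap φ (x r))
  have hL : ∀ t : (N.sum N').sum S, SymSeq.ap (relL φ) ((Sum.rec (Sum.rec
      (fun r => SymSeq.ap coprod.inl (SymSeq.ap coprod.inl (c r)))
        fun r => SymSeq.ap coprod.inl (SymSeq.ap coprod.inr (x r)))
      (fun s => SymSeq.ap coprod.inr (y s)) : ∀ t, (cellRel A X Y).el (d t) k) t) =
      (Sum.rec (fun r => SymSeq.ap (circMap (𝟙 _) coprod.inl) (c' r))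
        (fun s => SymSeq.ap (O.unit _) (SymSeq.ap coprod.inr (y s))) :
          ∀ t, (circ O.S (A.A ⨿ Y)).el (d t) k) t := by
    rintro ((r | r) | s)
    · exact congrArg (fun f => SymSeq.ap f (c r)) (relA_relL φ)
    · exact (congrArg (fun f => SymSeq.ap f (x r)) (relX_relL φ)).trans
        (congrArg (fun f => SymSeq.ap f (SymSeq.ap φ (x r))) (unit_naturality (O := O) coprod.inl))
    · exact congrArg (fun f => SymSeq.ap f (y s)) (relY_relL φ)
  have hR : ∀ t : (N.sum N').sum S, SymSeq.ap (relR i) ((Sum.rec (Sum.rec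
      (fun r => SymSeq.ap coprod.inl (SymSeq.ap coprod.inl (c r)))
        fun r => SymSeq.ap coprod.inl (SymSeq.ap coprod.inr (x r)))
      (fun s => SymSeq.ap coprod.inr (y s)) : ∀ t, (cellRel A X Y).el (d t) k) t) =
      (Sum.rec (Sum.rec (fun r => SymSeq.ap coprod.inl (SymSeq.ap (act₁ A) (c r)))
        fun r => SymSeq.ap coprod.inr (SymSeq.ap i (x r))) fun s => SymSeq.ap coprod.inr (y s) :
          ∀ t, (A.A ⨿ Y).el (d t) k) t := by
    rintro ((r | r) | s)
    exacts [congrArg (fun f => SymSeq.ap f (c r)) (relA_relR i),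
      congrArg (fun f => SymSeq.ap f (x r)) (relX_relR i),
      congrArg (fun f => SymSeq.ap f (y s)) (relY_relR i)]
  rw [funext hL, funext hR]
  refine (mult_lift_mk_sum (isWedge_coprod A.A Y) (N := N.sum N') o c' y).trans ?_
  -- Evaluating $[1;\varphi(x)]$ in $A$ returns $\varphi(x)$, by the unit law.
  have hc : (fun r => SymSeq.ap (act₁ A) (c' r)) =
      Sum.rec (fun r => SymSeq.ap (act₁ A) (c r)) fun r => SymSeq.ap φ (x r) := by
    refine funext ?_
    rintro (r | r)
    · rfl
    · exact (congrArg (fun f => SymSeq.ap f (SymSeq.ap φ (x r))) unit_act₁ :)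
  refine (congrArg (fun c => (cell.wedgeData i φ).f (N := N.sum N') o c y) hc).trans
    ((cell.wedgeData_plug o _ x y).trans ?_)
  refine ((cell.wedgeData i φ).lift_mk (isWedge_coprod A.A Y) (T := (N.sum N').sum S) (d := d)
    (WedgeSplit.mk (T := (N.sum N').sum S) (N := N) (S := N'.sum S) (d := d)
        (Equiv.sumAssoc N N' S).symm _ (Sum.rec (fun r => SymSeq.ap i (x r)) y) ?_ ?_) o).symm
  · exact fun r => rfl
  · rintro (r | s) <;> rfl

end Operad
end SymSpectra

/-! ### $P$ as a coequalizer of free left modules -/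

namespace SymSpectra
namespace Operad
variable {O : Operad.{u}} {A P Z : O.Lt} {X Y V : SymSeq.{u}}

/-- The underlying morphism of a morphism out of a free left module. -/
noncomputable def freeHom (h : O.free.obj V ⟶ Z) : circ O.S V ⟶ Z.A := h.f

theorem adjunct_eq (h : O.free.obj V ⟶ Z) : O.adjunct h = O.unit V ≫ freeHom h := rfl

/-- The free–forgetful adjunction in the form needed here: a morphism out of a free module is its
restriction to generators followed by the action. -/
theorem freeHom_eq (h : O.free.obj V ⟶ Z) :
    freeHom h = circMap (𝟙 O.S) (O.adjunct h) ≫ act₁ Z := by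
  have h₂ : circMap (𝟙 O.S) (freeHom h) ≫ act₁ Z = O.mult V ≫ freeHom h := h.h
  have h₁ : circMap (𝟙 O.S) (O.adjunct h) =
      circMap (𝟙 O.S) (O.unit V) ≫ circMap (𝟙 O.S) (freeHom h) := by
    rw [circMap_comp, Category.comp_id, adjunct_eq]
  rw [h₁, Category.assoc, h₂, ← Category.assoc, O.map_unit_mult, Category.id_comp]

theorem free_hom_ext {g h : O.free.obj V ⟶ Z} (H : O.adjunct g = O.adjunct h) : g = h :=
  Monad.Algebra.Hom.ext ((freeHom_eq g).trans (Eq.trans (by rw [H]) (freeHom_eq h).symm))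

/-- The morphism out of a free left module corresponding to a morphism of symmetric sequences. -/
noncomputable def freeDesc (z : V ⟶ Z.A) : O.free.obj V ⟶ Z where
  f := circMap (𝟙 O.S) z ≫ act₁ Z
  h := by
    have h₁ : circMap (𝟙 O.S) (circMap (𝟙 O.S) z ≫ act₁ Z) =
        circMap (𝟙 O.S) (circMap (𝟙 O.S) z) ≫ circMap (𝟙 O.S) (act₁ Z) := by
      rw [circMap_comp, Category.comp_id]
    have h₂ : circMap (𝟙 O.S) (circMap (𝟙 O.S) z) ≫ O.mult Z.A = O.mult V ≫ circMap (𝟙 O.S) z :=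
      O.monad.μ.naturality z
    refine (congrArg (fun f => f ≫ act₁ Z) h₁).trans ((Category.assoc _ _ _).trans
      ((congrArg _ mult_act₁.symm).trans ((Category.assoc _ _ _).symm.trans
        ((congrArg (fun f => f ≫ act₁ Z) h₂).trans (Category.assoc _ _ _)))))

theorem adjunct_freeDesc (z : V ⟶ Z.A) : O.adjunct (freeDesc z) = z := by
  have h : O.unit V ≫ circMap (𝟙 O.S) z = z ≫ O.unit Z.A := (unit_naturality z).symm
  refine (Category.assoc _ _ _).symm.trans ((congrArg (fun f => f ≫ act₁ Z) h).trans
    ((Category.assoc _ _ _).trans ((congrArg _ unit_act₁).trans (Category.comp_id _))))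

theorem adjunct_comp (h : O.free.obj V ⟶ Z) (p : Z ⟶ P) :
    O.adjunct (h ≫ p) = O.adjunct h ≫ p.f := (Category.assoc _ _ _).symm

theorem adjunct_map_comp (v : X ⟶ V) (h : O.free.obj V ⟶ Z) :
    O.adjunct (O.free.map v ≫ h) = v ≫ O.adjunct h := by
  have h₁ : O.unit X ≫ circMap (𝟙 O.S) v = v ≫ O.unit V := (unit_naturality v).symm
  exact (Category.assoc _ _ _).symm.trans ((congrArg (fun f => f ≫ h.f) h₁).trans
    (Category.assoc _ _ _))

variable {i : X ⟶ Y} {f : O.free.obj X ⟶ A} {j : A ⟶ P} {g : O.free.obj Y ⟶ P}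

theorem adjunct_of_comm (h : f ≫ j = O.free.map i ≫ g) :
    O.adjunct f ≫ j.f = i ≫ O.adjunct g := by
  rw [← adjunct_comp, h, adjunct_map_comp]

variable (i f j g) in
/-- The left hand sides of the relations, as a morphism of left modules. -/
noncomputable def freeL : O.free.obj (cellRel A X Y) ⟶ O.free.obj (A.A ⨿ Y) :=
  freeDesc (relL (O.adjunct f))

/-- The quotient map `O ∘ (A ⨿ Y) ⟶ P`. -/
noncomputable def freeπ (j : A ⟶ P) (g : O.free.obj Y ⟶ P) : O.free.obj (A.A ⨿ Y) ⟶ P :=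
  freeDesc (coprod.desc j.f (O.adjunct g))

theorem freeL_comp (h : O.free.obj (A.A ⨿ Y) ⟶ Z) :
    O.adjunct (freeL (Y := Y) f ≫ h) = relL (O.adjunct f) ≫ freeHom h := by
  rw [adjunct_comp]
  exact congrArg (fun z => z ≫ freeHom h) (adjunct_freeDesc _)

/-- Compatibility with the relations. -/
theorem freeL_comp_eq_iff (h : O.free.obj (A.A ⨿ Y) ⟶ Z) :
    freeL f ≫ h = O.free.map (relR i) ≫ h ↔
      (circMap (𝟙 O.S) (coprod.inl ≫ O.adjunct h) ≫ act₁ Z = act₁ A ≫ coprod.inl ≫ O.adjunct h ∧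
      O.adjunct f ≫ coprod.inl ≫ O.adjunct h = i ≫ coprod.inr ≫ O.adjunct h) := by
  have hA : relA A X Y ≫ relL (O.adjunct f) ≫ freeHom h =
      circMap (𝟙 O.S) (coprod.inl ≫ O.adjunct h) ≫ act₁ Z := by
    rw [← Category.assoc, relA_relL, freeHom_eq h, ← Category.assoc, circMap_comp, Category.comp_id]
  have hX : relX A X Y ≫ relL (O.adjunct f) ≫ freeHom h = O.adjunct f ≫ coprod.inl ≫ O.adjunct h := by
    rw [← Category.assoc, relX_relL, adjunct_eq h, Category.assoc, Category.assoc]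
  have hY : relY A X Y ≫ relL (O.adjunct f) ≫ freeHom h = coprod.inr ≫ O.adjunct h := by
    rw [← Category.assoc, relY_relL, adjunct_eq h, Category.assoc]
  have hA' : relA A X Y ≫ relR i ≫ O.adjunct h = act₁ A ≫ coprod.inl ≫ O.adjunct h := by
    rw [← Category.assoc, relA_relR, Category.assoc]
  have hX' : relX A X Y ≫ relR i ≫ O.adjunct h = i ≫ coprod.inr ≫ O.adjunct h := by
    rw [← Category.assoc, relX_relR, Category.assoc]
  have hY' : relY A X Y ≫ relR i ≫ O.adjunct h = coprod.inr ≫ O.adjunct h := by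
    rw [← Category.assoc, relY_relR]
  have key : freeL f ≫ h = O.free.map (relR i) ≫ h ↔
      relL (O.adjunct f) ≫ freeHom h = relR i ≫ O.adjunct h := by
    rw [← freeL_comp, ← adjunct_map_comp]
    exact ⟨congrArg _, free_hom_ext⟩
  rw [key, ← hA, ← hX, ← hA', ← hX']
  exact ⟨fun h => by rw [h]; exact ⟨rfl, rfl⟩, fun h => cellRel_hom_ext h.1 h.2 (hY.trans hY'.symm)⟩

theorem adjunct_freeπ : O.adjunct (freeπ j g) = coprod.desc j.f (O.adjunct g) := adjunct_freeDesc _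

theorem inl_adjunct_freeπ : coprod.inl ≫ O.adjunct (freeπ j g) = j.f := by
  rw [adjunct_freeπ, coprod.inl_desc]

theorem inr_adjunct_freeπ : coprod.inr ≫ O.adjunct (freeπ j g) = O.adjunct g := by
  rw [adjunct_freeπ, coprod.inr_desc]

theorem freeπ_condition (h : f ≫ j = O.free.map i ≫ g) :
    freeL f ≫ freeπ j g = O.free.map (relR i) ≫ freeπ j g := by
  rw [freeL_comp_eq_iff, inl_adjunct_freeπ, inr_adjunct_freeπ]
  exact ⟨j.h, adjunct_of_comm h⟩

/-- A pushout of a free map is a coequalizer of free left modules. -/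
theorem isColimit_freeπ (hP : IsPushout f (O.free.map i) j g) :
    Nonempty (IsColimit (Cofork.ofπ (freeπ j g) (freeπ_condition hP.w))) := by
  -- A morphism out of the free module on $A\amalg Y$ that respects the relations consists of a
  -- module morphism out of $A$ and a morphism out of $Y$ that agree over $X$, hence is a cocone on
  -- the pushout diagram.
  have H : ∀ {Z : O.Lt} (h : O.free.obj (A.A ⨿ Y) ⟶ Z)
      (_ : freeL f ≫ h = O.free.map (relR i) ≫ h),
      ∃ (a : A ⟶ Z) (b : O.free.obj Y ⟶ Z), f ≫ a = O.free.map i ≫ b ∧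
        a.f = coprod.inl ≫ O.adjunct h ∧ O.adjunct b = coprod.inr ≫ O.adjunct h := fun {Z} h hh => by
    obtain ⟨h₁, h₂⟩ := (freeL_comp_eq_iff h).1 hh
    refine ⟨⟨coprod.inl ≫ O.adjunct h, h₁⟩, freeDesc (coprod.inr ≫ O.adjunct h), ?_, rfl,
      adjunct_freeDesc _⟩
    refine free_hom_ext ?_
    rw [adjunct_comp, adjunct_map_comp, adjunct_freeDesc]
    exact h₂
  have ext : ∀ {Z : O.Lt} {p q : P ⟶ Z}, freeπ j g ≫ p = freeπ j g ≫ q → p = q := fun {Z p q} h => by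
    have h' := congrArg O.adjunct h
    rw [adjunct_comp, adjunct_comp, adjunct_freeπ] at h'
    refine hP.hom_ext (Monad.Algebra.Hom.ext ?_) (free_hom_ext ?_)
    · have := congrArg (fun z => coprod.inl ≫ z) h'
      simp only [← Category.assoc, coprod.inl_desc] at this
      exact this
    · have := congrArg (fun z => coprod.inr ≫ z) h'
      rw [adjunct_comp, adjunct_comp]
      simpa only [← Category.assoc, coprod.inr_desc] using this
  have H' : ∀ {Z : O.Lt} (h : O.free.obj (A.A ⨿ Y) ⟶ Z)
      (_ : freeL f ≫ h = O.free.map (relR i) ≫ h), ∃ p : P ⟶ Z, freeπ j g ≫ p = h :=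
    fun {Z} h hh => by
    obtain ⟨a, b, h₁, h₂, h₃⟩ := H h hh
    refine ⟨hP.desc a b h₁, free_hom_ext ?_⟩
    rw [adjunct_comp, adjunct_freeπ]
    refine coprod.hom_ext ?_ ?_
    · rw [← Category.assoc, coprod.inl_desc, ← h₂]
      exact congrArg Monad.Algebra.Hom.f (hP.inl_desc _ _ h₁)
    · rw [← Category.assoc, coprod.inr_desc, ← h₃, ← adjunct_comp, hP.inr_desc]
  exact ⟨Cofork.IsColimit.mk' _ fun s => ⟨(H' s.π s.condition).choose,
    (H' s.π s.condition).choose_spec, fun {m} hm => ext (hm.trans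
      (H' s.π s.condition).choose_spec.symm)⟩⟩

/-- The free coequalizer is preserved by the forgetful functor. -/
theorem isColimit_freeHom_freeπ (hP : IsPushout f (O.free.map i) j g) :
    ∃ w : (circMap (𝟙 O.S) (relL (O.adjunct f)) ≫ O.mult _) ≫ freeHom (freeπ j g) =
      circMap (𝟙 O.S) (relR i) ≫ freeHom (freeπ j g),
      Nonempty (IsColimit (Cofork.ofπ (freeHom (freeπ j g)) w)) := by
  -- On underlying sequences, the functor $\mathcal O\circ-$ applied to `relSection` is a common
  -- section of the two free morphisms.
  have hl : circMap (𝟙 O.S) (relSection A X Y) ≫ circMap (𝟙 O.S) (relL (O.adjunct f)) ≫ O.mult _ =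
      𝟙 _ := by
    rw [← Category.assoc, circMap_comp, relSection_relL, Category.comp_id, O.map_unit_mult]
  have hr : circMap (𝟙 O.S) (relSection A X Y) ≫ circMap (𝟙 O.S) (relR i) = 𝟙 _ := by
    rw [circMap_comp, relSection_relR, Category.comp_id, circMap_id]
  have := preservesColimit_forget O (parallelPair (freeL f) (O.free.map (relR i)))
    (circMap (𝟙 O.S) (relSection A X Y)) hl hr
  obtain ⟨h⟩ := isColimit_freeπ hP
  exact ⟨_, ⟨isColimitCoforkMapOfIsColimit O.monad.forget (freeπ_condition hP.w) h⟩⟩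

end Operad
end SymSpectra

/-! ### Identification with $P$ and assembly of the filtration -/

namespace SymSpectra

theorem DHom.split_unsplit {k : Dop} {N S : FinBij} (n : FinBij) (d : N ⊕ S → Deg) :
    (DHom.split n (fun r => d (.inl r)) fun s => d (.inr s) : DHom k _ _).comp (DHom.unsplit n d) =
      DHom.circFam (T := N.sum S) n (DHom.idElim d) := by
  ext1
  · exact Equiv.ext (by rintro ⟨r | s, x⟩ <;> rfl)
  · refine Lab.ext (funext ?_)
    rintro (x | ⟨r | s, x⟩) <;> rfl

namespace Operad
variable {O : Operad.{u}} {A P Z : O.Lt} {X Y : SymSeq.{u}} {k : Dop} {N S n : FinBij}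

theorem eval_sum_rec {d : N ⊕ S → Deg} (o : O.S.el ⟨N.sum S, n⟩ k) (a : ∀ r, A.A.el (d (.inl r)) k)
    (b : ∀ s, A.A.el (d (.inr s)) k) :
    O.eval (A := A) (T := N.sum S) (d := d) o (Sum.rec a b) = A.A.act (DHom.unsplit n d)
      (A.A.act (DHom.split n _ _) (O.eval (T := N.sum S) o (famSum a b))) := by
  have h : (Sum.rec a b : ∀ x, A.A.el (d x) k) = fun x => A.A.act (DHom.idElim d x) (famSum a b x) := by
    refine funext ?_
    rintro (r | s) <;> exact (SymSeq.act_id (X := A.A) _).symm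
  rw [SymSeq.act_act, DHom.split_unsplit, h]
  exact eval_act_right (T := N.sum S) _ _ _

namespace cell
variable {i : X ⟶ Y} {φ : X ⟶ A.A} {j : A ⟶ P} {γ : Y ⟶ P.A} (hj : φ ≫ j.f = i ≫ γ)

theorem liftCell_mk_sum {d : N ⊕ S → Deg} (o : O.S.el ⟨N.sum S, n⟩ k)
    (a : ∀ r, A.A.el (d (.inl r)) k) (b : ∀ s, Y.el (d (.inr s)) k) :
    SymSeq.ap (liftCell i φ) (circ.mk (N.sum S) n d o
      (Sum.rec (fun r => SymSeq.ap coprod.inl (a r)) fun s => SymSeq.ap coprod.inr (b s))) =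
    SymSeq.act _ (DHom.unsplit n d)
      (cell.mk i φ (p := fun _ => True) trivial (env.mk O A (T := N) (Q := S) o a) b) :=
  (cell.wedgeData i φ).lift_mk_sum (isWedge_coprod A.A Y) o a b

/-- Sorting the inputs and then evaluating in $P$ is direct evaluation of $[o;a,y]$ as
$o(j(a),\gamma(y))$. -/
theorem liftCell_toP : liftCell i φ ≫ toP _ hj =
    circMap (𝟙 O.S) (coprod.desc j.f γ) ≫ act₁ P := by
  refine (isWedge_coprod A.A Y).circ_hom_ext fun k N S n d o a b => ?_
  rw [SymSeq.ap_comp, liftCell_mk_sum, SymSeq.ap_act, toP_env_mk hj trivial, SymSeq.ap_comp,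
    ap_circMap, ap_act₁]
  refine (eval_sum_rec o _ _).symm.trans (congrArg (O.eval (A := P) (T := N.sum S) (d := d) o)
    (funext ?_))
  rintro (r | s)
  · exact (congrArg (fun f => SymSeq.ap f (a r)) (coprod.inl_desc j.f γ)).symm
  · exact (congrArg (fun f => SymSeq.ap f (b s)) (coprod.inr_desc j.f γ)).symm

/-- The sorting map is epi: up to an invertible change of index, the symbol $[o;a]\otimes y$ is the
image of $[o;a,y]$. -/
theorem liftCell_hom_ext {Z : SymSeq.{u}} {f g : cell i φ (fun _ => True) ⟶ Z}
    (h : liftCell i φ ≫ f = liftCell i φ ≫ g) : f = g := by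
  refine hom_ext fun k Q c e hQ x y => ?_
  rcases env.cases x with rfl | ⟨T, n, d, o, a, ψ, rfl⟩
  · rw [mk_pt_left, SymSeq.ap_pt, SymSeq.ap_pt]
  · rw [mk_act_left, SymSeq.ap_act, SymSeq.ap_act]
    refine congrArg (SymSeq.act _ _) ?_
    have h₁ := congrArg (fun f => SymSeq.ap f (circ.mk (T.sum Q) n (Sum.elim d e) o
      (Sum.rec (fun r => SymSeq.ap coprod.inl (a r)) fun s => SymSeq.ap coprod.inr (y s)))) h
    have h₂ := liftCell_mk_sum (i := i) (φ := φ) (N := T) (S := Q) (d := Sum.elim d e) o a y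
    refine SymSeq.act_injective (DHom.unsplit_resplit (n := n) (Sum.elim d e)) ?_
    refine (SymSeq.ap_act _ _ _).symm.trans (Eq.trans ?_ (SymSeq.ap_act _ _ _))
    exact (congrArg (SymSeq.ap f) h₂).symm.trans (h₁.trans (congrArg (SymSeq.ap g) h₂))

end cell

variable {i : X ⟶ Y} {f : O.free.obj X ⟶ A} {j : A ⟶ P} {g : O.free.obj Y ⟶ P}

/-- The sorting map respects the relations and so factors through $P$, which gives a candidate
inverse. One composite is checked after the sorting map, the other after the quotient map onto $P$;
both reduce to `cell.liftCell_toP`. -/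
theorem isIso_toP (hP : IsPushout f (O.free.map i) j g) :
    IsIso (cell.toP (fun _ => True) (adjunct_of_comm hP.w)) := by
  obtain ⟨w, ⟨h⟩⟩ := isColimit_freeHom_freeπ hP
  have hc : (circMap (𝟙 O.S) (relL (O.adjunct f)) ≫ O.mult _) ≫ liftCell i (O.adjunct f) =
      circMap (𝟙 O.S) (relR i) ≫ liftCell i (O.adjunct f) :=
    (Category.assoc _ _ _).trans (liftCell_condition i (O.adjunct f))
  have h₁ := cell.liftCell_toP (adjunct_of_comm hP.w)
  have h₂ := Cofork.IsColimit.π_desc' h (liftCell i (O.adjunct f)) hc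
  rw [Cofork.π_ofπ] at h₂
  refine ⟨Cofork.IsColimit.desc h (liftCell i (O.adjunct f)) hc, ?_, ?_⟩
  · refine cell.liftCell_hom_ext ?_
    rw [← Category.assoc, h₁, Category.comp_id]
    exact h₂
  · refine Cofork.IsColimit.hom_ext h ?_
    rw [Cofork.π_ofπ, ← Category.assoc, h₂, h₁]
    exact (Category.comp_id _).symm

/-- The cocone of the filtration by degree, with apex `P`. -/
noncomputable def cellCocone (h : f ≫ j = O.free.map i ≫ g) :
    cell.stage i (O.adjunct f) ⟶ (Functor.const ℕ).obj P.A :=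
  (cell.stageCocone i (O.adjunct f)).ι ≫ (Functor.const ℕ).map (cell.toP _ (adjunct_of_comm h))

theorem isColimit_cellCocone (hP : IsPushout f (O.free.map i) j g) :
    Nonempty (IsColimit (Cocone.mk P.A (cellCocone hP.w))) := by
  obtain ⟨h⟩ := cell.isColimit_stageCocone i (O.adjunct f)
  have := isIso_toP hP
  let e : cell i (O.adjunct f) (fun _ => True) ≅ P.A := asIso (cell.toP _ (adjunct_of_comm hP.w))
  exact ⟨IsColimit.ofIsoColimit h (Cocone.ext e fun t => rfl)⟩

theorem cellCocone_mk (h : f ≫ j = O.free.map i ≫ g) {t : ℕ} {T Q : FinBij} (hQ : Nat.card Q ≤ t)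
    {d : T → Deg} {e : Q → Deg} (o : O.S.el ⟨T.sum Q, n⟩ k) (a : ∀ t, A.A.el (d t) k)
    (y : ∀ t, Y.el (e t) k) :
    SymSeq.ap ((cellCocone h).app t) (cell.mk i (O.adjunct f) (p := (· ≤ t)) hQ (env.mk O A o a) y) =
      P.A.act (DHom.split n d e) (O.eval (T := T.sum Q) o (famSum (fun r => SymSeq.ap j.f (a r))
        fun s => SymSeq.ap (O.adjunct g) (y s))) :=
  (congrArg (SymSeq.ap (cell.toP _ (adjunct_of_comm h)))
    (cell.stageCocone_ι_mk (i := i) (φ := O.adjunct f) hQ _ y)).trans (cell.toP_env_mk _ trivial o a y)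

variable (i f) in
/-- The maps `ξ_t` of the filtration by degree. -/
noncomputable def cellξ (t : ℕ) :
    bal (O.env A) (pow Y) (FinBij.std t) ⟶ (cell.stage i (O.adjunct f)).obj t :=
  cell.ξ i (O.adjunct f) (p := (· ≤ t)) (Nat.card_fin t).le

theorem cellξ_mk (t : ℕ) {b : Deg} {e : FinBij.std t → Deg}
    (x : ((O.env A).obj (op (FinBij.std t))).el b k) (y : ∀ s, Y.el (e s) k) :
    SymSeq.ap (cellξ i f t) (bal.mk x (pow.mk y)) =
      cell.mk i (O.adjunct f) (p := (· ≤ t)) (Nat.card_fin t).le x y := cell.ξ_mk _ _ _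

variable (i f) in
/-- `O_A[0] ≅ A_0`. -/
noncomputable def cellZero :
    (O.env A).obj (op (FinBij.std 0)) ≅ (cell.stage i (O.adjunct f)).obj 0 :=
  cell.zeroIso i (O.adjunct f) (p := (· ≤ 0)) (fun _ => Nat.le_zero.1) (Nat.card_fin 0).le

theorem cellξ_zero {b : Deg} {e : FinBij.std 0 → Deg}
    (x : ((O.env A).obj (op (FinBij.std 0))).el b k) (y : ∀ s, Y.el (e s) k) :
    SymSeq.ap (cellξ i f 0) (bal.mk x (pow.mk y)) =
      SymSeq.act _ (DHom.sumZero b e) (SymSeq.ap (cellZero i f).hom x) :=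
  (cellξ_mk 0 x y).trans (cell.mk_of_isEmpty _ x y)

theorem dropZero_split {T : FinBij} (d : T → Deg) :
    (DHom.circ (T := T.sum (FinBij.std 0)) (T' := T) (c := Sum.elim d isEmptyElim) (d := d)
      (Equiv.sumEmpty T (Fin 0)).symm Lab.id fun _ => (DHom.id : DHom k _ _)) =
      (DHom.split n d (isEmptyElim : FinBij.std 0 → Deg)).comp
        (DHom.dropEmpty (Deg.circ n d) (Q := FinBij.std 0) isEmptyElim) := by
  ext1
  · exact Equiv.ext (by rintro ⟨t, x⟩; rfl)
  · refine Lab.ext (funext ?_)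
    rintro (x | ⟨t, x⟩) <;> rfl

/-- In degree zero evaluation involves no entries from $Y$, so it gives $o(j(a))=j(o(a))$. The two
ways of discarding the empty set of inputs are compared by `dropZero_split`. -/
theorem cellZero_c (h : f ≫ j = O.free.map i ≫ g) :
    (cellZero i f).hom ≫ (cellCocone h).app 0 = (augIso A).hom ≫ j.f := by
  refine env.hom_ext fun k T n d o a => ?_
  rw [SymSeq.ap_comp, SymSeq.ap_comp]
  refine Eq.trans ?_ (congrArg (SymSeq.ap j.f) (augHom_mk o a)).symm
  rw [ap_eval]
  have h₁ := eval_act_left (A := P) (T := T.sum (FinBij.std 0)) (T' := T) (n := n)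
    (d := Sum.elim d isEmptyElim) (Equiv.sumEmpty T (Fin 0)).symm Lab.id
    o (famSum (fun t => SymSeq.ap j.f (a t)) fun s : FinBij.std 0 =>
      SymSeq.ap (O.adjunct g) (isEmptyElim s : Y.el (isEmptyElim s) k))
  refine Eq.trans ?_ h₁.symm
  refine ((SymSeq.ap_act ((cellCocone h).app 0) _ _).trans (congrArg (SymSeq.act _ _)
    (cellCocone_mk h (T := T) (Q := FinBij.std 0) (e := isEmptyElim) (Nat.card_fin 0).le o a
      isEmptyElim))).trans ?_
  exact (SymSeq.act_act _ _ _).trans (congrArg (fun h => P.A.act h _) (dropZero_split d).symm)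

/-- The filtration by degree. -/
noncomputable def cellFiltration (hP : IsPushout f (O.free.map i) j g) :
    O.CellFiltration i f j g where
  stage := cell.stage i (O.adjunct f)
  c := cellCocone hP.w
  isColimit := isColimit_cellCocone hP
  zero := cellZero i f
  aug := augIso A
  aug_mk o a := augHom_mk o a
  zero_c := cellZero_c hP.w
  ξ := cellξ i f
  ξ_zero := cellξ_zero
  fStar t := cell.fStar i (O.adjunct f) (p := (· ≤ t)) (cell.card_compl_le (Nat.card_fin (t + 1)))
  isPushout t := cell.isPushout i (O.adjunct f) (T := FinBij.std (t + 1)) (Nat.card_fin (t + 1))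
  ξ_c {t k T n d e} o a y := (congrArg (SymSeq.ap ((cellCocone hP.w).app t)) (cellξ_mk t _ y)).trans
    (cellCocone_mk hP.w _ o a y)
  fStar_mk {t s} hs N w χ hX hY k T n d e o a z := by
    refine (cell.fStar_env_mk (p := (· ≤ t)) (N := N) (S := FinBij.std s) (Q := FinBij.std (t + 1))
      (cell.card_compl_le (Nat.card_fin (t + 1))) ((Nat.card_fin s).le.trans hs)
      w χ hX hY o a z).trans ?_
    refine congrArg (SymSeq.act _ _) ?_
    refine Eq.trans ?_ (congrArg (SymSeq.ap ((cell.stage i (O.adjunct f)).map (homOfLE hs)))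
      (cellξ_mk s _ _)).symm
    exact (cell.stage_map_mk (i := i) (φ := O.adjunct f) (homOfLE hs) (Nat.card_fin s).le _ _).symm

end Operad
end SymSpectra

/-! ### Functoriality of tensor powers, balanced products and the cube -/

namespace SymSpectra

section Functoriality
variable {X Y X' Y' : SymSeq.{u}} {i : X ⟶ Y} {i' : X' ⟶ Y'} {T : FinBij} {k : Dop}

/-- Functoriality of the tensor powers. -/
def powMap (y : Y ⟶ Y') : pow Y ⟶ pow Y' where
  app T := tensorMap (X := fun _ : T.unop => Y) (Y := fun _ : T.unop => Y') (Equiv.refl T.unop)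
    fun _ => y
  naturality T T' e := by
    refine (tensorMap_comp (X := fun _ : T.unop => Y) (Y := fun _ : T'.unop => Y)
      (Z := fun _ : T'.unop => Y') (id e.unop : T'.unop ≃ T.unop) (fun _ => 𝟙 Y)
      (Equiv.refl T'.unop) fun _ => y).trans (Eq.trans ?_ (tensorMap_comp
      (X := fun _ : T.unop => Y) (Y := fun _ : T.unop => Y') (Z := fun _ : T'.unop => Y')
      (Equiv.refl T.unop) (fun _ => y) (id e.unop : T'.unop ≃ T.unop) fun _ => 𝟙 Y').symm)
    exact congrArg (tensorMap (X := fun _ : T.unop => Y) (Y := fun _ : T'.unop => Y')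
      (id e.unop : T'.unop ≃ T.unop)) (funext fun _ =>
        (Category.id_comp y).trans (Category.comp_id y).symm)

theorem powMap_mk (y : Y ⟶ Y') {e : T → Deg} (b : ∀ t, Y.el (e t) k) :
    SymSeq.ap ((powMap y).app (op T)) (pow.mk b) = pow.mk fun t => SymSeq.ap y (b t) :=
  (tensorMap_mk (X := fun _ : T => Y) (Y := fun _ : T => Y') (Equiv.refl T) (fun _ => y) e b).trans
    (SymSeq.act_id _)

/-- Functoriality of `M[T] ⊗_{Σ_T} W[T]` in `M`. -/
noncomputable def balMapLeft {M M' : FinBijᵒᵖ ⥤ SymSeq.{u}} (h : M ⟶ M') (W : FinBijᵒᵖ ⥤ SymSeq.{u})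
    (T : FinBij) : bal M W T ⟶ bal M' W T :=
  bal.desc
    { f := fun x w => bal.mk (SymSeq.ap (h.app (op T)) x) w
      sm := fun α x w => by rw [SymSeq.ap_sm, bal.sm_mk]
      act := fun a b x w => by rw [SymSeq.ap_act, bal.mk_act]
      pt_left := fun w => by rw [SymSeq.ap_pt, bal.mk_pt_left]
      pt_right := fun x => bal.mk_pt_right _ }
    fun τ c d k x w => by
      have h₁ := congrArg (fun f => SymSeq.ap f x)
        (h.naturality (Quiver.Hom.op (X := T) (Y := T) τ))
      exact (congrArg (fun x => bal.mk x w) h₁).trans (bal.condition τ _ w)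

theorem balMapLeft_mk {M M' W : FinBijᵒᵖ ⥤ SymSeq.{u}} (h : M ⟶ M') {c d : Deg}
    (x : (M.obj (op T)).el c k) (w : (W.obj (op T)).el d k) :
    SymSeq.ap (balMapLeft h W T) (bal.mk x w) = bal.mk (SymSeq.ap (h.app (op T)) x) w :=
  bal.ap_desc _ _ x w

/-- A commutative square as a map of arrows. -/
def arrowMap (x : X ⟶ X') (y : Y ⟶ Y') (h : i ≫ y = x ≫ i') : arrow i ⟶ arrow i' where
  app b := match b with
    | false => x
    | true => y
  naturality b b' f := match b, b', f with
    | false, false, _ => (Category.id_comp x).trans (Category.comp_id x).symm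
    | false, true, _ => h
    | true, true, _ => (Category.id_comp y).trans (Category.comp_id y).symm
    | true, false, f => absurd (leOfHom f) (by decide)

theorem inArrow_arrowMap (x : X ⟶ X') (y : Y ⟶ Y') (h : i ≫ y = x ≫ i') {b b' : Bool} (hb : b = b')
    {c : Deg} (z : ((arrow i).obj b).el c k) :
    inArrow (i := i') hb (SymSeq.ap ((arrowMap x y h).app b) z) =
      SymSeq.ap ((arrowMap x y h).app b') (inArrow hb z) := by
  subst hb
  rfl

end Functoriality

namespace Operad
variable {O : Operad.{u}} {A A' : O.Lt} {X Y Y' Z : SymSeq.{u}} {i : X ⟶ Y} {T : FinBij}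

/-- Combines extensionality in $\mathcal O_A$ and in the tensor power: index maps are pulled out
until only representatives $[o;a]\otimes y$ remain. -/
theorem bal_env_hom_ext_pow {u v : bal (O.env A) (pow Y) T ⟶ Z}
    (h : ∀ {k : Dop} {N n : FinBij} {d : N → Deg} {e : T → Deg} (o : O.S.el ⟨N.sum T, n⟩ k)
      (a : ∀ r, A.A.el (d r) k) (b : ∀ s, Y.el (e s) k),
      SymSeq.ap u (bal.mk (env.mk O A o a) (pow.mk b)) =
        SymSeq.ap v (bal.mk (env.mk O A o a) (pow.mk b))) : u = v :=
  bal.hom_ext_pow fun k c x e b => by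
    rcases env.cases x with rfl | ⟨N, n, d, o, a, ψ, rfl⟩
    · rw [bal.mk_pt_left, SymSeq.ap_pt, SymSeq.ap_pt]
    · have h₁ := bal.mk_act (M := O.env A) (W := pow Y) ψ DHom.id (env.mk O A o a) (pow.mk b)
      rw [SymSeq.act_id] at h₁
      rw [h₁, SymSeq.ap_act, SymSeq.ap_act, h]

theorem bal_env_hom_ext_Q [Nonempty T] {u v : bal (O.env A) (Q i) T ⟶ Z}
    (h : ∀ {k : Dop} {N n : FinBij} {d : N → Deg} {e : T → Deg} (o : O.S.el ⟨N.sum T, n⟩ k)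
      (a : ∀ r, A.A.el (d r) k) (χ : Punctured T) (z : ∀ t, ((arrow i).obj (χ.obj t)).el (e t) k),
      SymSeq.ap u (bal.mk (env.mk O A o a) (Q.mk χ z)) =
        SymSeq.ap v (bal.mk (env.mk O A o a) (Q.mk χ z))) : u = v :=
  bal.hom_ext_Q fun k c x χ e z => by
    rcases env.cases x with rfl | ⟨N, n, d, o, a, ψ, rfl⟩
    · rw [bal.mk_pt_left, SymSeq.ap_pt, SymSeq.ap_pt]
    · have h₁ := bal.mk_act (M := O.env A) (W := Q i) ψ DHom.id (env.mk O A o a) (Q.mk χ z)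
      rw [SymSeq.act_id] at h₁
      rw [h₁, SymSeq.ap_act, SymSeq.ap_act, h]

/-- The map `[o; a] ⊗ y ↦ [o; α(a)] ⊗ y(y)`. -/
noncomputable def balEnvMap (α : A ⟶ A') (y : Y ⟶ Y') (T : FinBij) :
    bal (O.env A) (pow Y) T ⟶ bal (O.env A') (pow Y') T :=
  balMapLeft (envMap α) (pow Y) T ≫ balMap (O.env A') (powMap y) T

theorem balEnvMap_mk (α : A ⟶ A') (y : Y ⟶ Y') {k : Dop} {N n : FinBij} {d : N → Deg} {e : T → Deg}
    (o : O.S.el ⟨N.sum T, n⟩ k) (a : ∀ r, A.A.el (d r) k) (b : ∀ s, Y.el (e s) k) :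
    SymSeq.ap (balEnvMap α y T) (bal.mk (env.mk O A o a) (pow.mk b)) =
      bal.mk (env.mk O A' o fun r => SymSeq.ap α.f (a r)) (pow.mk fun s => SymSeq.ap y (b s)) := by
  rw [balEnvMap, SymSeq.ap_comp, balMapLeft_mk, balMap_mk, envMap_mk, powMap_mk]

/-! ### Generators of an arbitrary filtration -/

namespace CellFiltration
variable {P P' : O.Lt} {X' : SymSeq.{u}} {f : O.free.obj X ⟶ A} {j : A ⟶ P}
  {g : O.free.obj Y ⟶ P} {i' : X' ⟶ Y'} {f' : O.free.obj X' ⟶ A'} {j' : A' ⟶ P'}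
  {g' : O.free.obj Y' ⟶ P'} (Φ : O.CellFiltration i f j g) (Φ' : O.CellFiltration i' f' j' g')

/-- The image of `ξ_s([o; a] ⊗ b)` in `A_t`. -/
noncomputable def gen {s t : ℕ} (h : s ≤ t) {k : Dop} {N n : FinBij} {d : N → Deg}
    {e : FinBij.std s → Deg} (o : O.S.el ⟨N.sum (FinBij.std s), n⟩ k) (a : ∀ r, A.A.el (d r) k)
    (b : ∀ q, Y.el (e q) k) : (Φ.stage.obj t).el ((Deg.circ n d).sum (Deg.sigma e)) k :=
  SymSeq.ap (Φ.stage.map (homOfLE h)) (SymSeq.ap (Φ.ξ s) (bal.mk (env.mk O A o a) (pow.mk b)))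

section Gen
variable {s t : ℕ} {k : Dop} {N n : FinBij} {d : N → Deg}
    {e : FinBij.std s → Deg} (o : O.S.el ⟨N.sum (FinBij.std s), n⟩ k) (a : ∀ r, A.A.el (d r) k)
    (b : ∀ q, Y.el (e q) k)

theorem map_gen (h : s ≤ t) {t' : ℕ} (h' : t ≤ t') :
    SymSeq.ap (Φ.stage.map (homOfLE h')) (Φ.gen h o a b) = Φ.gen (h.trans h') o a b := by
  rw [gen, gen, ← SymSeq.ap_comp, ← Functor.map_comp]
  rfl

theorem gen_rfl : Φ.gen le_rfl o a b =
    SymSeq.ap (Φ.ξ s) (bal.mk (env.mk O A o a) (pow.mk b)) := by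
  have h : Φ.stage.map (homOfLE (le_refl s)) = 𝟙 _ := Φ.stage.map_id s
  rw [gen, h, SymSeq.ap_id]

theorem c_gen (h : s ≤ t) : SymSeq.ap (Φ.c.app t) (Φ.gen h o a b) =
    P.A.act (DHom.split n d e) (O.eval (T := N.sum (FinBij.std s)) o
      (famSum (fun r => SymSeq.ap j.f (a r)) fun q => SymSeq.ap (O.adjunct g) (b q))) := by
  have h₁ : Φ.stage.map (homOfLE h) ≫ Φ.c.app t = Φ.c.app s :=
    (Φ.c.naturality (homOfLE h)).trans (Category.comp_id _)
  rw [gen, ← SymSeq.ap_comp, h₁, Φ.ξ_c]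
end Gen

/-- Only the axioms of a filtration are used. The stage $A_0$ is isomorphic to $\mathcal O_A[0]$,
and each later stage is a pushout covered by the preceding stage and `ξ`. So the images of all
$\xi_s$ with $s\le t$ generate $A_t$. -/
theorem hom_ext {t : ℕ} {u v : Φ.stage.obj t ⟶ Z}
    (h : ∀ {s : ℕ} (hs : s ≤ t) {k : Dop} {N n : FinBij} {d : N → Deg} {e : FinBij.std s → Deg}
      (o : O.S.el ⟨N.sum (FinBij.std s), n⟩ k) (a : ∀ r, A.A.el (d r) k) (b : ∀ q, Y.el (e q) k),
      SymSeq.ap u (Φ.gen hs o a b) = SymSeq.ap v (Φ.gen hs o a b)) : u = v := by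
  induction t with
  | zero =>
    refine (cancel_epi Φ.zero.hom).1 (env.hom_ext fun k N n d o a => ?_)
    rw [SymSeq.ap_comp, SymSeq.ap_comp]
    -- In degree zero the family in $Y$ is empty. `ξ_zero` expresses $\xi_0$ through the isomorphism
    -- `zero` and an index bijection that acts injectively.
    have h₁ := h le_rfl o a (e := isEmptyElim) isEmptyElim
    rw [gen_rfl, Φ.ξ_zero, SymSeq.ap_act, SymSeq.ap_act] at h₁
    exact SymSeq.act_injective (DHom.sumEmpty_dropEmpty (Q := FinBij.std 0) _ isEmptyElim) h₁
  | succ t ih =>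
    refine (Φ.isPushout t).hom_ext (ih fun hs k N n d e o a b => ?_)
      (bal_env_hom_ext_pow fun o a b => ?_)
    · rw [SymSeq.ap_comp, SymSeq.ap_comp, map_gen, h]
    · rw [SymSeq.ap_comp, SymSeq.ap_comp, ← gen_rfl, h]

end CellFiltration
end Operad
end SymSpectra

/-! ### Naturality of the filtration -/

namespace SymSpectra
namespace Operad
namespace CellFiltration
variable {O : Operad.{u}} {A A' P P' : O.Lt} {X X' Y Y' : SymSeq.{u}} {i : X ⟶ Y}
  {f : O.free.obj X ⟶ A} {j : A ⟶ P} {g : O.free.obj Y ⟶ P} {i' : X' ⟶ Y'}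
  {f' : O.free.obj X' ⟶ A'} {j' : A' ⟶ P'} {g' : O.free.obj Y' ⟶ P'}
  (Φ : O.CellFiltration i f j g) (Φ' : O.CellFiltration i' f' j' g')

/-- The maps of stages that are compatible with the maps `ξ_s`. -/
def IsStageMap (α : A ⟶ A') (y : Y ⟶ Y') (t : ℕ) (η : Φ.stage.obj t ⟶ Φ'.stage.obj t) : Prop :=
  ∀ {s : ℕ} (hs : s ≤ t) {k : Dop} {N n : FinBij} {d : N → Deg} {e : FinBij.std s → Deg}
    (o : O.S.el ⟨N.sum (FinBij.std s), n⟩ k) (a : ∀ r, A.A.el (d r) k) (b : ∀ q, Y.el (e q) k),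
    SymSeq.ap η (Φ.gen hs o a b) =
      Φ'.gen hs o (fun r => SymSeq.ap α.f (a r)) fun q => SymSeq.ap y (b q)

/-- The formula for $f_*$ with the entries from $X$ and from $Y$ given as separate families `u` and
`v`. It can then be applied to the image of a mixed family, whose entries are known only through
equations. -/
theorem fStar_gen {t s : ℕ} (hs : s ≤ t) {R : FinBij} (w : R ⊕ Fin s ≃ Fin (t + 1))
    (χ : Punctured (FinBij.std (t + 1))) (hX : ∀ r, χ.obj (w (.inl r)) = false)
    (hY : ∀ q, χ.obj (w (.inr q)) = true) {k : Dop} {N n : FinBij} {d : N → Deg}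
    {e : FinBij.std (t + 1) → Deg} (o : O.S.el ⟨N.sum (FinBij.std (t + 1)), n⟩ k)
    (a : ∀ r, A.A.el (d r) k) (z : ∀ q, ((arrow i).obj (χ.obj q)).el (e q) k)
    (u : ∀ r, X.el (e (w (.inl r))) k) (v : ∀ q, Y.el (e (w (.inr q))) k)
    (hu : ∀ r, inArrow (i := i) (hX r) (z (w (.inl r))) = u r)
    (hv : ∀ q, inArrow (i := i) (hY q) (z (w (.inr q))) = v q) :
    SymSeq.ap (Φ.fStar t) (bal.mk (env.mk O A o a) (Q.mk χ z)) =
      SymSeq.act _ (DHom.move (S := FinBij.std s) n d e w)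
        (Φ.gen hs (O.S.act (DHom.moveInputs (S := FinBij.std s) N n w) o)
          (famSum a fun r => SymSeq.ap (O.adjunct f) (u r)) v) := by
  obtain rfl := funext hu
  obtain rfl := funext hv
  exact Φ.fStar_mk hs w χ hX hY o a z

variable {Φ Φ'} {α : A ⟶ A'} {x : X ⟶ X'} {y : Y ⟶ Y'} {p : P ⟶ P'}

theorem ap_adjunct_of_comm (hf : f ≫ α = O.free.map x ≫ f') {c : Deg} {k : Dop} (z : X.el c k) :
    SymSeq.ap α.f (SymSeq.ap (O.adjunct f) z) = SymSeq.ap (O.adjunct f') (SymSeq.ap x z) := by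
  rw [← SymSeq.ap_comp, ← adjunct_comp, hf, adjunct_map_comp, SymSeq.ap_comp]

/-- On $A_0\cong\mathcal O_A[0]$ the map is given by functoriality of the enveloping array in $A$.
-/
theorem exists_isStageMap_zero : ∃ η, IsStageMap Φ Φ' α y 0 η := by
  refine ⟨Φ.zero.inv ≫ (envMap α).app (op (FinBij.std 0)) ≫ Φ'.zero.hom, ?_⟩
  intro s hs k N n d e o a b
  obtain rfl := Nat.le_zero.1 hs
  rw [gen_rfl, gen_rfl, Φ.ξ_zero, Φ'.ξ_zero, SymSeq.ap_act, ← SymSeq.ap_comp,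
    Iso.hom_inv_id_assoc, SymSeq.ap_comp, envMap_mk]

/-- The split of the factors of a vertex of the punctured cube into those from `X` and from `Y`. -/
theorem exists_split {t : ℕ} (χ : Punctured (FinBij.std (t + 1))) :
    ∃ s ≤ t, ∃ (R : FinBij) (w : R ⊕ Fin s ≃ Fin (t + 1)), (∀ r, χ.obj (w (.inl r)) = false) ∧
      ∀ q, χ.obj (w (.inr q)) = true :=
  ⟨_, cell.card_compl_le (Nat.card_fin (t + 1)) χ, ⟨{q // χ.obj q = false}⟩,
    (Equiv.sumCongr (Equiv.refl _) (Finite.equivFin {q // ¬ χ.obj q = false}).symm).trans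
      (Equiv.sumCompl fun q => χ.obj q = false), fun r => r.2, fun q =>
        Bool.eq_true_of_not_eq_false ((Finite.equivFin {q // ¬ χ.obj q = false}).symm q).2⟩

/-- Plugging in `f` commutes with maps of cell attachments. -/
theorem fStar_stageMap (hi : i ≫ y = x ≫ i') (hf : f ≫ α = O.free.map x ≫ f') {t : ℕ}
    {η : Φ.stage.obj t ⟶ Φ'.stage.obj t} (hη : IsStageMap Φ Φ' α y t η)
    {k : Dop} {N n : FinBij} {d : N → Deg} {e : FinBij.std (t + 1) → Deg}
    (o : O.S.el ⟨N.sum (FinBij.std (t + 1)), n⟩ k) (a : ∀ r, A.A.el (d r) k)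
    (χ : Punctured (FinBij.std (t + 1))) (z : ∀ q, ((arrow i).obj (χ.obj q)).el (e q) k) :
    SymSeq.ap η (SymSeq.ap (Φ.fStar t) (bal.mk (env.mk O A o a) (Q.mk χ z))) =
      SymSeq.ap (Φ'.fStar t) (bal.mk (env.mk O A' o fun r => SymSeq.ap α.f (a r))
        (Q.mk χ fun q => SymSeq.ap ((arrowMap x y hi).app (χ.obj q)) (z q))) := by
  obtain ⟨s, hs, R, w, hX, hY⟩ := exists_split χ
  obtain ⟨u, hu⟩ : ∃ u : ∀ r, X.el (e (w (.inl r))) k,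
    ∀ r, inArrow (i := i) (hX r) (z (w (.inl r))) = u r := ⟨_, fun _ => rfl⟩
  obtain ⟨v, hv⟩ : ∃ v : ∀ q, Y.el (e (w (.inr q))) k,
    ∀ q, inArrow (i := i) (hY q) (z (w (.inr q))) = v q := ⟨_, fun _ => rfl⟩
  have h₁ := Φ.fStar_gen hs w χ hX hY o a z u v hu hv
  have h₂ := Φ'.fStar_gen hs w χ hX hY o (fun r => SymSeq.ap α.f (a r))
    (fun q => SymSeq.ap ((arrowMap x y hi).app (χ.obj q)) (z q)) (fun r => SymSeq.ap x (u r))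
    (fun q => SymSeq.ap y (v q))
    (fun r => (inArrow_arrowMap x y hi (hX r) _).trans (congrArg (SymSeq.ap x) (hu r)))
    fun q => (inArrow_arrowMap x y hi (hY q) _).trans (congrArg (SymSeq.ap y) (hv q))
  rw [h₁, h₂, SymSeq.ap_act]
  refine congrArg (SymSeq.act _ _) ((hη hs _ _ _).trans ?_)
  have h₃ : (fun r => SymSeq.ap α.f (famSum a (fun r => SymSeq.ap (O.adjunct f) (u r)) r)) =
      famSum (fun r => SymSeq.ap α.f (a r)) fun r => SymSeq.ap (O.adjunct f') (SymSeq.ap x (u r)) := by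
    refine funext ?_
    rintro (r | r)
    · rfl
    · exact ap_adjunct_of_comm hf _
  rw [h₃]

/-- Induction on `t`. The map on $A_t$ and the map $[o;a]\otimes
b\mapsto\xi'_{t+1}([o;\alpha(a)]\otimes y(b))$ agree on the source of the attaching map, so the
pushout square glues them. -/
theorem exists_isStageMap (hi : i ≫ y = x ≫ i') (hf : f ≫ α = O.free.map x ≫ f') (t : ℕ) :
    ∃ η, IsStageMap Φ Φ' α y t η := by
  induction t with
  | zero => exact exists_isStageMap_zero
  | succ t ih =>
    obtain ⟨η, hη⟩ := ih
    -- On a mixed family, `fStar_stageMap` passes to the attaching map of the second filtration, and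
    -- the square there returns to $\xi'_{t+1}$. The remaining equality is commutativity of the maps
    -- $i$, $i'$, $x$, $y$ factor by factor.
    have hw : Φ.fStar t ≫ η ≫ Φ'.stage.map (homOfLE t.le_succ) =
        balMap (O.env A) (iStar i) (FinBij.std (t + 1)) ≫
          balEnvMap α y (FinBij.std (t + 1)) ≫ Φ'.ξ (t + 1) := by
      refine bal_env_hom_ext_Q fun {k N n d e} o a χ z => ?_
      rw [SymSeq.ap_comp, SymSeq.ap_comp, fStar_stageMap hi hf hη, ← SymSeq.ap_comp,
        (Φ'.isPushout t).w, SymSeq.ap_comp, SymSeq.ap_comp, SymSeq.ap_comp, balMap_mk, balMap_mk,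
        iStar_mk, iStar_mk]
      refine congrArg _ (Eq.trans ?_ (balEnvMap_mk α y o a _).symm)
      refine congrArg (fun b => bal.mk _ (pow.mk b)) (funext fun q => ?_)
      have h₁ := (arrowMap x y hi).naturality (homOfLE (Bool.le_true (χ.obj q)))
      exact (congrArg (fun f => SymSeq.ap f (z q)) h₁).symm
    refine ⟨(Φ.isPushout t).desc _ _ hw, ?_⟩
    intro s hs k N n d e o a b
    rcases Nat.le_succ_iff.1 hs with hs' | rfl
    · rw [← Φ.map_gen o a b hs' t.le_succ, ← SymSeq.ap_comp, IsPushout.inl_desc, SymSeq.ap_comp, hη,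
        map_gen]
    · rw [gen_rfl, gen_rfl, ← SymSeq.ap_comp, IsPushout.inr_desc, SymSeq.ap_comp, balEnvMap_mk]

/-- The map of filtrations induced by a map of cell attachments is unique, and it exists. -/
theorem existsUnique_stageMap (hi : i ≫ y = x ≫ i') (hf : f ≫ α = O.free.map x ≫ f')
    (hj : j ≫ p = α ≫ j') (hg : g ≫ p = O.free.map y ≫ g') :
    ∃! η : Φ.stage ⟶ Φ'.stage, η ≫ Φ'.c = Φ.c ≫ (Functor.const ℕ).map p.f ∧
      ∀ {t : ℕ} {k : Dop} {N n : FinBij} {d : N → Deg} {e : FinBij.std t → Deg}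
        (o : O.S.el ⟨N.sum (FinBij.std t), n⟩ k) (a : ∀ r, A.A.el (d r) k) (b : ∀ s, Y.el (e s) k),
        SymSeq.ap (η.app t) (SymSeq.ap (Φ.ξ t) (bal.mk (env.mk O A o a) (pow.mk b))) =
          SymSeq.ap (Φ'.ξ t) (bal.mk (env.mk O A' o fun r => SymSeq.ap α.f (a r))
            (pow.mk fun s => SymSeq.ap y (b s))) := by
  choose η hη using exists_isStageMap (Φ := Φ) (Φ' := Φ') hi hf
  refine ⟨{ app := η, naturality := fun t t' h => ?_ }, ⟨?_, ?_⟩, ?_⟩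
  · refine Φ.hom_ext fun hs k N n d e o a b => ?_
    rw [SymSeq.ap_comp, SymSeq.ap_comp, hη]
    refine (congrArg _ (Φ.map_gen o a b hs (leOfHom h))).trans ((hη t' _ o a b).trans ?_)
    exact (Φ'.map_gen o _ _ hs (leOfHom h)).symm
  -- Compatibility with the maps to $P$ and $P'$: on a generator both sides are the value of `o` on
  -- the images of its entries. These agree by the squares for `j` and `g`.
  · refine NatTrans.ext (funext fun t => Φ.hom_ext fun hs k N n d e o a b => ?_)
    refine (congrArg (SymSeq.ap (Φ'.c.app t)) (hη t hs o a b)).trans ?_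
    refine (Φ'.c_gen o _ _ hs).trans (Eq.trans ?_ (congrArg (SymSeq.ap p.f)
      (Φ.c_gen o a b hs)).symm)
    rw [SymSeq.ap_act, ap_eval]
    refine congrArg (fun a => P'.A.act _ (O.eval (A := P') (T := N.sum (FinBij.std _)) o a))
      (funext ?_)
    rintro (r | q)
    · have h₁ : j.f ≫ p.f = α.f ≫ j'.f := congrArg Monad.Algebra.Hom.f hj
      exact (congrArg (fun f => SymSeq.ap f (a r)) h₁).symm
    · exact (ap_adjunct_of_comm hg (b q)).symm
  · intro t k N n d e o a b
    rw [← gen_rfl, ← gen_rfl]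
    exact hη t le_rfl o a b
  -- The formula on each $\xi_s$, together with naturality along $A_s\to A_t$, fixes the map on
  -- generators of every stage.
  · rintro η' ⟨-, h⟩
    refine NatTrans.ext (funext fun t => Φ.hom_ext fun {s} hs k N n d e o a b => ?_)
    refine Eq.trans ?_ (hη t hs o a b).symm
    have h₁ := congrArg (fun f => SymSeq.ap f (Φ.gen le_rfl o a b)) (η'.naturality (homOfLE hs))
    rw [← Φ'.map_gen o _ _ le_rfl hs, ← Φ.map_gen o a b le_rfl hs]
    refine h₁.trans (congrArg (SymSeq.ap (Φ'.stage.map (homOfLE hs))) ?_)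
    rw [gen_rfl, gen_rfl]
    exact h o a b

end CellFiltration
end Operad
end SymSpectra

theorem mainTheorem9 (O : SymSpectra.Operad.{u}) :
    (∀ {A P : O.Lt} {X Y : SymSpectra.SymSeq.{u}} (i : X ⟶ Y) (f : O.free.obj X ⟶ A) (j : A ⟶ P)
      (g : O.free.obj Y ⟶ P), IsPushout f (O.free.map i) j g →
      Nonempty (O.CellFiltration i f j g)) ∧
    (∀ {A P A' P' : O.Lt} {X Y X' Y' : SymSpectra.SymSeq.{u}}
      {i : X ⟶ Y} {f : O.free.obj X ⟶ A} {j : A ⟶ P} {g : O.free.obj Y ⟶ P}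
      {i' : X' ⟶ Y'} {f' : O.free.obj X' ⟶ A'} {j' : A' ⟶ P'} {g' : O.free.obj Y' ⟶ P'}
      (_ : IsPushout f (O.free.map i) j g) (_ : IsPushout f' (O.free.map i') j' g')
      (Φ : O.CellFiltration i f j g) (Φ' : O.CellFiltration i' f' j' g')
      (α : A ⟶ A') (x : X ⟶ X') (y : Y ⟶ Y') (p : P ⟶ P')
      (_ : i ≫ y = x ≫ i') (_ : f ≫ α = O.free.map x ≫ f')
      (_ : j ≫ p = α ≫ j') (_ : g ≫ p = O.free.map y ≫ g'),
      ∃! η : Φ.stage ⟶ Φ'.stage,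
        η ≫ Φ'.c = Φ.c ≫ (Functor.const ℕ).map p.f ∧
        ∀ {t : ℕ} {k : SymSpectra.Dop} {T n : SymSpectra.FinBij} {d : T → SymSpectra.Deg}
          {e : SymSpectra.FinBij.std t → SymSpectra.Deg}
          (o : O.S.el ⟨T.sum (SymSpectra.FinBij.std t), n⟩ k) (a : ∀ r, A.A.el (d r) k)
          (b : ∀ s, Y.el (e s) k),
          SymSpectra.SymSeq.ap (η.app t) (SymSpectra.SymSeq.ap (Φ.ξ t)
            (SymSpectra.bal.mk (SymSpectra.Operad.env.mk O A o a) (SymSpectra.pow.mk b))) =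
          SymSpectra.SymSeq.ap (Φ'.ξ t) (SymSpectra.bal.mk
            (SymSpectra.Operad.env.mk O A' o fun r => SymSpectra.SymSeq.ap α.f (a r))
            (SymSpectra.pow.mk fun s => SymSpectra.SymSeq.ap y (b s)))) :=
  ⟨fun _ _ _ _ hP => ⟨SymSpectra.Operad.cellFiltration hP⟩,
    fun _ _ _ _ _ _ _ _ hi hf hj hg =>
      SymSpectra.Operad.CellFiltration.existsUnique_stageMap hi hf hj hg⟩
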